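/- Work with categories fibred in groupoids (cfg's) over the category of smooth manifolds (not necessarily Hausdorff), with the topology of open covers. A cfg-groupoid $\mathcal G\rightrightarrows M$ is a groupoid object in cfg's over a (Hausdorff) manifold $M$, with associativity, identity and inversion 2-isomorphisms that satisfy the higher coherence conditions; it is a stacky groupoid if the cfg $\mathcal G$ of arrows is a stack. A right action of $\mathcal G$ on a cfg $\mathcal X$ consists of a moment map $a:\mathcal X\to M$, an action map $\mathcal X\times_M\mathcal G\to\mathcal X$, and associativity and identity 2-isomorphisms $\beta,\varepsilon$ that satisfy the higher coherence conditions. It is 1-free if, for every object $x$ and all $j,j':g\to\bar g$ in the fibre of the target map over $a(x)$, $\mathrm{id}_x\cdot j=\mathrm{id}_x\cdot j'$ implies $j=j'$. The prequotient $\mathcal X/\!/\mathcal G$ is the cfg with the objects of $\mathcal X$ and with the classes $[g,b]$, $b:x\cdot g\to y$, as arrows from $x$ to $y$, where $[g,b]=[g',b']$ if $b=b'\circ(\mathrm{id}_x\cdot j)$ for some $j:g\to g'$ over the identity. The quotient $\mathcal X/\mathcal G$ is the stackification of $\mathcal X/\!/\mathcal G$. Let $\mathcal G_1\rightrightarrows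 M_1$ and $\mathcal G_2\rightrightarrows M_2$ be stacky groupoids and let $\mathcal G_1\times\mathcal G_2$ act 1-freely on a prestack $\mathcal X$ along $(a_1,a_2):\mathcal X\to M_1\times M_2$. Let $\mathcal G_1$ and $\mathcal G_2$ act on $\mathcal X$ by $x\cdot g_1=x\cdot(g_1,1_{a_2(x)})$ and $x\cdot g_2=x\cdot(1_{a_1(x)},g_2)$, and let $\delta:(x\cdot g_2)\cdot g_1\to x\cdot(g_1,g_2)\to(x\cdot g_1)\cdot g_2$ be the isomorphism given by $\beta$ and by the identity 2-isomorphisms of $\mathcal G_1$ and $\mathcal G_2$. Then: 1. The quotients $\mathcal X/\mathcal G_1$ and $\mathcal X/(\mathcal G_1\times\mathcal G_2)$ exist, and there is an induced action of $\mathcal G_2$ on $\mathcal X/\mathcal G_1$, that is, an action together with a 2-isomorphism $\varphi:q(x)\cdot g_2\to q(x\cdot g_2)$ that makes the projection $q:\mathcal X\to\mathcal X/\mathcal G_1$ $\mathcal G_2$-equivariant, such that $$q(x)\cdot g_2\xrightarrow{\ \gamma\cdot\mathrm{id}\ }q(x\cdot g_1)\cdot g_2\xrightarrow{\ \varphi\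 }q((x\cdot g_1)\cdot g_2)\quad\text{and}\quad q(x)\cdot g_2\xrightarrow{\ \varphi\ }q(x\cdot g_2)\xrightarrow{\ \gamma\ }q((x\cdot g_2)\cdot g_1)\xrightarrow{\ q(\delta)\ }q((x\cdot g_1)\cdot g_2)$$ agree, where $\gamma:q(x)\to q(x\cdot g_1)$ is the image of $[g_1,\mathrm{id}]$. 2. For every such induced action, the quotient $(\mathcal X/\mathcal G_1)/\mathcal G_2$ exists and there is a canonical isomorphism of cfg's $$(\mathcal X/\mathcal G_1)/\mathcal G_2\;\xrightarrow{\ \sim\ }\;\mathcal X/(\mathcal G_1\times\mathcal G_2).$$ Here "canonical" means that it comes with a 2-isomorphism $\theta$ relating the two projections of $\mathcal X$, which takes the arrows $x\to x\cdot g_1$ and $x\to x\cdot g_2$ of $(\mathcal X/\mathcal G_1)/\mathcal G_2$ (the images of $[g_1,\mathrm{id}]$, and of $[g_2,\mathrm{id}]$ followed by $\varphi$) to the images of $[(g_1,1),\mathrm{id}]$ and $[(1,g_2),\mathrm{id}]$. Any two canonical morphisms $(\Theta,\theta)$, $(\Theta',\theta')$ are related by a unique 2-isomorphism $\Theta\to\Theta'$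 compatible with $\theta$ and $\theta'$. -/

import Mathlib

open CategoryTheory TopologicalSpace
open scoped ContDiff

noncomputable section

universe w w' u

namespace StackyQuotient

/-! ### Manifolds -/

/-- A smooth finite-dimensional manifold (second countable, but not necessarily Hausdorff),
modelled on the finite-dimensional real vector space `E`. -/
structure Man where
  carrier : Type u
  E : Type
  [top : TopologicalSpace carrier]
  [secondCountable : SecondCountableTopology carrier]
  [normed : NormedAddCommGroup E]
  [normedSpace : NormedSpace ℝ E]
  [finDim : FiniteDimensional ℝ E]
  [charted : ChartedSpace E carrier]
  [smooth : IsManifold (modelWithCornersSelf ℝ E) ∞ carrier]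

attribute [instance] Man.top Man.secondCountable Man.normed Man.normedSpace Man.finDim
  Man.charted Man.smooth

/-- The category of manifolds and smooth maps. -/
instance : Category.{u} Man.{u} where
  Hom M N := ContMDiffMap (modelWithCornersSelf ℝ M.E) (modelWithCornersSelf ℝ N.E) M.carrier N.carrier ∞
  id _ := ContMDiffMap.id
  comp f g := ContMDiffMap.comp g f
  id_comp _ := rfl
  comp_id _ := rfl
  assoc _ _ _ := rfl

namespace Man

/-- An open subset of a manifold, as a manifold. -/
def restrict (U : Man.{u}) (V : Opens U.carrier) : Man.{u} where
  carrier := V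
  E := U.E

/-- The inclusion of an open subset. -/
def incl {U : Man.{u}} (V : Opens U.carrier) : U.restrict V ⟶ U :=
  ⟨Subtype.val, contMDiff_subtype_val (I := modelWithCornersSelf ℝ U.E) (M := U.carrier) (U := V)⟩

/-- The inclusion of an open subset into a larger one. -/
def inclLE {U : Man.{u}} {V W : Opens U.carrier} (h : V ≤ W) : U.restrict V ⟶ U.restrict W :=
  ⟨Set.inclusion h, contMDiff_inclusion (I := modelWithCornersSelf ℝ U.E) (M := U.carrier) h⟩

/-- The product of two manifolds. -/
def prod (M N : Man.{u}) : Man.{u} where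
  carrier := M.carrier × N.carrier
  E := M.E × N.E
  charted := prodChartedSpace M.E M.carrier N.E N.carrier
  smooth := by
    rw [modelWithCornersSelf_prod]
    exact IsManifold.prod M.carrier N.carrier

def fst (M N : Man.{u}) : M.prod N ⟶ M :=
  ⟨Prod.fst, by
    have := contMDiff_fst (I := (modelWithCornersSelf ℝ M.E)) (J := (modelWithCornersSelf ℝ N.E)) (M := M.carrier) (N := N.carrier)
      (n := ∞)
    rw [← modelWithCornersSelf_prod] at this
    exact this⟩

def snd (M N : Man.{u}) : M.prod N ⟶ N :=
  ⟨Prod.snd, by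
    have := contMDiff_snd (I := (modelWithCornersSelf ℝ M.E)) (J := (modelWithCornersSelf ℝ N.E)) (M := M.carrier) (N := N.carrier)
      (n := ∞)
    rw [← modelWithCornersSelf_prod] at this
    exact this⟩

def pair {U M N : Man.{u}} (f : U ⟶ M) (g : U ⟶ N) : U ⟶ M.prod N :=
  ⟨fun z => (f.1 z, g.1 z), by
    have := f.2.prodMk g.2
    rw [← modelWithCornersSelf_prod] at this
    exact this⟩

theorem pair_fst {U M N : Man.{u}} (f : U ⟶ M) (g : U ⟶ N) : pair f g ≫ fst M N = f := rfl

theorem pair_snd {U M N : Man.{u}} (f : U ⟶ M) (g : U ⟶ N) : pair f g ≫ snd M N = g := rfl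

theorem comp_pair {U V M N : Man.{u}} (k : V ⟶ U) (f : U ⟶ M) (g : U ⟶ N) :
    k ≫ pair f g = pair (k ≫ f) (k ≫ g) := rfl

theorem prod_ext {U M N : Man.{u}} {f g : U ⟶ M.prod N}
    (h₁ : f ≫ fst M N = g ≫ fst M N) (h₂ : f ≫ snd M N = g ≫ snd M N) : f = g := by
  apply ContMDiffMap.ext
  intro z
  exact Prod.ext (congrArg (fun k : U ⟶ M => k.1 z) h₁) (congrArg (fun k : U ⟶ N => k.1 z) h₂)

theorem pair_eq {U M N : Man.{u}} {f f' : U ⟶ M} {g g' : U ⟶ N} (h₁ : f = f') (h₂ : g = g') :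
    pair f g = pair f' g' := by rw [h₁, h₂]

end Man

/-! ### Categories fibred in groupoids -/

/-- The total set of objects of a family of sets indexed by manifolds. -/
structure Tot (Ob : Man.{u} → Type w) where
  base : Man.{u}
  pt : Ob base

set_option linter.checkUnivs false in
/-- A category fibred in groupoids over the category of manifolds. The functor `π` to manifolds is
presented by the classes `Ob U` of objects `x` with `π x = U` (so the objects of the category are
the pairs `(U, x)` with `x` in `Ob U`) and by its effect `proj` on arrows. -/
structure CFG where
  /-- the objects over a manifold -/
  Ob : Man.{u} → Type w
  /-- the category structure on all objects together -/
  cat : Category.{w} (Tot Ob)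
  /-- the smooth map underlying an arrow -/
  proj : ∀ {x y : Tot Ob}, (x ⟶ y) → (x.base ⟶ y.base)
  proj_id : ∀ x : Tot Ob, proj (𝟙 x) = 𝟙 x.base
  proj_comp : ∀ {x y z : Tot Ob} (a : x ⟶ y) (b : y ⟶ z), proj (a ≫ b) = proj a ≫ proj b
  /-- arrows can be lifted with prescribed target -/
  exists_lift : ∀ {U : Man.{u}} (y : Tot Ob) (f : U ⟶ y.base),
    ∃ (x : Ob U) (a : (⟨U, x⟩ : Tot Ob) ⟶ y), proj a = f
  /-- every arrow is cartesian -/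
  cartesian : ∀ {x y z : Tot Ob} (a : x ⟶ y) (b : z ⟶ y) (g : z.base ⟶ x.base),
    g ≫ proj a = proj b → ∃! c : z ⟶ x, c ≫ a = b ∧ proj c = g

namespace CFG

/-- The underlying category of a category fibred in groupoids. -/
def Total (X : CFG.{w, u}) : Type (max (u + 1) w) := Tot X.Ob

instance (X : CFG.{w, u}) : Category.{w} X.Total := X.cat

/-- The structure functor to the category of manifolds. -/
def toMan (X : CFG.{w, u}) : X.Total ⥤ Man.{u} where
  obj x := x.base
  map a := X.proj a
  map_id x := X.proj_id x
  map_comp a b := X.proj_comp a b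

variable (X : CFG.{w, u}) {U V W : Man.{u}}

/-- An object over `U`, seen as an object of the total category. -/
def of (x : X.Ob U) : X.Total := ⟨U, x⟩

variable {X} {x : X.Ob U} {y : X.Ob V} {z : X.Ob W}

variable (X) in
/-- The smooth map underlying an arrow. -/
def pr (a : X.of x ⟶ X.of y) : U ⟶ V := X.proj a

variable (X) in
@[simp] theorem pr_id (x : X.Ob U) : X.pr (𝟙 (X.of x)) = 𝟙 U := X.proj_id _

@[simp] theorem pr_comp (a : X.of x ⟶ X.of y) (b : X.of y ⟶ X.of z) :
    X.pr (a ≫ b) = X.pr a ≫ X.pr b := X.proj_comp _ _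

theorem lift_exists (y : X.Ob V) (f : U ⟶ V) :
    ∃ (x : X.Ob U) (a : X.of x ⟶ X.of y), X.pr a = f := X.exists_lift (X.of y) f

theorem factor_exists (a : X.of x ⟶ X.of y) (b : X.of z ⟶ X.of y) (g : W ⟶ U)
    (h : g ≫ X.pr a = X.pr b) : ∃ c : X.of z ⟶ X.of x, c ≫ a = b ∧ X.pr c = g :=
  (X.cartesian (x := X.of x) (y := X.of y) (z := X.of z) a b g h).exists

theorem factor_unique (a : X.of x ⟶ X.of y) {c c' : X.of z ⟶ X.of x} (h : c ≫ a = c' ≫ a)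
    (hp : X.pr c = X.pr c') : c = c' :=
  (X.cartesian (x := X.of x) (y := X.of y) (z := X.of z) a (show X.of z ⟶ X.of y from c ≫ a)
    (X.pr c) (pr_comp c a).symm).unique ⟨rfl, rfl⟩ ⟨h.symm, hp.symm⟩

/-- Arrows over an identity are isomorphisms. -/
theorem isIso_of_pr {x x' : X.Ob U} (a : X.of x ⟶ X.of x') (h : X.pr a = 𝟙 U) : IsIso a := by
  obtain ⟨c, hc, hp⟩ := factor_exists a (𝟙 (X.of x')) (𝟙 U) (by rw [h]; simp)
  refine ⟨c, ?_, hc⟩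
  refine factor_unique a ?_ ?_
  · rw [Category.assoc, hc]; simp
  · rw [pr_comp, h, hp]; simp

theorem pr_inv {x x' : X.Ob U} (a : X.of x ≅ X.of x') (h : X.pr a.hom = 𝟙 U) :
    X.pr a.inv = 𝟙 U := by
  have := congrArg X.pr a.inv_hom_id
  rw [pr_comp, h, pr_id, Category.comp_id] at this
  exact this

/-- A morphism of categories fibred in groupoids: a functor over the category of manifolds. -/
structure Mor (X : CFG.{w, u}) (Y : CFG.{w', u}) where
  obj : ∀ {U : Man.{u}}, X.Ob U → Y.Ob U
  map : ∀ {U V : Man.{u}} {x : X.Ob U} {y : X.Ob V},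
    (X.of x ⟶ X.of y) → (Y.of (obj x) ⟶ Y.of (obj y))
  map_id : ∀ {U : Man.{u}} (x : X.Ob U), map (𝟙 (X.of x)) = 𝟙 (Y.of (obj x))
  map_comp : ∀ {U V W : Man.{u}} {x : X.Ob U} {y : X.Ob V} {z : X.Ob W}
    (a : X.of x ⟶ X.of y) (b : X.of y ⟶ X.of z), map (a ≫ b) = map a ≫ map b
  pr_map : ∀ {U V : Man.{u}} {x : X.Ob U} {y : X.Ob V} (a : X.of x ⟶ X.of y),
    Y.pr (map a) = X.pr a

namespace Mor

/-- The identity morphism. -/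
def id (X : CFG.{w, u}) : Mor X X where
  obj x := x
  map a := a
  map_id _ := rfl
  map_comp _ _ := rfl
  pr_map _ := rfl

/-- The composition of morphisms (first `F`, then `F'`). -/
def comp {X Y Z : CFG.{w, u}} (F : Mor X Y) (F' : Mor Y Z) : Mor X Z where
  obj x := F'.obj (F.obj x)
  map a := F'.map (F.map a)
  map_id x := by rw [F.map_id, F'.map_id]
  map_comp a b := by rw [F.map_comp, F'.map_comp]
  pr_map a := by rw [F'.pr_map, F.pr_map]

end Mor

/-- A 2-morphism: a natural transformation whose components lie over identities
(these are automatically isomorphisms). -/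
@[ext] structure TwoMor {X : CFG.{w, u}} {Y : CFG.{w', u}} (F F' : Mor X Y) where
  app : ∀ {U : Man.{u}} (x : X.Ob U), Y.of (F.obj x) ⟶ Y.of (F'.obj x)
  pr_app : ∀ {U : Man.{u}} (x : X.Ob U), Y.pr (app x) = 𝟙 U
  naturality : ∀ {U V : Man.{u}} {x : X.Ob U} {y : X.Ob V} (a : X.of x ⟶ X.of y),
    F.map a ≫ app y = app x ≫ F'.map a

/-- A morphism is an isomorphism of categories fibred in groupoids if it has an inverse up to
2-isomorphisms. -/
def Mor.IsIsomorphism {X Y : CFG.{w, u}} (F : Mor X Y) : Prop :=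
  ∃ F' : Mor Y X, Nonempty (TwoMor (F.comp F') (Mor.id X)) ∧
    Nonempty (TwoMor (F'.comp F) (Mor.id Y))

end CFG

open CFG

/-- A manifold as a category fibred in groupoids: the objects over `U` are the smooth maps
`U ⟶ M`. -/
def Man.cfg (M : Man.{u}) : CFG.{u, u} where
  Ob U := U ⟶ M
  cat :=
    { Hom := fun p q => { f : p.base ⟶ q.base // f ≫ q.pt = p.pt }
      id := fun p => ⟨𝟙 _, Category.id_comp _⟩
      comp := fun f g => ⟨f.1 ≫ g.1, by rw [Category.assoc, g.2, f.2]⟩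
      id_comp := fun _ => rfl
      comp_id := fun _ => rfl
      assoc := fun _ _ _ => rfl }
  proj f := f.1
  proj_id _ := rfl
  proj_comp _ _ := rfl
  exists_lift y f := ⟨f ≫ y.pt, ⟨f, rfl⟩, rfl⟩
  cartesian {x y z} a b g h :=
    ⟨⟨g, by
        have h₁ := a.2
        have h₂ := b.2
        change g ≫ a.1 = b.1 at h
        rw [← h₁, ← Category.assoc, h, h₂]⟩,
      ⟨Subtype.ext h, rfl⟩, fun c hc => Subtype.ext hc.2⟩

namespace CFG

/-- The value of a morphism to a manifold on an object over `U`, as a smooth map on `U`. -/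
def Mor.val {X : CFG.{w, u}} {M : Man.{u}} (F : Mor X M.cfg) {U : Man.{u}} (x : X.Ob U) : U ⟶ M :=
  F.obj x

theorem Mor.val_eq {X : CFG.{w, u}} {M : Man.{u}} (F : Mor X M.cfg) {U V : Man.{u}} {x : X.Ob U}
    {y : X.Ob V} (a : X.of x ⟶ X.of y) : X.pr a ≫ F.val y = F.val x := by
  have h := (show { f : U ⟶ V // f ≫ F.val y = F.val x } from F.map a).2
  have h' : (show { f : U ⟶ V // f ≫ F.val y = F.val x } from F.map a).1 = X.pr a := F.pr_map a
  rw [← h', h]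

/-- A smooth map `U ⟶ M` as an object over `U` of the manifold `M`. -/
def manOb {M U : Man.{u}} (p : U ⟶ M) : M.cfg.Ob U := p

/-- The unique arrow over `f` between two objects of a manifold. -/
def manHom {M U V : Man.{u}} (f : U ⟶ V) (p : U ⟶ M) (q : V ⟶ M) (h : f ≫ q = p) :
    M.cfg.of (manOb p) ⟶ M.cfg.of (manOb q) :=
  (⟨f, h⟩ : { f : U ⟶ V // f ≫ q = p })

/-- Pairs of objects of `X` and `Y` over the same manifold `U` which satisfy `P`. -/
structure PairOb (X Y : CFG.{w, u}) (P : ∀ {U : Man.{u}}, X.Ob U → Y.Ob U → Prop)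
    (U : Man.{u}) : Type w where
  fst : X.Ob U
  snd : Y.Ob U
  prop : P fst snd

/-- Pairs of arrows of `X` and `Y` over the same smooth map. -/
@[ext] structure PairHom (X Y : CFG.{w, u}) {U V : Man.{u}} (x : X.Ob U) (y : Y.Ob U)
    (x' : X.Ob V) (y' : Y.Ob V) : Type w where
  fst : X.of x ⟶ X.of x'
  snd : Y.of y ⟶ Y.of y'
  pr_eq : X.pr fst = Y.pr snd

/-- The category fibred in groupoids of pairs `(x, y)` of objects of `X` and `Y` over the same
manifold which satisfy `P`, with the pairs of arrows over the same smooth map. -/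
def prodOn (X Y : CFG.{w, u}) (P : ∀ {U : Man.{u}}, X.Ob U → Y.Ob U → Prop)
    (hP : ∀ {U V : Man.{u}} {x : X.Ob U} {x' : X.Ob V} {y : Y.Ob U} {y' : Y.Ob V}
      (a : X.of x ⟶ X.of x') (b : Y.of y ⟶ Y.of y'), X.pr a = Y.pr b → P x' y' → P x y) :
    CFG.{w, u} where
  Ob := PairOb X Y P
  cat :=
    { Hom := fun p q => PairHom X Y p.pt.fst p.pt.snd q.pt.fst q.pt.snd
      id := fun p => ⟨𝟙 _, 𝟙 _, by rw [pr_id, pr_id]⟩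
      comp := fun c d => ⟨c.fst ≫ d.fst, c.snd ≫ d.snd, by
        rw [pr_comp, pr_comp, c.pr_eq, d.pr_eq]⟩
      id_comp := fun _ => PairHom.ext (Category.id_comp _) (Category.id_comp _)
      comp_id := fun _ => PairHom.ext (Category.comp_id _) (Category.comp_id _)
      assoc := fun _ _ _ => PairHom.ext (Category.assoc _ _ _) (Category.assoc _ _ _) }
  proj c := X.pr (PairHom.fst c)
  proj_id p := X.pr_id _
  proj_comp c d := pr_comp _ _
  exists_lift := by
    rintro U ⟨V, ⟨x, y, h⟩⟩ f
    obtain ⟨x', a, ha⟩ := lift_exists x f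
    obtain ⟨y', b, hb⟩ := lift_exists y f
    exact ⟨⟨x', y', hP a b (ha.trans hb.symm) h⟩, ⟨a, b, ha.trans hb.symm⟩, ha⟩
  cartesian {p q r} a b g h := by
    obtain ⟨c, hc, hcg⟩ := factor_exists (PairHom.fst a) (PairHom.fst b) g h
    obtain ⟨c', hc', hcg'⟩ := factor_exists (PairHom.snd a) (PairHom.snd b) g
      (by rw [← PairHom.pr_eq a, ← PairHom.pr_eq b]; exact h)
    refine ⟨⟨c, c', hcg.trans hcg'.symm⟩, ⟨PairHom.ext hc hc', hcg⟩, ?_⟩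
    rintro d ⟨hd₁, hd₂⟩
    have e₁ : PairHom.fst d ≫ PairHom.fst a = PairHom.fst b := congrArg PairHom.fst hd₁
    have e₂ : PairHom.snd d ≫ PairHom.snd a = PairHom.snd b := congrArg PairHom.snd hd₁
    exact PairHom.ext (factor_unique _ (e₁.trans hc.symm) (hd₂.trans hcg.symm))
      (factor_unique _ (e₂.trans hc'.symm)
        ((PairHom.pr_eq d).symm.trans (hd₂.trans hcg'.symm)))

/-- The product of two categories fibred in groupoids. -/
def prod (X Y : CFG.{w, u}) : CFG.{w, u} := prodOn X Y (fun _ _ => True) fun _ _ _ _ => trivial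

/-- The fibred product of two morphisms to a manifold (which is fibred in sets). -/
def pull {X Y : CFG.{w, u}} {M : Man.{u}} (F : Mor X M.cfg) (F' : Mor Y M.cfg) : CFG.{w, u} :=
  prodOn X Y (fun x y => F.val x = F'.val y) fun a b h e => by
    rw [← F.val_eq a, ← F'.val_eq b, h, e]

section pull

variable {X Y : CFG.{w, u}} {M : Man.{u}} {F : Mor X M.cfg} {F' : Mor Y M.cfg} {U V : Man.{u}}

/-- Objects of the product. -/
def prodOb (x : X.Ob U) (y : Y.Ob U) : (prod X Y).Ob U := PairOb.mk x y trivial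

/-- Arrows of the product. -/
def prodHom {x : X.Ob U} {y : Y.Ob U} {x' : X.Ob V} {y' : Y.Ob V} (a : X.of x ⟶ X.of x')
    (b : Y.of y ⟶ Y.of y') (h : X.pr a = Y.pr b) :
    (prod X Y).of (prodOb x y) ⟶ (prod X Y).of (prodOb x' y') :=
  PairHom.mk a b h

/-- Objects of the fibred product. -/
def pullOb (x : X.Ob U) (y : Y.Ob U) (e : F.val x = F'.val y) : (pull F F').Ob U :=
  PairOb.mk x y e

/-- Arrows of the fibred product. -/
def pullHom {x : X.Ob U} {y : Y.Ob U} {x' : X.Ob V} {y' : Y.Ob V} (a : X.of x ⟶ X.of x')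
    (b : Y.of y ⟶ Y.of y') (e : F.val x = F'.val y) (e' : F.val x' = F'.val y')
    (h : X.pr a = Y.pr b) : (pull F F').of (pullOb x y e) ⟶ (pull F F').of (pullOb x' y' e') :=
  PairHom.mk a b h

end pull

/-! ### Stacks -/

/-- A family of open subsets of a manifold is an open cover. -/
def Covers {U : Man.{u}} {ι : Type u} (V : ι → Opens U.carrier) : Prop :=
  ∀ z : U.carrier, ∃ i, z ∈ V i

/-- Isomorphisms glue uniquely. An isomorphism from the restriction `x i` of `x` to `V i` to the
restriction of `y` is given as an arrow `ψ i` from `x i` to `y` over the inclusion of `V i`. -/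
def IsPrestack (X : CFG.{w, u}) : Prop :=
  ∀ {U : Man.{u}} (x y : X.Ob U) {ι : Type u} (V : ι → Opens U.carrier), Covers V →
  ∀ (xr : ∀ i, X.Ob (U.restrict (V i))) (p : ∀ i, X.of (xr i) ⟶ X.of x)
    (ψ : ∀ i, X.of (xr i) ⟶ X.of y),
    (∀ i, X.pr (p i) = Man.incl (V i)) → (∀ i, X.pr (ψ i) = Man.incl (V i)) →
    -- the isomorphisms agree on the overlaps
    (∀ (i j : ι) (z : X.Ob (U.restrict (V i ⊓ V j))) (r : X.of z ⟶ X.of (xr i))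
      (s : X.of z ⟶ X.of (xr j)), X.pr r = Man.inclLE inf_le_left →
      X.pr s = Man.inclLE inf_le_right → r ≫ p i = s ≫ p j → r ≫ ψ i = s ≫ ψ j) →
    ∃! φ : X.of x ⟶ X.of y, X.pr φ = 𝟙 U ∧ ∀ i, p i ≫ φ = ψ i

/-- Objects glue. A descent datum is given by objects `x i` over `V i` and, over each overlap
`V i ⊓ V j`, an object `z i j` with arrows `r i j` and `s i j` to `x i` and `x j` which exhibit it
as a restriction of both (this amounts to an isomorphism between the two restrictions), subject to
the cocycle condition over triple overlaps. -/
def ObjectsGlue (X : CFG.{w, u}) : Prop :=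
  ∀ {U : Man.{u}} {ι : Type u} (V : ι → Opens U.carrier), Covers V →
  ∀ (x : ∀ i, X.Ob (U.restrict (V i))) (z : ∀ i j, X.Ob (U.restrict (V i ⊓ V j)))
    (r : ∀ i j, X.of (z i j) ⟶ X.of (x i)) (s : ∀ i j, X.of (z i j) ⟶ X.of (x j)),
    (∀ i j, X.pr (r i j) = Man.inclLE inf_le_left) →
    (∀ i j, X.pr (s i j) = Man.inclLE inf_le_right) →
    -- the cocycle condition
    (∀ (i j k : ι) (t : X.Ob (U.restrict (V i ⊓ V j ⊓ V k))) (a : X.of t ⟶ X.of (z i j))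
      (b : X.of t ⟶ X.of (z j k)) (c : X.of t ⟶ X.of (z i k)),
      X.pr a = Man.inclLE inf_le_left →
      X.pr b = Man.inclLE (inf_le_inf_right _ inf_le_right) →
      X.pr c = Man.inclLE (inf_le_inf_right _ inf_le_left) →
      a ≫ s i j = b ≫ r j k → a ≫ r i j = c ≫ r i k → b ≫ s j k = c ≫ s i k) →
    ∃ (y : X.Ob U) (p : ∀ i, X.of (x i) ⟶ X.of y), (∀ i, X.pr (p i) = Man.incl (V i)) ∧
      ∀ i j, r i j ≫ p i = s i j ≫ p j

/-- Stacks (for the topology of open covers). -/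
def IsStack (X : CFG.{w, u}) : Prop := X.IsPrestack ∧ X.ObjectsGlue

/-- `ι` exhibits `Y` as the stackification of `X`: it is universal among the morphisms from `X` to
stacks. -/
def IsStackification {X Y : CFG.{w, u}} (ι : Mor X Y) : Prop :=
  Y.IsStack ∧
  (∀ S : CFG.{w, u}, S.IsStack → ∀ F : Mor X S,
    ∃ F' : Mor Y S, Nonempty (TwoMor (ι.comp F') F)) ∧
  (∀ S : CFG.{w, u}, S.IsStack → ∀ (F₁ F₂ : Mor X S) (η : TwoMor F₁ F₂) (F₁' F₂' : Mor Y S)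
    (ζ₁ : TwoMor (ι.comp F₁') F₁) (ζ₂ : TwoMor (ι.comp F₂') F₂),
    ∃! η' : TwoMor F₁' F₂', ∀ {U : Man.{u}} (x : X.Ob U),
      η'.app (ι.obj x) ≫ ζ₂.app x = ζ₁.app x ≫ η.app x)

end CFG

/-! ### Groupoids in categories fibred in groupoids -/

set_option linter.checkUnivs false in
/-- The structure maps of a groupoid in categories fibred in groupoids over a (Hausdorff) manifold
`M`, with their strict compatibilities. -/
structure PreGroupoid where
  M : Man.{u}
  hausdorff : T2Space M.carrier
  arr : CFG.{w, u}
  src : Mor arr M.cfg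
  tgt : Mor arr M.cfg
  unit : Mor M.cfg arr
  inverse : Mor arr arr
  mult : Mor (pull src tgt) arr
  src_unit : ∀ {U : Man.{u}} (p : U ⟶ M), src.val (unit.obj (manOb p)) = p
  tgt_unit : ∀ {U : Man.{u}} (p : U ⟶ M), tgt.val (unit.obj (manOb p)) = p
  src_inverse : ∀ {U : Man.{u}} (g : arr.Ob U), src.val (inverse.obj g) = tgt.val g
  tgt_inverse : ∀ {U : Man.{u}} (g : arr.Ob U), tgt.val (inverse.obj g) = src.val g
  src_mult : ∀ {U : Man.{u}} (g h : arr.Ob U) (e : src.val g = tgt.val h),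
    src.val (mult.obj (pullOb g h e)) = src.val h
  tgt_mult : ∀ {U : Man.{u}} (g h : arr.Ob U) (e : src.val g = tgt.val h),
    tgt.val (mult.obj (pullOb g h e)) = tgt.val g

namespace PreGroupoid

variable (G : PreGroupoid.{w, u}) {U V W : Man.{u}}

/-- The source of an object of arrows. -/
abbrev s (g : G.arr.Ob U) : U ⟶ G.M := G.src.val g

/-- The target of an object of arrows. -/
abbrev t (g : G.arr.Ob U) : U ⟶ G.M := G.tgt.val g

/-- The unit `1` at `p`. -/
def one (p : U ⟶ G.M) : G.arr.Ob U := G.unit.obj (manOb p)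

/-- The effect of the unit map on arrows. -/
def oneHom (f : U ⟶ V) (p : U ⟶ G.M) (q : V ⟶ G.M) (h : f ≫ q = p) :
    G.arr.of (G.one p) ⟶ G.arr.of (G.one q) := G.unit.map (manHom f p q h)

/-- The inverse of an object of arrows. -/
def inv (g : G.arr.Ob U) : G.arr.Ob U := G.inverse.obj g

/-- The effect of the inverse on arrows. -/
def invHom {g : G.arr.Ob U} {g' : G.arr.Ob V} (a : G.arr.of g ⟶ G.arr.of g') :
    G.arr.of (G.inv g) ⟶ G.arr.of (G.inv g') := G.inverse.map a

/-- The product `g · h`. -/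
def mul (g h : G.arr.Ob U) (e : G.s g = G.t h) : G.arr.Ob U := G.mult.obj (pullOb g h e)

/-- The effect of the multiplication on arrows. -/
def mulHom {g h : G.arr.Ob U} {g' h' : G.arr.Ob V} (a : G.arr.of g ⟶ G.arr.of g')
    (b : G.arr.of h ⟶ G.arr.of h') (e : G.s g = G.t h) (e' : G.s g' = G.t h')
    (hp : G.arr.pr a = G.arr.pr b) : G.arr.of (G.mul g h e) ⟶ G.arr.of (G.mul g' h' e') :=
  G.mult.map (pullHom a b e e' hp)

theorem s_one (p : U ⟶ G.M) : G.s (G.one p) = p := G.src_unit p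

theorem t_one (p : U ⟶ G.M) : G.t (G.one p) = p := G.tgt_unit p

theorem s_inv (g : G.arr.Ob U) : G.s (G.inv g) = G.t g := G.src_inverse g

theorem t_inv (g : G.arr.Ob U) : G.t (G.inv g) = G.s g := G.tgt_inverse g

theorem s_mul (g h : G.arr.Ob U) (e : G.s g = G.t h) : G.s (G.mul g h e) = G.s h :=
  G.src_mult g h e

theorem t_mul (g h : G.arr.Ob U) (e : G.s g = G.t h) : G.t (G.mul g h e) = G.t g :=
  G.tgt_mult g h e

@[simp] theorem pr_mulHom {g h : G.arr.Ob U} {g' h' : G.arr.Ob V} (a : G.arr.of g ⟶ G.arr.of g')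
    (b : G.arr.of h ⟶ G.arr.of h') (e : G.s g = G.t h) (e' : G.s g' = G.t h')
    (hp : G.arr.pr a = G.arr.pr b) : G.arr.pr (G.mulHom a b e e' hp) = G.arr.pr a :=
  G.mult.pr_map _

@[simp] theorem pr_invHom {g : G.arr.Ob U} {g' : G.arr.Ob V} (a : G.arr.of g ⟶ G.arr.of g') :
    G.arr.pr (G.invHom a) = G.arr.pr a := G.inverse.pr_map _

@[simp] theorem pr_oneHom (f : U ⟶ V) (p : U ⟶ G.M) (q : V ⟶ G.M) (h : f ≫ q = p) :
    G.arr.pr (G.oneHom f p q h) = f := G.unit.pr_map _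

@[simp] theorem mulHom_id (g h : G.arr.Ob U) (e : G.s g = G.t h) :
    G.mulHom (𝟙 (G.arr.of g)) (𝟙 (G.arr.of h)) e e (by simp) = 𝟙 (G.arr.of (G.mul g h e)) :=
  G.mult.map_id _

theorem mulHom_comp {g h : G.arr.Ob U} {g' h' : G.arr.Ob V} {g'' h'' : G.arr.Ob W}
    (a : G.arr.of g ⟶ G.arr.of g') (b : G.arr.of h ⟶ G.arr.of h') (e : G.s g = G.t h)
    (e' : G.s g' = G.t h') (hp : G.arr.pr a = G.arr.pr b) (a' : G.arr.of g' ⟶ G.arr.of g'')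
    (b' : G.arr.of h' ⟶ G.arr.of h'') (e'' : G.s g'' = G.t h'')
    (hp' : G.arr.pr a' = G.arr.pr b') :
    G.mulHom a b e e' hp ≫ G.mulHom a' b' e' e'' hp' =
      G.mulHom (a ≫ a') (b ≫ b') e e'' (by simp [hp, hp']) :=
  (G.mult.map_comp (pullHom a b e e' hp) (pullHom a' b' e' e'' hp')).symm

theorem oneHom_comp (f : U ⟶ V) (f' : V ⟶ W) (p : U ⟶ G.M) (q : V ⟶ G.M) (r : W ⟶ G.M)
    (h : f ≫ q = p) (h' : f' ≫ r = q) :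
    G.oneHom f p q h ≫ G.oneHom f' q r h' =
      G.oneHom (f ≫ f') p r (by rw [Category.assoc, h', h]) :=
  (G.unit.map_comp (manHom f p q h) (manHom f' q r h')).symm

theorem oneHom_id (p : U ⟶ G.M) : G.oneHom (𝟙 U) p p (Category.id_comp p) = 𝟙 (G.arr.of (G.one p)) :=
  G.unit.map_id _

/-- The associativity, identity and inversion 2-isomorphisms of a groupoid in categories fibred in
groupoids, given by their components, with the higher coherence conditions. In the identity
2-isomorphisms the unit is allowed to be the unit at any map `p` equal to the relevant source or
target. -/
structure Coherence where
  /-- the associativity 2-isomorphism `g · (h · k) ≅ (g · h) · k` -/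
  assoc : ∀ {U : Man.{u}} (g h k : G.arr.Ob U) (e : G.s g = G.t h) (e' : G.s h = G.t k),
    G.arr.of (G.mul g (G.mul h k e') (e.trans (G.t_mul h k e').symm)) ≅
      G.arr.of (G.mul (G.mul g h e) k ((G.s_mul g h e).trans e'))
  assoc_pr : ∀ {U : Man.{u}} (g h k : G.arr.Ob U) (e : G.s g = G.t h) (e' : G.s h = G.t k),
    G.arr.pr (assoc g h k e e').hom = 𝟙 U
  assoc_nat : ∀ {U V : Man.{u}} {g h k : G.arr.Ob U} {g' h' k' : G.arr.Ob V}
    (a : G.arr.of g ⟶ G.arr.of g') (b : G.arr.of h ⟶ G.arr.of h') (c : G.arr.of k ⟶ G.arr.of k')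
    (e₁ : G.s g = G.t h) (e₂ : G.s h = G.t k) (e₁' : G.s g' = G.t h') (e₂' : G.s h' = G.t k')
    (hab : G.arr.pr a = G.arr.pr b) (hbc : G.arr.pr b = G.arr.pr c),
    G.mulHom a (G.mulHom b c e₂ e₂' hbc) (e₁.trans (G.t_mul h k e₂).symm)
        (e₁'.trans (G.t_mul h' k' e₂').symm) (hab.trans (G.pr_mulHom b c e₂ e₂' hbc).symm) ≫
      (assoc g' h' k' e₁' e₂').hom =
    (assoc g h k e₁ e₂).hom ≫
      G.mulHom (G.mulHom a b e₁ e₁' hab) c ((G.s_mul g h e₁).trans e₂)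
        ((G.s_mul g' h' e₁').trans e₂') ((G.pr_mulHom a b e₁ e₁' hab).trans (hab.trans hbc))
  /-- the left identity 2-isomorphism `1 · g ≅ g` -/
  lam : ∀ {U : Man.{u}} (p : U ⟶ G.M) (g : G.arr.Ob U) (e : p = G.t g),
    G.arr.of (G.mul (G.one p) g ((G.s_one p).trans e)) ≅ G.arr.of g
  lam_pr : ∀ {U : Man.{u}} (p : U ⟶ G.M) (g : G.arr.Ob U) (e : p = G.t g),
    G.arr.pr (lam p g e).hom = 𝟙 U
  lam_nat : ∀ {U V : Man.{u}} (p : U ⟶ G.M) (g : G.arr.Ob U) (e : p = G.t g) (p' : V ⟶ G.M)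
    (g' : G.arr.Ob V) (e' : p' = G.t g') (a : G.arr.of g ⟶ G.arr.of g')
    (h : G.arr.pr a ≫ p' = p),
    G.mulHom (G.oneHom (G.arr.pr a) p p' h) a ((G.s_one p).trans e) ((G.s_one p').trans e')
        (G.pr_oneHom _ p p' h) ≫ (lam p' g' e').hom = (lam p g e).hom ≫ a
  /-- the right identity 2-isomorphism `g · 1 ≅ g` -/
  rho : ∀ {U : Man.{u}} (g : G.arr.Ob U) (p : U ⟶ G.M) (e : G.s g = p),
    G.arr.of (G.mul g (G.one p) (e.trans (G.t_one p).symm)) ≅ G.arr.of g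
  rho_pr : ∀ {U : Man.{u}} (g : G.arr.Ob U) (p : U ⟶ G.M) (e : G.s g = p),
    G.arr.pr (rho g p e).hom = 𝟙 U
  rho_nat : ∀ {U V : Man.{u}} (g : G.arr.Ob U) (p : U ⟶ G.M) (e : G.s g = p) (g' : G.arr.Ob V)
    (p' : V ⟶ G.M) (e' : G.s g' = p') (a : G.arr.of g ⟶ G.arr.of g') (h : G.arr.pr a ≫ p' = p),
    G.mulHom a (G.oneHom (G.arr.pr a) p p' h) (e.trans (G.t_one p).symm)
        (e'.trans (G.t_one p').symm) (G.pr_oneHom _ p p' h).symm ≫ (rho g' p' e').hom =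
      (rho g p e).hom ≫ a
  /-- the left inversion 2-isomorphism `g⁻¹ · g ≅ 1` -/
  invl : ∀ {U : Man.{u}} (g : G.arr.Ob U),
    G.arr.of (G.mul (G.inv g) g (G.s_inv g)) ≅ G.arr.of (G.one (G.s g))
  invl_pr : ∀ {U : Man.{u}} (g : G.arr.Ob U), G.arr.pr (invl g).hom = 𝟙 U
  invl_nat : ∀ {U V : Man.{u}} {g : G.arr.Ob U} {g' : G.arr.Ob V} (a : G.arr.of g ⟶ G.arr.of g'),
    G.mulHom (G.invHom a) a (G.s_inv g) (G.s_inv g') (G.pr_invHom a) ≫ (invl g').hom =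
      (invl g).hom ≫ G.oneHom (G.arr.pr a) _ _ (G.src.val_eq a)
  /-- the right inversion 2-isomorphism `g · g⁻¹ ≅ 1` -/
  invr : ∀ {U : Man.{u}} (g : G.arr.Ob U),
    G.arr.of (G.mul g (G.inv g) (G.t_inv g).symm) ≅ G.arr.of (G.one (G.t g))
  invr_pr : ∀ {U : Man.{u}} (g : G.arr.Ob U), G.arr.pr (invr g).hom = 𝟙 U
  invr_nat : ∀ {U V : Man.{u}} {g : G.arr.Ob U} {g' : G.arr.Ob V} (a : G.arr.of g ⟶ G.arr.of g'),
    G.mulHom a (G.invHom a) (G.t_inv g).symm (G.t_inv g').symm (G.pr_invHom a).symm ≫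
        (invr g').hom =
      (invr g).hom ≫ G.oneHom (G.arr.pr a) _ _ (G.tgt.val_eq a)
  /-- the two ways from `k · (g · (h · l))` to `((k · g) · h) · l` agree -/
  pentagon : ∀ {U : Man.{u}} (k g h l : G.arr.Ob U) (e₁ : G.s k = G.t g) (e₂ : G.s g = G.t h)
    (e₃ : G.s h = G.t l),
    (assoc k g (G.mul h l e₃) e₁ (e₂.trans (G.t_mul h l e₃).symm)).hom ≫
      (assoc (G.mul k g e₁) h l ((G.s_mul k g e₁).trans e₂) e₃).hom =
    G.mulHom (𝟙 (G.arr.of k)) (assoc g h l e₂ e₃).hom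
        (by rw [G.t_mul]; exact e₁) (by rw [G.t_mul, G.t_mul]; exact e₁)
        (by rw [pr_id, assoc_pr]) ≫
      (assoc k (G.mul g h e₂) l (e₁.trans (G.t_mul g h e₂).symm)
        ((G.s_mul g h e₂).trans e₃)).hom ≫
      G.mulHom (assoc k g h e₁ e₂).hom (𝟙 (G.arr.of l))
        (by rw [G.s_mul, G.s_mul]; exact e₃) (by rw [G.s_mul]; exact e₃)
        (by rw [pr_id, assoc_pr])
  /-- the two ways from `1 · (g · h)` to `g · h` agree -/
  one_left : ∀ {U : Man.{u}} (p : U ⟶ G.M) (g h : G.arr.Ob U) (e₀ : p = G.t g)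
    (e : G.s g = G.t h),
    (assoc (G.one p) g h ((G.s_one p).trans e₀) e).hom ≫
      G.mulHom (lam p g e₀).hom (𝟙 (G.arr.of h)) (by rw [G.s_mul]; exact e) e
        (by rw [pr_id, lam_pr]) =
    (lam p (G.mul g h e) (e₀.trans (G.t_mul g h e).symm)).hom
  /-- the two ways from `g · (1 · h)` to `g · h` agree -/
  one_mid : ∀ {U : Man.{u}} (g h : G.arr.Ob U) (p : U ⟶ G.M) (e : G.s g = p) (e' : p = G.t h),
    (assoc g (G.one p) h (e.trans (G.t_one p).symm) ((G.s_one p).trans e')).hom ≫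
      G.mulHom (rho g p e).hom (𝟙 (G.arr.of h)) (by rw [G.s_mul, G.s_one]; exact e')
        (e.trans e') (by rw [pr_id, rho_pr]) =
    G.mulHom (𝟙 (G.arr.of g)) (lam p h e').hom (by rw [G.t_mul, G.t_one]; exact e) (e.trans e')
      (by rw [pr_id, lam_pr])
  /-- the two ways from `g · (h · 1)` to `g · h` agree -/
  one_right : ∀ {U : Man.{u}} (g h : G.arr.Ob U) (p : U ⟶ G.M) (e : G.s g = G.t h)
    (e' : G.s h = p),
    (assoc g h (G.one p) e (e'.trans (G.t_one p).symm)).hom ≫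
      (rho (G.mul g h e) p ((G.s_mul g h e).trans e')).hom =
    G.mulHom (𝟙 (G.arr.of g)) (rho h p e').hom (by rw [G.t_mul]; exact e) e
      (by rw [pr_id, rho_pr])
  /-- the two ways from `g · (g⁻¹ · g)` to `g` agree -/
  inv_mid : ∀ {U : Man.{u}} (g : G.arr.Ob U),
    (assoc g (G.inv g) g (G.t_inv g).symm (G.s_inv g)).hom ≫
      G.mulHom (invr g).hom (𝟙 (G.arr.of g)) (by rw [G.s_mul, G.s_inv]) (G.s_one _)
        (by rw [pr_id, invr_pr]) ≫ (lam (G.t g) g rfl).hom =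
    G.mulHom (𝟙 (G.arr.of g)) (invl g).hom (by rw [G.t_mul, G.t_inv]) (G.t_one _).symm
        (by rw [pr_id, invl_pr]) ≫ (rho g (G.s g) rfl).hom

end PreGroupoid

set_option linter.checkUnivs false in
/-- A groupoid in categories fibred in groupoids (a cfg-groupoid) `G ⇉ M`. -/
structure CfgGroupoid extends PreGroupoid.{w, u} where
  coh : toPreGroupoid.Coherence

/-- A stacky groupoid is a cfg-groupoid whose category fibred in groupoids of arrows is a stack. -/
def CfgGroupoid.IsStacky (G : CfgGroupoid.{w, u}) : Prop := G.arr.IsStack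

/-! ### Actions -/

/-- The moment map and the action map of a right action, with their strict compatibility. -/
structure PreAction (G : CfgGroupoid.{w, u}) (X : CFG.{w, u}) where
  moment : Mor X G.M.cfg
  act : Mor (pull moment G.tgt) X
  moment_act : ∀ {U : Man.{u}} (x : X.Ob U) (g : G.arr.Ob U) (e : moment.val x = G.tgt.val g),
    moment.val (act.obj (pullOb x g e)) = G.src.val g

namespace PreAction

variable {G : CfgGroupoid.{w, u}} {X : CFG.{w, u}} (A : PreAction G X) {U V W : Man.{u}}

/-- The value of the moment map. -/
abbrev mo (x : X.Ob U) : U ⟶ G.M := A.moment.val x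

/-- The object `x · g`. -/
def sm (x : X.Ob U) (g : G.arr.Ob U) (e : A.mo x = G.t g) : X.Ob U := A.act.obj (pullOb x g e)

/-- The arrow `b · j`. -/
def smHom {x : X.Ob U} {x' : X.Ob V} {g : G.arr.Ob U} {g' : G.arr.Ob V} (b : X.of x ⟶ X.of x')
    (j : G.arr.of g ⟶ G.arr.of g') (e : A.mo x = G.t g) (e' : A.mo x' = G.t g')
    (hp : X.pr b = G.arr.pr j) : X.of (A.sm x g e) ⟶ X.of (A.sm x' g' e') :=
  A.act.map (pullHom b j e e' hp)

theorem mo_sm (x : X.Ob U) (g : G.arr.Ob U) (e : A.mo x = G.t g) : A.mo (A.sm x g e) = G.s g :=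
  A.moment_act x g e

@[simp] theorem pr_smHom {x : X.Ob U} {x' : X.Ob V} {g : G.arr.Ob U} {g' : G.arr.Ob V}
    (b : X.of x ⟶ X.of x') (j : G.arr.of g ⟶ G.arr.of g') (e : A.mo x = G.t g)
    (e' : A.mo x' = G.t g') (hp : X.pr b = G.arr.pr j) :
    X.pr (A.smHom b j e e' hp) = X.pr b := A.act.pr_map _

@[simp] theorem smHom_id (x : X.Ob U) (g : G.arr.Ob U) (e : A.mo x = G.t g) :
    A.smHom (𝟙 (X.of x)) (𝟙 (G.arr.of g)) e e (by simp) = 𝟙 (X.of (A.sm x g e)) :=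
  A.act.map_id _

theorem smHom_comp {x : X.Ob U} {x' : X.Ob V} {x'' : X.Ob W} {g : G.arr.Ob U} {g' : G.arr.Ob V}
    {g'' : G.arr.Ob W} (b : X.of x ⟶ X.of x') (j : G.arr.of g ⟶ G.arr.of g') (e : A.mo x = G.t g)
    (e' : A.mo x' = G.t g') (hp : X.pr b = G.arr.pr j) (b' : X.of x' ⟶ X.of x'')
    (j' : G.arr.of g' ⟶ G.arr.of g'') (e'' : A.mo x'' = G.t g'') (hp' : X.pr b' = G.arr.pr j') :
    A.smHom b j e e' hp ≫ A.smHom b' j' e' e'' hp' =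
      A.smHom (b ≫ b') (j ≫ j') e e'' (by simp [hp, hp']) :=
  (A.act.map_comp (pullHom b j e e' hp) (pullHom b' j' e' e'' hp')).symm

/-- The associativity and identity 2-isomorphisms of a right action, given by their components,
with the higher coherence conditions. -/
structure Coherence where
  /-- the associativity 2-isomorphism `x · (g · h) ≅ (x · g) · h` -/
  beta : ∀ {U : Man.{u}} (x : X.Ob U) (g h : G.arr.Ob U) (e : A.mo x = G.t g)
    (e' : G.s g = G.t h),
    X.of (A.sm x (G.mul g h e') (e.trans (G.t_mul g h e').symm)) ≅
      X.of (A.sm (A.sm x g e) h ((A.mo_sm x g e).trans e'))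
  beta_pr : ∀ {U : Man.{u}} (x : X.Ob U) (g h : G.arr.Ob U) (e : A.mo x = G.t g)
    (e' : G.s g = G.t h), X.pr (beta x g h e e').hom = 𝟙 U
  beta_nat : ∀ {U V : Man.{u}} {x : X.Ob U} {g h : G.arr.Ob U} {x' : X.Ob V} {g' h' : G.arr.Ob V}
    (a : X.of x ⟶ X.of x') (b : G.arr.of g ⟶ G.arr.of g') (c : G.arr.of h ⟶ G.arr.of h')
    (e₁ : A.mo x = G.t g) (e₂ : G.s g = G.t h) (e₁' : A.mo x' = G.t g') (e₂' : G.s g' = G.t h')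
    (hab : X.pr a = G.arr.pr b) (hbc : G.arr.pr b = G.arr.pr c),
    A.smHom a (G.mulHom b c e₂ e₂' hbc) (e₁.trans (G.t_mul g h e₂).symm)
        (e₁'.trans (G.t_mul g' h' e₂').symm) (hab.trans (G.pr_mulHom b c e₂ e₂' hbc).symm) ≫
      (beta x' g' h' e₁' e₂').hom =
    (beta x g h e₁ e₂).hom ≫
      A.smHom (A.smHom a b e₁ e₁' hab) c ((A.mo_sm x g e₁).trans e₂)
        ((A.mo_sm x' g' e₁').trans e₂') ((A.pr_smHom a b e₁ e₁' hab).trans (hab.trans hbc))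
  /-- the identity 2-isomorphism `x · 1 ≅ x` -/
  eps : ∀ {U : Man.{u}} (x : X.Ob U) (p : U ⟶ G.M) (e : A.mo x = p),
    X.of (A.sm x (G.one p) (e.trans (G.t_one p).symm)) ≅ X.of x
  eps_pr : ∀ {U : Man.{u}} (x : X.Ob U) (p : U ⟶ G.M) (e : A.mo x = p),
    X.pr (eps x p e).hom = 𝟙 U
  eps_nat : ∀ {U V : Man.{u}} (x : X.Ob U) (p : U ⟶ G.M) (e : A.mo x = p) (x' : X.Ob V)
    (p' : V ⟶ G.M) (e' : A.mo x' = p') (a : X.of x ⟶ X.of x') (h : X.pr a ≫ p' = p),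
    A.smHom a (G.oneHom (X.pr a) p p' h) (e.trans (G.t_one p).symm)
        (e'.trans (G.t_one p').symm) (G.pr_oneHom _ p p' h).symm ≫ (eps x' p' e').hom =
      (eps x p e).hom ≫ a
  /-- the two ways from `x · (g · (h · l))` to `((x · g) · h) · l` agree -/
  pentagon : ∀ {U : Man.{u}} (x : X.Ob U) (g h l : G.arr.Ob U) (e₁ : A.mo x = G.t g)
    (e₂ : G.s g = G.t h) (e₃ : G.s h = G.t l),
    (beta x g (G.mul h l e₃) e₁ (e₂.trans (G.t_mul h l e₃).symm)).hom ≫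
      (beta (A.sm x g e₁) h l ((A.mo_sm x g e₁).trans e₂) e₃).hom =
    A.smHom (𝟙 (X.of x)) (G.coh.assoc g h l e₂ e₃).hom
        (by rw [G.t_mul]; exact e₁) (by rw [G.t_mul, G.t_mul]; exact e₁)
        (by rw [pr_id, G.coh.assoc_pr]) ≫
      (beta x (G.mul g h e₂) l (e₁.trans (G.t_mul g h e₂).symm)
        ((G.s_mul g h e₂).trans e₃)).hom ≫
      A.smHom (beta x g h e₁ e₂).hom (𝟙 (G.arr.of l))
        (by rw [A.mo_sm, G.s_mul]; exact e₃) (by rw [A.mo_sm]; exact e₃)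
        (by rw [pr_id, beta_pr])
  /-- the two ways from `x · (1 · g)` to `x · g` agree -/
  one_mid : ∀ {U : Man.{u}} (x : X.Ob U) (g : G.arr.Ob U) (p : U ⟶ G.M) (e : A.mo x = p)
    (e' : p = G.t g),
    (beta x (G.one p) g (e.trans (G.t_one p).symm) ((G.s_one p).trans e')).hom ≫
      A.smHom (eps x p e).hom (𝟙 (G.arr.of g)) (by rw [A.mo_sm, G.s_one]; exact e')
        (e.trans e') (by rw [pr_id, eps_pr]) =
    A.smHom (𝟙 (X.of x)) (G.coh.lam p g e').hom (by rw [G.t_mul, G.t_one]; exact e)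
      (e.trans e') (by rw [pr_id, G.coh.lam_pr])
  /-- the two ways from `x · (g · 1)` to `x · g` agree -/
  one_right : ∀ {U : Man.{u}} (x : X.Ob U) (g : G.arr.Ob U) (p : U ⟶ G.M) (e : A.mo x = G.t g)
    (e' : G.s g = p),
    (beta x g (G.one p) e (e'.trans (G.t_one p).symm)).hom ≫
      (eps (A.sm x g e) p ((A.mo_sm x g e).trans e')).hom =
    A.smHom (𝟙 (X.of x)) (G.coh.rho g p e').hom (by rw [G.t_mul]; exact e) e
      (by rw [pr_id, G.coh.rho_pr])

end PreAction

/-- A right action of a cfg-groupoid on a category fibred in groupoids. -/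
structure Action (G : CfgGroupoid.{w, u}) (X : CFG.{w, u}) extends PreAction G X where
  coh : toPreAction.Coherence

/-- The action is 1-free: `𝟙 · j = 𝟙 · j'` implies `j = j'`, for arrows `j` and `j'` between
objects of the fibre of the target map over the value of the moment map. -/
def Action.OneFree {G : CfgGroupoid.{w, u}} {X : CFG.{w, u}} (A : Action G X) : Prop :=
  ∀ {U : Man.{u}} (x : X.Ob U) (g g' : G.arr.Ob U) (e : A.mo x = G.t g) (e' : A.mo x = G.t g')
    (j j' : G.arr.of g ⟶ G.arr.of g') (hj : X.pr (𝟙 (X.of x)) = G.arr.pr j)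
    (hj' : X.pr (𝟙 (X.of x)) = G.arr.pr j'),
    A.smHom (𝟙 (X.of x)) j e e' hj = A.smHom (𝟙 (X.of x)) j' e e' hj' → j = j'

/-! ### The prequotient of an action -/

namespace Action

variable {G : CfgGroupoid.{w, u}} {X : CFG.{w, u}} (A : Action G X) {U V W : Man.{u}}

/-- The pairs `(g, b)` with `b : x · g ⟶ y`. -/
structure PreArrow (x : X.Ob U) (y : X.Ob V) : Type w where
  g : G.arr.Ob U
  mo_eq : A.mo x = G.t g
  b : X.of (A.sm x g mo_eq) ⟶ X.of y

/-- Two pairs `(g, b)` and `(g', b')` are identified if there is an isomorphism `j : g ⟶ g'` over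
the identity with `b' ∘ (𝟙 · j) = b`. -/
def Rel {x : X.Ob U} {y : X.Ob V} (c c' : A.PreArrow x y) : Prop :=
  ∃ (j : G.arr.of c.g ⟶ G.arr.of c'.g) (hj : X.pr (𝟙 (X.of x)) = G.arr.pr j),
    A.smHom (𝟙 (X.of x)) j c.mo_eq c'.mo_eq hj ≫ c'.b = c.b

theorem rel_equivalence (x : X.Ob U) (y : X.Ob V) :
    Equivalence (A.Rel (x := x) (y := y)) where
  refl c := ⟨𝟙 _, by simp, by simp⟩
  symm := by
    rintro ⟨g, e, b⟩ ⟨g', e', b'⟩ ⟨j, hj, h⟩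
    have := isIso_of_pr j (by rw [← hj, pr_id])
    have hk : G.arr.pr (inv j) = 𝟙 U := pr_inv (asIso j) (by rw [asIso_hom, ← hj, pr_id])
    refine ⟨inv j, by rw [hk, pr_id], ?_⟩
    dsimp only at h ⊢
    rw [← h, ← Category.assoc, A.smHom_comp]
    simp
  trans := by
    rintro ⟨g, e, b⟩ ⟨g', e', b'⟩ ⟨g'', e'', b''⟩ ⟨j, hj, h⟩ ⟨k, hk, h'⟩
    refine ⟨j ≫ k, by rw [pr_comp, ← hj, ← hk]; simp, ?_⟩
    dsimp only at h h' ⊢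
    rw [← h, ← h', ← Category.assoc, A.smHom_comp]
    simp

/-- The setoid of pairs `(g, b)`. -/
def arrowSetoid (x : X.Ob U) (y : X.Ob V) : Setoid (A.PreArrow x y) := ⟨A.Rel, A.rel_equivalence x y⟩

/-- Arrows of the prequotient: classes `[g, b]`. -/
def Arrow (x : X.Ob U) (y : X.Ob V) : Type w := Quotient (A.arrowSetoid x y)

/-- The class `[g, b]`. -/
def cls {x : X.Ob U} {y : X.Ob V} (g : G.arr.Ob U) (e : A.mo x = G.t g)
    (b : X.of (A.sm x g e) ⟶ X.of y) : A.Arrow x y := Quotient.mk (A.arrowSetoid x y) ⟨g, e, b⟩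

theorem cls_eq_iff {x : X.Ob U} {y : X.Ob V} {g g' : G.arr.Ob U} {e : A.mo x = G.t g}
    {e' : A.mo x = G.t g'} {b : X.of (A.sm x g e) ⟶ X.of y} {b' : X.of (A.sm x g' e') ⟶ X.of y} :
    A.cls g e b = A.cls g' e' b' ↔ ∃ (j : G.arr.of g ⟶ G.arr.of g')
      (hj : X.pr (𝟙 (X.of x)) = G.arr.pr j), A.smHom (𝟙 (X.of x)) j e e' hj ≫ b' = b :=
  ⟨fun h => Quotient.exact h, fun h => Quotient.sound h⟩

/-- The smooth map underlying `[g, b]`. -/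
def arrowPr {x : X.Ob U} {y : X.Ob V} : A.Arrow x y → (U ⟶ V) :=
  Quotient.lift (fun c => X.pr c.b) (by
    rintro ⟨g, e, b⟩ ⟨g', e', b'⟩ ⟨j, hj, h⟩
    dsimp only at h ⊢
    rw [← h]
    simp)

theorem arrowPr_cls {x : X.Ob U} {y : X.Ob V} (g : G.arr.Ob U) (e : A.mo x = G.t g)
    (b : X.of (A.sm x g e) ⟶ X.of y) : A.arrowPr (A.cls g e b) = X.pr b := rfl

theorem comp_mo {x : X.Ob U} {y : X.Ob V} {g : G.arr.Ob U} {e : A.mo x = G.t g}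
    (b : X.of (A.sm x g e) ⟶ X.of y) {h : G.arr.Ob V} (e' : A.mo y = G.t h) {h' : G.arr.Ob U}
    (m : G.arr.of h' ⟶ G.arr.of h) (hm : G.arr.pr m = X.pr b) : G.s g = G.t h' := by
  rw [← A.mo_sm x g e]
  change A.moment.val _ = G.tgt.val _
  rw [← A.moment.val_eq b, ← G.tgt.val_eq m, hm]
  exact congrArg _ e'

/-- The composite of `[g, b]` and `[h, c]` computed with a pull-back `m : h' ⟶ h` of `h` along the
map underlying `b`: the class `[g · h', c ∘ (b · m) ∘ β]`. -/
def compAux {x : X.Ob U} {y : X.Ob V} {z : X.Ob W} (g : G.arr.Ob U) (e : A.mo x = G.t g)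
    (b : X.of (A.sm x g e) ⟶ X.of y) (h : G.arr.Ob V) (e' : A.mo y = G.t h)
    (c : X.of (A.sm y h e') ⟶ X.of z) (h' : G.arr.Ob U) (m : G.arr.of h' ⟶ G.arr.of h)
    (hm : G.arr.pr m = X.pr b) : A.Arrow x z :=
  A.cls (G.mul g h' (A.comp_mo b e' m hm)) (e.trans (G.t_mul _ _ _).symm)
    ((A.coh.beta x g h' e (A.comp_mo b e' m hm)).hom ≫
      A.smHom b m ((A.mo_sm x g e).trans (A.comp_mo b e' m hm)) e' hm.symm ≫ c)

theorem compAux_eq {x : X.Ob U} {y : X.Ob V} {z : X.Ob W} {g₁ g₂ : G.arr.Ob U}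
    {e₁ : A.mo x = G.t g₁} {e₂ : A.mo x = G.t g₂} {b₁ : X.of (A.sm x g₁ e₁) ⟶ X.of y}
    {b₂ : X.of (A.sm x g₂ e₂) ⟶ X.of y} {h₁ h₂ : G.arr.Ob V} {e₁' : A.mo y = G.t h₁}
    {e₂' : A.mo y = G.t h₂} {c₁ : X.of (A.sm y h₁ e₁') ⟶ X.of z}
    {c₂ : X.of (A.sm y h₂ e₂') ⟶ X.of z} {k₁ k₂ : G.arr.Ob U} (m₁ : G.arr.of k₁ ⟶ G.arr.of h₁)
    (hm₁ : G.arr.pr m₁ = X.pr b₁) (m₂ : G.arr.of k₂ ⟶ G.arr.of h₂)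
    (hm₂ : G.arr.pr m₂ = X.pr b₂) (j : G.arr.of g₁ ⟶ G.arr.of g₂)
    (hj : X.pr (𝟙 (X.of x)) = G.arr.pr j)
    (hb : A.smHom (𝟙 (X.of x)) j e₁ e₂ hj ≫ b₂ = b₁) (j' : G.arr.of h₁ ⟶ G.arr.of h₂)
    (hj' : X.pr (𝟙 (X.of y)) = G.arr.pr j')
    (hc : A.smHom (𝟙 (X.of y)) j' e₁' e₂' hj' ≫ c₂ = c₁) :
    A.compAux g₁ e₁ b₁ h₁ e₁' c₁ k₁ m₁ hm₁ = A.compAux g₂ e₂ b₂ h₂ e₂' c₂ k₂ m₂ hm₂ := by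
  have hpr : X.pr b₁ = X.pr b₂ := by rw [← hb]; simp
  have hj'1 : G.arr.pr j' = 𝟙 V := by rw [← hj', pr_id]
  have hj1 : G.arr.pr j = 𝟙 U := by rw [← hj, pr_id]
  obtain ⟨n, hn, hn1⟩ := factor_exists m₂ (m₁ ≫ j') (𝟙 U) (by
    rw [pr_comp, hm₁, hm₂, hj'1, hpr]; simp)
  refine A.cls_eq_iff.2 ⟨G.mulHom j n _ _ (by rw [hj1, hn1]), by simp [hj1], ?_⟩
  rw [← Category.assoc, A.coh.beta_nat (𝟙 (X.of x)) j n e₁ (A.comp_mo b₁ e₁' m₁ hm₁) e₂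
    (A.comp_mo b₂ e₂' m₂ hm₂) hj (by rw [hj1, hn1]), Category.assoc, ← Category.assoc (A.smHom _ _ _ _ _),
    A.smHom_comp]
  simp only [hb, hn]
  rw [← hc, ← Category.assoc (A.smHom _ _ _ _ _), A.smHom_comp]
  simp

/-- Composition of arrows of the prequotient. -/
def arrowComp {x : X.Ob U} {y : X.Ob V} {z : X.Ob W} (a : A.Arrow x y) (c : A.Arrow y z) :
    A.Arrow x z :=
  Quotient.liftOn₂ a c (fun a c => A.compAux a.g a.mo_eq a.b c.g c.mo_eq c.b
      (lift_exists c.g (X.pr a.b)).choose (lift_exists c.g (X.pr a.b)).choose_spec.choose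
      (lift_exists c.g (X.pr a.b)).choose_spec.choose_spec) (by
    rintro ⟨g₁, e₁, b₁⟩ ⟨h₁, e₁', c₁⟩ ⟨g₂, e₂, b₂⟩ ⟨h₂, e₂', c₂⟩ ⟨j, hj, hb⟩ ⟨j', hj', hc⟩
    exact A.compAux_eq _ _ _ _ j hj hb j' hj' hc)

/-- The composite can be computed with any choice of pull-back. -/
theorem cls_comp_mk {x : X.Ob U} {y : X.Ob V} {z : X.Ob W} (g : G.arr.Ob U) (e : A.mo x = G.t g)
    (b : X.of (A.sm x g e) ⟶ X.of y) (h : G.arr.Ob V) (e' : A.mo y = G.t h)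
    (c : X.of (A.sm y h e') ⟶ X.of z) (h' : G.arr.Ob U) (m : G.arr.of h' ⟶ G.arr.of h)
    (hm : G.arr.pr m = X.pr b) :
    A.arrowComp (A.cls g e b) (A.cls h e' c) = A.compAux g e b h e' c h' m hm :=
  A.compAux_eq (lift_exists h (X.pr b)).choose_spec.choose
    (lift_exists h (X.pr b)).choose_spec.choose_spec m hm (𝟙 _) (by simp) (by simp) (𝟙 _)
    (by simp) (by simp)

/-- The identity `[1, ε]`. -/
def arrowId (x : X.Ob U) : A.Arrow x x :=
  A.cls (G.one (A.mo x)) (G.t_one _).symm (A.coh.eps x (A.mo x) rfl).hom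

theorem arrowPr_comp {x : X.Ob U} {y : X.Ob V} {z : X.Ob W} (a : A.Arrow x y) (c : A.Arrow y z) :
    A.arrowPr (A.arrowComp a c) = A.arrowPr a ≫ A.arrowPr c := by
  induction a using Quotient.inductionOn with | _ a =>
  induction c using Quotient.inductionOn with | _ c =>
  obtain ⟨g, e, b⟩ := a
  obtain ⟨h, e', c⟩ := c
  obtain ⟨h', m, hm⟩ := lift_exists h (X.pr b)
  change A.arrowPr (A.arrowComp (A.cls g e b) (A.cls h e' c)) = X.pr b ≫ X.pr c
  rw [A.cls_comp_mk g e b h e' c h' m hm, compAux, arrowPr_cls]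
  simp [A.coh.beta_pr]

theorem arrowComp_assoc {U' : Man.{u}} {x : X.Ob U} {y : X.Ob V} {z : X.Ob W} {t : X.Ob U'}
    (a : A.Arrow x y) (c : A.Arrow y z) (d : A.Arrow z t) :
    A.arrowComp (A.arrowComp a c) d = A.arrowComp a (A.arrowComp c d) := by
  induction a using Quotient.inductionOn with | _ a =>
  induction c using Quotient.inductionOn with | _ c =>
  induction d using Quotient.inductionOn with | _ d =>
  obtain ⟨g, e₁, b⟩ := a
  obtain ⟨h, e₂, c⟩ := c
  obtain ⟨k, e₃, d⟩ := d
  obtain ⟨h', m, hm⟩ := lift_exists h (X.pr b)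
  obtain ⟨k', n, hn⟩ := lift_exists k (X.pr c)
  obtain ⟨k'', n', hn'⟩ := lift_exists k' (X.pr b)
  change A.arrowComp (A.arrowComp (A.cls g e₁ b) (A.cls h e₂ c)) (A.cls k e₃ d) =
    A.arrowComp (A.cls g e₁ b) (A.arrowComp (A.cls h e₂ c) (A.cls k e₃ d))
  have i₁ := A.comp_mo b e₂ m hm
  have i₂ := A.comp_mo c e₃ n hn
  have i₃ : G.s h' = G.t k'' := by
    change G.src.val h' = G.tgt.val k''
    rw [← G.src.val_eq m, ← G.tgt.val_eq n', hm, hn']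
    exact congrArg _ i₂
  rw [A.cls_comp_mk g e₁ b h e₂ c h' m hm, A.cls_comp_mk h e₂ c k e₃ d k' n hn, compAux, compAux,
    A.cls_comp_mk _ _ _ k e₃ d k'' (n' ≫ n) (by simp [A.coh.beta_pr, hn, hn']),
    A.cls_comp_mk g e₁ b (G.mul h k' i₂) _ _ (G.mul h' k'' i₃)
      (G.mulHom m n' i₃ i₂ (hm.trans hn'.symm)) (by simp [hm])]
  symm
  refine A.cls_eq_iff.2 ⟨(G.coh.assoc g h' k'' i₁ i₃).hom, by rw [G.coh.assoc_pr, pr_id], ?_⟩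
  have P := A.coh.pentagon x g h' k'' e₁ i₁ i₃
  have N := A.coh.beta_nat b m n' ((A.mo_sm x g e₁).trans i₁) i₃ e₂ i₂ hm.symm (hm.trans hn'.symm)
  have S : A.smHom ((A.coh.beta x g h' e₁ i₁).hom ≫
        A.smHom b m ((A.mo_sm x g e₁).trans i₁) e₂ hm.symm ≫ c) (n' ≫ n)
        (by rw [A.mo_sm, G.s_mul]; exact i₃) e₃ (by simp [A.coh.beta_pr, hn, hn']) =
      A.smHom (A.coh.beta x g h' e₁ i₁).hom (𝟙 (G.arr.of k''))
          (by rw [A.mo_sm, G.s_mul]; exact i₃) (by rw [A.mo_sm]; exact i₃)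
          (by rw [pr_id, A.coh.beta_pr]) ≫
        A.smHom (A.smHom b m ((A.mo_sm x g e₁).trans i₁) e₂ hm.symm) n' _
          (by rw [A.mo_sm]; exact i₂) (by simp [hn']) ≫ A.smHom c n _ e₃ hn.symm := by
    rw [A.smHom_comp, A.smHom_comp]
    simp
  rw [S]
  simp only [← Category.assoc] at P N ⊢
  rw [← P]
  simp only [Category.assoc] at P N ⊢
  rw [← reassoc_of% N]

theorem arrowId_comp {x : X.Ob U} {y : X.Ob V} (a : A.Arrow x y) :
    A.arrowComp (A.arrowId x) a = a := by
  induction a using Quotient.inductionOn with | _ a =>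
  obtain ⟨g, e, b⟩ := a
  change A.arrowComp (A.cls _ _ _) (A.cls g e b) = A.cls g e b
  rw [A.cls_comp_mk _ _ _ g e b g (𝟙 _) (by simp [A.coh.eps_pr]), compAux]
  refine A.cls_eq_iff.2 ⟨(G.coh.lam (A.mo x) g e).hom, by rw [G.coh.lam_pr, pr_id], ?_⟩
  rw [← A.coh.one_mid x g (A.mo x) rfl e, Category.assoc]

/-- The effect on arrows of the projection to the prequotient: `b ↦ [1, b ∘ ε]`. -/
def arrowOf {x : X.Ob U} {y : X.Ob V} (b : X.of x ⟶ X.of y) : A.Arrow x y :=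
  A.cls (G.one (A.mo x)) (G.t_one _).symm ((A.coh.eps x (A.mo x) rfl).hom ≫ b)

theorem arrowPr_arrowOf {x : X.Ob U} {y : X.Ob V} (b : X.of x ⟶ X.of y) :
    A.arrowPr (A.arrowOf b) = X.pr b := by
  rw [arrowOf, arrowPr_cls, pr_comp, A.coh.eps_pr, Category.id_comp]

theorem cls_comp_arrowOf {x : X.Ob U} {y : X.Ob V} {z : X.Ob W} (g : G.arr.Ob U)
    (e : A.mo x = G.t g) (b : X.of (A.sm x g e) ⟶ X.of y) (c : X.of y ⟶ X.of z) :
    A.arrowComp (A.cls g e b) (A.arrowOf c) = A.cls g e (b ≫ c) := by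
  have i : X.pr b ≫ A.mo y = G.s g := by
    rw [← A.mo_sm x g e]; exact A.moment.val_eq b
  rw [arrowOf, A.cls_comp_mk g e b _ _ _ (G.one (G.s g)) (G.oneHom (X.pr b) _ _ i) (by simp),
    compAux]
  refine A.cls_eq_iff.2 ⟨(G.coh.rho g (G.s g) rfl).hom, by rw [G.coh.rho_pr, pr_id], ?_⟩
  rw [← A.coh.one_right x g (G.s g) e rfl]
  have N := A.coh.eps_nat (A.sm x g e) (G.s g) (A.mo_sm x g e) y (A.mo y) rfl b i
  simp only [Category.assoc]
  rw [reassoc_of% N]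

theorem arrow_comp_id {x : X.Ob U} {y : X.Ob V} (a : A.Arrow x y) :
    A.arrowComp a (A.arrowId y) = a := by
  induction a using Quotient.inductionOn with | _ a =>
  obtain ⟨g, e, b⟩ := a
  have h : A.arrowId y = A.arrowOf (𝟙 (X.of y)) := by rw [arrowOf, Category.comp_id]; rfl
  rw [h]
  change A.arrowComp (A.cls g e b) _ = A.cls g e b
  rw [A.cls_comp_arrowOf, Category.comp_id]

theorem arrowOf_id (x : X.Ob U) : A.arrowOf (𝟙 (X.of x)) = A.arrowId x := by
  rw [arrowOf, Category.comp_id]; rfl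

theorem arrowOf_comp {x : X.Ob U} {y : X.Ob V} {z : X.Ob W} (b : X.of x ⟶ X.of y)
    (c : X.of y ⟶ X.of z) :
    A.arrowOf (b ≫ c) = A.arrowComp (A.arrowOf b) (A.arrowOf c) := by
  rw [arrowOf, arrowOf, A.cls_comp_arrowOf, Category.assoc]

/-- The arrow `[g, 𝟙]` from `x` to `x · g`. -/
def gammaArrow (x : X.Ob U) (g : G.arr.Ob U) (e : A.mo x = G.t g) : A.Arrow x (A.sm x g e) :=
  A.cls g e (𝟙 _)

theorem arrowPr_gammaArrow (x : X.Ob U) (g : G.arr.Ob U) (e : A.mo x = G.t g) :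
    A.arrowPr (A.gammaArrow x g e) = 𝟙 U := by rw [gammaArrow, arrowPr_cls, pr_id]

theorem cls_eq_gamma {x : X.Ob U} {y : X.Ob V} (g : G.arr.Ob U) (e : A.mo x = G.t g)
    (b : X.of (A.sm x g e) ⟶ X.of y) :
    A.cls g e b = A.arrowComp (A.gammaArrow x g e) (A.arrowOf b) := by
  rw [gammaArrow, A.cls_comp_arrowOf, Category.id_comp]

theorem gamma_right_inv (x : X.Ob U) (g : G.arr.Ob U) (e : A.mo x = G.t g) :
    ∃ b : X.of (A.sm (A.sm x g e) (G.inv g) ((A.mo_sm x g e).trans (G.t_inv g).symm)) ≅ X.of x,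
      X.pr b.hom = 𝟙 U ∧ A.arrowComp (A.gammaArrow x g e) (A.cls (G.inv g) _ b.hom) = A.arrowId x := by
  have i := (A.mo_sm x g e).trans (G.t_inv g).symm
  let f : X.of (A.sm x (G.mul g (G.inv g) (G.t_inv g).symm) (e.trans (G.t_mul _ _ _).symm)) ⟶
      X.of (A.sm x (G.one (A.mo x)) (G.t_one _).symm) :=
    A.smHom (𝟙 (X.of x)) ((G.coh.invr g).hom ≫ G.oneHom (𝟙 U) _ _ (by simpa using e)) _ _
      (by simp [G.coh.invr_pr])
  have hf : X.pr f = 𝟙 U := by simp [f]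
  have := isIso_of_pr f hf
  refine ⟨(A.coh.beta x g (G.inv g) e (G.t_inv g).symm).symm ≪≫ asIso f ≪≫
    A.coh.eps x (A.mo x) rfl, ?_, ?_⟩
  · simp only [Iso.trans_hom, Iso.symm_hom, asIso_hom, pr_comp, hf, A.coh.eps_pr]
    rw [pr_inv _ (A.coh.beta_pr x g (G.inv g) e (G.t_inv g).symm)]
    simp
  · rw [gammaArrow, A.cls_comp_mk _ _ _ _ _ _ (G.inv g) (𝟙 _) (by simp), compAux]
    refine A.cls_eq_iff.2 ⟨(G.coh.invr g).hom ≫ G.oneHom (𝟙 U) _ _ (by simpa using e),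
      by simp [G.coh.invr_pr], ?_⟩
    simp [f]

theorem gamma_isIso (x : X.Ob U) (g : G.arr.Ob U) (e : A.mo x = G.t g) :
    ∃ a : A.Arrow (A.sm x g e) x, A.arrowPr a = 𝟙 U ∧
      A.arrowComp (A.gammaArrow x g e) a = A.arrowId _ ∧
      A.arrowComp a (A.gammaArrow x g e) = A.arrowId _ := by
  obtain ⟨b, hb, h⟩ := A.gamma_right_inv x g e
  have i := (A.mo_sm x g e).trans (G.t_inv g).symm
  obtain ⟨b', hb', h'⟩ := A.gamma_right_inv (A.sm x g e) (G.inv g) i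
  set a := A.cls (G.inv g) i b.hom with ha
  obtain ⟨a', hq⟩ : ∃ a', A.arrowComp a a' = A.arrowId _ := by
    refine ⟨A.arrowComp (A.arrowOf b.inv) (A.cls (G.inv (G.inv g)) _ b'.hom), ?_⟩
    rw [← A.arrowComp_assoc, ha, A.cls_comp_arrowOf, b.hom_inv_id]
    exact h'
  have : a' = A.gammaArrow x g e := by
    rw [← A.arrowId_comp a', ← h, A.arrowComp_assoc, hq, A.arrow_comp_id]
  exact ⟨a, hb, h, this ▸ hq⟩

/-- The prequotient of a category fibred in groupoids by an action: the objects are those of `X`,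
the arrows from `x` to `y` are the classes `[g, b]` with `b : x · g ⟶ y`. -/
def preq : CFG.{w, u} where
  Ob := X.Ob
  cat :=
    { Hom := fun x y => A.Arrow x.pt y.pt
      id := fun x => A.arrowId x.pt
      comp := fun a c => A.arrowComp a c
      id_comp := fun a => A.arrowId_comp a
      comp_id := fun a => A.arrow_comp_id a
      assoc := fun a c d => A.arrowComp_assoc a c d }
  proj a := A.arrowPr a
  proj_id x := A.coh.eps_pr _ _ _
  proj_comp a c := A.arrowPr_comp a c
  exists_lift := by
    rintro U ⟨V, y⟩ f
    obtain ⟨x, b, hb⟩ := lift_exists y f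
    exact ⟨x, A.arrowOf b, (A.arrowPr_arrowOf b).trans hb⟩
  cartesian := by
    rintro ⟨U, x⟩ ⟨V, y⟩ ⟨W, z⟩ (a : A.Arrow x y) (c : A.Arrow z y) (f : W ⟶ U)
      (hf : f ≫ A.arrowPr a = A.arrowPr c)
    change ∃! d : A.Arrow z x, A.arrowComp d a = c ∧ A.arrowPr d = f
    induction a using Quotient.inductionOn with | _ a =>
    induction c using Quotient.inductionOn with | _ c =>
    obtain ⟨g, e, b⟩ := a
    obtain ⟨h, e', c⟩ := c
    change f ≫ X.pr b = X.pr c at hf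
    change ∃! d : A.Arrow z x, A.arrowComp d (A.cls g e b) = A.cls h e' c ∧ A.arrowPr d = f
    obtain ⟨i, hi, hi₁, hi₂⟩ := A.gamma_isIso x g e
    obtain ⟨c', hc', hcf⟩ := factor_exists b c f hf
    rw [A.cls_eq_gamma g e b]
    refine ⟨A.arrowComp (A.cls h e' c') i, ⟨?_, ?_⟩, ?_⟩
    · rw [A.arrowComp_assoc, ← A.arrowComp_assoc i, hi₂, A.arrowId_comp, A.cls_comp_arrowOf, hc']
    · rw [arrowPr_comp, hi, arrowPr_cls, hcf, Category.comp_id]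
    · rintro d ⟨hd₁, hd₂⟩
      have hd : d = A.arrowComp (A.arrowComp d (A.gammaArrow x g e)) i := by
        rw [A.arrowComp_assoc, hi₁, A.arrow_comp_id]
      rw [hd]
      congr 1
      rw [← A.arrowComp_assoc] at hd₁
      have hd₃ : A.arrowPr (A.arrowComp d (A.gammaArrow x g e)) = f := by
        rw [A.arrowPr_comp, hd₂, A.arrowPr_gammaArrow, Category.comp_id]
      generalize A.arrowComp d (A.gammaArrow x g e) = d' at hd₁ hd₃
      induction d' using Quotient.inductionOn with | _ d' =>
      obtain ⟨k, e'', d'⟩ := d'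
      change A.arrowComp (A.cls k e'' d') (A.arrowOf b) = _ at hd₁
      change X.pr d' = f at hd₃
      change A.cls k e'' d' = _
      rw [A.cls_comp_arrowOf] at hd₁
      obtain ⟨j, hj, hj'⟩ := A.cls_eq_iff.1 hd₁
      refine A.cls_eq_iff.2 ⟨j, hj, ?_⟩
      refine factor_unique b ?_ ?_
      · rw [Category.assoc, hc', hj']
      · rw [pr_comp, A.pr_smHom, pr_id, Category.id_comp, hcf, hd₃]

/-- The projection `q : X ⟶ X // G` to the prequotient. -/
def quot : Mor X A.preq where
  obj x := x
  map b := A.arrowOf b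
  map_id x := A.arrowOf_id x
  map_comp b c := A.arrowOf_comp b c
  pr_map b := A.arrowPr_arrowOf b

/-- The arrow `[g, 𝟙] : x ⟶ x · g` of the prequotient, by which the action is on the fibres of the
projection to the prequotient. -/
def gamma (x : X.Ob U) (g : G.arr.Ob U) (e : A.mo x = G.t g) :
    A.preq.of (A.quot.obj x) ⟶ A.preq.of (A.quot.obj (A.sm x g e)) :=
  A.gammaArrow x g e

end Action

set_option linter.unusedVariables false

/-! ### Products of groupoids -/

namespace CFG

variable {X Y : CFG.{w, u}} {U V W : Man.{u}}

/-- The first component of an object of the product. -/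
def obFst (p : (prod X Y).Ob U) : X.Ob U := PairOb.fst p

/-- The second component of an object of the product. -/
def obSnd (p : (prod X Y).Ob U) : Y.Ob U := PairOb.snd p

/-- The first component of an arrow of the product. -/
def homFst {p : (prod X Y).Ob U} {q : (prod X Y).Ob V} (a : (prod X Y).of p ⟶ (prod X Y).of q) :
    X.of (obFst p) ⟶ X.of (obFst q) := PairHom.fst a

/-- The second component of an arrow of the product. -/
def homSnd {p : (prod X Y).Ob U} {q : (prod X Y).Ob V} (a : (prod X Y).of p ⟶ (prod X Y).of q) :
    Y.of (obSnd p) ⟶ Y.of (obSnd q) := PairHom.snd a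

theorem homFst_pr {p : (prod X Y).Ob U} {q : (prod X Y).Ob V}
    (a : (prod X Y).of p ⟶ (prod X Y).of q) : X.pr (homFst a) = (prod X Y).pr a := rfl

theorem homSnd_pr {p : (prod X Y).Ob U} {q : (prod X Y).Ob V}
    (a : (prod X Y).of p ⟶ (prod X Y).of q) : Y.pr (homSnd a) = (prod X Y).pr a :=
  (PairHom.pr_eq a).symm

theorem hom_ext {p : (prod X Y).Ob U} {q : (prod X Y).Ob V}
    {a b : (prod X Y).of p ⟶ (prod X Y).of q} (h₁ : homFst a = homFst b)
    (h₂ : homSnd a = homSnd b) : a = b := PairHom.ext h₁ h₂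

/-- A pair of isomorphisms over identities. -/
def prodIso {x x' : X.Ob U} {y y' : Y.Ob U} (i : X.of x ≅ X.of x') (j : Y.of y ≅ Y.of y')
    (hi : X.pr i.hom = 𝟙 U) (hj : Y.pr j.hom = 𝟙 U) :
    (prod X Y).of (prodOb x y) ≅ (prod X Y).of (prodOb x' y') where
  hom := prodHom i.hom j.hom (hi.trans hj.symm)
  inv := prodHom i.inv j.inv ((pr_inv i hi).trans (pr_inv j hj).symm)
  hom_inv_id := hom_ext i.hom_inv_id j.hom_inv_id
  inv_hom_id := hom_ext i.inv_hom_id j.inv_hom_id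

/-- A morphism to a manifold, from its values. -/
def Mor.ofVal {X : CFG.{w, u}} {M : Man.{u}} (v : ∀ {U : Man.{u}}, X.Ob U → (U ⟶ M))
    (hv : ∀ {U V : Man.{u}} {x : X.Ob U} {y : X.Ob V} (a : X.of x ⟶ X.of y),
      X.pr a ≫ v y = v x) : Mor X M.cfg where
  obj x := manOb (v x)
  map a := manHom (X.pr a) _ _ (hv a)
  map_id x := Subtype.ext (X.pr_id x)
  map_comp a b := Subtype.ext (pr_comp a b)
  pr_map _ := rfl

end CFG

namespace PreGroupoid

/-- The structure maps of the product groupoid. -/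
def prod (G H : PreGroupoid.{w, u}) : PreGroupoid.{w, u} where
  M := G.M.prod H.M
  hausdorff := by
    have := G.hausdorff
    have := H.hausdorff
    exact inferInstanceAs (T2Space (G.M.carrier × H.M.carrier))
  arr := CFG.prod G.arr H.arr
  src := Mor.ofVal (fun g => Man.pair (G.s (obFst g)) (H.s (obSnd g))) fun a =>
    Man.prod_ext (G.src.val_eq (homFst a))
      ((congrArg (· ≫ _) (homSnd_pr a)).symm.trans (H.src.val_eq (homSnd a)))
  tgt := Mor.ofVal (fun g => Man.pair (G.t (obFst g)) (H.t (obSnd g))) fun a =>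
    Man.prod_ext (G.tgt.val_eq (homFst a))
      ((congrArg (· ≫ _) (homSnd_pr a)).symm.trans (H.tgt.val_eq (homSnd a)))
  unit :=
    { obj := fun p => prodOb (G.one (p ≫ Man.fst _ _)) (H.one (p ≫ Man.snd _ _))
      map := fun {U V p q} a => prodHom
        (G.oneHom ((G.M.prod H.M).cfg.pr a) _ _ (congrArg (· ≫ Man.fst _ _) a.2))
        (H.oneHom ((G.M.prod H.M).cfg.pr a) _ _ (congrArg (· ≫ Man.snd _ _) a.2))
        ((G.pr_oneHom _ _ _ _).trans (H.pr_oneHom _ _ _ _).symm)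
      map_id := fun p => hom_ext (G.oneHom_id _) (H.oneHom_id _)
      map_comp := fun a b => hom_ext (G.oneHom_comp _ _ _ _ _ _ _).symm
        (H.oneHom_comp _ _ _ _ _ _ _).symm
      pr_map := fun a => G.pr_oneHom _ _ _ _ }
  inverse :=
    { obj := fun g => prodOb (G.inv (obFst g)) (H.inv (obSnd g))
      map := fun a => prodHom (G.invHom (homFst a)) (H.invHom (homSnd a)) (by
        rw [G.pr_invHom, H.pr_invHom, homFst_pr, homSnd_pr])
      map_id := fun g => hom_ext (G.inverse.map_id _) (H.inverse.map_id _)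
      map_comp := fun a b => hom_ext (G.inverse.map_comp _ _) (H.inverse.map_comp _ _)
      pr_map := fun a => G.inverse.pr_map _ }
  mult :=
    { obj := fun c => prodOb
        (G.mul (obFst (PairOb.fst c)) (obFst (PairOb.snd c))
          (congrArg (· ≫ Man.fst _ _) (PairOb.prop c)))
        (H.mul (obSnd (PairOb.fst c)) (obSnd (PairOb.snd c))
          (congrArg (· ≫ Man.snd _ _) (PairOb.prop c)))
      map := fun c => prodHom
        (G.mulHom (homFst (PairHom.fst c)) (homFst (PairHom.snd c)) _ _ (PairHom.pr_eq c))
        (H.mulHom (homSnd (PairHom.fst c)) (homSnd (PairHom.snd c)) _ _ (by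
          rw [homSnd_pr, homSnd_pr]; exact PairHom.pr_eq c))
        ((G.pr_mulHom _ _ _ _ _).trans ((homSnd_pr (PairHom.fst c)).symm.trans
          (H.pr_mulHom _ _ _ _ _).symm))
      map_id := fun c => hom_ext (G.mulHom_id _ _ _) (H.mulHom_id _ _ _)
      map_comp := fun c d => hom_ext (G.mulHom_comp _ _ _ _ _ _ _ _ _).symm
        (H.mulHom_comp _ _ _ _ _ _ _ _ _).symm
      pr_map := fun c => G.pr_mulHom _ _ _ _ _ }
  src_unit p := Man.prod_ext (G.s_one _) (H.s_one _)
  tgt_unit p := Man.prod_ext (G.t_one _) (H.t_one _)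
  src_inverse g := Man.prod_ext (G.s_inv _) (H.s_inv _)
  tgt_inverse g := Man.prod_ext (G.t_inv _) (H.t_inv _)
  src_mult g h e := Man.prod_ext (G.s_mul _ _ _) (H.s_mul _ _ _)
  tgt_mult g h e := Man.prod_ext (G.t_mul _ _ _) (H.t_mul _ _ _)

end PreGroupoid

namespace CfgGroupoid

theorem fst_eq {G H : PreGroupoid.{w, u}} {U : Man.{u}} {p q : U ⟶ G.M.prod H.M} (e : p = q) :
    p ≫ Man.fst _ _ = q ≫ Man.fst _ _ := by rw [e]

theorem snd_eq {G H : PreGroupoid.{w, u}} {U : Man.{u}} {p q : U ⟶ G.M.prod H.M} (e : p = q) :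
    p ≫ Man.snd _ _ = q ≫ Man.snd _ _ := by rw [e]

variable {G : CfgGroupoid.{w, u}} {U V : Man.{u}}

theorem lam_nat_of (p : U ⟶ G.M) (g : G.arr.Ob U) (e : p = G.t g) (p' : V ⟶ G.M)
    (g' : G.arr.Ob V) (e' : p' = G.t g') (a : G.arr.of g ⟶ G.arr.of g') {f : U ⟶ V}
    (hf : G.arr.pr a = f) (h : f ≫ p' = p) :
    G.mulHom (G.oneHom f p p' h) a ((G.s_one p).trans e) ((G.s_one p').trans e')
        ((G.pr_oneHom _ p p' h).trans hf.symm) ≫ (G.coh.lam p' g' e').hom =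
      (G.coh.lam p g e).hom ≫ a := by
  subst hf
  exact G.coh.lam_nat p g e p' g' e' a h

theorem rho_nat_of (g : G.arr.Ob U) (p : U ⟶ G.M) (e : G.s g = p) (g' : G.arr.Ob V)
    (p' : V ⟶ G.M) (e' : G.s g' = p') (a : G.arr.of g ⟶ G.arr.of g') {f : U ⟶ V}
    (hf : G.arr.pr a = f) (h : f ≫ p' = p) :
    G.mulHom a (G.oneHom f p p' h) (e.trans (G.t_one p).symm)
        (e'.trans (G.t_one p').symm) (hf.trans (G.pr_oneHom _ p p' h).symm) ≫
      (G.coh.rho g' p' e').hom = (G.coh.rho g p e).hom ≫ a := by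
  subst hf
  exact G.coh.rho_nat g p e g' p' e' a h

theorem invl_nat_of {g : G.arr.Ob U} {g' : G.arr.Ob V} (a : G.arr.of g ⟶ G.arr.of g')
    {f : U ⟶ V} (hf : G.arr.pr a = f) :
    G.mulHom (G.invHom a) a (G.s_inv g) (G.s_inv g') (G.pr_invHom a) ≫ (G.coh.invl g').hom =
      (G.coh.invl g).hom ≫ G.oneHom f _ _ ((congrArg (· ≫ _) hf.symm).trans (G.src.val_eq a)) := by
  subst hf
  exact G.coh.invl_nat a

theorem invr_nat_of {g : G.arr.Ob U} {g' : G.arr.Ob V} (a : G.arr.of g ⟶ G.arr.of g')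
    {f : U ⟶ V} (hf : G.arr.pr a = f) :
    G.mulHom a (G.invHom a) (G.t_inv g).symm (G.t_inv g').symm (G.pr_invHom a).symm ≫
        (G.coh.invr g').hom =
      (G.coh.invr g).hom ≫ G.oneHom f _ _ ((congrArg (· ≫ _) hf.symm).trans (G.tgt.val_eq a)) := by
  subst hf
  exact G.coh.invr_nat a

/-- The product of two cfg-groupoids, over the product of the base manifolds. -/
def prod (G H : CfgGroupoid.{w, u}) : CfgGroupoid.{w, u} where
  toPreGroupoid := G.toPreGroupoid.prod H.toPreGroupoid
  coh :=
    { assoc := fun g h k e e' => prodIso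
        (G.coh.assoc (obFst g) (obFst h) (obFst k) (fst_eq e) (fst_eq e'))
        (H.coh.assoc (obSnd g) (obSnd h) (obSnd k) (snd_eq e) (snd_eq e'))
        (G.coh.assoc_pr _ _ _ _ _) (H.coh.assoc_pr _ _ _ _ _)
      assoc_pr := fun g h k e e' => G.coh.assoc_pr _ _ _ _ _
      assoc_nat := fun a b c e₁ e₂ e₁' e₂' hab hbc => hom_ext
        (G.coh.assoc_nat (homFst a) (homFst b) (homFst c) _ _ _ _ hab hbc)
        (H.coh.assoc_nat (homSnd a) (homSnd b) (homSnd c) _ _ _ _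
          ((homSnd_pr a).trans (hab.trans (homSnd_pr b).symm))
          ((homSnd_pr b).trans (hbc.trans (homSnd_pr c).symm)))
      lam := fun p g e => prodIso
        (G.coh.lam (p ≫ Man.fst _ _) (obFst g) (fst_eq e))
        (H.coh.lam (p ≫ Man.snd _ _) (obSnd g) (snd_eq e))
        (G.coh.lam_pr _ _ _) (H.coh.lam_pr _ _ _)
      lam_pr := fun p g e => G.coh.lam_pr _ _ _
      lam_nat := fun p g e p' g' e' a h => hom_ext
        (G.coh.lam_nat _ _ _ _ _ _ (homFst a) (fst_eq h))
        (lam_nat_of _ _ _ _ _ _ (homSnd a) (homSnd_pr a) (snd_eq h))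
      rho := fun g p e => prodIso
        (G.coh.rho (obFst g) (p ≫ Man.fst _ _) (fst_eq e))
        (H.coh.rho (obSnd g) (p ≫ Man.snd _ _) (snd_eq e))
        (G.coh.rho_pr _ _ _) (H.coh.rho_pr _ _ _)
      rho_pr := fun g p e => G.coh.rho_pr _ _ _
      rho_nat := fun g p e g' p' e' a h => hom_ext
        (G.coh.rho_nat _ _ _ _ _ _ (homFst a) (fst_eq h))
        (rho_nat_of _ _ _ _ _ _ (homSnd a) (homSnd_pr a) (snd_eq h))
      invl := fun g => prodIso (G.coh.invl (obFst g)) (H.coh.invl (obSnd g))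
        (G.coh.invl_pr _) (H.coh.invl_pr _)
      invl_pr := fun g => G.coh.invl_pr _
      invl_nat := fun a => hom_ext (G.coh.invl_nat (homFst a))
        (invl_nat_of (homSnd a) (homSnd_pr a))
      invr := fun g => prodIso (G.coh.invr (obFst g)) (H.coh.invr (obSnd g))
        (G.coh.invr_pr _) (H.coh.invr_pr _)
      invr_pr := fun g => G.coh.invr_pr _
      invr_nat := fun a => hom_ext (G.coh.invr_nat (homFst a))
        (invr_nat_of (homSnd a) (homSnd_pr a))
      pentagon := fun k g h l e₁ e₂ e₃ => hom_ext
        (G.coh.pentagon (obFst k) (obFst g) (obFst h) (obFst l) _ _ _)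
        (H.coh.pentagon (obSnd k) (obSnd g) (obSnd h) (obSnd l) _ _ _)
      one_left := fun p g h e₀ e => hom_ext (G.coh.one_left _ (obFst g) (obFst h) _ _)
        (H.coh.one_left _ (obSnd g) (obSnd h) _ _)
      one_mid := fun g h p e e' => hom_ext (G.coh.one_mid (obFst g) (obFst h) _ _ _)
        (H.coh.one_mid (obSnd g) (obSnd h) _ _ _)
      one_right := fun g h p e e' => hom_ext (G.coh.one_right (obFst g) (obFst h) _ _ _)
        (H.coh.one_right (obSnd g) (obSnd h) _ _ _)
      inv_mid := fun g => hom_ext (G.coh.inv_mid (obFst g)) (H.coh.inv_mid (obSnd g)) }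

end CfgGroupoid

/-! ### Actions of a product of two groupoids -/

/-- Both identity 2-isomorphisms agree on `1 · 1`. -/
theorem CfgGroupoid.rho_one (G : CfgGroupoid.{w, u}) {U : Man.{u}} (p : U ⟶ G.M) :
    (G.coh.rho (G.one p) p (G.s_one p)).hom = (G.coh.lam p (G.one p) (G.t_one p).symm).hom := by
  have h₁ := G.coh.one_mid (G.one p) (G.one p) p (G.s_one p) (G.t_one p).symm
  have h₂ := G.coh.one_left p (G.one p) (G.one p) (G.t_one p).symm
    ((G.s_one p).trans (G.t_one p).symm)
  have h₃ := CfgGroupoid.lam_nat_of (G := G) p _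
    (((G.t_mul _ _ ((G.s_one p).trans (G.t_one p).symm)).trans (G.t_one p)).symm) p _
    (G.t_one p).symm (G.coh.lam p (G.one p) (G.t_one p).symm).hom (G.coh.lam_pr _ _ _) (Category.id_comp p)
  have h₄ := fun (a : G.arr.of (G.mul (G.one p) (G.one p) ((G.s_one p).trans (G.t_one p).symm)) ⟶
      G.arr.of (G.one p)) (ha : G.arr.pr a = 𝟙 U) => CfgGroupoid.rho_nat_of (G := G) _ p
    ((G.s_mul _ _ ((G.s_one p).trans (G.t_one p).symm)).trans (G.s_one p)) (G.one p) p (G.s_one p)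
    a ha (Category.id_comp p)
  simp only [G.oneHom_id] at h₃ h₄
  rw [cancel_mono] at h₃
  rw [h₃, ← h₂, cancel_epi] at h₁
  have h₅ := h₄ _ (G.coh.rho_pr (G.one p) p (G.s_one p))
  have h₆ := h₄ _ (G.coh.lam_pr p (G.one p) (G.t_one p).symm)
  rw [h₁, h₆, cancel_epi] at h₅
  exact h₅.symm

namespace Action

variable {G H : CfgGroupoid.{w, u}} {X : CFG.{w, u}} {U V W : Man.{u}}

section two

variable (A : Action (G.prod H) X)

/-- The value of the moment map to the base of the first groupoid. -/
abbrev mo₁ (x : X.Ob U) : U ⟶ G.M := A.mo x ≫ Man.fst G.M H.M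

/-- The value of the moment map to the base of the second groupoid. -/
abbrev mo₂ (x : X.Ob U) : U ⟶ H.M := A.mo x ≫ Man.snd G.M H.M

/-- The object `x · (g, h)`. -/
def sm₂ (x : X.Ob U) (g : G.arr.Ob U) (h : H.arr.Ob U) (e₁ : A.mo₁ x = G.t g)
    (e₂ : A.mo₂ x = H.t h) : X.Ob U :=
  A.sm x (prodOb g h) (Man.prod_ext e₁ e₂)

theorem mo₁_sm (x : X.Ob U) (g : G.arr.Ob U) (h : H.arr.Ob U) (e₁ : A.mo₁ x = G.t g)
    (e₂ : A.mo₂ x = H.t h) : A.mo₁ (A.sm₂ x g h e₁ e₂) = G.s g :=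
  congrArg (· ≫ Man.fst G.M H.M) (A.mo_sm x (prodOb g h) (Man.prod_ext e₁ e₂))

theorem mo₂_sm (x : X.Ob U) (g : G.arr.Ob U) (h : H.arr.Ob U) (e₁ : A.mo₁ x = G.t g)
    (e₂ : A.mo₂ x = H.t h) : A.mo₂ (A.sm₂ x g h e₁ e₂) = H.s h :=
  congrArg (· ≫ Man.snd G.M H.M) (A.mo_sm x (prodOb g h) (Man.prod_ext e₁ e₂))

theorem mo₁_eq {x : X.Ob U} {x' : X.Ob V} (b : X.of x ⟶ X.of x') : X.pr b ≫ A.mo₁ x' = A.mo₁ x :=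
  congrArg (· ≫ Man.fst G.M H.M) (A.moment.val_eq b)

theorem mo₂_eq {x : X.Ob U} {x' : X.Ob V} (b : X.of x ⟶ X.of x') : X.pr b ≫ A.mo₂ x' = A.mo₂ x :=
  congrArg (· ≫ Man.snd G.M H.M) (A.moment.val_eq b)

/-- The arrow `b · (j, k)`. -/
def smHom₂ {x : X.Ob U} {x' : X.Ob V} {g : G.arr.Ob U} {g' : G.arr.Ob V} {h : H.arr.Ob U}
    {h' : H.arr.Ob V} (b : X.of x ⟶ X.of x') (j : G.arr.of g ⟶ G.arr.of g')
    (k : H.arr.of h ⟶ H.arr.of h') (e₁ : A.mo₁ x = G.t g) (e₂ : A.mo₂ x = H.t h)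
    (e₁' : A.mo₁ x' = G.t g') (e₂' : A.mo₂ x' = H.t h') (hj : X.pr b = G.arr.pr j)
    (hk : X.pr b = H.arr.pr k) :
    X.of (A.sm₂ x g h e₁ e₂) ⟶ X.of (A.sm₂ x' g' h' e₁' e₂') :=
  A.smHom b (prodHom j k (hj.symm.trans hk)) (Man.prod_ext e₁ e₂) (Man.prod_ext e₁' e₂') hj

@[simp] theorem pr_smHom₂ {x : X.Ob U} {x' : X.Ob V} {g : G.arr.Ob U} {g' : G.arr.Ob V}
    {h : H.arr.Ob U} {h' : H.arr.Ob V} (b : X.of x ⟶ X.of x') (j : G.arr.of g ⟶ G.arr.of g')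
    (k : H.arr.of h ⟶ H.arr.of h') (e₁ : A.mo₁ x = G.t g) (e₂ : A.mo₂ x = H.t h)
    (e₁' : A.mo₁ x' = G.t g') (e₂' : A.mo₂ x' = H.t h') (hj : X.pr b = G.arr.pr j)
    (hk : X.pr b = H.arr.pr k) : X.pr (A.smHom₂ b j k e₁ e₂ e₁' e₂' hj hk) = X.pr b :=
  A.pr_smHom _ _ _ _ _

@[simp] theorem smHom₂_id (x : X.Ob U) (g : G.arr.Ob U) (h : H.arr.Ob U) (e₁ : A.mo₁ x = G.t g)
    (e₂ : A.mo₂ x = H.t h) :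
    A.smHom₂ (𝟙 (X.of x)) (𝟙 (G.arr.of g)) (𝟙 (H.arr.of h)) e₁ e₂ e₁ e₂ (by simp) (by simp) =
      𝟙 (X.of (A.sm₂ x g h e₁ e₂)) :=
  A.smHom_id _ _ _

theorem smHom₂_comp {x : X.Ob U} {x' : X.Ob V} {x'' : X.Ob W} {g : G.arr.Ob U} {g' : G.arr.Ob V}
    {g'' : G.arr.Ob W} {h : H.arr.Ob U} {h' : H.arr.Ob V} {h'' : H.arr.Ob W}
    (b : X.of x ⟶ X.of x') (j : G.arr.of g ⟶ G.arr.of g') (k : H.arr.of h ⟶ H.arr.of h')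
    (e₁ : A.mo₁ x = G.t g) (e₂ : A.mo₂ x = H.t h) (e₁' : A.mo₁ x' = G.t g')
    (e₂' : A.mo₂ x' = H.t h') (hj : X.pr b = G.arr.pr j) (hk : X.pr b = H.arr.pr k)
    (b' : X.of x' ⟶ X.of x'') (j' : G.arr.of g' ⟶ G.arr.of g'') (k' : H.arr.of h' ⟶ H.arr.of h'')
    (e₁'' : A.mo₁ x'' = G.t g'') (e₂'' : A.mo₂ x'' = H.t h'') (hj' : X.pr b' = G.arr.pr j')
    (hk' : X.pr b' = H.arr.pr k') :
    A.smHom₂ b j k e₁ e₂ e₁' e₂' hj hk ≫ A.smHom₂ b' j' k' e₁' e₂' e₁'' e₂'' hj' hk' =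
      A.smHom₂ (b ≫ b') (j ≫ j') (k ≫ k') e₁ e₂ e₁'' e₂'' (by simp [hj, hj'])
        (by simp [hk, hk']) :=
  A.smHom_comp _ _ _ _ _ _ _ _ _

/-- The associativity 2-isomorphism `x · (g · g', h · h') ≅ (x · (g, h)) · (g', h')`. -/
def beta₂ (x : X.Ob U) (g g' : G.arr.Ob U) (h h' : H.arr.Ob U) (e₁ : A.mo₁ x = G.t g)
    (e₂ : A.mo₂ x = H.t h) (i₁ : G.s g = G.t g') (i₂ : H.s h = H.t h') :
    X.of (A.sm₂ x (G.mul g g' i₁) (H.mul h h' i₂) (e₁.trans (G.t_mul g g' i₁).symm)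
      (e₂.trans (H.t_mul h h' i₂).symm)) ≅
    X.of (A.sm₂ (A.sm₂ x g h e₁ e₂) g' h' ((A.mo₁_sm x g h e₁ e₂).trans i₁)
      ((A.mo₂_sm x g h e₁ e₂).trans i₂)) :=
  A.coh.beta x (prodOb g h) (prodOb g' h') (Man.prod_ext e₁ e₂) (Man.pair_eq i₁ i₂)

@[simp] theorem beta₂_pr (x : X.Ob U) (g g' : G.arr.Ob U) (h h' : H.arr.Ob U)
    (e₁ : A.mo₁ x = G.t g) (e₂ : A.mo₂ x = H.t h) (i₁ : G.s g = G.t g') (i₂ : H.s h = H.t h') :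
    X.pr (A.beta₂ x g g' h h' e₁ e₂ i₁ i₂).hom = 𝟙 U := A.coh.beta_pr _ _ _ _ _

@[simp] theorem beta₂_inv_pr (x : X.Ob U) (g g' : G.arr.Ob U) (h h' : H.arr.Ob U)
    (e₁ : A.mo₁ x = G.t g) (e₂ : A.mo₂ x = H.t h) (i₁ : G.s g = G.t g') (i₂ : H.s h = H.t h') :
    X.pr (A.beta₂ x g g' h h' e₁ e₂ i₁ i₂).inv = 𝟙 U := pr_inv _ (A.beta₂_pr _ _ _ _ _ _ _ _ _)

theorem beta₂_nat {x : X.Ob U} {y : X.Ob V} {g g' : G.arr.Ob U} {l l' : G.arr.Ob V}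
    {h h' : H.arr.Ob U} {m m' : H.arr.Ob V} (b : X.of x ⟶ X.of y) (j : G.arr.of g ⟶ G.arr.of l)
    (k : H.arr.of h ⟶ H.arr.of m) (j' : G.arr.of g' ⟶ G.arr.of l')
    (k' : H.arr.of h' ⟶ H.arr.of m') (e₁ : A.mo₁ x = G.t g) (e₂ : A.mo₂ x = H.t h)
    (i₁ : G.s g = G.t g') (i₂ : H.s h = H.t h') (e₁' : A.mo₁ y = G.t l) (e₂' : A.mo₂ y = H.t m)
    (i₁' : G.s l = G.t l') (i₂' : H.s m = H.t m') (hj : X.pr b = G.arr.pr j)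
    (hk : X.pr b = H.arr.pr k) (hj' : G.arr.pr j = G.arr.pr j') (hk' : H.arr.pr k = H.arr.pr k') :
    A.smHom₂ b (G.mulHom j j' i₁ i₁' hj') (H.mulHom k k' i₂ i₂' hk')
        (e₁.trans (G.t_mul g g' i₁).symm) (e₂.trans (H.t_mul h h' i₂).symm)
        (e₁'.trans (G.t_mul l l' i₁').symm) (e₂'.trans (H.t_mul m m' i₂').symm)
        (hj.trans (G.pr_mulHom _ _ _ _ _).symm) (hk.trans (H.pr_mulHom _ _ _ _ _).symm) ≫
      (A.beta₂ y l l' m m' e₁' e₂' i₁' i₂').hom =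
    (A.beta₂ x g g' h h' e₁ e₂ i₁ i₂).hom ≫
      A.smHom₂ (A.smHom₂ b j k e₁ e₂ e₁' e₂' hj hk) j' k' ((A.mo₁_sm x g h e₁ e₂).trans i₁)
        ((A.mo₂_sm x g h e₁ e₂).trans i₂) ((A.mo₁_sm y l m e₁' e₂').trans i₁')
        ((A.mo₂_sm y l m e₁' e₂').trans i₂') ((A.pr_smHom₂ _ _ _ _ _ _ _ _ _).trans (hj.trans hj'))
        ((A.pr_smHom₂ _ _ _ _ _ _ _ _ _).trans (hk.trans hk')) :=
  A.coh.beta_nat b (prodHom j k (hj.symm.trans hk))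
    (prodHom j' k' (hj'.symm.trans (hj.symm.trans (hk.trans hk'))))
    (Man.prod_ext e₁ e₂) (Man.pair_eq i₁ i₂) (Man.prod_ext e₁' e₂') (Man.pair_eq i₁' i₂') hj hj'

theorem beta₂_pentagon (x : X.Ob U) (g g' g'' : G.arr.Ob U) (h h' h'' : H.arr.Ob U)
    (e₁ : A.mo₁ x = G.t g) (e₂ : A.mo₂ x = H.t h) (i₁ : G.s g = G.t g') (i₂ : H.s h = H.t h')
    (k₁ : G.s g' = G.t g'') (k₂ : H.s h' = H.t h'') :
    (A.beta₂ x g (G.mul g' g'' k₁) h (H.mul h' h'' k₂) e₁ e₂ (i₁.trans (G.t_mul g' g'' k₁).symm)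
        (i₂.trans (H.t_mul h' h'' k₂).symm)).hom ≫
      (A.beta₂ (A.sm₂ x g h e₁ e₂) g' g'' h' h'' ((A.mo₁_sm x g h e₁ e₂).trans i₁)
        ((A.mo₂_sm x g h e₁ e₂).trans i₂) k₁ k₂).hom =
    A.smHom₂ (𝟙 (X.of x)) (G.coh.assoc g g' g'' i₁ k₁).hom (H.coh.assoc h h' h'' i₂ k₂).hom
        (by rw [G.t_mul]; exact e₁) (by rw [H.t_mul]; exact e₂)
        (by rw [G.t_mul, G.t_mul]; exact e₁) (by rw [H.t_mul, H.t_mul]; exact e₂)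
        (by rw [pr_id, G.coh.assoc_pr]) (by rw [pr_id, H.coh.assoc_pr]) ≫
      (A.beta₂ x (G.mul g g' i₁) g'' (H.mul h h' i₂) h'' (e₁.trans (G.t_mul g g' i₁).symm)
        (e₂.trans (H.t_mul h h' i₂).symm) ((G.s_mul g g' i₁).trans k₁)
        ((H.s_mul h h' i₂).trans k₂)).hom ≫
      A.smHom₂ (A.beta₂ x g g' h h' e₁ e₂ i₁ i₂).hom (𝟙 (G.arr.of g'')) (𝟙 (H.arr.of h''))
        (by rw [A.mo₁_sm, G.s_mul]; exact k₁) (by rw [A.mo₂_sm, H.s_mul]; exact k₂)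
        (by rw [A.mo₁_sm]; exact k₁) (by rw [A.mo₂_sm]; exact k₂)
        (by rw [pr_id, beta₂_pr]) (by rw [pr_id, beta₂_pr]) :=
  A.coh.pentagon x (prodOb g h) (prodOb g' h') (prodOb g'' h'') (Man.prod_ext e₁ e₂)
    (Man.pair_eq i₁ i₂) (Man.pair_eq k₁ k₂)

/-- The identity 2-isomorphism `x · (1, 1) ≅ x`. -/
def eps₂ (x : X.Ob U) (p : U ⟶ G.M) (q : U ⟶ H.M) (e₁ : A.mo₁ x = p) (e₂ : A.mo₂ x = q) :
    X.of (A.sm₂ x (G.one p) (H.one q) (e₁.trans (G.t_one p).symm) (e₂.trans (H.t_one q).symm)) ≅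
      X.of x :=
  A.coh.eps x (Man.pair p q) (Man.prod_ext e₁ e₂)

@[simp] theorem eps₂_pr (x : X.Ob U) (p : U ⟶ G.M) (q : U ⟶ H.M) (e₁ : A.mo₁ x = p)
    (e₂ : A.mo₂ x = q) : X.pr (A.eps₂ x p q e₁ e₂).hom = 𝟙 U := A.coh.eps_pr _ _ _

theorem eps₂_nat (x : X.Ob U) (p : U ⟶ G.M) (q : U ⟶ H.M) (e₁ : A.mo₁ x = p) (e₂ : A.mo₂ x = q)
    (x' : X.Ob V) (p' : V ⟶ G.M) (q' : V ⟶ H.M) (e₁' : A.mo₁ x' = p') (e₂' : A.mo₂ x' = q')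
    (b : X.of x ⟶ X.of x') (hp : X.pr b ≫ p' = p) (hq : X.pr b ≫ q' = q) :
    A.smHom₂ b (G.oneHom (X.pr b) p p' hp) (H.oneHom (X.pr b) q q' hq) (e₁.trans (G.t_one p).symm)
        (e₂.trans (H.t_one q).symm) (e₁'.trans (G.t_one p').symm) (e₂'.trans (H.t_one q').symm)
        (G.pr_oneHom _ p p' hp).symm (H.pr_oneHom _ q q' hq).symm ≫ (A.eps₂ x' p' q' e₁' e₂').hom =
      (A.eps₂ x p q e₁ e₂).hom ≫ b :=
  A.coh.eps_nat x (Man.pair p q) (Man.prod_ext e₁ e₂) x' (Man.pair p' q') (Man.prod_ext e₁' e₂') b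
    (Man.pair_eq hp hq)

theorem eps₂_one_mid (x : X.Ob U) (g : G.arr.Ob U) (h : H.arr.Ob U) (p : U ⟶ G.M) (q : U ⟶ H.M)
    (e₁ : A.mo₁ x = p) (e₂ : A.mo₂ x = q) (i₁ : p = G.t g) (i₂ : q = H.t h) :
    (A.beta₂ x (G.one p) g (H.one q) h (e₁.trans (G.t_one p).symm) (e₂.trans (H.t_one q).symm)
        ((G.s_one p).trans i₁) ((H.s_one q).trans i₂)).hom ≫
      A.smHom₂ (A.eps₂ x p q e₁ e₂).hom (𝟙 (G.arr.of g)) (𝟙 (H.arr.of h))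
        (by rw [A.mo₁_sm, G.s_one]; exact i₁) (by rw [A.mo₂_sm, H.s_one]; exact i₂)
        (e₁.trans i₁) (e₂.trans i₂) (by rw [pr_id, eps₂_pr]) (by rw [pr_id, eps₂_pr]) =
    A.smHom₂ (𝟙 (X.of x)) (G.coh.lam p g i₁).hom (H.coh.lam q h i₂).hom
      (by rw [G.t_mul, G.t_one]; exact e₁) (by rw [H.t_mul, H.t_one]; exact e₂)
      (e₁.trans i₁) (e₂.trans i₂) (by rw [pr_id, G.coh.lam_pr]) (by rw [pr_id, H.coh.lam_pr]) :=
  A.coh.one_mid x (prodOb g h) (Man.pair p q) (Man.prod_ext e₁ e₂) (Man.pair_eq i₁ i₂)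

theorem eps₂_one_right (x : X.Ob U) (g : G.arr.Ob U) (h : H.arr.Ob U) (p : U ⟶ G.M)
    (q : U ⟶ H.M) (e₁ : A.mo₁ x = G.t g) (e₂ : A.mo₂ x = H.t h) (i₁ : G.s g = p)
    (i₂ : H.s h = q) :
    (A.beta₂ x g (G.one p) h (H.one q) e₁ e₂ (i₁.trans (G.t_one p).symm)
        (i₂.trans (H.t_one q).symm)).hom ≫
      (A.eps₂ (A.sm₂ x g h e₁ e₂) p q ((A.mo₁_sm x g h e₁ e₂).trans i₁)
        ((A.mo₂_sm x g h e₁ e₂).trans i₂)).hom =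
    A.smHom₂ (𝟙 (X.of x)) (G.coh.rho g p i₁).hom (H.coh.rho h q i₂).hom
      (by rw [G.t_mul]; exact e₁) (by rw [H.t_mul]; exact e₂) e₁ e₂
      (by rw [pr_id, G.coh.rho_pr]) (by rw [pr_id, H.coh.rho_pr]) :=
  A.coh.one_right x (prodOb g h) (Man.pair p q) (Man.prod_ext e₁ e₂) (Man.pair_eq i₁ i₂)

end two

end Action

namespace CfgGroupoid

variable {G : CfgGroupoid.{w, u}} {U V : Man.{u}}

@[simp] theorem rho_inv_pr (g : G.arr.Ob U) (p : U ⟶ G.M) (e : G.s g = p) :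
    G.arr.pr (G.coh.rho g p e).inv = 𝟙 U := pr_inv _ (G.coh.rho_pr g p e)

/-- The unit 2-isomorphism `1 · 1 ≅ 1`, where the units are at equal maps `p` and `q`. -/
def oneOne (G : CfgGroupoid.{w, u}) (p q : U ⟶ G.M) (e : p = q) :
    G.arr.of (G.mul (G.one p) (G.one q) ((G.s_one p).trans (e.trans (G.t_one q).symm))) ≅
      G.arr.of (G.one p) :=
  G.coh.rho (G.one p) q ((G.s_one p).trans e)

@[simp] theorem oneOne_pr (p q : U ⟶ G.M) (e : p = q) : G.arr.pr (G.oneOne p q e).hom = 𝟙 U :=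
  G.coh.rho_pr _ _ _

@[simp] theorem oneOne_inv_pr (p q : U ⟶ G.M) (e : p = q) : G.arr.pr (G.oneOne p q e).inv = 𝟙 U :=
  pr_inv _ (G.oneOne_pr _ _ _)

theorem oneOne_nat (p q : U ⟶ G.M) (e : p = q) (p' q' : V ⟶ G.M) (e' : p' = q') (f : U ⟶ V)
    (hp : f ≫ p' = p) (hq : f ≫ q' = q) :
    G.oneHom f p p' hp ≫ (G.oneOne p' q' e').inv =
      (G.oneOne p q e).inv ≫ G.mulHom (G.oneHom f p p' hp) (G.oneHom f q q' hq)
        ((G.s_one p).trans (e.trans (G.t_one q).symm))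
        ((G.s_one p').trans (e'.trans (G.t_one q').symm))
        ((G.pr_oneHom _ _ _ _).trans (G.pr_oneHom _ _ _ _).symm) := by
  rw [Iso.comp_inv_eq, Category.assoc, Iso.eq_inv_comp]
  exact (rho_nat_of _ _ _ _ _ _ (G.oneHom f p p' hp) (G.pr_oneHom _ _ _ _) hq).symm

theorem oneOne_assoc (p p' p'' q : U ⟶ G.M) (e : p = p') (e' : p' = p'') (i : p = q)
    (k : q = p'') :
    (G.oneOne p p' e).inv ≫ G.mulHom (𝟙 _) (G.oneOne p' p'' e').inv
        ((G.s_one p).trans (e.trans (G.t_one p').symm))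
        ((G.s_one p).trans (e.trans ((G.t_mul _ _ _).trans (G.t_one p')).symm)) (by simp) ≫
      (G.coh.assoc (G.one p) (G.one p') (G.one p'') ((G.s_one p).trans (e.trans (G.t_one p').symm))
        ((G.s_one p').trans (e'.trans (G.t_one p'').symm))).hom =
    (G.oneOne p q i).inv ≫ G.mulHom (G.oneOne p p' e).inv
      (G.oneHom (𝟙 U) q p'' ((Category.id_comp _).trans k.symm))
      ((G.s_one p).trans (i.trans (G.t_one q).symm))
      ((G.s_mul _ _ _).trans ((G.s_one p').trans (e'.trans (G.t_one p'').symm))) (by simp) := by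
  subst e e' i
  simp only [G.oneHom_id]
  have h := G.coh.one_right (G.one p) (G.one p) p ((G.s_one p).trans (G.t_one p).symm) (G.s_one p)
  have h' := rho_nat_of (G := G) _ p (G.s_one p) _ p ((G.s_mul _ _ _).trans (G.s_one p))
    (G.oneOne p p rfl).inv (G.oneOne_inv_pr p p rfl) (Category.id_comp p)
  simp only [G.oneHom_id] at h'
  have h₁ : G.mulHom (𝟙 (G.arr.of (G.one p))) (G.oneOne p p rfl).inv
        ((G.s_one p).trans (G.t_one p).symm) ((G.s_one p).trans
      ((G.t_mul _ _ ((G.s_one p).trans (G.t_one p).symm)).trans (G.t_one p)).symm) (by simp) ≫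
      G.mulHom (𝟙 _) (G.coh.rho (G.one p) p (G.s_one p)).hom ((G.s_one p).trans
      ((G.t_mul _ _ ((G.s_one p).trans (G.t_one p).symm)).trans (G.t_one p)).symm)
      ((G.s_one p).trans (G.t_one p).symm) (by simp [G.coh.rho_pr]) = 𝟙 _ := by
    rw [G.mulHom_comp]
    have : (G.oneOne p p rfl).inv ≫ (G.coh.rho (G.one p) p (G.s_one p)).hom = 𝟙 _ :=
      (G.oneOne p p rfl).inv_hom_id
    simp only [this, Category.comp_id]
    exact G.mulHom_id _ _ _
  have h₂ : (G.coh.rho (G.one p) p (G.s_one p)).hom ≫ (G.oneOne p p rfl).inv = 𝟙 _ :=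
    (G.oneOne p p rfl).hom_inv_id
  rw [cancel_epi, ← cancel_mono (G.coh.rho _ p ((G.s_mul (G.one p) (G.one p)
    ((G.s_one p).trans (G.t_one p).symm)).trans (G.s_one p))).hom, Category.assoc, h, h₁, h', h₂]

theorem oneOne_lam (p q : U ⟶ G.M) (e : p = q) :
    (G.oneOne p q e).inv ≫ G.mulHom (𝟙 (G.arr.of (G.one p)))
        (G.oneHom (𝟙 U) q p ((Category.id_comp _).trans e))
        ((G.s_one p).trans (e.trans (G.t_one q).symm)) ((G.s_one p).trans (G.t_one p).symm)
        (by simp) ≫ (G.coh.lam p (G.one p) (G.t_one p).symm).hom = 𝟙 _ := by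
  subst e
  simp only [G.oneHom_id, G.mulHom_id, Category.id_comp]
  rw [← G.rho_one]
  exact (G.oneOne p p rfl).inv_hom_id

end CfgGroupoid

namespace Action

variable {G H : CfgGroupoid.{w, u}} {X : CFG.{w, u}} {U V W : Man.{u}}

/-- Isomorphisms `x · (g, h) ≅ x · (g, h')` from isomorphisms `h ≅ h'`. -/
def isoR (A : Action (G.prod H) X) (x : X.Ob U) (g : G.arr.Ob U) {h h' : H.arr.Ob U}
    (k : H.arr.of h ≅ H.arr.of h') (e₁ : A.mo₁ x = G.t g) (e₂ : A.mo₂ x = H.t h)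
    (e₂' : A.mo₂ x = H.t h') (hk : H.arr.pr k.hom = 𝟙 U) :
    X.of (A.sm₂ x g h e₁ e₂) ≅ X.of (A.sm₂ x g h' e₁ e₂') where
  hom := A.smHom₂ (𝟙 _) (𝟙 _) k.hom e₁ e₂ e₁ e₂' (by simp) (by simp [hk])
  inv := A.smHom₂ (𝟙 _) (𝟙 _) k.inv e₁ e₂' e₁ e₂ (by simp) (by simp [pr_inv k hk])
  hom_inv_id := by simp [A.smHom₂_comp]
  inv_hom_id := by simp [A.smHom₂_comp]

theorem isoR_hom (A : Action (G.prod H) X) (x : X.Ob U) (g : G.arr.Ob U) {h h' : H.arr.Ob U}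
    (k : H.arr.of h ≅ H.arr.of h') (e₁ : A.mo₁ x = G.t g) (e₂ : A.mo₂ x = H.t h)
    (e₂' : A.mo₂ x = H.t h') (hk : H.arr.pr k.hom = 𝟙 U) :
    (A.isoR x g k e₁ e₂ e₂' hk).hom =
      A.smHom₂ (𝟙 _) (𝟙 _) k.hom e₁ e₂ e₁ e₂' (by simp) (by simp [hk]) := rfl

/-- The object `x · (g, 1)`. -/
abbrev smL (A : Action (G.prod H) X) (x : X.Ob U) (g : G.arr.Ob U) (e : A.mo₁ x = G.t g) : X.Ob U :=
  A.sm₂ x g (H.one (A.mo₂ x)) e (H.t_one _).symm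

/-- The arrow `b · (j, 1)`. -/
def smLHom (A : Action (G.prod H) X) {x : X.Ob U} {x' : X.Ob V} {g : G.arr.Ob U} {g' : G.arr.Ob V}
    (b : X.of x ⟶ X.of x') (j : G.arr.of g ⟶ G.arr.of g') (e : A.mo₁ x = G.t g)
    (e' : A.mo₁ x' = G.t g') (hj : X.pr b = G.arr.pr j) :
    X.of (A.smL x g e) ⟶ X.of (A.smL x' g' e') :=
  A.smHom₂ b j (H.oneHom (X.pr b) _ _ (A.mo₂_eq b)) e (H.t_one _).symm e' (H.t_one _).symm hj
    (H.pr_oneHom _ _ _ _).symm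

@[simp] theorem pr_smLHom (A : Action (G.prod H) X) {x : X.Ob U} {x' : X.Ob V} {g : G.arr.Ob U}
    {g' : G.arr.Ob V} (b : X.of x ⟶ X.of x') (j : G.arr.of g ⟶ G.arr.of g') (e : A.mo₁ x = G.t g)
    (e' : A.mo₁ x' = G.t g') (hj : X.pr b = G.arr.pr j) :
    X.pr (A.smLHom b j e e' hj) = X.pr b := A.pr_smHom₂ _ _ _ _ _ _ _ _ _

theorem mo₁_smL (A : Action (G.prod H) X) (x : X.Ob U) (g : G.arr.Ob U) (e : A.mo₁ x = G.t g) :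
    A.mo₁ (A.smL x g e) = G.s g := A.mo₁_sm _ _ _ _ _

theorem mo₂_smL (A : Action (G.prod H) X) (x : X.Ob U) (g : G.arr.Ob U) (e : A.mo₁ x = G.t g) :
    A.mo₂ (A.smL x g e) = A.mo₂ x := (A.mo₂_sm _ _ _ _ _).trans (H.s_one _)

theorem smL_eq (A : Action (G.prod H) X) {x : X.Ob U} {x' : X.Ob V} {g : G.arr.Ob U}
    {g' : G.arr.Ob V} (b : X.of x ⟶ X.of x') (j : G.arr.of g ⟶ G.arr.of g') {f : U ⟶ V}
    (hf : X.pr b = f) (e : A.mo₁ x = G.t g) (e' : A.mo₁ x' = G.t g') (hj : X.pr b = G.arr.pr j) :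
    A.smLHom b j e e' hj = A.smHom₂ b j (H.oneHom f _ _ (hf ▸ A.mo₂_eq b)) e (H.t_one _).symm e'
      (H.t_one _).symm hj (hf.trans (H.pr_oneHom _ _ _ _).symm) := by
  subst hf
  rfl

theorem smLHom_id (A : Action (G.prod H) X) (x : X.Ob U) (g : G.arr.Ob U) (e : A.mo₁ x = G.t g) :
    A.smLHom (𝟙 (X.of x)) (𝟙 (G.arr.of g)) e e (by simp) = 𝟙 (X.of (A.smL x g e)) := by
  rw [A.smL_eq _ _ (X.pr_id x)]
  simp only [H.oneHom_id]
  exact A.smHom₂_id _ _ _ _ _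

theorem smLHom_comp (A : Action (G.prod H) X) {x : X.Ob U} {x' : X.Ob V} {x'' : X.Ob W}
    {g : G.arr.Ob U} {g' : G.arr.Ob V} {g'' : G.arr.Ob W} (b : X.of x ⟶ X.of x')
    (j : G.arr.of g ⟶ G.arr.of g') (e : A.mo₁ x = G.t g) (e' : A.mo₁ x' = G.t g')
    (hj : X.pr b = G.arr.pr j) (b' : X.of x' ⟶ X.of x'') (j' : G.arr.of g' ⟶ G.arr.of g'')
    (e'' : A.mo₁ x'' = G.t g'') (hj' : X.pr b' = G.arr.pr j') :
    A.smLHom b j e e' hj ≫ A.smLHom b' j' e' e'' hj' =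
      A.smLHom (b ≫ b') (j ≫ j') e e'' (by simp [hj, hj']) := by
  rw [A.smL_eq (b ≫ b') _ (pr_comp b b'), smLHom, smLHom, A.smHom₂_comp]
  simp only [H.oneHom_comp]

/-- The 2-isomorphism `x · (g · h, 1) ≅ x · (g · h, 1 · 1) ≅ (x · (g, 1)) · (h, 1)`. -/
def betaL (A : Action (G.prod H) X) (x : X.Ob U) (g h : G.arr.Ob U) (e : A.mo₁ x = G.t g)
    (i : G.s g = G.t h) :
    X.of (A.smL x (G.mul g h i) (e.trans (G.t_mul g h i).symm)) ≅
      X.of (A.smL (A.smL x g e) h ((A.mo₁_smL x g e).trans i)) :=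
  A.isoR x (G.mul g h i) (H.oneOne (A.mo₂ x) (A.mo₂ (A.smL x g e)) (A.mo₂_smL x g e).symm).symm
    (e.trans (G.t_mul g h i).symm) (H.t_one _).symm
    ((H.t_one _).symm.trans (H.t_mul _ _ _).symm) (H.oneOne_inv_pr _ _ _) ≪≫
  A.beta₂ x g h _ _ e (H.t_one _).symm i ((H.s_one _).trans ((A.mo₂_smL x g e).symm.trans (H.t_one _).symm))

theorem betaL_hom (A : Action (G.prod H) X) (x : X.Ob U) (g h : G.arr.Ob U) (e : A.mo₁ x = G.t g)
    (i : G.s g = G.t h) :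
    (A.betaL x g h e i).hom =
      A.smHom₂ (𝟙 _) (𝟙 _) (H.oneOne (A.mo₂ x) (A.mo₂ (A.smL x g e)) (A.mo₂_smL x g e).symm).inv
        (e.trans (G.t_mul g h i).symm) (H.t_one _).symm (e.trans (G.t_mul g h i).symm)
        ((H.t_one _).symm.trans (H.t_mul _ _ _).symm) (by simp) (by simp) ≫
      (A.beta₂ x g h _ _ e (H.t_one _).symm i
        ((H.s_one _).trans ((A.mo₂_smL x g e).symm.trans (H.t_one _).symm))).hom := rfl

theorem betaL_pr (A : Action (G.prod H) X) (x : X.Ob U) (g h : G.arr.Ob U) (e : A.mo₁ x = G.t g)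
    (i : G.s g = G.t h) : X.pr (A.betaL x g h e i).hom = 𝟙 U := by
  rw [betaL, Iso.trans_hom, pr_comp, A.isoR_hom, pr_smHom₂, beta₂_pr]
  simp

theorem betaL_nat (A : Action (G.prod H) X) {x : X.Ob U} {g h : G.arr.Ob U} {x' : X.Ob V}
    {g' h' : G.arr.Ob V}
    (a : X.of x ⟶ X.of x') (b : G.arr.of g ⟶ G.arr.of g') (c : G.arr.of h ⟶ G.arr.of h')
    (e₁ : A.mo₁ x = G.t g) (e₂ : G.s g = G.t h) (e₁' : A.mo₁ x' = G.t g') (e₂' : G.s g' = G.t h')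
    (hab : X.pr a = G.arr.pr b) (hbc : G.arr.pr b = G.arr.pr c) :
    A.smLHom a (G.mulHom b c e₂ e₂' hbc) (e₁.trans (G.t_mul g h e₂).symm)
        (e₁'.trans (G.t_mul g' h' e₂').symm) (hab.trans (G.pr_mulHom b c e₂ e₂' hbc).symm) ≫
      (A.betaL x' g' h' e₁' e₂').hom =
    (A.betaL x g h e₁ e₂).hom ≫
      A.smLHom (A.smLHom a b e₁ e₁' hab) c ((A.mo₁_smL x g e₁).trans e₂)
        ((A.mo₁_smL x' g' e₁').trans e₂')
        ((A.pr_smLHom _ _ _ _ _).trans (hab.trans hbc)) := by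
  rw [A.smL_eq (A.smLHom a b e₁ e₁' hab) c (A.pr_smLHom _ _ _ _ _)]
  have N := A.beta₂_nat a b (H.oneHom (X.pr a) _ _ (A.mo₂_eq a)) c
    (H.oneHom (X.pr a) (A.mo₂ (A.smL x g e₁)) (A.mo₂ (A.smL x' g' e₁'))
      (by rw [A.mo₂_smL, A.mo₂_smL]; exact A.mo₂_eq a)) e₁ (H.t_one _).symm e₂
    ((H.s_one _).trans ((A.mo₂_smL x g e₁).symm.trans (H.t_one _).symm)) e₁' (H.t_one _).symm e₂'
    ((H.s_one _).trans ((A.mo₂_smL x' g' e₁').symm.trans (H.t_one _).symm)) hab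
    (H.pr_oneHom _ _ _ _).symm hbc (by simp)
  simp only [betaL_hom, Category.assoc, smLHom] at N ⊢
  rw [← N, reassoc_of% A.smHom₂_comp, reassoc_of% A.smHom₂_comp]
  simp only [Category.comp_id, Category.id_comp]
  congr 2
  exact H.oneOne_nat _ _ _ _ _ _ _ _ _

theorem betaL_pentagon (A : Action (G.prod H) X) (x : X.Ob U) (g h l : G.arr.Ob U)
    (e₁ : A.mo₁ x = G.t g) (e₂ : G.s g = G.t h) (e₃ : G.s h = G.t l) :
    (A.betaL x g (G.mul h l e₃) e₁ (e₂.trans (G.t_mul h l e₃).symm)).hom ≫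
      (A.betaL (A.smL x g e₁) h l ((A.mo₁_smL x g e₁).trans e₂) e₃).hom =
    A.smLHom (𝟙 (X.of x)) (G.coh.assoc g h l e₂ e₃).hom
        (by rw [G.t_mul]; exact e₁) (by rw [G.t_mul, G.t_mul]; exact e₁)
        (by rw [pr_id, G.coh.assoc_pr]) ≫
      (A.betaL x (G.mul g h e₂) l (e₁.trans (G.t_mul g h e₂).symm)
        ((G.s_mul g h e₂).trans e₃)).hom ≫
      A.smLHom (A.betaL x g h e₁ e₂).hom (𝟙 (G.arr.of l))
        (by rw [A.mo₁_smL, G.s_mul]; exact e₃) (by rw [A.mo₁_smL]; exact e₃)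
        (by rw [pr_id, betaL_pr]) := by
  have j₁ := (A.mo₂_smL x g e₁).symm
  have j₂ := (A.mo₂_smL (A.smL x g e₁) h ((A.mo₁_smL x g e₁).trans e₂)).symm
  have j₃ := (A.mo₂_smL x (G.mul g h e₂) (e₁.trans (G.t_mul g h e₂).symm)).symm
  have t₁ := (H.s_one (A.mo₂ x)).trans (j₁.trans (H.t_one _).symm)
  have t₂ := (H.s_one (A.mo₂ (A.smL x g e₁))).trans (j₂.trans (H.t_one _).symm)
  have N₁ := A.beta₂_nat (𝟙 (X.of x)) (𝟙 (G.arr.of g)) (𝟙 (H.arr.of (H.one (A.mo₂ x))))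
    (𝟙 (G.arr.of (G.mul h l e₃))) (H.oneOne _ _ j₂).inv e₁ (H.t_one _).symm
    (e₂.trans (G.t_mul h l e₃).symm) t₁ e₁ (H.t_one _).symm (e₂.trans (G.t_mul h l e₃).symm)
    (t₁.trans ((H.t_one _).trans ((H.t_mul _ _ t₂).trans (H.t_one _)).symm))
    (by simp) (by simp) (by simp) (by simp)
  have N₂ := A.beta₂_nat (𝟙 (X.of x)) (𝟙 (G.arr.of (G.mul g h e₂))) (H.oneOne _ _ j₁).inv
    (𝟙 (G.arr.of l)) (H.oneHom (𝟙 U) _ _ ((Category.id_comp _).trans (j₂.symm.trans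
      (j₁.symm.trans j₃)))) (e₁.trans (G.t_mul g h e₂).symm) (H.t_one _).symm
    ((G.s_mul g h e₂).trans e₃) ((H.s_one _).trans (j₃.trans (H.t_one _).symm))
    (e₁.trans (G.t_mul g h e₂).symm) ((H.t_one _).symm.trans (H.t_mul _ _ t₁).symm)
    ((G.s_mul g h e₂).trans e₃) ((H.s_mul _ _ t₁).trans t₂)
    (by simp) (by simp) (by simp) (by simp)
  have P := A.beta₂_pentagon x g h l _ _ _ e₁ (H.t_one _).symm e₂ t₁ e₃ t₂
  have Q := H.oneOne_assoc _ _ _ _ j₁ j₂ j₃ (j₃.symm.trans (j₁.trans j₂))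
  rw [A.smL_eq (A.betaL x g h e₁ e₂).hom _ (A.betaL_pr _ _ _ _ _),
    A.smL_eq (𝟙 (X.of x)) _ (X.pr_id x)]
  simp only [betaL_hom, Category.assoc, G.mulHom_id, A.smHom₂_id, H.oneHom_id] at N₁ N₂ P ⊢
  have S : A.smHom₂ (A.smHom₂ (𝟙 (X.of x)) (𝟙 (G.arr.of (G.mul g h e₂))) (H.oneOne _ _ j₁).inv
          (e₁.trans (G.t_mul g h e₂).symm) (H.t_one _).symm (e₁.trans (G.t_mul g h e₂).symm)
          ((H.t_one _).symm.trans (H.t_mul _ _ t₁).symm) (by simp) (by simp) ≫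
          (A.beta₂ x g h _ _ e₁ (H.t_one _).symm e₂ t₁).hom) (𝟙 (G.arr.of l))
        (H.oneHom (𝟙 U) (A.mo₂ (A.smL x (G.mul g h e₂) (e₁.trans (G.t_mul g h e₂).symm)))
          (A.mo₂ (A.smL (A.smL x g e₁) h ((A.mo₁_smL x g e₁).trans e₂)))
          ((Category.id_comp _).trans (j₂.symm.trans (j₁.symm.trans j₃))))
        (by rw [A.mo₁_smL, G.s_mul]; exact e₃) (H.t_one _).symm (by rw [A.mo₁_smL]; exact e₃)
        (H.t_one _).symm (by simp) (by simp) =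
      A.smHom₂ (A.smHom₂ (𝟙 (X.of x)) (𝟙 (G.arr.of (G.mul g h e₂))) (H.oneOne _ _ j₁).inv
          (e₁.trans (G.t_mul g h e₂).symm) (H.t_one _).symm (e₁.trans (G.t_mul g h e₂).symm)
          ((H.t_one _).symm.trans (H.t_mul _ _ t₁).symm) (by simp) (by simp))
        (𝟙 (G.arr.of l))
        (H.oneHom (𝟙 U) _ _ ((Category.id_comp _).trans (j₂.symm.trans (j₁.symm.trans j₃))))
        (by rw [A.mo₁_smL, G.s_mul]; exact e₃) (H.t_one _).symm
        (by rw [A.mo₁_sm, G.s_mul]; exact e₃)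
        ((A.mo₂_sm _ _ _ _ _).trans ((H.s_mul _ _ t₁).trans t₂)) (by simp) (by simp) ≫
      A.smHom₂ (A.beta₂ x g h _ _ e₁ (H.t_one _).symm e₂ t₁).hom (𝟙 (G.arr.of l))
        (𝟙 (H.arr.of (H.one _))) (by rw [A.mo₁_sm, G.s_mul]; exact e₃)
        ((A.mo₂_sm _ _ _ _ _).trans ((H.s_mul _ _ t₁).trans t₂))
        (by rw [A.mo₁_smL]; exact e₃) (H.t_one _).symm (by simp) (by simp) := by
    rw [A.smHom₂_comp]
    simp
  rw [S, ← reassoc_of% N₂, ← reassoc_of% N₁, P, reassoc_of% A.smHom₂_comp,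
    reassoc_of% A.smHom₂_comp, reassoc_of% A.smHom₂_comp, reassoc_of% A.smHom₂_comp]
  simp only [Category.id_comp, Category.comp_id, Category.assoc, Q]



theorem left_one_mid (A : Action (G.prod H) X) (x : X.Ob U) (g : G.arr.Ob U) (p : U ⟶ G.M)
    (e : A.mo₁ x = p) (e' : p = G.t g) :
    (A.betaL x (G.one p) g (e.trans (G.t_one p).symm) ((G.s_one p).trans e')).hom ≫
      A.smLHom (A.eps₂ x p (A.mo₂ x) e rfl).hom (𝟙 (G.arr.of g))
        ((A.mo₁_smL _ _ _).trans ((G.s_one p).trans e'))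
        (e.trans e') (by rw [pr_id, eps₂_pr]) =
    A.smLHom (𝟙 (X.of x)) (G.coh.lam p g e').hom (by rw [G.t_mul, G.t_one]; exact e)
      (e.trans e') (by rw [pr_id, G.coh.lam_pr]) := by
  have j₁ := (A.mo₂_smL x (G.one p) (e.trans (G.t_one p).symm)).symm
  have t₁ := (H.s_one (A.mo₂ x)).trans (j₁.trans (H.t_one _).symm)
  have N := A.beta₂_nat (𝟙 (X.of x)) (𝟙 (G.arr.of (G.one p))) (𝟙 (H.arr.of (H.one (A.mo₂ x))))
    (𝟙 (G.arr.of g)) (H.oneHom (𝟙 U) _ _ ((Category.id_comp _).trans j₁))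
    (e.trans (G.t_one p).symm) (H.t_one _).symm ((G.s_one p).trans e') t₁
    (e.trans (G.t_one p).symm) (H.t_one _).symm ((G.s_one p).trans e')
    ((H.s_one _).trans (H.t_one _).symm)
    (by simp) (by simp) (by simp) (by simp)
  have P := A.eps₂_one_mid x g (H.one (A.mo₂ x)) p (A.mo₂ x) e rfl e' (H.t_one _).symm
  have Q := H.oneOne_lam _ _ j₁
  rw [A.smL_eq (𝟙 (X.of x)) _ (X.pr_id x), A.smL_eq _ _ (A.eps₂_pr _ _ _ _ _)]
  simp only [betaL_hom, Category.assoc, G.mulHom_id, A.smHom₂_id, H.oneHom_id] at N P ⊢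
  have S : A.smHom₂ (A.eps₂ x p (A.mo₂ x) e rfl).hom (𝟙 (G.arr.of g)) (H.oneHom (𝟙 U)
        (A.mo₂ (A.smL x (G.one p) (e.trans (G.t_one p).symm))) (A.mo₂ x)
        ((Category.id_comp _).trans j₁)) ((A.mo₁_smL _ _ _).trans ((G.s_one p).trans e'))
        (H.t_one _).symm (e.trans e') (H.t_one _).symm (by simp) (by simp) =
      A.smHom₂ (𝟙 _) (𝟙 (G.arr.of g)) (H.oneHom (𝟙 U) _ _ ((Category.id_comp _).trans j₁))
        ((A.mo₁_smL _ _ _).trans ((G.s_one p).trans e')) (H.t_one _).symm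
        ((A.mo₁_smL _ _ _).trans ((G.s_one p).trans e')) (j₁.symm.trans (H.t_one _).symm)
        (by simp) (by simp) ≫
      A.smHom₂ (A.eps₂ x p (A.mo₂ x) e rfl).hom (𝟙 (G.arr.of g)) (𝟙 (H.arr.of (H.one (A.mo₂ x))))
        ((A.mo₁_smL _ _ _).trans ((G.s_one p).trans e')) (j₁.symm.trans (H.t_one _).symm)
        (e.trans e') (H.t_one _).symm (by simp) (by simp) := by
    rw [A.smHom₂_comp]
    simp
  rw [S, ← reassoc_of% N, P, A.smHom₂_comp, A.smHom₂_comp]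
  simp only [Category.id_comp]
  congr 1



theorem left_one_right (A : Action (G.prod H) X) (x : X.Ob U) (g : G.arr.Ob U) (p : U ⟶ G.M)
    (e : A.mo₁ x = G.t g) (e' : G.s g = p) :
    (A.betaL x g (G.one p) e (e'.trans (G.t_one p).symm)).hom ≫
      (A.eps₂ (A.smL x g e) p _ ((A.mo₁_smL x g e).trans e') rfl).hom =
    A.smLHom (𝟙 (X.of x)) (G.coh.rho g p e').hom (by rw [G.t_mul]; exact e) e
      (by rw [pr_id, G.coh.rho_pr]) := by
  rw [A.smL_eq (𝟙 (X.of x)) _ (X.pr_id x), betaL_hom, Category.assoc, A.eps₂_one_right _ _ _ _ _ _ _ e',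
    A.smHom₂_comp]
  simp only [Category.id_comp, H.oneHom_id]
  congr 1
  exact (H.oneOne _ _ (A.mo₂_smL x g e).symm).inv_hom_id


/-- The restriction to `G` of an action of `G × H`: `x · g = x · (g, 1)`. -/
def leftPre (A : Action (G.prod H) X) : PreAction G X where
  moment := Mor.ofVal (fun x => A.mo₁ x) fun b => A.mo₁_eq b
  act :=
    { obj := fun c => A.smL (PairOb.fst c) (PairOb.snd c) (PairOb.prop c)
      map := fun {U V c d} a => A.smLHom (PairHom.fst a) (PairHom.snd a) (PairOb.prop c)
        (PairOb.prop d) (PairHom.pr_eq a)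
      map_id := fun c => A.smLHom_id _ _ (PairOb.prop c)
      map_comp := fun a b => (A.smLHom_comp _ _ _ _ _ _ _ _ _).symm
      pr_map := fun a => A.pr_smHom₂ _ _ _ _ _ _ _ _ _ }
  moment_act x g e := A.mo₁_smL x g e

/-- The restriction to `G` of an action of `G × H`: `x · g = x · (g, 1)`. The associativity
2-isomorphism is `x · (g · h, 1) ≅ x · (g · h, 1 · 1) ≅ (x · (g, 1)) · (h, 1)`. -/
def left (A : Action (G.prod H) X) : Action G X where
  toPreAction := A.leftPre
  coh :=
    { beta := fun x g h e i => A.betaL x g h e i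
      beta_pr := fun x g h e i => A.betaL_pr x g h e i
      beta_nat := fun a b c e₁ e₂ e₁' e₂' hab hbc => A.betaL_nat a b c e₁ e₂ e₁' e₂' hab hbc
      eps := fun x p e => A.eps₂ x p (A.mo₂ x) e rfl
      eps_pr := fun x p e => A.eps₂_pr _ _ _ _ _
      eps_nat := fun x p e x' p' e' a h => A.eps₂_nat x p _ e rfl x' p' _ e' rfl a h (A.mo₂_eq a)
      pentagon := fun x g h l e₁ e₂ e₃ => A.betaL_pentagon x g h l e₁ e₂ e₃
      one_mid := fun x g p e e' => A.left_one_mid x g p e e'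
      one_right := fun x g p e e' => A.left_one_right x g p e e' }

end Action

namespace Action

variable {G H : CfgGroupoid.{w, u}} {X : CFG.{w, u}} {U V W : Man.{u}}

/-- An action of `G × H` as an action of `H × G`: the structure maps. -/
def swapPre (A : Action (G.prod H) X) : PreAction (H.prod G) X where
  moment := Mor.ofVal (fun x => Man.pair (A.mo₂ x) (A.mo₁ x)) fun b =>
    Man.pair_eq (A.mo₂_eq b) (A.mo₁_eq b)
  act :=
    { obj := fun c => A.sm₂ (PairOb.fst c) (obSnd (PairOb.snd c)) (obFst (PairOb.snd c))
        (CfgGroupoid.snd_eq (PairOb.prop c)) (CfgGroupoid.fst_eq (PairOb.prop c))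
      map := fun {U V c d} a => A.smHom₂ (PairHom.fst a) (homSnd (PairHom.snd a))
        (homFst (PairHom.snd a))
        (CfgGroupoid.snd_eq (PairOb.prop c)) (CfgGroupoid.fst_eq (PairOb.prop c))
        (CfgGroupoid.snd_eq (PairOb.prop d)) (CfgGroupoid.fst_eq (PairOb.prop d))
        ((PairHom.pr_eq a).trans (homSnd_pr (PairHom.snd a)).symm) (PairHom.pr_eq a)
      map_id := fun c => A.smHom₂_id _ _ _ (CfgGroupoid.snd_eq (PairOb.prop c))
        (CfgGroupoid.fst_eq (PairOb.prop c))
      map_comp := fun a b => (A.smHom₂_comp _ _ _ _ _ _ _ _ _ _ _ _ _ _ _ _).symm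
      pr_map := fun a => A.pr_smHom₂ _ _ _ _ _ _ _ _ _ }
  moment_act x g e := Man.pair_eq
    (A.mo₂_sm x (obSnd g) (obFst g) (CfgGroupoid.snd_eq e) (CfgGroupoid.fst_eq e))
    (A.mo₁_sm x (obSnd g) (obFst g) (CfgGroupoid.snd_eq e) (CfgGroupoid.fst_eq e))

/-- An action of `G × H` as an action of `H × G`: `x · (h, g) = x · (g, h)`. -/
def swap (A : Action (G.prod H) X) : Action (H.prod G) X where
  toPreAction := A.swapPre
  coh :=
    { beta := fun x g h e i => A.beta₂ x (obSnd g) (obSnd h) (obFst g) (obFst h)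
        (CfgGroupoid.snd_eq e) (CfgGroupoid.fst_eq e)
        (CfgGroupoid.snd_eq i) (CfgGroupoid.fst_eq i)
      beta_pr := fun x g h e i => A.beta₂_pr _ _ _ _ _ _ _ _ _
      beta_nat := fun a b c e₁ e₂ e₁' e₂' hab hbc => A.beta₂_nat a (homSnd b) (homFst b) (homSnd c)
        (homFst c) (CfgGroupoid.snd_eq e₁) (CfgGroupoid.fst_eq e₁) (CfgGroupoid.snd_eq e₂)
        (CfgGroupoid.fst_eq e₂) (CfgGroupoid.snd_eq e₁') (CfgGroupoid.fst_eq e₁')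
        (CfgGroupoid.snd_eq e₂') (CfgGroupoid.fst_eq e₂') (hab.trans (homSnd_pr b).symm) hab
        ((homSnd_pr b).trans (hbc.trans (homSnd_pr c).symm)) hbc
      eps := fun x p e => A.eps₂ x (p ≫ Man.snd _ _) (p ≫ Man.fst _ _) (CfgGroupoid.snd_eq e)
        (CfgGroupoid.fst_eq e)
      eps_pr := fun x p e => A.eps₂_pr _ _ _ _ _
      eps_nat := fun x p e x' p' e' a h => A.eps₂_nat x _ _ (CfgGroupoid.snd_eq e)
        (CfgGroupoid.fst_eq e) x' _ _ (CfgGroupoid.snd_eq e') (CfgGroupoid.fst_eq e') a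
        (CfgGroupoid.snd_eq h) (CfgGroupoid.fst_eq h)
      pentagon := fun x g h l e₁ e₂ e₃ => A.beta₂_pentagon x (obSnd g) (obSnd h) (obSnd l) (obFst g)
        (obFst h) (obFst l) (CfgGroupoid.snd_eq e₁) (CfgGroupoid.fst_eq e₁) (CfgGroupoid.snd_eq e₂)
        (CfgGroupoid.fst_eq e₂) (CfgGroupoid.snd_eq e₃) (CfgGroupoid.fst_eq e₃)
      one_mid := fun x g p e e' => A.eps₂_one_mid x (obSnd g) (obFst g) _ _ (CfgGroupoid.snd_eq e)
        (CfgGroupoid.fst_eq e) (CfgGroupoid.snd_eq e') (CfgGroupoid.fst_eq e')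
      one_right := fun x g p e e' => A.eps₂_one_right x (obSnd g) (obFst g) _ _
        (CfgGroupoid.snd_eq e) (CfgGroupoid.fst_eq e) (CfgGroupoid.snd_eq e')
        (CfgGroupoid.fst_eq e') }

/-- The restriction to `H` of an action of `G × H`: `x · h = x · (1, h)`. -/
def right (A : Action (G.prod H) X) : Action H X := A.swap.left

theorem left_sm (A : Action (G.prod H) X) (x : X.Ob U) (g : G.arr.Ob U) (e : A.mo₁ x = G.t g) :
    A.left.sm x g e = A.sm x (prodOb g (H.one (A.mo₂ x))) (Man.prod_ext e (H.t_one _).symm) := rfl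

theorem right_sm (A : Action (G.prod H) X) (x : X.Ob U) (h : H.arr.Ob U) (e : A.mo₂ x = H.t h) :
    A.right.sm x h e = A.sm x (prodOb (G.one (A.mo₁ x)) h) (Man.prod_ext (G.t_one _).symm e) := rfl

end Action

/-! ### Equivariant morphisms and the induced action on the first quotient -/

/-- The structure of an equivariant morphism on a morphism `F`: the moment maps correspond, and
there is a 2-isomorphism `φ : F x · g ⟶ F (x · g)` (of which the components lie over identities),
compatible with the associativity and identity 2-isomorphisms of the actions. -/
structure Equivariance {G : CfgGroupoid.{w, u}} {X Y : CFG.{w, u}} (A : Action G X)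
    (B : Action G Y) (F : Mor X Y) where
  mo_eq : ∀ {U : Man.{u}} (x : X.Ob U), B.mo (F.obj x) = A.mo x
  phi : ∀ {U : Man.{u}} (x : X.Ob U) (g : G.arr.Ob U) (e : A.mo x = G.t g),
    Y.of (B.sm (F.obj x) g ((mo_eq x).trans e)) ⟶ Y.of (F.obj (A.sm x g e))
  phi_pr : ∀ {U : Man.{u}} (x : X.Ob U) (g : G.arr.Ob U) (e : A.mo x = G.t g),
    Y.pr (phi x g e) = 𝟙 U
  phi_nat : ∀ {U V : Man.{u}} {x : X.Ob U} {g : G.arr.Ob U} {x' : X.Ob V} {g' : G.arr.Ob V}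
    (b : X.of x ⟶ X.of x') (j : G.arr.of g ⟶ G.arr.of g') (e : A.mo x = G.t g)
    (e' : A.mo x' = G.t g') (hp : X.pr b = G.arr.pr j),
    B.smHom (F.map b) j ((mo_eq x).trans e) ((mo_eq x').trans e') ((F.pr_map b).trans hp) ≫
      phi x' g' e' = phi x g e ≫ F.map (A.smHom b j e e' hp)
  /-- the two ways from `F x · (g · h)` to `F ((x · g) · h)` agree -/
  phi_beta : ∀ {U : Man.{u}} (x : X.Ob U) (g h : G.arr.Ob U) (e : A.mo x = G.t g)
    (i : G.s g = G.t h),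
    phi x (G.mul g h i) (e.trans (G.t_mul g h i).symm) ≫ F.map (A.coh.beta x g h e i).hom =
      (B.coh.beta (F.obj x) g h ((mo_eq x).trans e) i).hom ≫
        B.smHom (phi x g e) (𝟙 (G.arr.of h)) ((B.mo_sm _ _ _).trans i)
          ((mo_eq _).trans ((A.mo_sm x g e).trans i)) ((phi_pr x g e).trans (G.arr.pr_id h).symm) ≫
        phi (A.sm x g e) h ((A.mo_sm x g e).trans i)
  /-- the two ways from `F x · 1` to `F x` agree -/
  phi_eps : ∀ {U : Man.{u}} (x : X.Ob U) (p : U ⟶ G.M) (e : A.mo x = p),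
    phi x (G.one p) (e.trans (G.t_one p).symm) ≫ F.map (A.coh.eps x p e).hom =
      (B.coh.eps (F.obj x) p ((mo_eq x).trans e)).hom

namespace Action

variable {G H : CfgGroupoid.{w, u}} {X : CFG.{w, u}} {U V W : Man.{u}}

/-- An isomorphism `x · (g, h) ≅ x · (g', h')` from isomorphisms `g ≅ g'` and `h ≅ h'`. -/
def iso₂ (A : Action (G.prod H) X) (x : X.Ob U) {g g' : G.arr.Ob U} {h h' : H.arr.Ob U}
    (j : G.arr.of g ≅ G.arr.of g') (k : H.arr.of h ≅ H.arr.of h') (hj : G.arr.pr j.hom = 𝟙 U)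
    (hk : H.arr.pr k.hom = 𝟙 U) (e₁ : A.mo₁ x = G.t g) (e₂ : A.mo₂ x = H.t h)
    (e₁' : A.mo₁ x = G.t g') (e₂' : A.mo₂ x = H.t h') :
    X.of (A.sm₂ x g h e₁ e₂) ≅ X.of (A.sm₂ x g' h' e₁' e₂') where
  hom := A.smHom₂ (𝟙 _) j.hom k.hom e₁ e₂ e₁' e₂' (by simp [hj]) (by simp [hk])
  inv := A.smHom₂ (𝟙 _) j.inv k.inv e₁' e₂' e₁ e₂ (by simp [pr_inv j hj]) (by simp [pr_inv k hk])
  hom_inv_id := by simp [A.smHom₂_comp]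
  inv_hom_id := by simp [A.smHom₂_comp]

/-- The isomorphism `(x · h) · g ≅ x · (1 · g, h · 1) ≅ x · (g, h)`, where `x · h = x · (1, h)` and
`x · g = x · (g, 1)`. -/
def xi₁ (A : Action (G.prod H) X) (x : X.Ob U) (g : G.arr.Ob U) (h : H.arr.Ob U)
    (e₁ : A.mo₁ x = G.t g) (e₂ : A.mo₂ x = H.t h) :
    X.of (A.left.sm (A.right.sm x h e₂) g
      ((A.mo₁_sm x _ h (G.t_one _).symm e₂).trans ((G.s_one _).trans e₁))) ≅
      X.of (A.sm₂ x g h e₁ e₂) :=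
  (A.beta₂ x (G.one (A.mo₁ x)) g h (H.one (A.mo₂ (A.right.sm x h e₂))) (G.t_one _).symm e₂
    ((G.s_one _).trans e₁)
    ((A.mo₂_sm x _ h (G.t_one _).symm e₂).symm.trans (H.t_one _).symm)).symm ≪≫
  A.iso₂ x (G.coh.lam (A.mo₁ x) g e₁) (H.coh.rho h (A.mo₂ (A.right.sm x h e₂))
    (A.mo₂_sm x _ h (G.t_one _).symm e₂).symm) (G.coh.lam_pr _ _ _) (H.coh.rho_pr _ _ _)
    ((G.t_one _).symm.trans (G.t_mul _ _ _).symm) (e₂.trans (H.t_mul _ _ _).symm) e₁ e₂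

/-- The isomorphism `(x · g) · h ≅ x · (g · 1, 1 · h) ≅ x · (g, h)`, where `x · h = x · (1, h)` and
`x · g = x · (g, 1)`. -/
def xi₂ (A : Action (G.prod H) X) (x : X.Ob U) (g : G.arr.Ob U) (h : H.arr.Ob U)
    (e₁ : A.mo₁ x = G.t g) (e₂ : A.mo₂ x = H.t h) :
    X.of (A.right.sm (A.left.sm x g e₁) h
      ((A.mo₂_sm x g _ e₁ (H.t_one _).symm).trans ((H.s_one _).trans e₂))) ≅
      X.of (A.sm₂ x g h e₁ e₂) :=
  (A.beta₂ x g (G.one (A.mo₁ (A.left.sm x g e₁))) (H.one (A.mo₂ x)) h e₁ (H.t_one _).symm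
    ((A.mo₁_sm x g _ e₁ (H.t_one _).symm).symm.trans (G.t_one _).symm)
    ((H.s_one _).trans e₂)).symm ≪≫
  A.iso₂ x (G.coh.rho g (A.mo₁ (A.left.sm x g e₁)) (A.mo₁_sm x g _ e₁ (H.t_one _).symm).symm)
    (H.coh.lam (A.mo₂ x) h e₂) (G.coh.rho_pr _ _ _) (H.coh.lam_pr _ _ _)
    (e₁.trans (G.t_mul _ _ _).symm) ((H.t_one _).symm.trans (H.t_mul _ _ _).symm) e₁ e₂

/-- The isomorphism `δ : (x · h) · g ≅ (x · g) · h` for an action of `G × H`. -/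
def delta (A : Action (G.prod H) X) (x : X.Ob U) (g : G.arr.Ob U) (h : H.arr.Ob U)
    (e₁ : A.mo₁ x = G.t g) (e₂ : A.mo₂ x = H.t h) :
    X.of (A.left.sm (A.right.sm x h e₂) g
      ((A.mo₁_sm x _ h (G.t_one _).symm e₂).trans ((G.s_one _).trans e₁))) ≅
    X.of (A.right.sm (A.left.sm x g e₁) h
      ((A.mo₂_sm x g _ e₁ (H.t_one _).symm).trans ((H.s_one _).trans e₂))) :=
  A.xi₁ x g h e₁ e₂ ≪≫ (A.xi₂ x g h e₁ e₂).symm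

set_option linter.checkUnivs false in
/-- The action of `H` on the quotient `Q = X / G` induced by an action of `G × H` on `X`, where
`ι : X // G ⟶ Q` is the stackification of the prequotient: it is the action for which the projection
`X ⟶ X // G ⟶ Q` is `H`-equivariant, compatibly with the arrows `γ = [g, 𝟙] : x ⟶ x · g` of the
prequotient. -/
structure InducedAction (A : Action (G.prod H) X) {Q : CFG.{w, u}} (ι : Mor A.left.preq Q) where
  action : Action H Q
  equiv : Equivariance A.right action (A.left.quot.comp ι)
  /-- the two ways from `x · h` to `(x · g) · h` in the quotient agree -/
  phi_gamma : ∀ {U : Man.{u}} (x : X.Ob U) (g : G.arr.Ob U) (h : H.arr.Ob U)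
    (e₁ : A.mo₁ x = G.t g) (e₂ : A.mo₂ x = H.t h),
    action.smHom (ι.map (A.left.gamma x g e₁)) (𝟙 (H.arr.of h)) ((equiv.mo_eq x).trans e₂)
        ((equiv.mo_eq (A.left.sm x g e₁)).trans
          ((A.mo₂_sm x g _ e₁ (H.t_one _).symm).trans ((H.s_one _).trans e₂)))
        ((ι.pr_map _).trans ((A.left.arrowPr_gammaArrow x g e₁).trans (H.arr.pr_id h).symm)) ≫
      equiv.phi (A.left.sm x g e₁) h
        ((A.mo₂_sm x g _ e₁ (H.t_one _).symm).trans ((H.s_one _).trans e₂)) =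
    equiv.phi x h e₂ ≫
      ι.map (A.left.gamma (A.right.sm x h e₂) g
        ((A.mo₁_sm x _ h (G.t_one _).symm e₂).trans ((G.s_one _).trans e₁))) ≫
      (A.left.quot.comp ι).map (A.delta x g h e₁ e₂).hom

section stages

variable {A : Action (G.prod H) X} {Q₁ Q₁₂ Q : CFG.{w, u}} {ι₁ : Mor A.left.preq Q₁}

/-- The projection of `X` to the iterated quotient, where `ι₁ : X // G ⟶ Q₁` is the map to the first
quotient and `ι₁₂ : Q₁ // H ⟶ Q₁₂` is the map to the second. -/
def InducedAction.proj (B : InducedAction A ι₁) (ι₁₂ : Mor B.action.preq Q₁₂) : Mor X Q₁₂ :=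
  ((A.left.quot.comp ι₁).comp B.action.quot).comp ι₁₂

/-- The arrow from `x` to `x · g` in the iterated quotient. -/
def InducedAction.gamma₁ (B : InducedAction A ι₁) (ι₁₂ : Mor B.action.preq Q₁₂) (x : X.Ob U)
    (g : G.arr.Ob U) (e : A.mo₁ x = G.t g) :
    Q₁₂.of ((B.proj ι₁₂).obj x) ⟶ Q₁₂.of ((B.proj ι₁₂).obj (A.left.sm x g e)) :=
  ι₁₂.map (B.action.quot.map (ι₁.map (A.left.gamma x g e)))

/-- The arrow from `x` to `x · h` in the iterated quotient. -/
def InducedAction.gamma₂ (B : InducedAction A ι₁) (ι₁₂ : Mor B.action.preq Q₁₂) (x : X.Ob U)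
    (h : H.arr.Ob U) (e : A.mo₂ x = H.t h) :
    Q₁₂.of ((B.proj ι₁₂).obj x) ⟶ Q₁₂.of ((B.proj ι₁₂).obj (A.right.sm x h e)) :=
  ι₁₂.map (B.action.gamma ((A.left.quot.comp ι₁).obj x) h ((B.equiv.mo_eq x).trans e)) ≫
    ι₁₂.map (B.action.quot.map (B.equiv.phi x h e))

/-- A morphism from the iterated quotient to the quotient by `G × H` under `X` (that is, with a
2-isomorphism `θ` relating the two projections of `X`) is canonical if `θ` is compatible with the
arrows from `x` to `x · g` and from `x` to `x · h`, by which `G` and `H` act on the fibres of the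
projections. -/
def InducedAction.IsCanonical (B : InducedAction A ι₁) (ι₁₂ : Mor B.action.preq Q₁₂)
    (ι : Mor A.preq Q) (Θ : Mor Q₁₂ Q)
    (θ : TwoMor ((B.proj ι₁₂).comp Θ) (A.quot.comp ι)) : Prop :=
  (∀ {U : Man.{u}} (x : X.Ob U) (g : G.arr.Ob U) (e : A.mo₁ x = G.t g),
    Θ.map (B.gamma₁ ι₁₂ x g e) ≫ θ.app (A.left.sm x g e) =
      θ.app x ≫ ι.map (A.gamma x (prodOb g (H.one (A.mo₂ x)))
        (Man.prod_ext e (H.t_one _).symm))) ∧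
  (∀ {U : Man.{u}} (x : X.Ob U) (h : H.arr.Ob U) (e : A.mo₂ x = H.t h),
    Θ.map (B.gamma₂ ι₁₂ x h e) ≫ θ.app (A.right.sm x h e) =
      θ.app x ≫ ι.map (A.gamma x (prodOb (G.one (A.mo₁ x)) h)
        (Man.prod_ext (G.t_one _).symm e)))

end stages

end Action

end StackyQuotient

end

universe v u

open StackyQuotient StackyQuotient.CFG

noncomputable section

universe w w' k

namespace StackyQuotient

/-! ### The site of manifolds -/

namespace Man

/-- A smooth map with values in an open subset, as a map to this open subset. -/
def lift {T U : Man.{u}} (V : Opens U.carrier) (f : T ⟶ U) (h : ∀ z, f.1 z ∈ V) :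
    T ⟶ U.restrict V :=
  ⟨fun z => ⟨f.1 z, h z⟩, (ContMDiff.subtypeVal_comp_iff (I := modelWithCornersSelf ℝ T.E)
    (I' := modelWithCornersSelf ℝ U.E) V fun z => ⟨f.1 z, h z⟩).1 f.2⟩

theorem incl_cancel {T U : Man.{u}} {V : Opens U.carrier} {f g : T ⟶ U.restrict V}
    (h : f ≫ incl V = g ≫ incl V) : f = g := by
  apply ContMDiffMap.ext
  intro z
  exact Subtype.ext (congrArg (fun k : T ⟶ U => k.1 z) h)

theorem mem_of_incl {T U : Man.{u}} {V : Opens U.carrier} (g : T ⟶ U.restrict V) {f : T ⟶ U}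
    (h : g ≫ incl V = f) (z : T.carrier) : f.1 z ∈ V := by
  subst h
  exact (g.1 z).2

/-- The preimage of an open subset. -/
def preimage {T U : Man.{u}} (f : T ⟶ U) (V : Opens U.carrier) : Opens T.carrier :=
  Opens.comap ⟨f.1, f.2.continuous⟩ V

/-- The restriction of a map to open subsets. -/
def restrictMap {T U : Man.{u}} (f : T ⟶ U) {W : Opens T.carrier} {V : Opens U.carrier}
    (h : W ≤ preimage f V) : T.restrict W ⟶ U.restrict V :=
  lift V (incl W ≫ f) fun z => h z.2

/-- The topology of open covers. -/
def topology : GrothendieckTopology Man.{u} where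
  sieves U := {S | ∀ z : U.carrier, ∃ V : Opens U.carrier, z ∈ V ∧ S.arrows (incl V)}
  top_mem' U z := ⟨⊤, trivial, trivial⟩
  pullback_stable' := by
    intro U T S f hS z
    obtain ⟨V, hV, h⟩ := hS (f.1 z)
    exact ⟨preimage f V, hV, S.downward_closed h (restrictMap f le_rfl)⟩
  transitive' := by
    intro U S hS R hR z
    obtain ⟨V, hV, h⟩ := hS z
    obtain ⟨W, hW, h'⟩ := hR h ⟨z, hV⟩
    let O : Opens U.carrier :=
      ⟨(Subtype.val : V → U.carrier) '' W.1, V.2.isOpenMap_subtype_val _ W.2⟩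
    have hm : ∀ y : U.carrier, y ∈ O → y ∈ V := by
      rintro _ ⟨y, -, rfl⟩
      exact y.2
    have hm' : ∀ y : O, (⟨y.1, hm _ y.2⟩ : V) ∈ W := by
      rintro ⟨_, y, hy, rfl⟩
      exact hy
    exact ⟨O, ⟨⟨z, hV⟩, hW, rfl⟩, R.downward_closed h'
      (lift (U := U.restrict V) W (lift V (incl O) fun y => hm _ y.2) hm')⟩

/-- A family of maps to `U` is covering if it generates a covering sieve. -/
def Covering {U : Man.{u}} {K : Sort k} {W : K → Man.{u}} (f : ∀ i, W i ⟶ U) : Prop :=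
  ∀ z : U.carrier, ∃ V : Opens U.carrier, z ∈ V ∧ ∃ i, ∃ g : U.restrict V ⟶ W i, g ≫ f i = incl V

/-- The sieve of maps which factor through one of the members of a family. -/
def sieveOf {U : Man.{u}} {K : Sort k} {W : K → Man.{u}} (f : ∀ i, W i ⟶ U) : Sieve U where
  arrows T t := ∃ i, ∃ g : T ⟶ W i, g ≫ f i = t
  downward_closed := by
    rintro T T' _ ⟨i, g, rfl⟩ s
    exact ⟨i, s ≫ g, Category.assoc _ _ _⟩

theorem Covering.sieveOf_mem {U : Man.{u}} {K : Sort k} {W : K → Man.{u}} {f : ∀ i, W i ⟶ U}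
    (h : Covering f) : sieveOf f ∈ topology U := h

theorem covering_of_mem {U : Man.{u}} {K : Sort k} {W : K → Man.{u}} {f : ∀ i, W i ⟶ U}
    {S : Sieve U} (hS : S ∈ topology U)
    (h : ∀ {T : Man.{u}} (t : T ⟶ U), S t → ∃ i, ∃ g : T ⟶ W i, g ≫ f i = t) : Covering f := by
  intro z
  obtain ⟨V, hV, hS'⟩ := hS z
  exact ⟨V, hV, h _ hS'⟩

theorem covers_covering {U : Man.{u}} {ι : Type u} {V : ι → Opens U.carrier} (h : Covers V) :
    Covering fun i => incl (V i) := by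
  intro z
  obtain ⟨i, hi⟩ := h z
  exact ⟨V i, hi, i, 𝟙 _, rfl⟩

/-- Maps which agree on a cover are equal. -/
theorem hom_ext_of_covering {U M : Man.{u}} {K : Sort k} {W : K → Man.{u}} {f : ∀ i, W i ⟶ U}
    (hf : Covering f) {v v' : U ⟶ M} (h : ∀ i, f i ≫ v = f i ≫ v') : v = v' := by
  apply ContMDiffMap.ext
  intro z
  obtain ⟨V, hV, i, g, hg⟩ := hf z
  have : incl V ≫ v = incl V ≫ v' := by rw [← hg, Category.assoc, h, Category.assoc]
  exact congrArg (fun k : U.restrict V ⟶ M => k.1 ⟨z, hV⟩) this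

/-- Smooth maps glue. -/
theorem exists_glue {U M : Man.{u}} {K : Sort k} {W : K → Man.{u}} {f : ∀ i, W i ⟶ U}
    (hf : Covering f) (v : ∀ i, W i ⟶ M)
    (h : ∀ (i j : K) (T : Man.{u}) (s : T ⟶ W i) (s' : T ⟶ W j), s ≫ f i = s' ≫ f j →
      s ≫ v i = s' ≫ v j) : ∃ m : U ⟶ M, ∀ i, f i ≫ m = v i := by
  choose V hV i g hg using hf
  let m₀ : U.carrier → M.carrier := fun z => (v (i z)).1 ((g z).1 ⟨z, hV z⟩)
  have key : ∀ (z : U.carrier) (y : V z), m₀ y.1 = (g z ≫ v (i z)).1 y := by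
    intro z y
    have := h (i y.1) (i z) (U.restrict (V y.1 ⊓ V z)) (inclLE inf_le_left ≫ g y.1)
      (inclLE inf_le_right ≫ g z) (by rw [Category.assoc, Category.assoc, hg, hg]; rfl)
    exact congrArg (fun k : U.restrict (V y.1 ⊓ V z) ⟶ M => k.1 ⟨y.1, hV y.1, y.2⟩) this
  have sm : ContMDiff (modelWithCornersSelf ℝ U.E) (modelWithCornersSelf ℝ M.E) ∞ m₀ := by
    intro z
    refine (contMDiffAt_subtype_iff (U := V z) (x := ⟨z, hV z⟩)).1 ?_
    have : (fun y : V z => m₀ y.1) = (g z ≫ v (i z)).1 := funext (key z)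
    rw [this]
    exact (g z ≫ v (i z)).2 _
  let m : U ⟶ M := ⟨m₀, sm⟩
  refine ⟨m, fun j => ?_⟩
  apply ContMDiffMap.ext
  intro y
  let z := (f j).1 y
  have := h (i z) j ((W j).restrict (preimage (f j) (V z))) (restrictMap (f j) le_rfl ≫ g z)
    (incl _) (by rw [Category.assoc, hg]; rfl)
  exact congrArg (fun k : (W j).restrict (preimage (f j) (V z)) ⟶ M => k.1 ⟨y, hV z⟩) this

theorem Covering.pullback {T U : Man.{u}} {K : Sort k} {W : K → Man.{u}} {f : ∀ i, W i ⟶ U}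
    (hf : Covering f) (t : T ⟶ U) : (sieveOf f).pullback t ∈ topology T :=
  topology.pullback_stable t hf.sieveOf_mem

end Man

end StackyQuotient

end

noncomputable section

universe w w' k

namespace StackyQuotient

namespace CFG

/-! ### Gluing of arrows -/

section arrows

variable {X : CFG.{w, u}} {U V : Man.{u}}

/-- Arrows of a prestack which agree on a cover are equal. -/
theorem IsPrestack.hom_ext_sieve (hX : X.IsPrestack) {x : X.Ob U} {y : X.Ob V}
    {φ φ' : X.of x ⟶ X.of y} (hp : X.pr φ = X.pr φ') {S : Sieve U} (hS : S ∈ Man.topology U)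
    (h : ∀ {W : Man.{u}} (z : X.Ob W) (r : X.of z ⟶ X.of x), S (X.pr r) → r ≫ φ = r ≫ φ') :
    φ = φ' := by
  obtain ⟨y', l, hl⟩ := lift_exists y (X.pr φ)
  obtain ⟨a, ha, ha'⟩ := factor_exists l φ (𝟙 U) (by rw [hl]; simp)
  obtain ⟨b, hb, hb'⟩ := factor_exists l φ' (𝟙 U) (by rw [hl, hp]; simp)
  choose O hO hS using hS
  choose z p hpr using fun i => lift_exists x (Man.incl (O i))
  obtain ⟨m, -, hm⟩ := hX x y' O (fun i => ⟨i, hO i⟩) z p (fun i => p i ≫ a) hpr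
    (fun i => by rw [pr_comp, ha', hpr]; simp) (fun i j t r s _ _ e => by
      rw [← Category.assoc, e, Category.assoc])
  rw [← ha, ← hb, hm a ⟨ha', fun _ => rfl⟩, ← hm b ⟨hb', fun i => ?_⟩]
  refine factor_unique l ?_ (by rw [pr_comp, pr_comp, ha', hb'])
  rw [Category.assoc, Category.assoc, ha, hb]
  refine (h (z i) (p i) ?_).symm
  rw [hpr]
  exact hS i

theorem IsPrestack.hom_ext (hX : X.IsPrestack) {x : X.Ob U} {y : X.Ob V}
    {φ φ' : X.of x ⟶ X.of y} (hp : X.pr φ = X.pr φ') {K : Sort k} {W : K → Man.{u}}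
    {z : ∀ i, X.Ob (W i)} (r : ∀ i, X.of (z i) ⟶ X.of x) (hr : Man.Covering fun i => X.pr (r i))
    (h : ∀ i, r i ≫ φ = r i ≫ φ') : φ = φ' := by
  refine hX.hom_ext_sieve hp hr.sieveOf_mem ?_
  rintro W z s ⟨i, g, hg⟩
  obtain ⟨c, hc, -⟩ := factor_exists (r i) s g hg
  rw [← hc, Category.assoc, h, Category.assoc]

/-- Arrows of a prestack glue. -/
theorem IsPrestack.exists_glue (hX : X.IsPrestack) {x : X.Ob U} {y : X.Ob V} (f : U ⟶ V)
    {K : Sort k} {W : K → Man.{u}} {z : ∀ i, X.Ob (W i)} (r : ∀ i, X.of (z i) ⟶ X.of x)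
    (hr : Man.Covering fun i => X.pr (r i)) (ψ : ∀ i, X.of (z i) ⟶ X.of y)
    (hψ : ∀ i, X.pr (ψ i) = X.pr (r i) ≫ f)
    (h : ∀ (i j : K) {T : Man.{u}} (t : X.Ob T) (s : X.of t ⟶ X.of (z i))
      (s' : X.of t ⟶ X.of (z j)), s ≫ r i = s' ≫ r j → s ≫ ψ i = s' ≫ ψ j) :
    ∃ φ : X.of x ⟶ X.of y, X.pr φ = f ∧ ∀ i, r i ≫ φ = ψ i := by
  obtain ⟨y', l, hl⟩ := lift_exists y f
  have hr' := hr
  choose O hO i g hg using hr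
  choose t p hpr using fun q => lift_exists x (Man.incl (O q))
  choose e he he' using fun q => factor_exists (r (i q)) (p q) (g q) (by rw [hg, hpr])
  choose a ha ha' using fun q => factor_exists l (e q ≫ ψ (i q)) (Man.incl (O q)) (by
    rw [pr_comp, hψ, he', hl, ← Category.assoc, hg])
  obtain ⟨m, ⟨hm, hm'⟩, -⟩ := hX x y' O (fun q => ⟨q, hO q⟩) t p a hpr ha' (by
    intro q q' c s s' hs hs' H
    refine factor_unique l ?_ (by rw [pr_comp, pr_comp, ha', ha', hs, hs']; rfl)
    rw [Category.assoc, Category.assoc, ha, ha, ← Category.assoc, ← Category.assoc]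
    apply h
    rw [Category.assoc, Category.assoc, he, he, H])
  refine ⟨m ≫ l, by rw [pr_comp, hm, hl]; simp, fun j => ?_⟩
  refine hX.hom_ext_sieve (by simp only [pr_comp, hψ, hm, hl, Category.id_comp])
    (Man.topology.pullback_stable (X.pr (r j)) (hr'.sieveOf_mem)) ?_
  intro T c s _
  have hcov : Man.Covering fun q => X.pr (p q) := fun q => ⟨O q, hO q, q, 𝟙 _, by simp [hpr]⟩
  refine hX.hom_ext_sieve (by simp only [pr_comp, hψ, hm, hl, Category.id_comp])
    (Man.topology.pullback_stable (X.pr (s ≫ r j)) hcov.sieveOf_mem) ?_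
  rintro T' c' s' ⟨q, b, hb⟩
  obtain ⟨d, hd, -⟩ := factor_exists (p q) (s' ≫ s ≫ r j) b (by
    simpa using hb)
  have e₁ : s' ≫ s ≫ r j ≫ m ≫ l = (d ≫ p q) ≫ m ≫ l := by rw [hd]; simp only [Category.assoc]
  rw [e₁, Category.assoc, ← Category.assoc (p q), hm', ha, ← Category.assoc, ← Category.assoc]
  apply h
  rw [Category.assoc, Category.assoc, he, hd]

/-- A criterion for prestacks. -/
theorem isPrestack_of (sep : ∀ {U : Man.{u}} {x y : X.Ob U} {φ φ' : X.of x ⟶ X.of y},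
      X.pr φ = 𝟙 U → X.pr φ' = 𝟙 U → ∀ S ∈ Man.topology U,
      (∀ {W : Man.{u}} (z : X.Ob W) (r : X.of z ⟶ X.of x), S (X.pr r) → r ≫ φ = r ≫ φ') → φ = φ')
    (glue : ∀ {U : Man.{u}} {x y : X.Ob U}, ∀ S ∈ Man.topology U,
      ∀ ψ : ∀ {W : Man.{u}} (z : X.Ob W) (r : X.of z ⟶ X.of x), S (X.pr r) → (X.of z ⟶ X.of y),
      (∀ {W : Man.{u}} (z : X.Ob W) (r : X.of z ⟶ X.of x) (h : S (X.pr r)),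
        X.pr (ψ z r h) = X.pr r) →
      (∀ {W : Man.{u}} (z : X.Ob W) (r : X.of z ⟶ X.of x) (h : S (X.pr r)) {W' : Man.{u}}
        (z' : X.Ob W') (s : X.of z' ⟶ X.of z) (h' : S (X.pr (s ≫ r))),
        ψ z' (s ≫ r) h' = s ≫ ψ z r h) →
      ∃ φ : X.of x ⟶ X.of y, X.pr φ = 𝟙 U ∧ ∀ {W : Man.{u}} (z : X.Ob W) (r : X.of z ⟶ X.of x)
        (h : S (X.pr r)), r ≫ φ = ψ z r h) : X.IsPrestack := by
  intro U x y ι V hV xr p ψ hp hψ H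
  have hS := (Man.covers_covering hV).sieveOf_mem
  have fac : ∀ {W : Man.{u}} (z : X.Ob W) (r : X.of z ⟶ X.of x),
      Man.sieveOf (fun i => Man.incl (V i)) (X.pr r) →
      ∃ (i : ι) (e : X.of z ⟶ X.of (xr i)), e ≫ p i = r := by
    rintro W z r ⟨i, g, hg⟩
    obtain ⟨e, he, -⟩ := factor_exists (p i) r g (by rw [hp, hg])
    exact ⟨i, e, he⟩
  have ind : ∀ {W : Man.{u}} (z : X.Ob W) (i j : ι) (e : X.of z ⟶ X.of (xr i))
      (e' : X.of z ⟶ X.of (xr j)), e ≫ p i = e' ≫ p j → e ≫ ψ i = e' ≫ ψ j := by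
    intro W z i j e e' h
    have hpr := congrArg X.pr h
    rw [pr_comp, pr_comp, hp, hp] at hpr
    obtain ⟨t, r, hr⟩ := lift_exists (xr i) (Man.inclLE (inf_le_left : V i ⊓ V j ≤ V i))
    obtain ⟨s, hs, hs'⟩ := factor_exists (p j) (r ≫ p i)
      (Man.inclLE (inf_le_right : V i ⊓ V j ≤ V j)) (by rw [pr_comp, hr, hp, hp]; rfl)
    let q : W ⟶ U.restrict (V i ⊓ V j) := Man.lift _ (X.pr e ≫ Man.incl (V i)) fun z =>
      ⟨Man.mem_of_incl (X.pr e) rfl z, Man.mem_of_incl (X.pr e') hpr.symm z⟩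
    obtain ⟨c, hc, -⟩ := factor_exists r e q (by rw [hr]; exact Man.incl_cancel rfl)
    have hc' : c ≫ s = e' := by
      refine factor_unique (p j) (by rw [Category.assoc, hs, ← Category.assoc, hc, h]) ?_
      refine Man.incl_cancel ?_
      have h2 := congrArg X.pr (show (c ≫ s) ≫ p j = e' ≫ p j by
        rw [Category.assoc, hs, ← Category.assoc, hc, h])
      rwa [pr_comp, pr_comp e', hp] at h2
    rw [← hc, ← hc', Category.assoc, Category.assoc, H i j t r s hr hs' hs.symm]
  obtain ⟨φ, hφ, hφ'⟩ := glue _ hS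
    (fun z r h => (fac z r h).choose_spec.choose ≫ ψ (fac z r h).choose)
    (fun z r h => by
      have := congrArg X.pr (fac z r h).choose_spec.choose_spec
      rw [pr_comp, hp] at this
      rw [pr_comp, hψ, this])
    (by
      intro W z r h W' z' s h'
      rw [← Category.assoc]
      refine ind _ _ _ _ _ ?_
      rw [(fac z' (s ≫ r) h').choose_spec.choose_spec, Category.assoc,
        (fac z r h).choose_spec.choose_spec])
  have key : ∀ {W : Man.{u}} (z : X.Ob W) (r : X.of z ⟶ X.of x) (i : ι)
      (e : X.of z ⟶ X.of (xr i)), e ≫ p i = r → r ≫ φ = e ≫ ψ i := by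
    intro W z r i e he
    have h : Man.sieveOf (fun i => Man.incl (V i)) (X.pr r) := ⟨i, X.pr e, by
      rw [← he, pr_comp, hp]⟩
    rw [hφ' _ r h]
    exact ind _ _ _ _ _ ((fac z r h).choose_spec.choose_spec.trans he.symm)
  refine ⟨φ, ⟨hφ, fun i => ?_⟩, ?_⟩
  · rw [key _ (p i) i (𝟙 _) (Category.id_comp _), Category.id_comp]
  · rintro φ' ⟨h₁, h₂⟩
    refine sep h₁ hφ _ hS ?_
    intro W z r h
    obtain ⟨i, e, he⟩ := fac z r h
    rw [key _ r i e he, ← he, Category.assoc, h₂]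

end arrows

/-! ### Gluing of objects -/

/-- A descent datum for objects: a family of objects over a covering family and a relation between
the arrows to its members, which identifies the restrictions of the members. -/
structure Descent (X : CFG.{w, u}) (U : Man.{u}) where
  K : Type k
  W : K → Man.{u}
  f : ∀ i, W i ⟶ U
  cov : Man.Covering f
  ob : ∀ i, X.Ob (W i)
  rel : ∀ {T : Man.{u}} {t : X.Ob T} {i j : K}, (X.of t ⟶ X.of (ob i)) →
    (X.of t ⟶ X.of (ob j)) → Prop
  pr_rel : ∀ {T : Man.{u}} {t : X.Ob T} {i j : K} {a : X.of t ⟶ X.of (ob i)}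
    {b : X.of t ⟶ X.of (ob j)}, rel a b → X.pr a ≫ f i = X.pr b ≫ f j
  exists_rel : ∀ {T : Man.{u}} {t : X.Ob T} {i : K} (a : X.of t ⟶ X.of (ob i)) (j : K)
    (g : T ⟶ W j), X.pr a ≫ f i = g ≫ f j →
    ∃ b : X.of t ⟶ X.of (ob j), X.pr b = g ∧ rel a b
  comp_rel : ∀ {T T' : Man.{u}} {t : X.Ob T} {t' : X.Ob T'} {i j : K} (s : X.of t' ⟶ X.of t)
    {a : X.of t ⟶ X.of (ob i)} {b : X.of t ⟶ X.of (ob j)}, rel a b → rel (s ≫ a) (s ≫ b)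
  rel_symm : ∀ {T : Man.{u}} {t : X.Ob T} {i j : K} {a : X.of t ⟶ X.of (ob i)}
    {b : X.of t ⟶ X.of (ob j)}, rel a b → rel b a
  rel_trans : ∀ {T : Man.{u}} {t : X.Ob T} {i j l : K} {a : X.of t ⟶ X.of (ob i)}
    {b : X.of t ⟶ X.of (ob j)} {c : X.of t ⟶ X.of (ob l)}, rel a b → rel b c → rel a c
  eq_of_rel : ∀ {T : Man.{u}} {t : X.Ob T} {i : K} {a b : X.of t ⟶ X.of (ob i)}, rel a b →
    X.pr a = X.pr b → a = b

/-- A descent datum is effective if it comes from an object. -/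
def Descent.Effective {X : CFG.{w, u}} {U : Man.{u}} (d : Descent.{u, w, k} X U) : Prop :=
  ∃ (y : X.Ob U) (p : ∀ i, X.of (d.ob i) ⟶ X.of y), (∀ i, X.pr (p i) = d.f i) ∧
    ∀ {T : Man.{u}} {t : X.Ob T} {i j : d.K} (a : X.of t ⟶ X.of (d.ob i))
      (b : X.of t ⟶ X.of (d.ob j)), d.rel a b → a ≫ p i = b ≫ p j

theorem Descent.rel_unique {X : CFG.{w, u}} {U T : Man.{u}} (d : Descent.{u, w, k} X U) {t : X.Ob T}
    {i j : d.K} {a : X.of t ⟶ X.of (d.ob i)} {b c : X.of t ⟶ X.of (d.ob j)} (h : d.rel a b)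
    (h' : d.rel a c) (hp : X.pr b = X.pr c) : b = c :=
  d.eq_of_rel (d.rel_trans (d.rel_symm h) h') hp

section objects

variable {X : CFG.{w, u}} {U V : Man.{u}}

/-- Descent data in stacks are effective. -/
theorem IsStack.effective (hX : X.IsStack) (d : Descent.{u, w, k} X U) : d.Effective := by
  have hX₁ : X.IsPrestack := hX.1
  have hcov := d.cov
  choose O hO i g hg using hcov
  choose x l hl using fun q => lift_exists (d.ob (i q)) (g q)
  choose z r hr using fun q q' => lift_exists (x q) (Man.inclLE (inf_le_left : O q ⊓ O q' ≤ O q))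
  have hs : ∀ q q', ∃ s : X.of (z q q') ⟶ X.of (x q'),
      X.pr s = Man.inclLE inf_le_right ∧ d.rel (r q q' ≫ l q) (s ≫ l q') := by
    intro q q'
    obtain ⟨b, hb, hb'⟩ := d.exists_rel (r q q' ≫ l q) (i q')
      (Man.inclLE (inf_le_right : O q ⊓ O q' ≤ O q') ≫ g q') (by
        rw [pr_comp, hr, hl, Category.assoc, Category.assoc, hg, hg]
        rfl)
    obtain ⟨s, hs, hs'⟩ := factor_exists (l q') b (Man.inclLE inf_le_right) (by rw [hl, hb])
    exact ⟨s, hs', by rwa [hs]⟩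
  choose s hs hs' using hs
  have hl' : ∀ q {T : Man.{u}} {t : X.Ob T} {a b : X.of t ⟶ X.of (x q)},
      d.rel (a ≫ l q) (b ≫ l q) → a = b := by
    intro q T t a b h
    have h₁ := d.pr_rel h
    rw [pr_comp, pr_comp, hl, Category.assoc, Category.assoc, hg] at h₁
    have h₂ := Man.incl_cancel h₁
    exact factor_unique (l q) (d.eq_of_rel h (by rw [pr_comp, pr_comp, h₂])) h₂
  obtain ⟨y, p, hp, hp'⟩ := hX.2 O (fun q => ⟨q, hO q⟩) x z r s hr hs (by
    intro q q' q'' t a b c ha hb hc h₁ h₂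
    refine hl' q'' ?_
    have e₁ := d.comp_rel a (hs' q q')
    have e₂ := d.comp_rel b (hs' q' q'')
    have e₃ := d.comp_rel c (hs' q q'')
    rw [← Category.assoc, ← Category.assoc, h₁] at e₁
    rw [← Category.assoc, ← Category.assoc] at e₂
    rw [← Category.assoc, ← Category.assoc, ← h₂] at e₃
    exact d.rel_trans (d.rel_symm e₂) (d.rel_trans (d.rel_symm e₁) e₃))
  have key : ∀ (q q' : U.carrier) {T : Man.{u}} (t : X.Ob T) (a : X.of t ⟶ X.of (x q))
      (c : X.of t ⟶ X.of (x q')), d.rel (a ≫ l q) (c ≫ l q') → a ≫ p q = c ≫ p q' := by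
    intro q q' T t a c h
    have hac := d.pr_rel h
    rw [pr_comp, pr_comp, hl, hl, Category.assoc, Category.assoc, hg, hg] at hac
    let m : T ⟶ U.restrict (O q ⊓ O q') := Man.lift _ (X.pr a ≫ Man.incl (O q)) fun z =>
      ⟨Man.mem_of_incl (X.pr a) rfl z, Man.mem_of_incl (X.pr c) hac.symm z⟩
    obtain ⟨e, he, he'⟩ := factor_exists (r q q') a m (by rw [hr]; exact Man.incl_cancel rfl)
    have he2 : e ≫ s q q' = c := by
      refine hl' q' ?_
      have := d.comp_rel e (hs' q q')
      rw [← Category.assoc, ← Category.assoc, he] at this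
      exact d.rel_trans (d.rel_symm this) h
    rw [← he, ← he2, Category.assoc, Category.assoc, hp']
  have hcovp : ∀ {T : Man.{u}} (f : T ⟶ U),
      (Man.sieveOf (fun q => Man.incl (O q))).pullback f ∈ Man.topology T := fun f =>
    Man.Covering.pullback (fun q => ⟨O q, hO q, q, 𝟙 _, rfl⟩) f
  have loc : ∀ (j : d.K) {T : Man.{u}} (t : X.Ob T) (b : X.of t ⟶ X.of (d.ob j)),
      Man.sieveOf (fun q => Man.incl (O q)) (X.pr b ≫ d.f j) →
      ∃ (q : U.carrier) (c : X.of t ⟶ X.of (x q)), d.rel b (c ≫ l q) := by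
    rintro j T t b ⟨q, h, hh⟩
    obtain ⟨c, hc, hc'⟩ := d.exists_rel b (i q) (h ≫ g q) (by rw [Category.assoc, hg, hh])
    obtain ⟨c', hcc, -⟩ := factor_exists (l q) c h (by rw [hl, hc])
    exact ⟨q, c', by rwa [hcc]⟩
  -- the arrows from the given objects, by gluing
  have hP : ∀ j : d.K, ∃ P : X.of (d.ob j) ⟶ X.of y, X.pr P = d.f j ∧
      ∀ {T : Man.{u}} (t : X.Ob T) (b : X.of t ⟶ X.of (d.ob j)) (q : U.carrier)
        (c : X.of t ⟶ X.of (x q)), d.rel b (c ≫ l q) → b ≫ P = c ≫ p q := by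
    intro j
    let K := Σ (T : Man.{u}) (t : X.Ob T) (q : U.carrier),
      { b : (X.of t ⟶ X.of (d.ob j)) × (X.of t ⟶ X.of (x q)) // d.rel b.1 (b.2 ≫ l q) }
    obtain ⟨P, hP, hP'⟩ := hX₁.exists_glue (x := d.ob j) (y := y) (d.f j) (K := K)
      (W := fun κ => κ.1) (z := fun κ => κ.2.1) (fun κ => κ.2.2.2.1.1) (by
        refine Man.covering_of_mem (hcovp (d.f j)) ?_
        intro T f hf
        obtain ⟨t, b, hb⟩ := lift_exists (d.ob j) f
        obtain ⟨q, c, hc⟩ := loc j t b (by rw [hb]; exact hf)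
        exact ⟨⟨T, t, q, ⟨b, c⟩, hc⟩, 𝟙 _, by rw [Category.id_comp]; exact hb⟩)
      (fun κ => κ.2.2.2.1.2 ≫ p _) (fun κ => by
        have := d.pr_rel κ.2.2.2.2
        rw [this, pr_comp, pr_comp, hl, hp, Category.assoc, hg]) (by
        rintro ⟨T, t, q, ⟨b, c⟩, h₁⟩ ⟨T', t', q', ⟨b', c'⟩, h₂⟩ T'' t'' e e' h
        dsimp only at h₁ h₂ h ⊢
        rw [← Category.assoc, ← Category.assoc]
        refine key _ _ _ _ _ ?_
        have e₁ := d.comp_rel e h₁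
        have e₂ := d.comp_rel e' h₂
        rw [← Category.assoc] at e₁ e₂
        rw [h] at e₁
        exact d.rel_trans (d.rel_symm e₁) e₂)
    exact ⟨P, hP, fun {T} t b q c h => hP' ⟨T, t, q, ⟨b, c⟩, h⟩⟩
  choose P hP hP' using hP
  refine ⟨y, P, hP, ?_⟩
  intro T t m j a b h
  refine hX₁.hom_ext_sieve (by rw [pr_comp, pr_comp, hP, hP, d.pr_rel h])
    (hcovp (X.pr a ≫ d.f m)) ?_
  intro T' t' e he
  obtain ⟨q, c, hc⟩ := loc m t' (e ≫ a) (by rw [pr_comp, Category.assoc]; exact he)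
  rw [← Category.assoc, ← Category.assoc, hP' m t' _ q c hc,
    hP' j t' _ q c (d.rel_trans (d.rel_symm (d.comp_rel e h)) hc)]

/-- A criterion for stacks. -/
theorem isStack_of (hX : X.IsPrestack)
    (h : ∀ {U : Man.{u}} (d : Descent.{u, w, u} X U), d.Effective) : X.IsStack := by
  refine ⟨hX, ?_⟩
  intro U ι V hV x z r s hr hs H
  let A := fun {T : Man.{u}} {t : X.Ob T} {i j : ι} (a : X.of t ⟶ X.of (x i))
    (b : X.of t ⟶ X.of (x j)) => ∃ e : X.of t ⟶ X.of (z i j), e ≫ r i j = a ∧ e ≫ s i j = b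
  have ex : ∀ {T : Man.{u}} {t : X.Ob T} {i : ι} (a : X.of t ⟶ X.of (x i)) (j : ι)
      (g : T ⟶ U.restrict (V j)), X.pr a ≫ Man.incl (V i) = g ≫ Man.incl (V j) →
      ∃ b : X.of t ⟶ X.of (x j), X.pr b = g ∧ A a b := by
    intro T t i a j g hg
    obtain ⟨e, he, he'⟩ := factor_exists (r i j) a (Man.lift _ (X.pr a ≫ Man.incl (V i)) fun z =>
      ⟨Man.mem_of_incl (X.pr a) rfl z, Man.mem_of_incl g hg.symm z⟩) (by
        rw [hr]; exact Man.incl_cancel rfl)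
    refine ⟨e ≫ s i j, ?_, e, he, rfl⟩
    rw [pr_comp, hs, he']
    exact Man.incl_cancel hg
  have prA : ∀ {T : Man.{u}} {t : X.Ob T} {i j : ι} {a : X.of t ⟶ X.of (x i)}
      {b : X.of t ⟶ X.of (x j)}, A a b → X.pr a ≫ Man.incl (V i) = X.pr b ≫ Man.incl (V j) := by
    rintro T t i j _ _ ⟨e, rfl, rfl⟩
    rw [pr_comp, pr_comp, hr, hs]
    rfl
  have uni : ∀ {T : Man.{u}} {t : X.Ob T} {i j : ι} {a : X.of t ⟶ X.of (x i)}
      {b c : X.of t ⟶ X.of (x j)}, A a b → A a c → b = c := by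
    rintro T t i j a b c h h'
    have hbc : X.pr b = X.pr c := Man.incl_cancel ((prA h).symm.trans (prA h'))
    obtain ⟨e, he, rfl⟩ := h
    obtain ⟨e', he', rfl⟩ := h'
    have : e = e' := by
      refine factor_unique (r i j) (he.trans he'.symm) (Man.incl_cancel ?_)
      have := congrArg (· ≫ Man.incl _) (congrArg X.pr (he.trans he'.symm))
      simp only [pr_comp, hr, Category.assoc] at this
      exact this
    rw [this]
  have inj : ∀ {T : Man.{u}} {t : X.Ob T} {i j : ι} {a b : X.of t ⟶ X.of (x i)}
      {c : X.of t ⟶ X.of (x j)}, A a c → A b c → a = b := by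
    rintro T t i j a b c h h'
    obtain ⟨e, rfl, he⟩ := h
    obtain ⟨e', rfl, he'⟩ := h'
    have : e = e' := by
      refine factor_unique (s i j) (he.trans he'.symm) (Man.incl_cancel ?_)
      have := congrArg (· ≫ Man.incl _) (congrArg X.pr (he.trans he'.symm))
      simp only [pr_comp, hs, Category.assoc] at this
      exact this
    rw [this]
  have cc : ∀ {T T' : Man.{u}} {t : X.Ob T} {t' : X.Ob T'} {i j : ι} (q : X.of t' ⟶ X.of t)
      {a : X.of t ⟶ X.of (x i)} {b : X.of t ⟶ X.of (x j)}, A a b → A (q ≫ a) (q ≫ b) := by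
    rintro T T' t t' i j q _ _ ⟨e, rfl, rfl⟩
    exact ⟨q ≫ e, Category.assoc _ _ _, Category.assoc _ _ _⟩
  have tr : ∀ {T : Man.{u}} {t : X.Ob T} {i j l : ι} {a : X.of t ⟶ X.of (x i)}
      {b : X.of t ⟶ X.of (x j)} {c : X.of t ⟶ X.of (x l)}, A a b → A b c → A a c := by
    rintro T t i j l a b c h h'
    obtain ⟨c', hc', hac'⟩ := ex a l (X.pr c) ((prA h).trans (prA h'))
    have hp₁ := prA h
    have hp₂ := prA h'
    obtain ⟨e₁, he₁, he₁'⟩ := h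
    obtain ⟨e₂, he₂, he₂'⟩ := h'
    obtain ⟨e₃, he₃, he₃'⟩ := id hac'
    let m : T ⟶ U.restrict (V i ⊓ V j ⊓ V l) := Man.lift _ (X.pr a ≫ Man.incl (V i)) fun z =>
      ⟨⟨Man.mem_of_incl (X.pr a) rfl z, Man.mem_of_incl (X.pr b) hp₁.symm z⟩,
        Man.mem_of_incl (X.pr c) (hp₁.trans hp₂).symm z⟩
    have m₁ : ∀ {W : Opens U.carrier} (k : T ⟶ U.restrict W) (hW : V i ⊓ V j ⊓ V l ≤ W),
        k ≫ Man.incl W = X.pr a ≫ Man.incl (V i) → k = m ≫ Man.inclLE hW := fun k hW hk =>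
      Man.incl_cancel hk
    obtain ⟨t₀, α, hα⟩ := lift_exists (z i j) (Man.inclLE (inf_le_left : V i ⊓ V j ⊓ V l ≤ V i ⊓ V j))
    have pr₁ := congrArg X.pr he₁
    have pr₂ := congrArg X.pr he₂
    have pr₃ := congrArg X.pr he₃
    rw [pr_comp, hr] at pr₁ pr₂ pr₃
    obtain ⟨q, hq, hq'⟩ := factor_exists α e₁ m (by
      rw [hα]
      exact (m₁ _ _ (by rw [← pr₁]; rfl)).symm)
    obtain ⟨β, hβ, hβ'⟩ := factor_exists (r j l) (α ≫ s i j)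
      (Man.inclLE (inf_le_inf_right _ inf_le_right)) (by rw [hr, pr_comp, hα, hs]; rfl)
    obtain ⟨γ, hγ, hγ'⟩ := factor_exists (r i l) (α ≫ r i j)
      (Man.inclLE (inf_le_inf_right _ inf_le_left)) (by rw [hr, pr_comp, hα, hr]; rfl)
    have co := H i j l t₀ α β γ hα hβ' hγ' hβ.symm hγ.symm
    have hqβ : q ≫ β = e₂ := by
      refine factor_unique (r j l) ?_ ?_
      · rw [Category.assoc, hβ, ← Category.assoc, hq, he₁', he₂]
      · rw [pr_comp, hq', hβ', ← m₁ _ _ (by rw [hp₁, ← pr₂]; rfl)]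
    have hqγ : q ≫ γ = e₃ := by
      refine factor_unique (r i l) ?_ ?_
      · rw [Category.assoc, hγ, ← Category.assoc, hq, he₁, he₃]
      · rw [pr_comp, hq', hγ', ← m₁ _ _ (by rw [← pr₃]; rfl)]
    have : c = c' := by
      rw [← he₂', ← he₃', ← hqβ, ← hqγ, Category.assoc, Category.assoc, co]
    rw [this]
    exact hac'
  have self : ∀ {T : Man.{u}} {t : X.Ob T} {i : ι} (a : X.of t ⟶ X.of (x i)), A a a := by
    intro T t i a
    obtain ⟨b, hb, hab⟩ := ex a i (X.pr a) rfl
    obtain ⟨c, hc, hbc⟩ := ex b i (X.pr b) rfl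
    have := uni hab (tr hab hbc)
    have h2 := inj hab (by rw [← this] at hbc; exact hbc)
    rwa [← h2] at hab
  have sy : ∀ {T : Man.{u}} {t : X.Ob T} {i j : ι} {a : X.of t ⟶ X.of (x i)}
      {b : X.of t ⟶ X.of (x j)}, A a b → A b a := by
    intro T t i j a b hab
    obtain ⟨c, hc, hbc⟩ := ex b i (X.pr a) (prA hab).symm
    rwa [uni (self a) (tr hab hbc)]
  obtain ⟨y, p, hp, hp'⟩ := h
    { K := ι
      W := fun i => U.restrict (V i)
      f := fun i => Man.incl (V i)
      cov := Man.covers_covering hV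
      ob := x
      rel := A
      pr_rel := prA
      exists_rel := ex
      comp_rel := cc
      rel_symm := sy
      rel_trans := tr
      eq_of_rel := fun h _ => uni (self _) h }
  refine ⟨y, p, hp, fun i j => hp' (r i j) (s i j) ⟨𝟙 _, Category.id_comp _, Category.id_comp _⟩⟩

end objects

end CFG

end StackyQuotient

end

noncomputable section

universe w w' k

namespace StackyQuotient

namespace CFG

/-! ### Local equivalences -/

variable {P Q S : CFG.{w, u}} {U V W : Man.{u}}

/-- A morphism is a local equivalence if, locally, it is surjective on objects, full and
faithful. -/
structure Mor.LocEquiv (ι : Mor P Q) : Prop where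
  surj : ∀ {U : Man.{u}} (y : Q.Ob U), ∃ C ∈ Man.topology U, ∀ {W : Man.{u}} (f : W ⟶ U), C f →
    ∃ (x : P.Ob W) (a : Q.of (ι.obj x) ⟶ Q.of y), Q.pr a = f
  full : ∀ {U : Man.{u}} (x x' : P.Ob U) (m : Q.of (ι.obj x) ⟶ Q.of (ι.obj x')), Q.pr m = 𝟙 U →
    ∃ C ∈ Man.topology U, ∀ {W : Man.{u}} (z : P.Ob W) (r : P.of z ⟶ P.of x), C (P.pr r) →
      ∃ n : P.of z ⟶ P.of x', ι.map n = ι.map r ≫ m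
  faithful : ∀ {U : Man.{u}} {x x' : P.Ob U} {n n' : P.of x ⟶ P.of x'}, P.pr n = 𝟙 U →
    P.pr n' = 𝟙 U → ι.map n = ι.map n' →
    ∃ C ∈ Man.topology U, ∀ {W : Man.{u}} (z : P.Ob W) (r : P.of z ⟶ P.of x), C (P.pr r) →
      r ≫ n = r ≫ n'

/-- An arrow between images of objects, up to restriction of the target, lies over an identity. -/
theorem exists_lift_map (ι : Mor P Q) {x : P.Ob U} {x' : P.Ob V}
    (m : Q.of (ι.obj x) ⟶ Q.of (ι.obj x')) : ∃ (x'' : P.Ob U) (l : P.of x'' ⟶ P.of x')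
      (m' : Q.of (ι.obj x) ⟶ Q.of (ι.obj x'')), P.pr l = Q.pr m ∧ Q.pr m' = 𝟙 U ∧
      m' ≫ ι.map l = m := by
  obtain ⟨x'', l, hl⟩ := lift_exists x' (Q.pr m)
  obtain ⟨m', hm, hm'⟩ := factor_exists (ι.map l) m (𝟙 U) (by rw [ι.pr_map, hl]; simp)
  exact ⟨x'', l, m', hl, hm', hm⟩

/-- Restrictions of pairs of arrows to a common domain. -/
theorem Mor.exists_common (F : Mor P S) {T Z Z' : Man.{u}} {t : S.Ob T} {x : P.Ob U} {z : P.Ob Z}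
    {z' : P.Ob Z'} (r : P.of z ⟶ P.of x) (r' : P.of z' ⟶ P.of x) (s : S.of t ⟶ S.of (F.obj z))
    (s' : S.of t ⟶ S.of (F.obj z')) (h : s ≫ F.map r = s' ≫ F.map r') :
    ∃ (x₀ : P.Ob T) (ρ : P.of x₀ ⟶ P.of z) (ρ' : P.of x₀ ⟶ P.of z')
      (e : S.of t ⟶ S.of (F.obj x₀)), S.pr e = 𝟙 T ∧ e ≫ F.map ρ = s ∧ e ≫ F.map ρ' = s' ∧
      ρ ≫ r = ρ' ≫ r' := by
  obtain ⟨x₀, ρ, hρ⟩ := lift_exists z (S.pr s)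
  obtain ⟨e, he, he'⟩ := factor_exists (F.map ρ) s (𝟙 T) (by rw [F.pr_map, hρ]; simp)
  have hpr := congrArg S.pr h
  rw [pr_comp, pr_comp, F.pr_map, F.pr_map] at hpr
  obtain ⟨ρ', hρ', hρ''⟩ := factor_exists r' (ρ ≫ r) (S.pr s') (by rw [pr_comp, hρ, hpr])
  refine ⟨x₀, ρ, ρ', e, he', he, ?_, hρ'.symm⟩
  refine factor_unique (F.map r') ?_ (by rw [pr_comp, F.pr_map, hρ'', he']; simp)
  rw [Category.assoc, ← F.map_comp, hρ', F.map_comp, ← Category.assoc, he, h]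

namespace Mor.LocEquiv

variable {ι : Mor P Q} (h : ι.LocEquiv)

include h

theorem exists_full {x : P.Ob U} {x' : P.Ob V} (m : Q.of (ι.obj x) ⟶ Q.of (ι.obj x')) :
    ∃ C ∈ Man.topology U, ∀ {W : Man.{u}} (z : P.Ob W) (r : P.of z ⟶ P.of x), C (P.pr r) →
      ∃ n : P.of z ⟶ P.of x', ι.map n = ι.map r ≫ m := by
  obtain ⟨x'', l, m', hl, hm', rfl⟩ := exists_lift_map ι m
  obtain ⟨C, hC, hh⟩ := h.full x x'' m' hm'
  refine ⟨C, hC, fun z r hr => ?_⟩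
  obtain ⟨n, hn⟩ := hh z r hr
  exact ⟨n ≫ l, by rw [ι.map_comp, hn, Category.assoc]⟩

theorem locally_eq {x : P.Ob U} {x' : P.Ob V} {n n' : P.of x ⟶ P.of x'}
    (e : ι.map n = ι.map n') : ∃ C ∈ Man.topology U, ∀ {W : Man.{u}} (z : P.Ob W)
      (r : P.of z ⟶ P.of x), C (P.pr r) → r ≫ n = r ≫ n' := by
  have hp : P.pr n' = P.pr n := by rw [← ι.pr_map, ← ι.pr_map, e]
  obtain ⟨x'', l, hl⟩ := lift_exists x' (P.pr n)
  obtain ⟨m, hm, hm'⟩ := factor_exists l n (𝟙 U) (by rw [hl]; simp)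
  obtain ⟨m₁, hm₁, hm₁'⟩ := factor_exists l n' (𝟙 U) (by rw [hl, hp]; simp)
  obtain ⟨C, hC, hh⟩ := h.faithful hm' hm₁' (factor_unique (ι.map l) (by
    rw [← ι.map_comp, ← ι.map_comp, hm, hm₁, e]) (by rw [ι.pr_map, ι.pr_map, hm', hm₁']))
  refine ⟨C, hC, fun z r hr => ?_⟩
  rw [← hm, ← hm₁, ← Category.assoc, ← Category.assoc, hh z r hr]

theorem map_eq (hS : S.IsPrestack) (F : Mor P S) {x : P.Ob U} {x' : P.Ob V}
    {n n' : P.of x ⟶ P.of x'} (e : ι.map n = ι.map n') : F.map n = F.map n' := by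
  obtain ⟨C, hC, hh⟩ := h.locally_eq e
  refine hS.hom_ext_sieve (by rw [F.pr_map, F.pr_map, ← ι.pr_map, ← ι.pr_map, e]) hC ?_
  intro W z r hr
  obtain ⟨z', l, hl⟩ := lift_exists x (S.pr r)
  obtain ⟨c, hc, -⟩ := factor_exists (F.map l) r (𝟙 W) (by rw [F.pr_map, hl]; simp)
  rw [← hc, Category.assoc, Category.assoc, ← F.map_comp, ← F.map_comp, hh z' l (by rwa [hl])]

theorem exists_tilde (hS : S.IsPrestack) (F : Mor P S) {x : P.Ob U} {x' : P.Ob V}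
    (c : Q.of (ι.obj x) ⟶ Q.of (ι.obj x')) :
    ∃ φ : S.of (F.obj x) ⟶ S.of (F.obj x'), S.pr φ = Q.pr c ∧
      ∀ {W : Man.{u}} (z : P.Ob W) (r : P.of z ⟶ P.of x) (n : P.of z ⟶ P.of x'),
        ι.map n = ι.map r ≫ c → F.map r ≫ φ = F.map n := by
  obtain ⟨C, hC, hh⟩ := h.exists_full c
  let K := Σ (W : Man.{u}) (z : P.Ob W),
    { q : (P.of z ⟶ P.of x) × (P.of z ⟶ P.of x') // ι.map q.2 = ι.map q.1 ≫ c }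
  obtain ⟨φ, hφ, hφ'⟩ := hS.exists_glue (x := F.obj x) (y := F.obj x') (Q.pr c) (K := K)
    (W := fun κ => κ.1) (z := fun κ => F.obj κ.2.1) (fun κ => F.map κ.2.2.1.1) (by
      refine Man.covering_of_mem hC ?_
      intro T t ht
      obtain ⟨z, r, hr⟩ := lift_exists x t
      obtain ⟨n, hn⟩ := hh z r (by rwa [hr])
      exact ⟨⟨T, z, ⟨r, n⟩, hn⟩, 𝟙 T, by rw [F.pr_map]; exact hr⟩)
    (fun κ => F.map κ.2.2.1.2) (by
      rintro ⟨W, z, ⟨r, n⟩, hn⟩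
      dsimp only at hn ⊢
      rw [F.pr_map, F.pr_map, ← ι.pr_map, hn, pr_comp, ι.pr_map]) (by
      rintro ⟨W, z, ⟨r, n⟩, hn⟩ ⟨W', z', ⟨r', n'⟩, hn'⟩ T t s s' hs
      dsimp only at hn hn' hs ⊢
      obtain ⟨x₀, ρ, ρ', e, -, rfl, rfl, hρ⟩ := F.exists_common r r' s s' hs
      rw [Category.assoc, Category.assoc, ← F.map_comp, ← F.map_comp,
        h.map_eq hS F (n := ρ ≫ n) (n' := ρ' ≫ n')]
      rw [ι.map_comp, ι.map_comp, hn, hn', ← Category.assoc, ← ι.map_comp, hρ, ι.map_comp,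
        Category.assoc])
  exact ⟨φ, hφ, fun {W} z r n hn => hφ' ⟨W, z, ⟨r, n⟩, hn⟩⟩

/-- The effect of a morphism to a prestack on the arrows between images of a local equivalence. -/
def tilde (hS : S.IsPrestack) (F : Mor P S) {x : P.Ob U} {x' : P.Ob V}
    (c : Q.of (ι.obj x) ⟶ Q.of (ι.obj x')) : S.of (F.obj x) ⟶ S.of (F.obj x') :=
  (h.exists_tilde hS F c).choose

theorem pr_tilde (hS : S.IsPrestack) (F : Mor P S) {x : P.Ob U} {x' : P.Ob V}
    (c : Q.of (ι.obj x) ⟶ Q.of (ι.obj x')) : S.pr (h.tilde hS F c) = Q.pr c :=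
  (h.exists_tilde hS F c).choose_spec.1

theorem map_tilde (hS : S.IsPrestack) (F : Mor P S) {x : P.Ob U} {x' : P.Ob V}
    (c : Q.of (ι.obj x) ⟶ Q.of (ι.obj x')) (z : P.Ob W) (r : P.of z ⟶ P.of x)
    (n : P.of z ⟶ P.of x') (e : ι.map n = ι.map r ≫ c) : F.map r ≫ h.tilde hS F c = F.map n :=
  (h.exists_tilde hS F c).choose_spec.2 z r n e

theorem tilde_map (hS : S.IsPrestack) (F : Mor P S) {x : P.Ob U} {x' : P.Ob V}
    (n : P.of x ⟶ P.of x') : h.tilde hS F (ι.map n) = F.map n := by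
  have := h.map_tilde hS F (ι.map n) x (𝟙 _) n (by rw [ι.map_id, Category.id_comp])
  rwa [F.map_id, Category.id_comp] at this

theorem covering_full {x : P.Ob U} {x' : P.Ob V} (m : Q.of (ι.obj x) ⟶ Q.of (ι.obj x')) :
    Man.Covering fun κ : (Σ (W : Man.{u}) (z : P.Ob W),
      { q : (P.of z ⟶ P.of x) × (P.of z ⟶ P.of x') // ι.map q.2 = ι.map q.1 ≫ m }) =>
        P.pr κ.2.2.1.1 := by
  obtain ⟨C, hC, hh⟩ := h.exists_full m
  refine Man.covering_of_mem hC ?_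
  intro T t ht
  obtain ⟨z, r, hr⟩ := lift_exists x t
  obtain ⟨n, hn⟩ := hh z r (by rwa [hr])
  exact ⟨⟨T, z, ⟨r, n⟩, hn⟩, 𝟙 T, by simpa using hr⟩

theorem tilde_comp (hS : S.IsPrestack) (F : Mor P S) {x : P.Ob U} {x' : P.Ob V} {x'' : P.Ob W}
    (c : Q.of (ι.obj x) ⟶ Q.of (ι.obj x')) (c' : Q.of (ι.obj x') ⟶ Q.of (ι.obj x'')) :
    h.tilde hS F (c ≫ c') = h.tilde hS F c ≫ h.tilde hS F c' := by
  refine hS.hom_ext (by simp only [pr_comp, h.pr_tilde])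
    (fun κ : (Σ (W : Man.{u}) (z : P.Ob W),
      { q : (P.of z ⟶ P.of x) × (P.of z ⟶ P.of x') // ι.map q.2 = ι.map q.1 ≫ c }) =>
        F.map κ.2.2.1.1) ?_ ?_
  · simpa only [F.pr_map] using h.covering_full c
  rintro ⟨T, z, ⟨r, n⟩, hn⟩
  dsimp only at hn ⊢
  rw [← Category.assoc, h.map_tilde hS F c z r n hn]
  obtain ⟨C', hC', hh'⟩ := h.exists_full c'
  have hp : S.pr (F.map n ≫ h.tilde hS F c') = S.pr (F.map r ≫ h.tilde hS F (c ≫ c')) := by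
    simp only [pr_comp, h.pr_tilde, F.pr_map]
    rw [← Category.assoc, ← ι.pr_map, ← ι.pr_map, hn, pr_comp]
  refine hS.hom_ext hp.symm
    (fun κ : (Σ (W : Man.{u}) (y : P.Ob W),
      { q : (P.of y ⟶ P.of z) × (P.of y ⟶ P.of x'') //
        ι.map q.2 = ι.map q.1 ≫ ι.map n ≫ c' }) => F.map κ.2.2.1.1) ?_ ?_
  · simpa only [F.pr_map] using h.covering_full (ι.map n ≫ c')
  rintro ⟨T', z', ⟨r', n'⟩, hn'⟩
  dsimp only at hn' ⊢
  rw [← Category.assoc, ← Category.assoc, ← F.map_comp, ← F.map_comp,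
    h.map_tilde hS F (c ≫ c') z' (r' ≫ r) n', h.map_tilde hS F c' z' (r' ≫ n) n']
  · rw [hn', ι.map_comp, Category.assoc]
  · rw [hn', hn, ι.map_comp]
    simp only [Category.assoc]

theorem tilde_id (hS : S.IsPrestack) (F : Mor P S) (x : P.Ob U) :
    h.tilde hS F (𝟙 (Q.of (ι.obj x))) = 𝟙 (S.of (F.obj x)) := by
  rw [← ι.map_id, h.tilde_map, F.map_id]

omit h in
/-- The arrows from objects of `P` to an object of `Q`. -/
abbrev Over (ι : Mor P Q) (y : Q.Ob U) :=
  Σ (W : Man.{u}) (x : P.Ob W), (Q.of (ι.obj x) ⟶ Q.of y)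

theorem covering_over (y : Q.Ob U) : Man.Covering fun κ : Over ι y => Q.pr κ.2.2 := by
  obtain ⟨C, hC, hh⟩ := h.surj y
  refine Man.covering_of_mem hC ?_
  intro T t ht
  obtain ⟨x, a, ha⟩ := hh t ht
  exact ⟨⟨T, x, a⟩, 𝟙 T, by simpa using ha⟩

/-- The descent datum for the value at `y` of the extension of `F`. -/
def descent (hS : S.IsPrestack) (F : Mor P S) (y : Q.Ob U) : Descent S U where
  K := Over ι y
  W κ := κ.1
  f κ := Q.pr κ.2.2
  cov := h.covering_over y
  ob κ := F.obj κ.2.1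
  rel {T} {t} {i} {j} s s' := ∃ (x : P.Ob T) (e : S.of t ⟶ S.of (F.obj x))
    (c : Q.of (ι.obj x) ⟶ Q.of (ι.obj i.2.1)) (c' : Q.of (ι.obj x) ⟶ Q.of (ι.obj j.2.1)),
    S.pr e = 𝟙 T ∧ c ≫ i.2.2 = c' ≫ j.2.2 ∧ e ≫ h.tilde hS F c = s ∧ e ≫ h.tilde hS F c' = s'
  pr_rel := by
    rintro T t i j _ _ ⟨x, e, c, c', he, hc, rfl, rfl⟩
    rw [pr_comp, pr_comp, he, h.pr_tilde, h.pr_tilde, Category.id_comp, Category.id_comp,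
      ← pr_comp, hc, pr_comp]
  exists_rel := by
    intro T t i a j g hg
    obtain ⟨x, ρ, hρ⟩ := lift_exists i.2.1 (S.pr a)
    obtain ⟨e, he, he'⟩ := factor_exists (F.map ρ) a (𝟙 T) (by rw [F.pr_map, hρ]; simp)
    obtain ⟨c, hc, hc'⟩ := factor_exists j.2.2 (ι.map ρ ≫ i.2.2) g (by
      rw [pr_comp, ι.pr_map, hρ, hg])
    refine ⟨e ≫ h.tilde hS F c, ?_, x, e, ι.map ρ, c, he', hc.symm, ?_, rfl⟩
    · rw [pr_comp, he', h.pr_tilde, hc', Category.id_comp]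
    · rw [h.tilde_map, he]
  comp_rel := by
    rintro T T' t t' i j s _ _ ⟨x, e, c, c', he, hc, rfl, rfl⟩
    obtain ⟨x', q, hq⟩ := lift_exists x (S.pr s)
    obtain ⟨e', he', he''⟩ := factor_exists (F.map q) (s ≫ e) (𝟙 T') (by
      rw [F.pr_map, hq, pr_comp, he]; simp)
    refine ⟨x', e', ι.map q ≫ c, ι.map q ≫ c', he'', ?_, ?_, ?_⟩
    · rw [Category.assoc, hc, Category.assoc]
    · rw [h.tilde_comp, h.tilde_map, ← Category.assoc, he', Category.assoc]
    · rw [h.tilde_comp, h.tilde_map, ← Category.assoc, he', Category.assoc]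
  rel_symm := by
    rintro T t i j _ _ ⟨x, e, c, c', he, hc, hs, hs'⟩
    exact ⟨x, e, c', c, he, hc.symm, hs', hs⟩
  rel_trans := by
    rintro T t i j l _ _ _ ⟨x, e, c, c', he, hc, rfl, rfl⟩ ⟨x₁, e₁, d, d', he₁, hd, hs, rfl⟩
    have hp := congrArg S.pr hs
    rw [pr_comp, pr_comp, he, he₁, h.pr_tilde, h.pr_tilde, Category.id_comp,
      Category.id_comp] at hp
    obtain ⟨θ, hθ, hθ'⟩ := factor_exists d c' (𝟙 T) (by rw [hp]; simp)
    have hθe : e ≫ h.tilde hS F θ = e₁ := by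
      refine factor_unique (h.tilde hS F d) ?_ (by
        rw [pr_comp, he, he₁, h.pr_tilde, hθ', Category.id_comp])
      rw [Category.assoc, ← h.tilde_comp, hθ, hs]
    refine ⟨x, e, c, θ ≫ d', he, ?_, rfl, ?_⟩
    · rw [hc, ← hθ, Category.assoc, hd, Category.assoc]
    · rw [h.tilde_comp, ← Category.assoc, hθe]
  eq_of_rel := by
    rintro T t i _ _ ⟨x, e, c, c', he, hc, rfl, rfl⟩ hp
    rw [pr_comp, pr_comp, he, h.pr_tilde, h.pr_tilde, Category.id_comp, Category.id_comp] at hp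
    rw [factor_unique i.2.2 hc hp]

/-- Morphisms to stacks extend along local equivalences. -/
theorem exists_extension (hS : S.IsStack) (F : Mor P S) :
    ∃ F' : Mor Q S, Nonempty (TwoMor (ι.comp F') F) := by
  have hS₁ : S.IsPrestack := hS.1
  have eff := fun {U : Man.{u}} (y : Q.Ob U) => hS.effective (h.descent hS₁ F y)
  choose yF p' hp' hrel using @eff
  obtain ⟨p, hp, hpc⟩ : ∃ p : ∀ {U W : Man.{u}} (y : Q.Ob U) {x : P.Ob W}
      (_ : Q.of (ι.obj x) ⟶ Q.of y), S.of (F.obj x) ⟶ S.of (yF y),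
      (∀ {U W : Man.{u}} (y : Q.Ob U) {x : P.Ob W} (a : Q.of (ι.obj x) ⟶ Q.of y),
        S.pr (p y a) = Q.pr a) ∧
      (∀ {U W Z : Man.{u}} (y : Q.Ob U) {x : P.Ob W} {z : P.Ob Z}
        (a : Q.of (ι.obj x) ⟶ Q.of y) (c : Q.of (ι.obj z) ⟶ Q.of (ι.obj x)),
        h.tilde hS₁ F c ≫ p y a = p y (c ≫ a)) := by
    refine ⟨fun {U W} y {x} a => p' y ⟨W, x, a⟩, fun {U W} y {x} a => hp' y ⟨W, x, a⟩, ?_⟩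
    intro U W Z y x z a c
    have := hrel y (i := ⟨Z, z, c ≫ a⟩) (j := ⟨W, x, a⟩) (𝟙 (S.of (F.obj z))) (h.tilde hS₁ F c)
      ⟨z, 𝟙 _, 𝟙 _, c, S.pr_id _, Category.id_comp _,
        (Category.id_comp _).trans (h.tilde_id hS₁ F z), Category.id_comp _⟩
    exact this.symm.trans (Category.id_comp _)
  have hcov : ∀ {U : Man.{u}} (y : Q.Ob U),
      Man.Covering fun κ : Over ι y => S.pr (p y κ.2.2) := by
    intro U y
    simpa only [hp] using h.covering_over y
  have ex : ∀ {U V : Man.{u}} {y : Q.Ob U} {y' : Q.Ob V} (m : Q.of y ⟶ Q.of y'),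
      ∃ φ : S.of (yF y) ⟶ S.of (yF y'), S.pr φ = Q.pr m ∧ ∀ κ : Over ι y,
        p y κ.2.2 ≫ φ = p y' (κ.2.2 ≫ m) := by
    intro U V y y' m
    refine hS₁.exists_glue (x := yF y) (y := yF y') (Q.pr m) (fun κ : Over ι y => p y κ.2.2)
      (hcov y) (fun κ => p y' (κ.2.2 ≫ m)) (fun κ => by rw [hp, hp, pr_comp]) ?_
    rintro ⟨W, x, a⟩ ⟨W', x', a'⟩ T t s s' hs
    dsimp only at hs ⊢
    obtain ⟨x₀, ρ, hρ⟩ := lift_exists x (S.pr s)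
    obtain ⟨e, he, he'⟩ := factor_exists (F.map ρ) s (𝟙 T) (by rw [F.pr_map, hρ]; simp)
    have hpr := congrArg S.pr hs
    rw [pr_comp, pr_comp, hp, hp] at hpr
    obtain ⟨c, hc, hc'⟩ := factor_exists a' (ι.map ρ ≫ a) (S.pr s') (by
      rw [pr_comp, ι.pr_map, hρ, hpr])
    have h₁ : e ≫ h.tilde hS₁ F c = s' := by
      refine factor_unique (p y a') ?_ (by rw [pr_comp, he', h.pr_tilde, hc', Category.id_comp])
      rw [Category.assoc, hpc, hc, ← hpc, h.tilde_map, ← Category.assoc, he, hs]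
    rw [← h₁, ← he, Category.assoc, Category.assoc, ← h.tilde_map hS₁ F, hpc, hpc,
      ← Category.assoc, ← Category.assoc, hc]
  choose φ hφ hφ' using @ex
  have uni : ∀ {U V : Man.{u}} {y : Q.Ob U} {z : S.Ob V} {ψ ψ' : S.of (yF y) ⟶ S.of z},
      S.pr ψ = S.pr ψ' → (∀ κ : Over ι y, p y κ.2.2 ≫ ψ = p y κ.2.2 ≫ ψ') → ψ = ψ' :=
    fun {U V y z ψ ψ'} e H => hS₁.hom_ext e (fun κ : Over ι y => p y κ.2.2) (hcov y) H
  let F' : Mor Q S :=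
    { obj := fun y => yF y
      map := fun m => φ m
      map_id := fun y => uni (by rw [hφ, pr_id, pr_id]) fun κ => by rw [hφ']; simp
      map_comp := fun a b => uni (by rw [pr_comp, hφ, hφ, hφ, pr_comp]) fun κ => by
        rw [hφ', ← Category.assoc, ← Category.assoc, hφ', hφ' b ⟨_, _, κ.2.2 ≫ a⟩]
      pr_map := fun m => hφ m }
  have iso : ∀ {U : Man.{u}} (x : P.Ob U), IsIso (p (ι.obj x) (𝟙 (Q.of (ι.obj x)))) :=
    fun x => isIso_of_pr _ (by rw [hp, pr_id])
  let i := fun {U : Man.{u}} (x : P.Ob U) =>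
    @asIso _ _ _ _ (p (ι.obj x) (𝟙 (Q.of (ι.obj x)))) (iso x)
  refine ⟨F', ⟨{ app := fun x => (i x).inv, pr_app := ?_, naturality := ?_ }⟩⟩
  · intro U x
    exact pr_inv (i x) ((hp _ _).trans (Q.pr_id _))
  · intro U V x x' a
    change φ (ι.map a) ≫ (i x').inv = (i x).inv ≫ F.map a
    rw [Iso.comp_inv_eq, Category.assoc, Iso.eq_inv_comp]
    change p (ι.obj x) (𝟙 _) ≫ φ (ι.map a) = F.map a ≫ p (ι.obj x') (𝟙 _)
    rw [hφ' _ ⟨_, x, 𝟙 _⟩, ← h.tilde_map hS₁ F, hpc, Category.comp_id, Category.id_comp]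

/-- 2-morphisms extend uniquely along local equivalences. -/
theorem existsUnique_twoMor (hS : S.IsPrestack) {F₁ F₂ : Mor Q S}
    (η : ∀ {U : Man.{u}} (x : P.Ob U), S.of (F₁.obj (ι.obj x)) ⟶ S.of (F₂.obj (ι.obj x)))
    (pr_η : ∀ {U : Man.{u}} (x : P.Ob U), S.pr (η x) = 𝟙 U)
    (η_nat : ∀ {U V : Man.{u}} {x : P.Ob U} {x' : P.Ob V} (a : P.of x ⟶ P.of x'),
      F₁.map (ι.map a) ≫ η x' = η x ≫ F₂.map (ι.map a)) :
    ∃! η' : TwoMor F₁ F₂, ∀ {U : Man.{u}} (x : P.Ob U), η'.app (ι.obj x) = η x := by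
  have hcov : ∀ (F : Mor Q S) {U : Man.{u}} (y : Q.Ob U),
      Man.Covering fun κ : Over ι y => S.pr (F.map κ.2.2) := by
    intro F U y
    simpa only [F.pr_map] using h.covering_over y
  have nat : ∀ {U V : Man.{u}} {x : P.Ob U} {x' : P.Ob V}
      (c : Q.of (ι.obj x) ⟶ Q.of (ι.obj x')),
      F₁.map c ≫ η x' = η x ≫ F₂.map c := by
    intro U V x x' c
    refine hS.hom_ext (by
      simp only [pr_comp, pr_η, F₁.pr_map, F₂.pr_map, Category.comp_id, Category.id_comp])
      (fun κ : (Σ (W : Man.{u}) (z : P.Ob W),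
      { q : (P.of z ⟶ P.of x) × (P.of z ⟶ P.of x') // ι.map q.2 = ι.map q.1 ≫ c }) =>
        F₁.map (ι.map κ.2.2.1.1)) ?_ ?_
    · simpa only [F₁.pr_map, ι.pr_map] using h.covering_full c
    rintro ⟨T, z, ⟨r, n⟩, hn⟩
    dsimp only at hn ⊢
    have e₁ := η_nat r
    rw [← Category.assoc, ← F₁.map_comp, ← hn, η_nat n, ← Category.assoc, e₁, Category.assoc,
      ← F₂.map_comp, hn]
  have ex : ∀ {U : Man.{u}} (y : Q.Ob U), ∃ φ : S.of (F₁.obj y) ⟶ S.of (F₂.obj y),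
      S.pr φ = 𝟙 U ∧ ∀ κ : Over ι y, F₁.map κ.2.2 ≫ φ = η κ.2.1 ≫ F₂.map κ.2.2 := by
    intro U y
    refine hS.exists_glue (x := F₁.obj y) (y := F₂.obj y) (𝟙 U) (fun κ : Over ι y => F₁.map κ.2.2)
      (hcov F₁ y) (fun κ => η κ.2.1 ≫ F₂.map κ.2.2) (fun κ => by
        rw [pr_comp, pr_η, F₁.pr_map, F₂.pr_map]; simp) ?_
    rintro ⟨W, x, a⟩ ⟨W', x', a'⟩ T t s s' hs
    dsimp only at hs ⊢
    obtain ⟨x₀, ρ, hρ⟩ := lift_exists x (S.pr s)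
    obtain ⟨e, he, he'⟩ := factor_exists (F₁.map (ι.map ρ)) s (𝟙 T) (by
      rw [F₁.pr_map, ι.pr_map, hρ]; simp)
    have hpr := congrArg S.pr hs
    rw [pr_comp, pr_comp, F₁.pr_map, F₁.pr_map] at hpr
    obtain ⟨c, hc, hc'⟩ := factor_exists a' (ι.map ρ ≫ a) (S.pr s') (by
      rw [pr_comp, ι.pr_map, hρ, hpr])
    have h₁ : e ≫ F₁.map c = s' := by
      refine factor_unique (F₁.map a') ?_ (by rw [pr_comp, he', F₁.pr_map, hc', Category.id_comp])
      rw [Category.assoc, ← F₁.map_comp, hc, F₁.map_comp, ← Category.assoc, he, hs]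
    rw [← h₁, ← he, Category.assoc, Category.assoc, ← Category.assoc (F₁.map _), nat,
      ← Category.assoc (F₁.map c), nat, Category.assoc, Category.assoc, ← F₂.map_comp,
      ← F₂.map_comp, hc]
  choose φ hφ hφ' using @ex
  have uni : ∀ {U V : Man.{u}} {y : Q.Ob U} {z : S.Ob V} {ψ ψ' : S.of (F₁.obj y) ⟶ S.of z},
      S.pr ψ = S.pr ψ' → (∀ κ : Over ι y, F₁.map κ.2.2 ≫ ψ = F₁.map κ.2.2 ≫ ψ') → ψ = ψ' :=
    fun {U V y z ψ ψ'} e H => hS.hom_ext e (fun κ : Over ι y => F₁.map κ.2.2) (hcov F₁ y) H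
  refine ⟨{ app := fun y => φ y, pr_app := fun y => hφ y, naturality := ?_ }, ?_, ?_⟩
  · intro U V y y' a
    refine uni (by rw [pr_comp, pr_comp, hφ, hφ, F₁.pr_map, F₂.pr_map]; simp) fun κ => ?_
    rw [← Category.assoc, ← Category.assoc, ← F₁.map_comp, hφ' y' ⟨_, _, κ.2.2 ≫ a⟩, hφ',
      F₂.map_comp, Category.assoc]
  · intro U x
    have := hφ' (ι.obj x) ⟨U, x, 𝟙 _⟩
    simpa [F₁.map_id, F₂.map_id] using this
  · intro η' hη'
    ext U y
    refine uni (by rw [η'.pr_app, hφ]) fun κ => ?_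
    rw [hφ', η'.naturality, hη']

end Mor.LocEquiv

/-- The identity 2-morphism. -/
def TwoMor.refl {X : CFG.{w, u}} {Y : CFG.{w', u}} (F : Mor X Y) : TwoMor F F where
  app _ := 𝟙 _
  pr_app _ := Y.pr_id _
  naturality a := by simp

/-- The composition of 2-morphisms. -/
def TwoMor.trans {X : CFG.{w, u}} {Y : CFG.{w', u}} {F F' F'' : Mor X Y} (η : TwoMor F F')
    (η' : TwoMor F' F'') : TwoMor F F'' where
  app x := η.app x ≫ η'.app x
  pr_app x := by rw [pr_comp, η.pr_app, η'.pr_app]; simp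
  naturality a := by rw [← Category.assoc, η.naturality, Category.assoc, η'.naturality,
    Category.assoc]

instance TwoMor.isIso_app {X : CFG.{w, u}} {Y : CFG.{w', u}} {F F' : Mor X Y} (η : TwoMor F F')
    {U : Man.{u}} (x : X.Ob U) : IsIso (η.app x) := isIso_of_pr _ (η.pr_app x)

theorem pr_isIso_inv {X : CFG.{w, u}} {U : Man.{u}} {x x' : X.Ob U} (a : X.of x ⟶ X.of x')
    [IsIso a] (h : X.pr a = 𝟙 U) : X.pr (inv a) = 𝟙 U := pr_inv (asIso a) h

/-- The inverse of a 2-morphism. -/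
def TwoMor.symm {X : CFG.{w, u}} {Y : CFG.{w', u}} {F F' : Mor X Y} (η : TwoMor F F') :
    TwoMor F' F where
  app x := inv (η.app x)
  pr_app x := pr_isIso_inv _ (η.pr_app x)
  naturality a := by rw [IsIso.comp_inv_eq, Category.assoc, IsIso.eq_inv_comp, η.naturality]

theorem TwoMor.eq_comp_symm_app {X : CFG.{w, u}} {Y : CFG.{w', u}} {F F' : Mor X Y}
    (η : TwoMor F F') (x : X.Ob U) {z : Y.Ob V} {a : Y.of z ⟶ Y.of (F.obj x)}
    {b : Y.of z ⟶ Y.of (F'.obj x)} (h : a ≫ η.app x = b) : a = b ≫ η.symm.app x :=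
  (IsIso.eq_comp_inv (η.app x)).2 h

theorem TwoMor.symm_app_app {X : CFG.{w, u}} {Y : CFG.{w', u}} {F F' : Mor X Y}
    (η : TwoMor F F') (x : X.Ob U) : η.symm.app x ≫ η.app x = 𝟙 _ :=
  IsIso.inv_hom_id (η.app x)

/-- Local equivalences to stacks are stackifications. -/
theorem Mor.LocEquiv.isStackification {ι : Mor P Q} (h : ι.LocEquiv) (hQ : Q.IsStack) :
    IsStackification ι := by
  refine ⟨hQ, fun S hS F => h.exists_extension hS F, ?_⟩
  intro S hS F₁ F₂ η F₁' F₂' ζ₁ ζ₂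
  let τ := (ζ₁.trans η).trans ζ₂.symm
  obtain ⟨η', h₁, h₂⟩ := h.existsUnique_twoMor hS.1 (F₁ := F₁') (F₂ := F₂') (fun x => τ.app x)
    (fun x => τ.pr_app x) (fun a => τ.naturality a)
  refine ⟨η', ?_, ?_⟩
  · intro U x
    rw [h₁]
    exact (Category.assoc _ _ _).trans ((congrArg (_ ≫ ·) (ζ₂.symm_app_app x)).trans
      (Category.comp_id _))
  · intro η'' h''
    refine h₂ _ fun {U} x => ?_
    exact TwoMor.eq_comp_symm_app ζ₂ x (h'' x)

end CFG

end StackyQuotient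

end

noncomputable section

universe w w' k

namespace StackyQuotient

namespace CFG

/-! ### Torsors -/

/-- A torsor over `U` describes an object of the stackification by the arrows to it from the
objects of `P`. -/
structure Torsor (P : CFG.{max u v, u}) (U : Man.{u}) where
  el : ∀ {T : Man.{u}}, P.Ob T → Type (max (u + 1) v)
  pr : ∀ {T : Man.{u}} {t : P.Ob T}, el t → (T ⟶ U)
  act : ∀ {T T' : Man.{u}} {t : P.Ob T} {t' : P.Ob T'}, (P.of t' ⟶ P.of t) → el t → el t'
  pr_act : ∀ {T T' : Man.{u}} {t : P.Ob T} {t' : P.Ob T'} (c : P.of t' ⟶ P.of t) (e : el t),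
    pr (act c e) = P.pr c ≫ pr e
  id_act : ∀ {T : Man.{u}} {t : P.Ob T} (e : el t), act (𝟙 _) e = e
  comp_act : ∀ {T T' T'' : Man.{u}} {t : P.Ob T} {t' : P.Ob T'} {t'' : P.Ob T''}
    (b : P.of t'' ⟶ P.of t') (c : P.of t' ⟶ P.of t) (e : el t), act (b ≫ c) e = act b (act c e)
  loc : ∃ C ∈ Man.topology U, ∀ {W : Man.{u}} (f : W ⟶ U), C f →
    ∃ (t : P.Ob W) (e : el t), pr e = f
  factor : ∀ {T T' : Man.{u}} {t : P.Ob T} {t' : P.Ob T'} (e : el t) (e' : el t') (g : T' ⟶ T),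
    g ≫ pr e = pr e' → ∃ c : P.of t' ⟶ P.of t, P.pr c = g ∧ act c e = e'
  act_inj : ∀ {T T' : Man.{u}} {t : P.Ob T} {t' : P.Ob T'} {c c' : P.of t' ⟶ P.of t} (e : el t),
    P.pr c = P.pr c' → act c e = act c' e → c = c'
  glue : ∀ {T : Man.{u}} (t : P.Ob T) (g : T ⟶ U), ∀ C ∈ Man.topology T,
    ∀ ψ : ∀ {Z : Man.{u}} (z : P.Ob Z) (r : P.of z ⟶ P.of t), C (P.pr r) → el z,
    (∀ {Z : Man.{u}} (z : P.Ob Z) (r : P.of z ⟶ P.of t) (h : C (P.pr r)),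
      pr (ψ z r h) = P.pr r ≫ g) →
    (∀ {Z : Man.{u}} (z : P.Ob Z) (r : P.of z ⟶ P.of t) (h : C (P.pr r)) {Z' : Man.{u}}
      (z' : P.Ob Z') (s : P.of z' ⟶ P.of z) (h' : C (P.pr (s ≫ r))),
      ψ z' (s ≫ r) h' = act s (ψ z r h)) →
    ∃ e : el t, pr e = g ∧ ∀ {Z : Man.{u}} (z : P.Ob Z) (r : P.of z ⟶ P.of t) (h : C (P.pr r)),
      act r e = ψ z r h

namespace Torsor

variable {P : CFG.{max u v, u}} {U V W T : Man.{u}}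

/-- The torsor of an object. -/
def yoneda (hP : P.IsPrestack) (x : P.Ob U) : Torsor.{v} P U where
  el t := ULift.{u + 1} (P.of t ⟶ P.of x)
  pr e := P.pr e.down
  act c e := ⟨c ≫ e.down⟩
  pr_act c e := pr_comp _ _
  id_act e := ULift.ext _ _ (Category.id_comp _)
  comp_act b c e := ULift.ext _ _ (Category.assoc _ _ _)
  loc := ⟨⊤, Man.topology.top_mem U, fun f _ => by
    obtain ⟨t, a, ha⟩ := lift_exists x f
    exact ⟨t, ⟨a⟩, ha⟩⟩
  factor e e' g h := by
    obtain ⟨c, hc, hc'⟩ := factor_exists e.down e'.down g h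
    exact ⟨c, hc', ULift.ext _ _ hc⟩
  act_inj e h h' := factor_unique e.down (congrArg ULift.down h') h
  glue := by
    intro T t g C hC ψ h₁ h₂
    obtain ⟨φ, hφ, hφ'⟩ := hP.exists_glue (x := t) (y := x) g
      (K := Σ (Z : Man.{u}) (z : P.Ob Z), { r : P.of z ⟶ P.of t // C (P.pr r) })
      (fun κ => κ.2.2.1) (by
        refine Man.covering_of_mem hC ?_
        intro Z f hf
        obtain ⟨z, r, hr⟩ := lift_exists t f
        exact ⟨⟨Z, z, r, by rwa [hr]⟩, 𝟙 _, by rw [Category.id_comp]; exact hr⟩)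
      (fun κ => (ψ κ.2.1 κ.2.2.1 κ.2.2.2).down) (fun κ => h₁ _ _ _) (by
        rintro ⟨Z, z, r, hr⟩ ⟨Z', z', r', hr'⟩ A a s s' h
        dsimp only at h ⊢
        have m : C (P.pr (s ≫ r)) := by rw [pr_comp]; exact C.downward_closed hr _
        have m' : C (P.pr (s' ≫ r')) := by rw [pr_comp]; exact C.downward_closed hr' _
        have e₁ := h₂ z r hr a s m
        have e₂ := h₂ z' r' hr' a s' m'
        have e₃ : ∀ (q q' : P.of a ⟶ P.of t) (h : C (P.pr q)) (h' : C (P.pr q')), q = q' →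
            ψ a q h = ψ a q' h' := by rintro q _ _ _ rfl; rfl
        exact congrArg ULift.down (e₁.symm.trans ((e₃ _ _ m m' h).trans e₂)))
    exact ⟨⟨φ⟩, hφ, fun z r h => ULift.ext _ _ (hφ' ⟨_, z, r, h⟩)⟩

theorem ext (hP : P.IsPrestack) (E : Torsor.{v} P U) {t : P.Ob T} {e e' : E.el t}
    (hp : E.pr e = E.pr e') {C : Sieve T} (hC : C ∈ Man.topology T)
    (h : ∀ {Z : Man.{u}} (z : P.Ob Z) (r : P.of z ⟶ P.of t), C (P.pr r) → E.act r e = E.act r e') :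
    e = e' := by
  obtain ⟨c, hc, rfl⟩ := E.factor e' e (𝟙 _) (by rw [hp]; simp)
  suffices c = 𝟙 _ by rw [this, E.id_act]
  refine hP.hom_ext_sieve (by rw [hc, pr_id]) hC ?_
  intro Z z r hr
  refine E.act_inj e' (by rw [pr_comp, hc, pr_comp, pr_id]) ?_
  rw [E.comp_act, Category.comp_id, h z r hr]

/-- Gluing of elements described by a relation. -/
theorem exists_of_rel (hP : P.IsPrestack) (E : Torsor.{v} P U) (t : P.Ob T) (g : T ⟶ U)
    (R : ∀ {Z : Man.{u}} (z : P.Ob Z), (P.of z ⟶ P.of t) → E.el z → Prop)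
    (hR : ∀ {Z : Man.{u}} (z : P.Ob Z) (r : P.of z ⟶ P.of t) (e : E.el z), R z r e →
      E.pr e = P.pr r ≫ g)
    (uniq : ∀ {Z : Man.{u}} (z : P.Ob Z) (r : P.of z ⟶ P.of t) (e e' : E.el z), R z r e →
      R z r e' → e = e')
    (res : ∀ {Z Z' : Man.{u}} (z : P.Ob Z) (z' : P.Ob Z') (s : P.of z' ⟶ P.of z)
      (r : P.of z ⟶ P.of t) (e : E.el z), R z r e → R z' (s ≫ r) (E.act s e))
    {C : Sieve T} (hC : C ∈ Man.topology T)
    (ex : ∀ {Z : Man.{u}} (z : P.Ob Z) (r : P.of z ⟶ P.of t), C (P.pr r) → ∃ e : E.el z, R z r e) :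
    ∃ e : E.el t, E.pr e = g ∧ ∀ {Z : Man.{u}} (z : P.Ob Z) (r : P.of z ⟶ P.of t) (e' : E.el z),
      R z r e' → E.act r e = e' := by
  obtain ⟨e, he, he'⟩ := E.glue t g C hC (fun z r h => (ex z r h).choose)
    (fun z r h => hR z r _ (ex z r h).choose_spec)
    (fun {_} z r h {_} z' s h' => uniq _ _ _ _ (ex z' (s ≫ r) h').choose_spec
      (res z z' s r _ (ex z r h).choose_spec))
  refine ⟨e, he, fun {Z} z r e' h => ?_⟩
  refine E.ext hP (by rw [E.pr_act, he, hR z r e' h]) (Man.topology.pullback_stable (P.pr r) hC) ?_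
  intro Z' z' s hs
  have hs' : C (P.pr (s ≫ r)) := by rw [pr_comp]; exact hs
  rw [← E.comp_act, he' z' (s ≫ r) hs']
  exact uniq _ _ _ _ (ex z' (s ≫ r) hs').choose_spec (res z z' s r _ h)

/-- Morphisms of torsors. -/
@[ext] structure Hom (E : Torsor.{v} P U) (E' : Torsor.{v} P V) where
  base : U ⟶ V
  map : ∀ {T : Man.{u}} {t : P.Ob T}, E.el t → E'.el t
  pr_map : ∀ {T : Man.{u}} {t : P.Ob T} (e : E.el t), E'.pr (map e) = E.pr e ≫ base
  map_act : ∀ {T T' : Man.{u}} {t : P.Ob T} {t' : P.Ob T'} (c : P.of t' ⟶ P.of t) (e : E.el t),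
    map (E.act c e) = E'.act c (map e)

/-- The identity. -/
def Hom.id (E : Torsor.{v} P U) : Hom E E := ⟨𝟙 _, fun e => e, fun _ => rfl, fun _ _ => rfl⟩

/-- The composition. -/
def Hom.comp {E : Torsor.{v} P U} {E' : Torsor.{v} P V} {E'' : Torsor.{v} P W} (η : Hom E E')
    (η' : Hom E' E'') : Hom E E'' :=
  ⟨η.base ≫ η'.base, fun e => η'.map (η.map e), fun e => by
    rw [η'.pr_map, η.pr_map, Category.assoc], fun c e => by rw [η.map_act, η'.map_act]⟩

variable {E : Torsor.{v} P U} {E' : Torsor.{v} P V}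

/-- Morphisms described by a relation. -/
theorem exists_hom (hP : P.IsPrestack) (f : U ⟶ V)
    (R : ∀ {T : Man.{u}} {t : P.Ob T}, E.el t → E'.el t → Prop)
    (hR : ∀ {T : Man.{u}} {t : P.Ob T} {e : E.el t} {e' : E'.el t}, R e e' →
      E'.pr e' = E.pr e ≫ f)
    (uniq : ∀ {T : Man.{u}} {t : P.Ob T} {e : E.el t} {e' e'' : E'.el t}, R e e' → R e e'' →
      e' = e'')
    (res : ∀ {T T' : Man.{u}} {t : P.Ob T} {t' : P.Ob T'} (c : P.of t' ⟶ P.of t) {e : E.el t}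
      {e' : E'.el t}, R e e' → R (E.act c e) (E'.act c e'))
    (ex : ∀ {T : Man.{u}} {t : P.Ob T} (e : E.el t), ∃ C ∈ Man.topology T, ∀ {Z : Man.{u}}
      (z : P.Ob Z) (r : P.of z ⟶ P.of t), C (P.pr r) → ∃ e' : E'.el z, R (E.act r e) e') :
    ∃ η : Hom E E', η.base = f ∧ ∀ {T : Man.{u}} {t : P.Ob T} {e : E.el t} {e' : E'.el t},
      R e e' → η.map e = e' := by
  have key : ∀ {T : Man.{u}} {t : P.Ob T} (e : E.el t), ∃ e' : E'.el t, E'.pr e' = E.pr e ≫ f ∧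
      ∀ {Z : Man.{u}} (z : P.Ob Z) (r : P.of z ⟶ P.of t) (e'' : E'.el z), R (E.act r e) e'' →
      E'.act r e' = e'' := by
    intro T t e
    obtain ⟨C, hC, hh⟩ := ex e
    refine E'.exists_of_rel hP t _ (fun z r e' => R (E.act r e) e') ?_ ?_ ?_ hC hh
    · intro Z z r e' h
      rw [hR h, E.pr_act, Category.assoc]
    · intro Z z r e' e'' h h'
      exact uniq h h'
    · intro Z Z' z z' s r e' h
      rw [E.comp_act]
      exact res s h
  choose m hm hm' using @key
  refine ⟨⟨f, fun e => m e, fun e => hm e, ?_⟩, rfl, ?_⟩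
  · intro T T' t t' c e
    obtain ⟨C, hC, hh⟩ := ex (E.act c e)
    refine E'.ext hP (by rw [hm, E'.pr_act, hm, E.pr_act, Category.assoc]) hC ?_
    intro Z z r hr
    obtain ⟨e', he'⟩ := hh z r hr
    rw [hm' _ z r e' he', ← E'.comp_act, hm' e z (r ≫ c) e' (by rwa [E.comp_act])]
  · intro T t e e' h
    have := hm' e t (𝟙 _) e' (by rwa [E.id_act])
    rwa [E'.id_act] at this

theorem hom_ext_of_loc (hP : P.IsPrestack) {η η' : Hom E E'} (hb : η.base = η'.base)
    (h : ∀ {T : Man.{u}} {t : P.Ob T} (e : E.el t), ∃ C ∈ Man.topology T, ∀ {Z : Man.{u}}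
      (z : P.Ob Z) (r : P.of z ⟶ P.of t), C (P.pr r) → η.map (E.act r e) = η'.map (E.act r e)) :
    η = η' := by
  apply Hom.ext hb
  funext T t e
  obtain ⟨C, hC, hh⟩ := h e
  refine E'.ext hP (by rw [η.pr_map, η'.pr_map, hb]) hC ?_
  intro Z z r hr
  rw [← η.map_act, ← η'.map_act, hh z r hr]

theorem hom_ext_of_covering (hP : P.IsPrestack) {η η' : Hom E E'} (hb : η.base = η'.base)
    {K : Sort k} {W : K → Man.{u}} {x : ∀ i, P.Ob (W i)} (e : ∀ i, E.el (x i))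
    (he : Man.Covering fun i => E.pr (e i)) (h : ∀ i, η.map (e i) = η'.map (e i)) : η = η' := by
  refine hom_ext_of_loc hP hb fun {T t} e₀ => ⟨_, Man.Covering.pullback he (E.pr e₀), ?_⟩
  rintro Z z r ⟨i, g, hg⟩
  obtain ⟨c, -, hc⟩ := E.factor (e i) (E.act r e₀) g (by rw [hg, E.pr_act])
  rw [← hc, η.map_act, η'.map_act, h]

theorem Hom.existsUnique_preimage (hP : P.IsPrestack) (η : Hom E E') {t : P.Ob T} (e' : E'.el t)
    (g : T ⟶ U) (h : g ≫ η.base = E'.pr e') : ∃! e : E.el t, E.pr e = g ∧ η.map e = e' := by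
  have uniq : ∀ {T : Man.{u}} {t : P.Ob T} {e₁ e₂ : E.el t}, E.pr e₁ = E.pr e₂ →
      η.map e₁ = η.map e₂ → e₁ = e₂ := by
    intro T t e₁ e₂ h₁ h₂
    obtain ⟨c, hc, rfl⟩ := E.factor e₂ e₁ (𝟙 _) (by rw [h₁]; simp)
    rw [η.map_act] at h₂
    rw [E'.act_inj (c := c) (c' := 𝟙 _) (η.map e₂) (by rw [hc, pr_id]) (by rw [h₂, E'.id_act]),
      E.id_act]
  obtain ⟨C, hC, hh⟩ := E.loc
  obtain ⟨e, he, he'⟩ := E.exists_of_rel hP t g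
    (fun z r e => E.pr e = P.pr r ≫ g ∧ η.map e = E'.act r e') (fun z r e h => h.1)
    (fun z r e e'' h₁ h₂ => uniq (h₁.1.trans h₂.1.symm) (h₁.2.trans h₂.2.symm))
    (fun z z' s r e h => ⟨by rw [E.pr_act, h.1, pr_comp, Category.assoc], by
      rw [η.map_act, h.2, E'.comp_act]⟩)
    (Man.topology.pullback_stable g hC) (by
      intro Z z r hr
      obtain ⟨t₀, e₀, he₀⟩ := hh (P.pr r ≫ g) hr
      obtain ⟨c, hc, hc'⟩ := E'.factor (η.map e₀) (E'.act r e') (𝟙 _) (by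
        rw [η.pr_map, he₀, E'.pr_act, ← h]; simp)
      exact ⟨E.act c e₀, by rw [E.pr_act, hc, he₀, Category.id_comp], by rw [η.map_act, hc']⟩)
  refine ⟨e, ⟨he, ?_⟩, fun e₂ h₂ => ?_⟩
  · refine E'.ext hP (by rw [η.pr_map, he, h]) (Man.topology.pullback_stable g hC) ?_
    intro Z z r hr
    obtain ⟨t₀, e₀, he₀⟩ := hh (P.pr r ≫ g) hr
    obtain ⟨c, hc, hc'⟩ := E'.factor (η.map e₀) (E'.act r e') (𝟙 _) (by
        rw [η.pr_map, he₀, E'.pr_act, ← h]; simp)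
    have := he' z r (E.act c e₀) ⟨by rw [E.pr_act, hc, he₀, Category.id_comp], by
      rw [η.map_act, hc']⟩
    rw [← η.map_act, this, η.map_act, hc']
  · have := he' t (𝟙 _) e₂ ⟨by rw [h₂.1, pr_id]; simp, by rw [h₂.2, E'.id_act]⟩
    rw [← this, E.id_act]

theorem exists_hom_of_el
    {x : P.Ob U} (a : E.el x) (ha : E.pr a = 𝟙 U) (e : E'.el x) :
    ∃ η : Hom E E', η.base = E'.pr e ∧ η.map a = e := by
  have hf : ∀ {T : Man.{u}} {t : P.Ob T} (e₀ : E.el t), ∃ c : P.of t ⟶ P.of x,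
      P.pr c = E.pr e₀ ∧ E.act c a = e₀ := fun e₀ => E.factor a e₀ (E.pr e₀) (by rw [ha]; simp)
  choose c hc hc' using @hf
  have hu : ∀ {T : Man.{u}} {t : P.Ob T} (d : P.of t ⟶ P.of x), c (E.act d a) = d := by
    intro T t d
    exact E.act_inj a (by rw [hc, E.pr_act, ha, Category.comp_id]) (hc' _)
  refine ⟨⟨E'.pr e, fun e₀ => E'.act (c e₀) e, fun e₀ => by rw [E'.pr_act, hc], ?_⟩, rfl, ?_⟩
  · intro T T' t t' d e₀
    rw [← E'.comp_act, ← hu (d ≫ c e₀), E.comp_act, hc']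
  · have := hu (𝟙 (P.of x))
    rw [E.id_act] at this
    change E'.act (c a) e = e
    rw [this, E'.id_act]

/-- The pull-back of a torsor. -/
def pullback (E : Torsor.{v} P V) (f : U ⟶ V) : Torsor.{v} P U where
  el {T} t := { p : E.el t × (T ⟶ U) // E.pr p.1 = p.2 ≫ f }
  pr e := e.1.2
  act c e := ⟨(E.act c e.1.1, P.pr c ≫ e.1.2), by rw [E.pr_act, e.2, Category.assoc]⟩
  pr_act c e := rfl
  id_act e := Subtype.ext (Prod.ext (E.id_act _) (by
    change P.pr (𝟙 _) ≫ _ = _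
    rw [pr_id, Category.id_comp]))
  comp_act b c e := Subtype.ext (Prod.ext (E.comp_act _ _ _) (by
    change P.pr (_ ≫ _) ≫ _ = _
    rw [pr_comp, Category.assoc]))
  loc := by
    obtain ⟨C, hC, h⟩ := E.loc
    refine ⟨_, Man.topology.pullback_stable f hC, fun g hg => ?_⟩
    obtain ⟨t, e, he⟩ := h (g ≫ f) hg
    exact ⟨t, ⟨(e, g), he⟩, rfl⟩
  factor e e' g h := by
    obtain ⟨c, hc, hc'⟩ := E.factor e.1.1 e'.1.1 g (by
      rw [e.2, e'.2, ← Category.assoc]; exact congrArg (· ≫ f) h)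
    exact ⟨c, hc, Subtype.ext (Prod.ext hc' (by rw [← h, ← hc]))⟩
  act_inj e h h' := E.act_inj e.1.1 h (congrArg (fun p => p.1.1) h')
  glue := by
    intro T t g C hC ψ h₁ h₂
    obtain ⟨e, he, he'⟩ := E.glue t (g ≫ f) C hC (fun z r h => (ψ z r h).1.1) (fun z r h => by
      rw [(ψ z r h).2, ← Category.assoc]; exact congrArg (· ≫ f) (h₁ z r h))
      (fun {_} z r h {_} z' s h' => congrArg (fun p => p.1.1) (h₂ z r h z' s h'))
    exact ⟨⟨(e, g), he⟩, rfl, fun z r h => Subtype.ext (Prod.ext (he' z r h) (h₁ z r h).symm)⟩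

/-- The projection from the pull-back. -/
def pullbackHom (E : Torsor.{v} P V) (f : U ⟶ V) : Hom (E.pullback f) E :=
  ⟨f, fun e => e.1.1, fun e => e.2, fun _ _ => rfl⟩

end Torsor

end CFG

end StackyQuotient

end

noncomputable section

universe w w' k

namespace StackyQuotient

namespace CFG

namespace Torsor

variable {P : CFG.{max u v, u}} {U V W T : Man.{u}}

/-- Morphisms of torsors are cartesian. -/
theorem Hom.existsUnique_factor (hP : P.IsPrestack) {E : Torsor.{v} P U} {E' : Torsor.{v} P V}
    {E'' : Torsor.{v} P W} (η : Hom E E') (ζ : Hom E'' E') (g : W ⟶ U) (h : g ≫ η.base = ζ.base) :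
    ∃! ξ : Hom E'' E, ξ.comp η = ζ ∧ ξ.base = g := by
  have key := fun {T : Man.{u}} {t : P.Ob T} (e : E''.el t) =>
    η.existsUnique_preimage hP (ζ.map e) (E''.pr e ≫ g) (by rw [ζ.pr_map, Category.assoc, h])
  refine ⟨⟨g, fun e => (key e).choose, fun e => (key e).choose_spec.1.1, ?_⟩, ⟨?_, rfl⟩, ?_⟩
  · intro T T' t t' c e
    refine ((key (E''.act c e)).choose_spec.2 _ ⟨?_, ?_⟩).symm
    · rw [E.pr_act, (key e).choose_spec.1.1, E''.pr_act, Category.assoc]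
    · rw [η.map_act, (key e).choose_spec.1.2, ζ.map_act]
  · refine Hom.ext h ?_
    funext T t e
    exact (key e).choose_spec.1.2
  · rintro ξ ⟨rfl, rfl⟩
    refine Hom.ext rfl ?_
    funext T t e
    exact (key e).choose_spec.2 _ ⟨ξ.pr_map e, rfl⟩

theorem Hom.exists_inv (hP : P.IsPrestack) {E E' : Torsor.{v} P U} (η : Hom E E')
    (h : η.base = 𝟙 U) : ∃ η' : Hom E' E, η'.base = 𝟙 U ∧ η'.comp η = Hom.id E' ∧
      η.comp η' = Hom.id E := by
  obtain ⟨η', ⟨h₁, h₂⟩, -⟩ := η.existsUnique_factor hP (Hom.id E') (𝟙 U) (by rw [h]; rfl)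
  refine ⟨η', h₂, h₁, ?_⟩
  refine (η.existsUnique_factor hP η (𝟙 U) (Category.id_comp _)).unique ⟨?_, ?_⟩ ⟨rfl, rfl⟩
  · have : (η.comp η').comp η = η.comp (η'.comp η) :=
      Hom.ext (Category.assoc _ _ _) rfl
    rw [this, h₁]
    exact Hom.ext (Category.comp_id _) rfl
  · change η.base ≫ η'.base = _
    rw [h, h₂, Category.comp_id]

/-- Isomorphism of torsors. -/
def isoSetoid (hP : P.IsPrestack) (U : Man.{u}) : Setoid (Torsor.{v} P U) where
  r E E' := ∃ η : Hom E E', η.base = 𝟙 U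
  iseqv :=
    { refl := fun E => ⟨Hom.id E, rfl⟩
      symm := fun ⟨η, h⟩ => (η.exists_inv hP h).imp fun _ h => h.1
      trans := fun ⟨η, h⟩ ⟨η', h'⟩ => ⟨η.comp η', by
        change η.base ≫ η'.base = _
        rw [h, h', Category.comp_id]⟩ }

/-- A local description of a torsor. -/
structure Chart (P : CFG.{max u v, u}) (U : Man.{u}) : Type (max u v) where
  O : U.carrier → Opens U.carrier
  x : ∀ z, P.Ob (U.restrict (O z))
  rel : ∀ (z z' : U.carrier) (V : Opens U.carrier) (t : P.Ob (U.restrict V)),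
    (P.of t ⟶ P.of (x z)) → (P.of t ⟶ P.of (x z')) → Prop

/-- The description of a torsor by a chart. -/
def IsChart (E : Torsor.{v} P U) (D : Chart.{v} P U) : Prop :=
  ∃ e : ∀ z, E.el (D.x z), (∀ z, z ∈ D.O z) ∧ (∀ z, E.pr (e z) = Man.incl (D.O z)) ∧
    ∀ z z' V t a b, D.rel z z' V t a b ↔ E.act a (e z) = E.act b (e z')

theorem exists_isChart (E : Torsor.{v} P U) : ∃ D : Chart.{v} P U, E.IsChart D := by
  obtain ⟨C, hC, hh⟩ := E.loc
  choose O hO hS using hC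
  choose x e he using fun z => hh _ (hS z)
  exact ⟨⟨O, x, fun z z' V t a b => E.act a (e z) = E.act b (e z')⟩, e, hO, he,
    fun _ _ _ _ _ _ => Iff.rfl⟩

theorem covering_of_incl {O : U.carrier → Opens U.carrier} (hO : ∀ z, z ∈ O z) :
    Man.Covering fun z => Man.incl (O z) := fun z => ⟨O z, hO z, z, 𝟙 _, rfl⟩

theorem exists_hom_of_isChart (hP : P.IsPrestack) {E E' : Torsor.{v} P U} {D : Chart.{v} P U}
    (h : E.IsChart D) (h' : E'.IsChart D) : ∃ η : Hom E E', η.base = 𝟙 U := by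
  obtain ⟨e, hO, he, hR⟩ := h
  obtain ⟨e', -, he', hR'⟩ := h'
  have key : ∀ {Z : Man.{u}} {t : P.Ob Z} (i j : U.carrier) (a : P.of t ⟶ P.of (D.x i))
      (b : P.of t ⟶ P.of (D.x j)), E.act a (e i) = E.act b (e j) →
      E'.act a (e' i) = E'.act b (e' j) := by
    intro Z t i j a b h
    have hp := congrArg E.pr h
    rw [E.pr_act, E.pr_act, he, he] at hp
    obtain ⟨t₀, a₀, ha₀⟩ := lift_exists (D.x i) (Man.inclLE (inf_le_left : D.O i ⊓ D.O j ≤ D.O i))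
    obtain ⟨b₀, hb₀, hb₀'⟩ := E.factor (e j) (E.act a₀ (e i))
      (Man.inclLE (inf_le_right : D.O i ⊓ D.O j ≤ D.O j)) (by rw [he, E.pr_act, ha₀, he]; rfl)
    obtain ⟨c, rfl, -⟩ := factor_exists a₀ a (Man.lift _ (P.pr a ≫ Man.incl (D.O i)) fun z =>
      ⟨Man.mem_of_incl (P.pr a) rfl z, Man.mem_of_incl (P.pr b) hp.symm z⟩) (by
        rw [ha₀]; exact Man.incl_cancel rfl)
    have hb : c ≫ b₀ = b := by
      refine E.act_inj (e j) ?_ ?_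
      · refine Man.incl_cancel ?_
        rw [← hp, pr_comp, pr_comp, hb₀, ha₀]
        rfl
      · rw [← h, E.comp_act, E.comp_act, hb₀']
    rw [← hb, E'.comp_act, E'.comp_act, (hR' _ _ _ _ _ _).1 ((hR _ _ _ _ _ _).2 hb₀'.symm)]
  obtain ⟨η, hη, -⟩ := exists_hom (E := E) (E' := E') hP (𝟙 U)
    (fun {T t} e₁ e₂ => ∃ (i : U.carrier) (a : P.of t ⟶ P.of (D.x i)),
      e₁ = E.act a (e i) ∧ e₂ = E'.act a (e' i)) (by
      rintro T t _ _ ⟨i, a, rfl, rfl⟩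
      rw [E.pr_act, E'.pr_act, he, he', Category.comp_id]) (by
      rintro T t _ _ _ ⟨i, a, rfl, rfl⟩ ⟨j, b, h, rfl⟩
      exact key i j a b h) (by
      rintro T T' t t' c _ _ ⟨i, a, rfl, rfl⟩
      exact ⟨i, c ≫ a, by rw [E.comp_act], by rw [E'.comp_act]⟩) (by
      intro T t e₁
      refine ⟨_, Man.Covering.pullback (covering_of_incl hO) (E.pr e₁), ?_⟩
      rintro Z z r ⟨i, g, hg⟩
      obtain ⟨a, -, ha⟩ := E.factor (e i) (E.act r e₁) g (by rw [he, hg, E.pr_act])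
      exact ⟨_, i, a, ha.symm, rfl⟩)
  exact ⟨η, hη⟩

instance small_quotient (hP : P.IsPrestack) (U : Man.{u}) :
    Small.{max u v} (Quotient (isoSetoid.{v} hP U)) := by
  refine small_of_injective (β := Chart.{v} P U) (f := fun q => q.out.exists_isChart.choose) ?_
  intro q q' h
  dsimp only at h
  have h₁ := q.out.exists_isChart.choose_spec
  rw [h] at h₁
  rw [← q.out_eq, ← q'.out_eq]
  exact Quotient.sound (exists_hom_of_isChart hP h₁ q'.out.exists_isChart.choose_spec)

theorem small_hom (hP : P.IsPrestack) (E : Torsor.{v} P U) (E' : Torsor.{v} P V) :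
    Small.{max u v} (Hom E E') := by
  obtain ⟨D, e, hO, he, -⟩ := E.exists_isChart
  by_cases hne : Nonempty (Hom E E')
  swap
  · exact small_of_injective (β := PEmpty) (f := fun η => (hne ⟨η⟩).elim)
      fun η => (hne ⟨η⟩).elim
  let η₀ : (U ⟶ V) → Hom E E' := fun f => Classical.epsilon fun η => η.base = f
  have hη₀ : ∀ η : Hom E E', (η₀ η.base).base = η.base := fun η =>
    Classical.epsilon_spec (p := fun η' : Hom E E' => η'.base = η.base) ⟨η, rfl⟩
  have key := fun (η : Hom E E') z => E'.factor ((η₀ η.base).map (e z)) (η.map (e z)) (𝟙 _)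
    (by rw [Hom.pr_map, Hom.pr_map, hη₀]; simp)
  choose c hc hc' using key
  refine small_of_injective (β := (U ⟶ V) × ∀ z, P.of (D.x z) ⟶ P.of (D.x z))
    (f := fun η => (η.base, fun z => c η z)) ?_
  intro η η' h
  obtain ⟨h₁, h₂⟩ := Prod.ext_iff.1 h
  dsimp only at h₁ h₂
  refine hom_ext_of_covering hP h₁ e ?_ ?_
  · simpa only [he] using covering_of_incl hO
  · intro z
    rw [← hc' η, ← hc' η', congrFun h₂ z, h₁]

end Torsor

/-! ### The stackification of a prestack -/

section stackify

open StackyQuotient.CFG.Torsor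

variable {P : CFG.{max u v, u}} (hP : P.IsPrestack) {U V W T : Man.{u}}

attribute [local instance] Torsor.small_quotient

/-- A representative of an isomorphism class of torsors. -/
def outTorsor (x : Shrink.{max u v} (Quotient (isoSetoid.{v} hP U))) : Torsor.{v} P U :=
  ((equivShrink _).symm x).out

theorem exists_outTorsor (E : Torsor.{v} P U) : ∃ x,
    ∃ η : Torsor.Hom E (outTorsor hP x), η.base = 𝟙 U := by
  refine ⟨equivShrink _ (Quotient.mk (isoSetoid.{v} hP U) E), ?_⟩
  have h : outTorsor hP (equivShrink _ (Quotient.mk (isoSetoid.{v} hP U) E)) =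
      (Quotient.mk (isoSetoid.{v} hP U) E).out := congrArg Quotient.out (Equiv.symm_apply_apply _ _)
  rw [h]
  exact (isoSetoid hP U).symm (Quotient.mk_out (s := isoSetoid.{v} hP U) E)

instance small_outTorsor_hom (x : Shrink.{max u v} (Quotient (isoSetoid.{v} hP U)))
    (y : Shrink.{max u v} (Quotient (isoSetoid.{v} hP V))) :
    Small.{max u v} (Torsor.Hom (outTorsor hP x) (outTorsor hP y)) := small_hom hP _ _

/-- The stackification of a prestack: its objects are the isomorphism classes of torsors. -/
def stackify : CFG.{max u v, u} where
  Ob U := Shrink.{max u v} (Quotient (isoSetoid.{v} hP U))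
  cat :=
    { Hom := fun x y => Shrink.{max u v} (Torsor.Hom (outTorsor hP x.pt) (outTorsor hP y.pt))
      id := fun x => equivShrink _ (Torsor.Hom.id _)
      comp := fun a b => equivShrink _ (((equivShrink _).symm a).comp ((equivShrink _).symm b))
      id_comp := fun a => by
        rw [Equiv.symm_apply_apply]
        exact (Equiv.apply_symm_apply _ a)
      comp_id := fun a => by
        rw [Equiv.symm_apply_apply]
        exact (Equiv.apply_symm_apply _ a)
      assoc := fun a b c => by
        rw [Equiv.symm_apply_apply, Equiv.symm_apply_apply]
        rfl }
  proj a := ((equivShrink _).symm a).base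
  proj_id x := by
    change ((equivShrink _).symm (equivShrink _ (Torsor.Hom.id _))).base = _
    rw [Equiv.symm_apply_apply]
    rfl
  proj_comp a b := by
    change ((equivShrink _).symm (equivShrink _
      (((equivShrink _).symm a).comp ((equivShrink _).symm b)))).base = _
    rw [Equiv.symm_apply_apply]
    rfl
  exists_lift := by
    rintro U ⟨V, y⟩ f
    obtain ⟨x, η, hη⟩ := exists_outTorsor hP ((outTorsor hP y).pullback f)
    obtain ⟨η', hη', -⟩ := η.exists_inv hP hη
    refine ⟨x, equivShrink _ (η'.comp (pullbackHom _ f)), ?_⟩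
    rw [Equiv.symm_apply_apply]
    change η'.base ≫ f = f
    rw [hη', Category.id_comp]
  cartesian := by
    rintro ⟨U, x⟩ ⟨V, y⟩ ⟨W, z⟩ a b g h
    obtain ⟨ξ, ⟨h₁, h₂⟩, h₃⟩ := ((equivShrink _).symm a).existsUnique_factor hP
      ((equivShrink _).symm b) g h
    refine ⟨equivShrink _ ξ, ⟨?_, ?_⟩, ?_⟩
    · change equivShrink _ (((equivShrink _).symm (equivShrink _ ξ)).comp
        ((equivShrink _).symm a)) = b
      rw [Equiv.symm_apply_apply, h₁]
      exact Equiv.apply_symm_apply _ b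
    · rw [Equiv.symm_apply_apply]
      exact h₂
    · rintro c ⟨hc, hc'⟩
      rw [← h₃ ((equivShrink _).symm c) ⟨?_, hc'⟩]
      · exact (Equiv.apply_symm_apply _ c).symm
      · rw [← hc]
        exact (Equiv.symm_apply_apply _ _).symm

/-- The torsor of an object of the stackification. -/
def rep (x : (stackify hP).Ob U) : Torsor.{v} P U := outTorsor hP x

theorem exists_rep (E : Torsor.{v} P U) : ∃ (x : (stackify hP).Ob U) (η : Torsor.Hom E (rep hP x)),
    η.base = 𝟙 U := exists_outTorsor hP E

variable {hP} {x : (stackify hP).Ob U} {y : (stackify hP).Ob V} {z : (stackify hP).Ob W}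

/-- The arrows of the stackification are the morphisms of torsors. -/
def torsorHom : ((stackify hP).of x ⟶ (stackify hP).of y) ≃ Torsor.Hom (rep hP x) (rep hP y) :=
  (equivShrink _).symm

theorem torsorHom_id (x : (stackify hP).Ob U) :
    torsorHom (𝟙 ((stackify hP).of x)) = Torsor.Hom.id _ :=
  (@equivShrink.{max u v, max (u + 1) v} _ (small_hom hP (rep hP x) (rep hP x))).symm_apply_apply _

theorem torsorHom_comp (a : (stackify hP).of x ⟶ (stackify hP).of y)
    (b : (stackify hP).of y ⟶ (stackify hP).of z) :
    torsorHom (a ≫ b) = (torsorHom a).comp (torsorHom b) :=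
  (@equivShrink.{max u v, max (u + 1) v} _ (small_hom hP (rep hP x) (rep hP z))).symm_apply_apply _

theorem torsorHom_base (a : (stackify hP).of x ⟶ (stackify hP).of y) :
    (torsorHom a).base = (stackify hP).pr a := rfl

end stackify

end CFG

end StackyQuotient

end

noncomputable section

universe w w' k

namespace StackyQuotient

namespace CFG

section stackify

variable {P : CFG.{max u v, u}} (hP : P.IsPrestack) {U V W T : Man.{u}}

/-- The object of the stackification which corresponds to an object. -/
def stackOb (t : P.Ob T) : (stackify hP).Ob T := (exists_rep hP (Torsor.yoneda hP t)).choose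

/-- The universal element. -/
def univ (t : P.Ob T) : (rep hP (stackOb hP t)).el t :=
  (exists_rep hP (Torsor.yoneda hP t)).choose_spec.choose.map ⟨𝟙 _⟩

theorem pr_univ (t : P.Ob T) : (rep hP (stackOb hP t)).pr (univ hP t) = 𝟙 T := by
  refine (Torsor.Hom.pr_map _ _).trans ?_
  rw [(exists_rep hP (Torsor.yoneda hP t)).choose_spec.choose_spec]
  exact (Category.comp_id _).trans (P.pr_id t)

theorem covering_univ (t : P.Ob T) :
    Man.Covering fun _ : Unit => (rep hP (stackOb hP t)).pr (univ hP t) := fun z =>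
  ⟨⊤, trivial, (), Man.incl _, by rw [pr_univ]; rfl⟩

variable {hP} {x : (stackify hP).Ob U} {y : (stackify hP).Ob V}

/-- The element of a torsor which corresponds to an arrow of the stackification. -/
def elOf {t : P.Ob T} (a : (stackify hP).of (stackOb hP t) ⟶ (stackify hP).of x) :
    (rep hP x).el t := (torsorHom a).map (univ hP t)

theorem pr_elOf {t : P.Ob T} (a : (stackify hP).of (stackOb hP t) ⟶ (stackify hP).of x) :
    (rep hP x).pr (elOf a) = (stackify hP).pr a := by
  rw [elOf, Torsor.Hom.pr_map, pr_univ, Category.id_comp, torsorHom_base]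

theorem elOf_comp {t : P.Ob T} (a : (stackify hP).of (stackOb hP t) ⟶ (stackify hP).of x)
    (b : (stackify hP).of x ⟶ (stackify hP).of y) :
    elOf (a ≫ b) = (torsorHom b).map (elOf a) := by
  rw [elOf, torsorHom_comp]
  rfl

theorem elOf_id (t : P.Ob T) : elOf (𝟙 ((stackify hP).of (stackOb hP t))) = univ hP t := by
  rw [elOf, torsorHom_id]
  rfl

theorem elOf_inj {t : P.Ob T} {a b : (stackify hP).of (stackOb hP t) ⟶ (stackify hP).of x}
    (h : elOf a = elOf b) : a = b := by
  refine torsorHom.injective (Torsor.hom_ext_of_covering hP ?_ (fun _ => univ hP t)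
    (covering_univ hP t) fun _ => h)
  rw [torsorHom_base, torsorHom_base, ← pr_elOf, ← pr_elOf, h]

theorem exists_elOf {t : P.Ob T} (e : (rep hP x).el t) :
    ∃ a : (stackify hP).of (stackOb hP t) ⟶ (stackify hP).of x, elOf a = e := by
  obtain ⟨η, -, h⟩ := Torsor.exists_hom_of_el (univ hP t) (pr_univ hP t) e
  exact ⟨torsorHom.symm η, by rw [elOf, Equiv.apply_symm_apply, h]⟩

/-- The arrow of the stackification which corresponds to an element of a torsor. -/
def arrOf {t : P.Ob T} (e : (rep hP x).el t) :
    (stackify hP).of (stackOb hP t) ⟶ (stackify hP).of x := (exists_elOf e).choose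

@[simp] theorem elOf_arrOf {t : P.Ob T} (e : (rep hP x).el t) : elOf (arrOf e) = e :=
  (exists_elOf e).choose_spec

@[simp] theorem arrOf_elOf {t : P.Ob T}
    (a : (stackify hP).of (stackOb hP t) ⟶ (stackify hP).of x) : arrOf (elOf a) = a :=
  elOf_inj (elOf_arrOf _)

@[simp] theorem pr_arrOf {t : P.Ob T} (e : (rep hP x).el t) :
    (stackify hP).pr (arrOf e) = (rep hP x).pr e := by
  rw [← pr_elOf, elOf_arrOf]

variable (hP) in
/-- The map to the stackification on arrows. -/
def stackHom {t : P.Ob T} {t' : P.Ob W} (c : P.of t ⟶ P.of t') :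
    (stackify hP).of (stackOb hP t) ⟶ (stackify hP).of (stackOb hP t') :=
  arrOf ((rep hP (stackOb hP t')).act c (univ hP t'))

@[simp] theorem elOf_stackHom {t : P.Ob T} {t' : P.Ob W} (c : P.of t ⟶ P.of t') :
    elOf (stackHom hP c) = (rep hP (stackOb hP t')).act c (univ hP t') := elOf_arrOf _

theorem elOf_stackHom_comp {t : P.Ob T} {t' : P.Ob W} (c : P.of t ⟶ P.of t')
    (a : (stackify hP).of (stackOb hP t') ⟶ (stackify hP).of x) :
    elOf (stackHom hP c ≫ a) = (rep hP x).act c (elOf a) := by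
  rw [elOf_comp, elOf_stackHom, Torsor.Hom.map_act, elOf]

theorem stackHom_comp_arrOf {t : P.Ob T} {t' : P.Ob W} (c : P.of t ⟶ P.of t')
    (e : (rep hP x).el t') : stackHom hP c ≫ arrOf e = arrOf ((rep hP x).act c e) :=
  elOf_inj (by rw [elOf_stackHom_comp, elOf_arrOf, elOf_arrOf])

variable (hP) in
/-- The map from a prestack to its stackification. -/
def toStackify : Mor P (stackify hP) where
  obj t := stackOb hP t
  map c := stackHom hP c
  map_id t := elOf_inj (by rw [elOf_stackHom, Torsor.id_act, elOf_id])
  map_comp a b := elOf_inj (by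
    rw [elOf_stackHom_comp, elOf_stackHom, elOf_stackHom, Torsor.comp_act])
  pr_map c := by
    rw [← pr_elOf, elOf_stackHom, Torsor.pr_act, pr_univ, Category.comp_id]

theorem pr_stackHom {t : P.Ob T} {t' : P.Ob W} (c : P.of t ⟶ P.of t') :
    (stackify hP).pr (stackHom hP c) = P.pr c := (toStackify hP).pr_map c

theorem stackHom_comp {t : P.Ob T} {t' : P.Ob W} {t'' : P.Ob U} (c : P.of t ⟶ P.of t')
    (d : P.of t' ⟶ P.of t'') : stackHom hP (c ≫ d) = stackHom hP c ≫ stackHom hP d :=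
  (toStackify hP).map_comp c d

theorem stackHom_id (t : P.Ob T) : stackHom hP (𝟙 (P.of t)) = 𝟙 _ :=
  (toStackify hP).map_id t

theorem exists_stackHom {t : P.Ob T} {t' : P.Ob W}
    (a : (stackify hP).of (stackOb hP t) ⟶ (stackify hP).of (stackOb hP t')) :
    ∃ c : P.of t ⟶ P.of t', stackHom hP c = a := by
  obtain ⟨c, -, hc⟩ := (rep hP (stackOb hP t')).factor (univ hP t') (elOf a) ((stackify hP).pr a)
    (by rw [pr_univ, pr_elOf, Category.comp_id])
  exact ⟨c, elOf_inj (by rw [elOf_stackHom, hc])⟩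

theorem stackHom_inj {t : P.Ob T} {t' : P.Ob W} {c d : P.of t ⟶ P.of t'}
    (h : stackHom hP c = stackHom hP d) : c = d := by
  refine (rep hP (stackOb hP t')).act_inj (univ hP t') ?_ ?_
  · rw [← pr_stackHom (hP := hP), h, pr_stackHom]
  · have := congrArg elOf h
    rwa [elOf_stackHom, elOf_stackHom] at this

variable (hP) in
theorem toStackify_locEquiv : (toStackify hP).LocEquiv where
  surj y := by
    obtain ⟨C, hC, h⟩ := (rep hP y).loc
    refine ⟨C, hC, fun f hf => ?_⟩
    obtain ⟨t, e, he⟩ := h f hf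
    exact ⟨t, arrOf e, by rw [← he]; exact pr_arrOf e⟩
  full x x' m hm := ⟨⊤, Man.topology.top_mem _, fun z r _ => by
    obtain ⟨c, hc⟩ := exists_stackHom m
    exact ⟨r ≫ c, by rw [Mor.map_comp]; exact congrArg (_ ≫ ·) hc⟩⟩
  faithful {U x x' n n'} hn hn' h := ⟨⊤, Man.topology.top_mem _, fun {W} z r _ => by
    rw [stackHom_inj h]⟩

/-- Arrows of the stackification are determined locally by elements. -/
theorem stackify_hom_ext {φ φ' : (stackify hP).of x ⟶ (stackify hP).of y}
    (hp : (stackify hP).pr φ = (stackify hP).pr φ')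
    {C : Sieve U} (hC : C ∈ Man.topology U) (h : ∀ {T : Man.{u}} {t : P.Ob T}
      (r : (stackify hP).of (stackOb hP t) ⟶ (stackify hP).of x), C ((stackify hP).pr r) →
      r ≫ φ = r ≫ φ') : φ = φ' := by
  refine torsorHom.injective (Torsor.hom_ext_of_loc hP hp fun {T t} e =>
    ⟨_, Man.topology.pullback_stable ((rep hP x).pr e) hC, fun {Z} z r hr => ?_⟩)
  have := congrArg elOf (h (arrOf ((rep hP x).act r e)) (by
    rw [pr_arrOf, Torsor.pr_act]; exact hr))
  rwa [elOf_comp, elOf_comp, elOf_arrOf] at this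

variable (hP) in
theorem stackify_isPrestack : (stackify hP).IsPrestack := by
  refine isPrestack_of ?_ ?_
  · intro U x y φ φ' h h' C hC H
    exact stackify_hom_ext (h.trans h'.symm) hC fun r hr => H _ r hr
  · intro U x y C hC ψ hψ hψ'
    obtain ⟨η, hη, hη'⟩ := Torsor.exists_hom (E := rep hP x) (E' := rep hP y) hP (𝟙 U)
      (fun {T t} e e' => ∃ (r : (stackify hP).of (stackOb hP t) ⟶ (stackify hP).of x)
        (h : C ((stackify hP).pr r)), elOf r = e ∧ elOf (ψ _ r h) = e') (by
        rintro T t _ _ ⟨r, h, rfl, rfl⟩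
        rw [pr_elOf, pr_elOf, hψ, Category.comp_id]) (by
        rintro T t _ _ _ ⟨r, h, rfl, rfl⟩ ⟨r', h', e, rfl⟩
        obtain rfl := elOf_inj e
        rfl) (by
        rintro T T' t t' c _ _ ⟨r, h, rfl, rfl⟩
        have h' : C ((stackify hP).pr (stackHom hP c ≫ r)) := by
          rw [pr_comp]; exact C.downward_closed h _
        exact ⟨stackHom hP c ≫ r, h', elOf_stackHom_comp _ _, by
          rw [hψ' _ r h _ (stackHom hP c) h', elOf_stackHom_comp]⟩) (by
        intro T t e
        refine ⟨_, Man.topology.pullback_stable ((rep hP x).pr e) hC, fun {Z} z r hr => ?_⟩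
        exact ⟨_, arrOf ((rep hP x).act r e), by rw [pr_arrOf, Torsor.pr_act]; exact hr,
          elOf_arrOf _, rfl⟩)
    obtain ⟨φ, rfl⟩ := torsorHom.surjective η
    rw [torsorHom_base] at hη
    refine ⟨φ, hη, ?_⟩
    intro W z r h
    refine stackify_hom_ext (by
      rw [pr_comp, hψ, hη, Category.comp_id])
      (Man.topology.top_mem _) ?_
    intro T t s _
    have h' : C ((stackify hP).pr (s ≫ r)) := by rw [pr_comp]; exact C.downward_closed h _
    refine elOf_inj ?_
    rw [← Category.assoc, elOf_comp,
      hη' (e' := elOf (ψ _ (s ≫ r) h')) ⟨_, h', rfl, rfl⟩, hψ' _ r h _ s h']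

end stackify

end CFG

end StackyQuotient

end

noncomputable section

universe w w' k

namespace StackyQuotient

namespace CFG

section germs

variable {P : CFG.{max u v, u}} {hP : P.IsPrestack} {U V W T : Man.{u}}

/-- An arrow from an object to the object described by a descent datum: the coherent choice of the
local arrows. -/
@[ext] structure Germ (d : Descent.{u, max u v, u} (stackify hP) U) (t : P.Ob T) :
    Type (max (u + 1) v) where
  g : T ⟶ U
  mem : ∀ {Z : Man.{u}} {z : P.Ob Z} (_ : P.of z ⟶ P.of t) {i : d.K}
    (_ : (stackify hP).of (stackOb hP z) ⟶ (stackify hP).of (d.ob i)), Prop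
  pr_mem : ∀ {Z : Man.{u}} {z : P.Ob Z} {r : P.of z ⟶ P.of t} {i : d.K}
    {a : (stackify hP).of (stackOb hP z) ⟶ (stackify hP).of (d.ob i)}, mem r a →
    (stackify hP).pr a ≫ d.f i = P.pr r ≫ g
  res : ∀ {Z Z' : Man.{u}} {z : P.Ob Z} {z' : P.Ob Z'} {r : P.of z ⟶ P.of t} {i : d.K}
    {a : (stackify hP).of (stackOb hP z) ⟶ (stackify hP).of (d.ob i)} (s : P.of z' ⟶ P.of z),
    mem r a → mem (s ≫ r) (stackHom hP s ≫ a)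
  rel : ∀ {Z : Man.{u}} {z : P.Ob Z} {r : P.of z ⟶ P.of t} {i j : d.K}
    {a : (stackify hP).of (stackOb hP z) ⟶ (stackify hP).of (d.ob i)}
    {b : (stackify hP).of (stackOb hP z) ⟶ (stackify hP).of (d.ob j)}, mem r a → mem r b →
    d.rel a b
  trans : ∀ {Z : Man.{u}} {z : P.Ob Z} {r : P.of z ⟶ P.of t} {i j : d.K}
    {a : (stackify hP).of (stackOb hP z) ⟶ (stackify hP).of (d.ob i)}
    {b : (stackify hP).of (stackOb hP z) ⟶ (stackify hP).of (d.ob j)}, mem r a → d.rel a b →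
    mem r b
  ex : ∀ {Z : Man.{u}} {z : P.Ob Z} (r : P.of z ⟶ P.of t) (i : d.K) (h : Z ⟶ d.W i),
    h ≫ d.f i = P.pr r ≫ g → ∃ a : (stackify hP).of (stackOb hP z) ⟶ (stackify hP).of (d.ob i),
      (stackify hP).pr a = h ∧ mem r a

namespace Germ

variable {d : Descent.{u, max u v, u} (stackify hP) U} {t : P.Ob T}

theorem mem_of_loc (e : Germ d t) {z : P.Ob W} {r : P.of z ⟶ P.of t} {i : d.K}
    {a : (stackify hP).of (stackOb hP z) ⟶ (stackify hP).of (d.ob i)}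
    (hp : (stackify hP).pr a ≫ d.f i = P.pr r ≫ e.g) {C : Sieve W} (hC : C ∈ Man.topology W)
    (h : ∀ {Z : Man.{u}} {z' : P.Ob Z} (s : P.of z' ⟶ P.of z), C (P.pr s) →
      e.mem (s ≫ r) (stackHom hP s ≫ a)) : e.mem r a := by
  obtain ⟨a₀, h₀, h₁⟩ := e.ex r i _ hp
  suffices a = a₀ by rwa [this]
  refine stackify_hom_ext h₀.symm hC ?_
  intro Z z' q hq
  obtain ⟨s, rfl⟩ := exists_stackHom q
  rw [pr_stackHom] at hq
  exact d.eq_of_rel (e.rel (h s hq) (e.res s h₁)) (by rw [pr_comp, pr_comp, h₀])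

theorem ext_of_loc {e e' : Germ d t} (hg : e.g = e'.g) {C : Sieve T} (hC : C ∈ Man.topology T)
    (h : ∀ {Z : Man.{u}} {z : P.Ob Z} (r : P.of z ⟶ P.of t), C (P.pr r) → ∃ (i : d.K)
      (a : (stackify hP).of (stackOb hP z) ⟶ (stackify hP).of (d.ob i)),
      e.mem r a ∧ e'.mem r a) : e = e' := by
  have key : ∀ {e e' : Germ d t}, e.g = e'.g → (∀ {Z : Man.{u}} {z : P.Ob Z} (r : P.of z ⟶ P.of t),
      C (P.pr r) → ∃ (i : d.K)
      (a : (stackify hP).of (stackOb hP z) ⟶ (stackify hP).of (d.ob i)),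
      e.mem r a ∧ e'.mem r a) → ∀ {Z : Man.{u}} {z : P.Ob Z} (r : P.of z ⟶ P.of t) {i : d.K}
      (a : (stackify hP).of (stackOb hP z) ⟶ (stackify hP).of (d.ob i)), e.mem r a →
      e'.mem r a := by
    intro e e' hg h Z z r i a ha
    refine e'.mem_of_loc (by rw [e.pr_mem ha, hg]) (Man.topology.pullback_stable (P.pr r) hC) ?_
    intro Z' z' s hs
    obtain ⟨j, b, hb, hb'⟩ := h (s ≫ r) (by rw [pr_comp]; exact hs)
    exact e'.trans hb' (e.rel hb (e.res s ha))
  refine Germ.ext hg ?_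
  funext Z z r i a
  exact propext ⟨key hg h r a, key hg.symm (fun r hr => by
    obtain ⟨j, b, hb, hb'⟩ := h r hr
    exact ⟨j, b, hb', hb⟩) r a⟩

theorem hom_unique (e : Germ d t) {z : P.Ob W} {r r' : P.of z ⟶ P.of t} {i j : d.K}
    {a : (stackify hP).of (stackOb hP z) ⟶ (stackify hP).of (d.ob i)}
    {b : (stackify hP).of (stackOb hP z) ⟶ (stackify hP).of (d.ob j)} (ha : e.mem r a)
    (hb : e.mem r' b) (hab : d.rel a b) (hp : P.pr r = P.pr r') : r = r' := by
  have hb' := e.trans hb (d.rel_symm hab)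
  obtain ⟨m, rfl, hm⟩ := factor_exists r r' (𝟙 W) (by rw [hp]; simp)
  have h₁ := d.eq_of_rel (e.rel (e.res m ha) hb') (by
    rw [pr_comp, pr_stackHom, hm, Category.id_comp])
  have h₂ : stackHom hP m = stackHom hP (𝟙 _) :=
    factor_unique a (by rw [h₁, stackHom_id, Category.id_comp]) (by
      rw [pr_stackHom, pr_stackHom, hm, pr_id])
  rw [stackHom_inj h₂, Category.id_comp]

/-- The restriction of a germ. -/
def act {t' : P.Ob W} (c : P.of t' ⟶ P.of t) (e : Germ d t) : Germ d t' where
  g := P.pr c ≫ e.g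
  mem r _ a := e.mem (r ≫ c) a
  pr_mem h := by rw [e.pr_mem h, pr_comp, Category.assoc]
  res s h := by rw [Category.assoc]; exact e.res s h
  rel h h' := e.rel h h'
  trans h h' := e.trans h h'
  ex r i h hh := e.ex (r ≫ c) i h (by rw [hh, pr_comp, Category.assoc])

/-- The germ of an arrow to a member of the descent datum. -/
def single {i : d.K} (e : (rep hP (d.ob i)).el t) : Germ d t where
  g := (rep hP (d.ob i)).pr e ≫ d.f i
  mem r _ a := d.rel (stackHom hP r ≫ arrOf e) a
  pr_mem h := by
    rw [← d.pr_rel h, pr_comp, pr_stackHom, pr_arrOf, Category.assoc]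
  res s h := by
    rw [stackHom_comp, Category.assoc]
    exact d.comp_rel _ h
  rel h h' := d.rel_trans (d.rel_symm h) h'
  trans h h' := d.rel_trans h h'
  ex r j h hh := d.exists_rel _ j h (by
    rw [pr_comp, pr_stackHom, pr_arrOf, hh, Category.assoc])

theorem cov_sieve (e : Germ d t) : (Man.sieveOf d.f).pullback e.g ∈ Man.topology T :=
  Man.Covering.pullback d.cov e.g

theorem single_act {i : d.K} (e : (rep hP (d.ob i)).el t) {t' : P.Ob W} (c : P.of t' ⟶ P.of t) :
    single ((rep hP (d.ob i)).act c e) = act c (single e) := by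
  refine Germ.ext (by
    change (rep hP (d.ob i)).pr _ ≫ _ = P.pr c ≫ (rep hP (d.ob i)).pr e ≫ _
    rw [Torsor.pr_act, Category.assoc]) ?_
  funext Z z r j a
  change d.rel _ a = d.rel _ a
  rw [stackHom_comp, Category.assoc, stackHom_comp_arrOf c]

theorem exists_factor {t' : P.Ob W} (e : Germ d t) (e' : Germ d t') (k : W ⟶ T)
    (hk : k ≫ e.g = e'.g) : ∃ c : P.of t' ⟶ P.of t, P.pr c = k ∧ act c e = e' := by
  let K := Σ (Z : Man.{u}) (z : P.Ob Z), { p : (P.of z ⟶ P.of t') × (P.of z ⟶ P.of t) //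
    P.pr p.2 = P.pr p.1 ≫ k ∧ ∃ (i : d.K)
      (a : (stackify hP).of (stackOb hP z) ⟶ (stackify hP).of (d.ob i)),
      e'.mem p.1 a ∧ e.mem p.2 a }
  have hK : ∀ {Z : Man.{u}} {z : P.Ob Z} (r : P.of z ⟶ P.of t'),
      (Man.sieveOf d.f).pullback e'.g (P.pr r) → ∃ n : P.of z ⟶ P.of t,
      P.pr n = P.pr r ≫ k ∧ ∃ (i : d.K)
      (a : (stackify hP).of (stackOb hP z) ⟶ (stackify hP).of (d.ob i)),
      e'.mem r a ∧ e.mem n a := by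
    rintro Z z r ⟨i, h, hh⟩
    obtain ⟨a', ha', hm⟩ := e'.ex r i h hh
    obtain ⟨z₁, n₁, hn₁⟩ := lift_exists t (P.pr r ≫ k)
    obtain ⟨a₁, ha₁, hm₁⟩ := e.ex n₁ i h (by rw [hh, hn₁, Category.assoc, hk])
    obtain ⟨m, hm', hm''⟩ := factor_exists a₁ a' (𝟙 Z) (by rw [ha₁, ha']; simp)
    obtain ⟨n, rfl⟩ := exists_stackHom m
    rw [pr_stackHom] at hm''
    refine ⟨n ≫ n₁, by rw [pr_comp, hm'', hn₁, Category.id_comp], i, a', hm, ?_⟩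
    rw [← hm']
    exact e.res n hm₁
  obtain ⟨c, hc, hc'⟩ := hP.exists_glue (x := t') (y := t) k (K := K) (W := fun κ => κ.1)
    (z := fun κ => κ.2.1) (fun κ => κ.2.2.1.1) (by
      refine Man.covering_of_mem e'.cov_sieve ?_
      intro Z f hf
      obtain ⟨z, r, hr⟩ := lift_exists t' f
      obtain ⟨n, hn, hh⟩ := hK r (by rw [hr]; exact hf)
      exact ⟨⟨Z, z, ⟨r, n⟩, hn, hh⟩, 𝟙 _, by rw [Category.id_comp]; exact hr⟩)
    (fun κ => κ.2.2.1.2) (fun κ => κ.2.2.2.1) (by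
      rintro ⟨Z, z, ⟨r, n⟩, hn, i, a, h₁, h₂⟩ ⟨Z', z', ⟨r', n'⟩, hn', i', a', h₁', h₂'⟩ A x s s' h
      dsimp only at h hn hn' h₁ h₁' h₂ h₂' ⊢
      have m₁ := e'.res s h₁
      have m₂ := e'.res s' h₁'
      rw [← h] at m₂
      refine e.hom_unique (e.res s h₂) (e.res s' h₂') (e'.rel m₁ m₂) ?_
      have hp := congrArg P.pr h
      rw [pr_comp, pr_comp] at hp
      rw [pr_comp, pr_comp]
      exact (congrArg (P.pr s ≫ ·) hn).trans ((Category.assoc _ _ _).symm.trans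
        ((congrArg (· ≫ k) hp).trans ((Category.assoc _ _ _).trans
          (congrArg (P.pr s' ≫ ·) hn').symm))))
  refine ⟨c, hc, ext_of_loc (by rw [← hk, ← hc]; rfl) e'.cov_sieve ?_⟩
  intro Z z r hr
  obtain ⟨n, hn, i, a, h₁, h₂⟩ := hK r hr
  refine ⟨i, a, ?_, h₁⟩
  have := hc' ⟨Z, z, ⟨r, n⟩, hn, i, a, h₁, h₂⟩
  change e.mem (r ≫ c) a
  rw [this]
  exact h₂

theorem exists_glued (t : P.Ob T) (g : T ⟶ U) {C : Sieve T} (hC : C ∈ Man.topology T)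
    (ψ : ∀ {Z : Man.{u}} (z : P.Ob Z) (r : P.of z ⟶ P.of t), C (P.pr r) → Germ d z)
    (hψ : ∀ {Z : Man.{u}} (z : P.Ob Z) (r : P.of z ⟶ P.of t) (h : C (P.pr r)),
      (ψ z r h).g = P.pr r ≫ g)
    (hψ' : ∀ {Z : Man.{u}} (z : P.Ob Z) (r : P.of z ⟶ P.of t) (h : C (P.pr r)) {Z' : Man.{u}}
      (z' : P.Ob Z') (s : P.of z' ⟶ P.of z) (h' : C (P.pr (s ≫ r))),
      ψ z' (s ≫ r) h' = act s (ψ z r h)) :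
    ∃ e : Germ d t, e.g = g ∧ ∀ {Z : Man.{u}} (z : P.Ob Z) (r : P.of z ⟶ P.of t)
      (h : C (P.pr r)), act r e = ψ z r h := by
  have hCr : ∀ {Z : Man.{u}} {z : P.Ob Z} (r : P.of z ⟶ P.of t),
      C.pullback (P.pr r) ∈ Man.topology Z := fun r => Man.topology.pullback_stable _ hC
  have hCs : ∀ {Z Z' : Man.{u}} {z : P.Ob Z} {r : P.of z ⟶ P.of t} {z' : P.Ob Z'}
      {s : P.of z' ⟶ P.of z}, C.pullback (P.pr r) (P.pr s) → C (P.pr (s ≫ r)) := by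
    intro Z Z' z r z' s h
    rw [pr_comp]
    exact h
  let mem : ∀ {Z : Man.{u}} {z : P.Ob Z} (_ : P.of z ⟶ P.of t) {i : d.K}
    (_ : (stackify hP).of (stackOb hP z) ⟶ (stackify hP).of (d.ob i)), Prop :=
    fun {Z z} r {i} a => (stackify hP).pr a ≫ d.f i = P.pr r ≫ g ∧
      ∀ {Z' : Man.{u}} {z' : P.Ob Z'} (s : P.of z' ⟶ P.of z) (q : P.of z' ⟶ P.of t)
        (_ : q = s ≫ r) (h : C (P.pr q)), (ψ z' q h).mem (𝟙 _) (stackHom hP s ≫ a)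
  let e : Germ d t :=
    { g := g
      mem := fun r _ a => mem r a
      pr_mem := fun h => h.1
      res := by
        intro Z Z' z z' r i a s h
        refine ⟨by rw [pr_comp, pr_comp, Category.assoc, h.1, pr_stackHom, Category.assoc], ?_⟩
        intro Z'' z'' s' q hq hqC
        rw [← Category.assoc, ← stackHom_comp]
        exact h.2 (s' ≫ s) q (by rw [hq, Category.assoc]) hqC
      rel := by
        intro Z z r i j a b h h'
        obtain ⟨b', hb', hab⟩ := d.exists_rel a j ((stackify hP).pr b) (by rw [h.1, h'.1])
        suffices b = b' by rwa [this]
        refine stackify_hom_ext hb'.symm (hCr r) ?_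
        intro Z' z' q hq
        obtain ⟨s, rfl⟩ := exists_stackHom q
        rw [pr_stackHom] at hq
        refine d.rel_unique ((ψ z' (s ≫ r) (hCs hq)).rel (h.2 s _ rfl _) (h'.2 s _ rfl _))
          (d.comp_rel _ hab) (by rw [pr_comp, pr_comp, hb'])
      trans := by
        intro Z z r i j a b h h'
        refine ⟨by rw [← d.pr_rel h', h.1], ?_⟩
        intro Z' z' s q hq hqC
        exact (ψ z' q hqC).trans (h.2 s q hq hqC) (d.comp_rel _ h')
      ex := by
        intro Z z r i h hh
        obtain ⟨x, hx, hx'⟩ := (rep hP (d.ob i)).exists_of_rel hP z h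
          (fun {Z'} z' s x => (rep hP (d.ob i)).pr x = P.pr s ≫ h ∧
            ∃ (q : P.of z' ⟶ P.of t) (_ : q = s ≫ r) (hq : C (P.pr q)),
              (ψ z' q hq).mem (𝟙 _) (arrOf x)) (fun z' s x hx => hx.1) (by
            rintro Z' z' s x x' ⟨h₁, q, rfl, hq, h₂⟩ ⟨h₁', _, rfl, _, h₂'⟩
            rw [← elOf_arrOf x, ← elOf_arrOf x', d.eq_of_rel ((ψ z' _ hq).rel h₂ h₂') (by
              rw [pr_arrOf, pr_arrOf, h₁, h₁'])]) (by
            rintro Z' Z'' z' z'' s' s x ⟨h₁, q, rfl, hq, h₂⟩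
            have hq' : C (P.pr (s' ≫ s ≫ r)) := by rw [pr_comp]; exact C.downward_closed hq _
            refine ⟨by rw [Torsor.pr_act, h₁, pr_comp, Category.assoc], _,
              (Category.assoc _ _ _).symm, hq', ?_⟩
            rw [hψ' z' (s ≫ r) hq z'' s' hq', ← stackHom_comp_arrOf]
            change (ψ z' _ hq).mem (𝟙 _ ≫ s') _
            rw [Category.id_comp, ← Category.comp_id s']
            have := (ψ z' _ hq).res s' h₂
            rwa [Category.comp_id] at this ⊢) (hCr r) (by
            intro Z' z' s hs
            obtain ⟨a, ha, ha'⟩ := (ψ z' (s ≫ r) (hCs hs)).ex (𝟙 _) i (P.pr s ≫ h) (by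
              rw [hψ, pr_id, Category.assoc, hh, pr_comp, Category.id_comp, Category.assoc])
            exact ⟨elOf a, by rw [pr_elOf, ha], _, rfl, hCs hs, by rwa [arrOf_elOf]⟩)
        refine ⟨arrOf x, by rw [pr_arrOf, hx], by rw [pr_arrOf, hx, hh], ?_⟩
        rintro Z' z' s q rfl hq
        obtain ⟨a, ha, ha'⟩ := (ψ z' (s ≫ r) hq).ex (𝟙 _) i (P.pr s ≫ h) (by
          rw [hψ, pr_id, Category.assoc, hh, pr_comp, Category.id_comp, Category.assoc])
        rw [stackHom_comp_arrOf, hx' z' s (elOf a) ⟨by rw [pr_elOf, ha], _, rfl, hq, by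
          rwa [arrOf_elOf]⟩, arrOf_elOf]
        exact ha' }
  refine ⟨e, rfl, fun {Z} z r h => ?_⟩
  refine ext_of_loc (by rw [hψ]; rfl) (ψ z r h).cov_sieve ?_
  rintro Z' z' s ⟨i, k, hk⟩
  obtain ⟨a, ha, ha'⟩ := (ψ z r h).ex s i k hk
  refine ⟨i, a, ⟨by rw [ha, hk, hψ, pr_comp, Category.assoc], ?_⟩, ha'⟩
  rintro Z'' z'' s' q rfl hq
  have e₁ : s' ≫ s ≫ r = (s' ≫ s) ≫ r := (Category.assoc _ _ _).symm
  have e₂ : ∀ (q q' : P.of z'' ⟶ P.of t) (_ : q = q') (h : C (P.pr q)) (h' : C (P.pr q')),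
      ψ z'' q h = ψ z'' q' h' := by rintro q _ rfl _ _; rfl
  rw [e₂ _ _ e₁ hq (e₁ ▸ hq), hψ' z r h z'' (s' ≫ s) (e₁ ▸ hq)]
  change (ψ z r h).mem (𝟙 _ ≫ s' ≫ s) _
  rw [Category.id_comp]
  exact (ψ z r h).res s' ha'

end Germ

/-- The torsor described by a descent datum. -/
def Descent.torsor (d : Descent.{u, max u v, u} (stackify hP) U) : Torsor.{v} P U where
  el t := Germ d t
  pr e := e.g
  act c e := Germ.act c e
  pr_act _ _ := rfl
  id_act e := by
    refine Germ.ext ((congrArg (· ≫ e.g) (P.pr_id _)).trans (Category.id_comp _)) ?_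
    funext Z z r i a
    change e.mem (r ≫ 𝟙 _) a = _
    rw [Category.comp_id]
  comp_act b c e := by
    refine Germ.ext ((congrArg (· ≫ e.g) (pr_comp b c)).trans (Category.assoc _ _ _)) ?_
    funext Z z r i a
    change e.mem (r ≫ b ≫ c) a = e.mem ((r ≫ b) ≫ c) a
    rw [Category.assoc]
  loc := by
    let K := Σ (i : d.K) (T : Man.{u}) (t : P.Ob T), (rep hP (d.ob i)).el t
    let S := Man.sieveOf fun κ : K => (rep hP (d.ob κ.1)).pr κ.2.2.2 ≫ d.f κ.1
    refine ⟨S, Man.topology.transitive d.cov.sieveOf_mem _ ?_, ?_⟩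
    · rintro T _ ⟨i, g, rfl⟩
      obtain ⟨C, hC, hh⟩ := (rep hP (d.ob i)).loc
      refine Man.topology.superset_covering ?_ (Man.topology.pullback_stable g hC)
      intro Z f hf
      obtain ⟨t, e, he⟩ := hh (f ≫ g) hf
      exact ⟨⟨i, Z, t, e⟩, 𝟙 _, by
        change 𝟙 _ ≫ (rep hP (d.ob i)).pr e ≫ d.f i = f ≫ g ≫ d.f i
        rw [he, Category.id_comp, Category.assoc]⟩
    · rintro T _ ⟨⟨i, Z, t, e⟩, g, rfl⟩
      obtain ⟨t', r, rfl⟩ := lift_exists t g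
      exact ⟨t', Germ.act r (Germ.single e), rfl⟩
  factor e e' g h := Germ.exists_factor e e' g h
  act_inj {T T' t t' c c'} e hp h := by
    have hS := Man.topology.pullback_stable (P.pr c) e.cov_sieve
    refine hP.hom_ext_sieve hp hS ?_
    rintro W z r ⟨i, g, hg⟩
    obtain ⟨a, ha, ha'⟩ := e.ex (r ≫ c) i g (by
      rw [hg, pr_comp])
    have h₁ : (Germ.act c e).mem r a := ha'
    rw [h] at h₁
    have h₂ : e.mem (r ≫ c') a := h₁
    exact e.hom_unique ha' h₂ (e.rel ha' ha') (by rw [pr_comp, pr_comp, hp])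
  glue t g C hC ψ h₁ h₂ := Germ.exists_glued t g hC ψ h₁ h₂

/-- The morphism from a member of a descent datum. -/
def Descent.torsorHom (d : Descent.{u, max u v, u} (stackify hP) U) (i : d.K) :
    Torsor.Hom (rep hP (d.ob i)) d.torsor where
  base := d.f i
  map e := Germ.single e
  pr_map _ := rfl
  map_act c e := Germ.single_act e c

variable (hP) in
theorem stackify_isStack : (stackify hP).IsStack := by
  refine isStack_of (stackify_isPrestack hP) fun {U} d => ?_
  obtain ⟨y, η, hη⟩ := exists_rep hP d.torsor
  choose p hp using fun i => (CFG.torsorHom (hP := hP)).surjective ((d.torsorHom i).comp η)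
  have hpr : ∀ i, (stackify hP).pr (p i) = d.f i := by
    intro i
    rw [← torsorHom_base, hp]
    change d.f i ≫ η.base = _
    rw [hη, Category.comp_id]
  refine ⟨y, p, hpr, ?_⟩
  intro T t i j a b h
  refine stackify_hom_ext (by rw [pr_comp, pr_comp, hpr, hpr, d.pr_rel h])
    (Man.topology.top_mem _) ?_
  intro Z z r _
  refine elOf_inj ?_
  rw [← Category.assoc, ← Category.assoc, elOf_comp (r ≫ a), elOf_comp (r ≫ b), hp, hp]
  change η.map (Germ.single (elOf (r ≫ a))) = η.map (Germ.single (elOf (r ≫ b)))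
  congr 1
  have h' := d.comp_rel r h
  refine Germ.ext (by
    change (rep hP (d.ob i)).pr _ ≫ d.f i = (rep hP (d.ob j)).pr _ ≫ d.f j
    rw [pr_elOf, pr_elOf, d.pr_rel h']) ?_
  funext Z' z' r' l c
  change d.rel (stackHom hP r' ≫ arrOf (elOf (r ≫ a))) c =
    d.rel (stackHom hP r' ≫ arrOf (elOf (r ≫ b))) c
  rw [arrOf_elOf, arrOf_elOf]
  have h'' := d.comp_rel (stackHom hP r') h'
  exact propext ⟨fun h => d.rel_trans (d.rel_symm h'') h, fun h => d.rel_trans h'' h⟩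

end germs

/-- Prestacks have stackifications, by local equivalences. -/
theorem IsPrestack.exists_stackification {P : CFG.{max u v, u}} (hP : P.IsPrestack) :
    ∃ (Q : CFG.{max u v, u}) (ι : Mor P Q), Q.IsStack ∧ ι.LocEquiv :=
  ⟨_, toStackify hP, stackify_isStack hP, toStackify_locEquiv hP⟩

end CFG

end StackyQuotient

end

noncomputable section

universe w w' k

namespace StackyQuotient

namespace CFG

section comparison

variable {P Q Q' : CFG.{w, u}} {U V W : Man.{u}}

/-- The components of a 2-morphism from a composite. -/
theorem TwoMor.exists_comp {F : Mor Q Q'} {ι : Mor P Q} {ι' : Mor P Q'}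
    (ζ : TwoMor (ι.comp F) ι') :
    ∃ z : ∀ {U : Man.{u}} (x : P.Ob U), Q'.of (F.obj (ι.obj x)) ⟶ Q'.of (ι'.obj x),
      (∀ {U : Man.{u}} (x : P.Ob U), z x = ζ.app x) ∧
      (∀ {U : Man.{u}} (x : P.Ob U), Q'.pr (z x) = 𝟙 U) ∧
      ∀ {U V : Man.{u}} {x : P.Ob U} {y : P.Ob V} (a : P.of x ⟶ P.of y),
        F.map (ι.map a) ≫ z y = z x ≫ ι'.map a :=
  ⟨fun x => ζ.app x, fun _ => rfl, fun x => ζ.pr_app x, fun a => ζ.naturality a⟩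

/-- The components of a 2-morphism from a composite to the identity. -/
theorem TwoMor.exists_id {F : Mor Q Q'} {F' : Mor Q' Q} (η : TwoMor (F.comp F') (Mor.id Q)) :
    ∃ z : ∀ {U : Man.{u}} (x : Q.Ob U), Q.of (F'.obj (F.obj x)) ⟶ Q.of x,
      (∀ {U : Man.{u}} (x : Q.Ob U), Q.pr (z x) = 𝟙 U) ∧
      ∀ {U V : Man.{u}} {x : Q.Ob U} {y : Q.Ob V} (a : Q.of x ⟶ Q.of y),
        F'.map (F.map a) ≫ z y = z x ≫ a :=
  ⟨fun x => η.app x, fun x => η.pr_app x, fun a => η.naturality a⟩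

theorem TwoMor.faithful {F : Mor Q Q'} {F' : Mor Q' Q} (η : TwoMor (F.comp F') (Mor.id Q))
    {x : Q.Ob U} {y : Q.Ob V} {a b : Q.of x ⟶ Q.of y} (h : F.map a = F.map b) : a = b := by
  obtain ⟨z, hz, hz'⟩ := η.exists_id
  have := isIso_of_pr (z x) (hz x)
  rw [← cancel_epi (z x), ← hz', ← hz', h]

/-- Two stackifications are isomorphic. -/
theorem IsStackification.exists_isomorphism {ι : Mor P Q} {ι' : Mor P Q'} (h : IsStackification ι)
    (h' : IsStackification ι') : ∃ (F : Mor Q Q') (F' : Mor Q' Q),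
      Nonempty (TwoMor (ι.comp F) ι') ∧ Nonempty (TwoMor (F.comp F') (Mor.id Q)) ∧
      Nonempty (TwoMor (F'.comp F) (Mor.id Q')) := by
  have key : ∀ {Q Q' : CFG.{w, u}} {ι : Mor P Q} {ι' : Mor P Q'} (_ : IsStackification ι)
      (F : Mor Q Q') (F' : Mor Q' Q) (_ : TwoMor (ι.comp F) ι') (_ : TwoMor (ι'.comp F') ι),
      Nonempty (TwoMor (F.comp F') (Mor.id Q)) := by
    intro Q Q' ι ι' h F F' ζ ζ'
    obtain ⟨z, -, hz, hn⟩ := ζ.exists_comp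
    obtain ⟨z', -, hz', hn'⟩ := ζ'.exists_comp
    have hp : ∀ {U} (x : P.Ob U), Q.pr (F'.map (z x) ≫ z' x) = 𝟙 U := by
      intro U x
      rw [pr_comp, F'.pr_map, hz, hz', Category.comp_id]
    have ζ₁ : TwoMor (ι.comp (F.comp F')) ι :=
      { app := fun x => F'.map (z x) ≫ z' x
        pr_app := fun {U} x => hp x
        naturality := fun {U V x y} a => by
          change F'.map (F.map (ι.map a)) ≫ F'.map (z y) ≫ z' y = (F'.map (z x) ≫ z' x) ≫ ι.map a
          rw [Category.assoc, ← hn', ← Category.assoc, ← F'.map_comp, hn, F'.map_comp,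
            Category.assoc] }
    exact ⟨(h.2.2 Q h.1 ι ι (TwoMor.refl ι) (F.comp F') (Mor.id Q) ζ₁ (TwoMor.refl ι)).choose⟩
  obtain ⟨F, ⟨ζ⟩⟩ := h.2.1 Q' h'.1 ι'
  obtain ⟨F', ⟨ζ'⟩⟩ := h'.2.1 Q h.1 ι
  exact ⟨F, F', ⟨ζ⟩, key h F F' ζ ζ', key h' F' F ζ' ζ⟩

/-- Local equivalences are invariant under isomorphism. -/
theorem Mor.LocEquiv.of_isomorphism {ι : Mor P Q} {ι' : Mor P Q'} (h : ι'.LocEquiv) {F : Mor Q Q'}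
    {F' : Mor Q' Q} (ζ : TwoMor (ι.comp F) ι') (η : TwoMor (F.comp F') (Mor.id Q)) :
    ι.LocEquiv where
  surj y := by
    obtain ⟨z, -, hz, -⟩ := ζ.exists_comp
    obtain ⟨l, hl, -⟩ := η.exists_id
    obtain ⟨C, hC, hh⟩ := h.surj (F.obj y)
    refine ⟨C, hC, fun f hf => ?_⟩
    obtain ⟨x, a, ha⟩ := hh f hf
    have := isIso_of_pr (l (ι.obj x)) (hl _)
    exact ⟨x, inv (l (ι.obj x)) ≫ F'.map (z x ≫ a) ≫ l y, by
      rw [pr_comp, pr_comp, pr_isIso_inv _ (hl _), F'.pr_map, pr_comp, hz, ha, hl]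
      simp⟩
  full {U} x x' m hm := by
    obtain ⟨z, -, hz, hn⟩ := ζ.exists_comp
    have := isIso_of_pr (z x) (hz x)
    have := isIso_of_pr (z x') (hz x')
    obtain ⟨C, hC, hh⟩ := h.full x x' (inv (z x) ≫ F.map m ≫ z x') (by
      rw [pr_comp, pr_comp, pr_isIso_inv _ (hz x), hz, F.pr_map, hm]; simp)
    refine ⟨C, hC, fun {W} t r hr => ?_⟩
    obtain ⟨n, hn'⟩ := hh t r hr
    refine ⟨n, TwoMor.faithful η ?_⟩
    rw [← cancel_mono (z x'), hn, hn', ← Category.assoc, ← hn, F.map_comp]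
    simp
  faithful {U x x' n n'} hp hp' e := by
    obtain ⟨z, -, hz, hn⟩ := ζ.exists_comp
    have := isIso_of_pr (z x) (hz x)
    refine h.faithful hp hp' ?_
    rw [← cancel_epi (z x), ← hn, ← hn, e]

end comparison

/-- Stackifications of prestacks are local equivalences. -/
theorem IsStackification.locEquiv {P Q : CFG.{max u v, u}} (hP : P.IsPrestack) {ι : Mor P Q}
    (h : IsStackification ι) : ι.LocEquiv := by
  obtain ⟨Q', ι', hQ', h'⟩ := IsPrestack.exists_stackification.{v} hP
  obtain ⟨F, F', ⟨ζ⟩, ⟨η⟩, -⟩ := h.exists_isomorphism (h'.isStackification hQ')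
  exact h'.of_isomorphism ζ η

end CFG

end StackyQuotient

end

noncomputable section

universe w w' k

namespace StackyQuotient

namespace Action

variable {G : CfgGroupoid.{w, u}} {X : CFG.{w, u}} {U V W : Man.{u}}

theorem arrowOf_comp_cls (A : Action G X) {x : X.Ob U} {y : X.Ob V} {z : X.Ob W}
    (p : X.of x ⟶ X.of y) {g : G.arr.Ob V} (e : A.mo y = G.t g) (b : X.of (A.sm y g e) ⟶ X.of z)
    {g' : G.arr.Ob U} (e' : A.mo x = G.t g') (m : G.arr.of g' ⟶ G.arr.of g)
    (hm : X.pr p = G.arr.pr m) :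
    A.arrowComp (A.arrowOf p) (A.cls g e b) = A.cls g' e' (A.smHom p m e' e hm ≫ b) := by
  rw [arrowOf, A.cls_comp_mk _ _ _ g e b g' m (by simp [A.coh.eps_pr, hm]), compAux]
  refine A.cls_eq_iff.2 ⟨(G.coh.lam (A.mo x) g' e').hom, by rw [G.coh.lam_pr, pr_id], ?_⟩
  rw [← A.coh.one_mid x g' (A.mo x) rfl e', Category.assoc, ← Category.assoc (A.smHom _ _ _ _ _),
    A.smHom_comp]
  simp

theorem moment_lift (A : Action G X) {x : X.Ob U} {y : X.Ob V} (p : X.of x ⟶ X.of y)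
    {g : G.arr.Ob V} (e : A.mo y = G.t g) {g' : G.arr.Ob U} (m : G.arr.of g' ⟶ G.arr.of g)
    (hm : X.pr p = G.arr.pr m) : A.mo x = G.t g' := by
  change A.moment.val x = G.tgt.val g'
  rw [← A.moment.val_eq p, ← G.tgt.val_eq m, hm]
  exact congrArg _ e

/-- Arrows `j` of a 1-free action are determined by `p · j`. -/
theorem OneFree.hom_ext {A : Action G X} (hA : A.OneFree) {x : X.Ob U} {y : X.Ob V}
    {p : X.of x ⟶ X.of y} {g : G.arr.Ob U} {g' : G.arr.Ob V} {e : A.mo x = G.t g}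
    {e' : A.mo y = G.t g'} {j j' : G.arr.of g ⟶ G.arr.of g'} {hj : X.pr p = G.arr.pr j}
    {hj' : X.pr p = G.arr.pr j'} (h : A.smHom p j e e' hj = A.smHom p j' e e' hj') : j = j' := by
  obtain ⟨g'', l, hl⟩ := lift_exists g' (X.pr p)
  obtain ⟨c, rfl, hc⟩ := factor_exists l j (𝟙 U) (by rw [hl, hj]; simp)
  obtain ⟨c', rfl, hc'⟩ := factor_exists l j' (𝟙 U) (by rw [hl, hj']; simp)
  have e'' := A.moment_lift p e' l hl.symm
  have key : ∀ (d : G.arr.of g ⟶ G.arr.of g'') (hd : G.arr.pr d = 𝟙 U)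
      (hp : X.pr p = G.arr.pr (d ≫ l)), A.smHom p (d ≫ l) e e' hp =
      A.smHom (𝟙 (X.of x)) d e e'' (by rw [pr_id, hd]) ≫ A.smHom p l e'' e' hl.symm := by
    intro d hd hp
    rw [A.smHom_comp]
    simp
  rw [key c hc, key c' hc'] at h
  rw [hA x g g'' e e'' c c' _ _ (factor_unique _ h (by simp))]

section sep

variable (A : Action G X)

/-- Local isomorphisms between two arrows `[g, b]` and `[g', b']` of the prequotient. -/
structure LocalIso {x y : X.Ob U} {g g' : G.arr.Ob U} (e : A.mo x = G.t g) (e' : A.mo x = G.t g')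
    (b : X.of (A.sm x g e) ⟶ X.of y) (b' : X.of (A.sm x g' e') ⟶ X.of y) where
  W : Man.{u}
  z : X.Ob W
  h : G.arr.Ob W
  p : X.of z ⟶ X.of x
  m : G.arr.of h ⟶ G.arr.of g
  ψ : G.arr.of h ⟶ G.arr.of g'
  hm : X.pr p = G.arr.pr m
  hψ : X.pr p = G.arr.pr ψ
  mo : A.mo z = G.t h
  eq : A.smHom p ψ mo e' hψ ≫ b' = A.smHom p m mo e hm ≫ b

variable {A} (hA : A.OneFree)
include hA

theorem LocalIso.compatible {x y : X.Ob U} {g g' : G.arr.Ob U} {e : A.mo x = G.t g}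
    {e' : A.mo x = G.t g'} {b : X.of (A.sm x g e) ⟶ X.of y} {b' : X.of (A.sm x g' e') ⟶ X.of y}
    (hb' : X.pr b' = 𝟙 U) (κ₁ κ₂ : LocalIso A e e' b b') {T : Man.{u}} (t : G.arr.Ob T)
    (s : G.arr.of t ⟶ G.arr.of κ₁.h) (s' : G.arr.of t ⟶ G.arr.of κ₂.h)
    (hs : s ≫ κ₁.m = s' ≫ κ₂.m) : s ≫ κ₁.ψ = s' ≫ κ₂.ψ := by
  have hi' := isIso_of_pr b' hb'
  obtain ⟨W₁, z₁, h₁, p₁, m₁, ψ₁, hm₁, hψ₁, i₁, E₁⟩ := κ₁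
  obtain ⟨W₂, z₂, h₂, p₂, m₂, ψ₂, hm₂, hψ₂, i₂, E₂⟩ := κ₂
  dsimp only at s s' hs ⊢
  obtain ⟨z₀, r, hr⟩ := lift_exists z₁ (G.arr.pr s)
  obtain ⟨r', hr', hrp⟩ := factor_exists p₂ (r ≫ p₁) (G.arr.pr s') (by
    have := congrArg G.arr.pr hs
    rw [pr_comp, pr_comp] at this
    rw [pr_comp, hr, hm₂, hm₁, this])
  have et : A.mo z₀ = G.t t := A.moment_lift r i₁ s hr
  have H₁ : A.smHom (r ≫ p₁) (s ≫ ψ₁) et e' (by simp [hr, hψ₁]) ≫ b' =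
      A.smHom (r ≫ p₁) (s ≫ m₁) et e (by simp [hr, hm₁]) ≫ b := by
    rw [← A.smHom_comp r s et i₁ hr p₁ ψ₁ e' hψ₁,
      ← A.smHom_comp r s et i₁ hr p₁ m₁ e hm₁, Category.assoc, E₁, Category.assoc]
  have H₂ : A.smHom (r' ≫ p₂) (s' ≫ ψ₂) et e' (by simp [hrp, hψ₂]) ≫ b' =
      A.smHom (r' ≫ p₂) (s' ≫ m₂) et e (by simp [hrp, hm₂]) ≫ b := by
    rw [← A.smHom_comp r' s' et i₂ hrp p₂ ψ₂ e' hψ₂,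
      ← A.smHom_comp r' s' et i₂ hrp p₂ m₂ e hm₂, Category.assoc, E₂, Category.assoc]
  simp only [hr', ← hs, ← H₁] at H₂
  rw [cancel_mono] at H₂
  exact (hA.hom_ext H₂).symm

/-- Equality of arrows of the prequotient is local. -/
theorem OneFree.cls_eq_of_locally (hG : G.arr.IsPrestack) (hX : X.IsPrestack) {x y : X.Ob U}
    {g g' : G.arr.Ob U} (e : A.mo x = G.t g) (e' : A.mo x = G.t g')
    (b : X.of (A.sm x g e) ⟶ X.of y) (b' : X.of (A.sm x g' e') ⟶ X.of y) (hb : X.pr b = 𝟙 U)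
    (hb' : X.pr b' = 𝟙 U) {S : Sieve U} (hS : S ∈ Man.topology U)
    (h : ∀ {W : Man.{u}} (z : X.Ob W) (p : X.of z ⟶ X.of x), S (X.pr p) →
      A.arrowComp (A.arrowOf p) (A.cls g e b) = A.arrowComp (A.arrowOf p) (A.cls g' e' b')) :
    A.cls g e b = A.cls g' e' b' := by
  have hcov : Man.Covering fun κ : LocalIso A e e' b b' => X.pr κ.p := by
    refine Man.covering_of_mem hS ?_
    intro T t ht
    obtain ⟨z, p, hp⟩ := lift_exists x t
    obtain ⟨h₁, m, hm⟩ := lift_exists g t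
    obtain ⟨h₂, l, hl⟩ := lift_exists g' t
    have hm' : X.pr p = G.arr.pr m := hp.trans hm.symm
    have hl' : X.pr p = G.arr.pr l := hp.trans hl.symm
    have := h z p (by rwa [hp])
    rw [A.arrowOf_comp_cls p e b (A.moment_lift p e m hm') m hm',
      A.arrowOf_comp_cls p e' b' (A.moment_lift p e' l hl') l hl'] at this
    obtain ⟨j, hj, hh⟩ := A.cls_eq_iff.1 this
    refine ⟨⟨T, z, h₁, p, m, j ≫ l, hm', by rw [pr_comp, ← hj, hl']; simp,
      A.moment_lift p e m hm', ?_⟩, 𝟙 T, by simpa using hp⟩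
    rw [← hh, ← Category.assoc, A.smHom_comp]
    simp
  obtain ⟨φ, hφ, hφ'⟩ := hG.exists_glue (x := g) (y := g') (𝟙 U)
    (fun κ : LocalIso A e e' b b' => κ.m) (by simpa only [LocalIso.hm] using hcov)
    (fun κ => κ.ψ) (fun κ => by rw [← κ.hm, ← κ.hψ, Category.comp_id])
    (fun κ₁ κ₂ T t s s' hs => LocalIso.compatible hA hb' κ₁ κ₂ t s s' hs)
  refine A.cls_eq_iff.2 ⟨φ, by rw [hφ, pr_id], ?_⟩
  refine hX.hom_ext (by rw [pr_comp, A.pr_smHom, hb', hb]; simp)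
    (fun κ : LocalIso A e e' b b' => A.smHom κ.p κ.m κ.mo e κ.hm) ?_ ?_
  · simpa only [A.pr_smHom] using hcov
  · intro κ
    rw [← κ.eq, ← Category.assoc, A.smHom_comp]
    simp only [Category.comp_id, hφ']

end sep

end Action

end StackyQuotient

end

noncomputable section

universe w w' k

namespace StackyQuotient

namespace Action

variable {G : CfgGroupoid.{w, u}} {X : CFG.{w, u}} {U V W : Man.{u}}

/-- Two arrows to `x · g` over it, from objects of the form `x · g`, become comparable over a
common object of this form. -/
theorem _root_.StackyQuotient.PreAction.exists_common (A : PreAction G X) {Z Z' T : Man.{u}}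
    {x : X.Ob U} {g : G.arr.Ob U} {z : X.Ob Z} {h : G.arr.Ob Z} {z' : X.Ob Z'} {h' : G.arr.Ob Z'}
    (p : X.of z ⟶ X.of x) (q : G.arr.of h ⟶ G.arr.of g) (e : A.mo z = G.t h) (e₀ : A.mo x = G.t g)
    (hp : X.pr p = G.arr.pr q) (p' : X.of z' ⟶ X.of x) (q' : G.arr.of h' ⟶ G.arr.of g)
    (e' : A.mo z' = G.t h') (hp' : X.pr p' = G.arr.pr q') {t : X.Ob T}
    (s : X.of t ⟶ X.of (A.sm z h e)) (s' : X.of t ⟶ X.of (A.sm z' h' e'))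
    (hs : s ≫ A.smHom p q e e₀ hp = s' ≫ A.smHom p' q' e' e₀ hp') :
    ∃ (y : X.Ob T) (k : G.arr.Ob T) (m : A.mo y = G.t k) (r : X.of y ⟶ X.of z)
      (a : G.arr.of k ⟶ G.arr.of h) (hr : X.pr r = G.arr.pr a) (r' : X.of y ⟶ X.of z')
      (a' : G.arr.of k ⟶ G.arr.of h') (hr' : X.pr r' = G.arr.pr a')
      (c : X.of t ⟶ X.of (A.sm y k m)), c ≫ A.smHom r a m e hr = s ∧
      c ≫ A.smHom r' a' m e' hr' = s' ∧ r ≫ p = r' ≫ p' ∧ a ≫ q = a' ≫ q' := by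
  obtain ⟨⟨y, k, m⟩, ⟨r, a, hr⟩, ⟨r', a', hr'⟩, c, hc, hc₁, hc₂, hρ⟩ := A.act.exists_common
    (pullHom p q e e₀ hp) (pullHom p' q' e' e₀ hp') s s' hs
  exact ⟨y, k, m, r, a, hr, r', a', hr', c, hc₁, hc₂, congrArg PairHom.fst hρ,
    congrArg PairHom.snd hρ⟩

/-- A compatible family of arrows of the prequotient on the members of a sieve. -/
structure ArrowFamily (A : Action G X) (x y : X.Ob U) (S : Sieve U) where
  arrow : ∀ {W : Man.{u}} (z : X.Ob W) (p : X.of z ⟶ X.of x), S (X.pr p) → A.Arrow z y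
  pr_arrow : ∀ {W : Man.{u}} (z : X.Ob W) (p : X.of z ⟶ X.of x) (hp : S (X.pr p)),
    A.arrowPr (arrow z p hp) = X.pr p
  compat : ∀ {W W' : Man.{u}} (z : X.Ob W) (p : X.of z ⟶ X.of x) (hp : S (X.pr p)) (z' : X.Ob W')
    (s : X.of z' ⟶ X.of z) (h : S (X.pr (s ≫ p))),
    arrow z' (s ≫ p) h = A.arrowComp (A.arrowOf s) (arrow z p hp)

/-- A representative of a member of a family of arrows. -/
structure ArrowFamily.Rep {A : Action G X} {x y : X.Ob U} {S : Sieve U}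
    (ψ : A.ArrowFamily x y S) where
  W : Man.{u}
  z : X.Ob W
  p : X.of z ⟶ X.of x
  hp : S (X.pr p)
  g : G.arr.Ob W
  e : A.mo z = G.t g
  b : X.of (A.sm z g e) ⟶ X.of y
  eq : A.cls g e b = ψ.arrow z p hp

namespace ArrowFamily

variable {A : Action G X} {x y : X.Ob U} {S : Sieve U} {ψ : A.ArrowFamily x y S}

theorem exists_rep {W : Man.{u}} (z : X.Ob W) (p : X.of z ⟶ X.of x) (hp : S (X.pr p)) :
    ∃ (g : G.arr.Ob W) (e : A.mo z = G.t g) (b : X.of (A.sm z g e) ⟶ X.of y),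
      A.cls g e b = ψ.arrow z p hp := by
  have : ∀ a : A.Arrow z y, ∃ (g : G.arr.Ob W) (e : A.mo z = G.t g)
      (b : X.of (A.sm z g e) ⟶ X.of y), A.cls g e b = a := fun a =>
    Quotient.inductionOn a fun ⟨g, e, b⟩ => ⟨g, e, b, rfl⟩
  exact this _

theorem Rep.pr_b (i : ψ.Rep) : X.pr i.b = X.pr i.p := by
  rw [← ψ.pr_arrow i.z i.p i.hp, ← i.eq, A.arrowPr_cls]

/-- The relation of the descent datum for `g` given by a family of arrows `[g, b]`. -/
def Rep.Rel (i j : ψ.Rep) {T : Man.{u}} {t : G.arr.Ob T} (a : G.arr.of t ⟶ G.arr.of i.g)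
    (b : G.arr.of t ⟶ G.arr.of j.g) : Prop :=
  ∃ (z : X.Ob T) (s : X.of z ⟶ X.of i.z) (s' : X.of z ⟶ X.of j.z) (e : A.mo z = G.t t)
    (hs : X.pr s = G.arr.pr a) (hs' : X.pr s' = G.arr.pr b), s ≫ i.p = s' ≫ j.p ∧
    A.smHom s a e i.e hs ≫ i.b = A.smHom s' b e j.e hs' ≫ j.b

theorem Rep.Rel.eq {i j : ψ.Rep} {T : Man.{u}} {t : G.arr.Ob T} {a : G.arr.of t ⟶ G.arr.of i.g}
    {b : G.arr.of t ⟶ G.arr.of j.g} (h : Rep.Rel i j a b) {z : X.Ob T} (s : X.of z ⟶ X.of i.z)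
    (s' : X.of z ⟶ X.of j.z) (e : A.mo z = G.t t)
    (hs : X.pr s = G.arr.pr a) (hs' : X.pr s' = G.arr.pr b) (hh : s ≫ i.p = s' ≫ j.p) :
    A.smHom s a e i.e hs ≫ i.b = A.smHom s' b e j.e hs' ≫ j.b := by
  obtain ⟨z', r, r', e', hr, hr', hh', H⟩ := h
  obtain ⟨c, hc, hc'⟩ := factor_exists r s (𝟙 T) (by rw [hr, hs]; simp)
  have hc₂ : c ≫ r' = s' := by
    refine factor_unique j.p ?_ (by rw [pr_comp, hc', hr', hs']; simp)
    rw [Category.assoc, ← hh', ← Category.assoc, hc, hh]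
  subst hc hc₂
  have : ∀ (k : ψ.Rep) (d : G.arr.of t ⟶ G.arr.of k.g) (q : X.of z' ⟶ X.of k.z)
      (hq : X.pr q = G.arr.pr d) (hq' : X.pr (c ≫ q) = G.arr.pr d), A.smHom (c ≫ q) d e k.e hq' =
      A.smHom c (𝟙 _) e e' (by simp [hc']) ≫ A.smHom q d e' k.e hq := by
    intro k d q hq hq'
    rw [A.smHom_comp]
    simp
  rw [this i a r hr, this j b r' hr', Category.assoc, H, Category.assoc]

theorem Rep.exists_rel (i j : ψ.Rep) {T : Man.{u}} {t : G.arr.Ob T}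
    (a : G.arr.of t ⟶ G.arr.of i.g) (f : T ⟶ j.W)
    (hf : G.arr.pr a ≫ X.pr i.p = f ≫ X.pr j.p) :
    ∃ b : G.arr.of t ⟶ G.arr.of j.g, G.arr.pr b = f ∧ Rep.Rel i j a b := by
  obtain ⟨z, s, hs⟩ := lift_exists i.z (G.arr.pr a)
  obtain ⟨s', hss, hs'⟩ := factor_exists j.p (s ≫ i.p) f (by rw [pr_comp, hs, hf])
  obtain ⟨h, l, hl⟩ := lift_exists j.g f
  have et := A.moment_lift s i.e a hs
  have hl' := hs'.trans hl.symm
  have eh := A.moment_lift s' j.e l hl'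
  have hS : S (X.pr (s ≫ i.p)) := by rw [pr_comp]; exact S.downward_closed i.hp _
  have e₁ := ψ.compat i.z i.p i.hp z s hS
  have e₂ := ψ.compat j.z j.p j.hp z s' (by rwa [hss])
  simp only [hss] at e₂
  rw [e₁, ← i.eq, ← j.eq, A.arrowOf_comp_cls s i.e i.b et a hs,
    A.arrowOf_comp_cls s' j.e j.b eh l hl'] at e₂
  obtain ⟨k, hk, hh⟩ := A.cls_eq_iff.1 e₂
  refine ⟨k ≫ l, by rw [pr_comp, ← hk, hl]; simp, z, s, s', et, hs,
    by rw [pr_comp, ← hk, hl']; simp, hss.symm, ?_⟩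
  rw [← hh, ← Category.assoc, A.smHom_comp]
  simp

theorem Rep.covering (ψ : A.ArrowFamily x y S) (hS : S ∈ Man.topology U) :
    Man.Covering fun i : ψ.Rep => X.pr i.p := by
  refine Man.covering_of_mem hS ?_
  intro T t ht
  obtain ⟨z, p, hp⟩ := lift_exists x t
  obtain ⟨g, e, b, h⟩ := exists_rep (ψ := ψ) z p (by rwa [hp])
  exact ⟨⟨T, z, p, by rwa [hp], g, e, b, h⟩, 𝟙 T, by simpa using hp⟩

/-- The descent datum for `g` given by a family of arrows `[g, b]`. -/
def descent (hA : A.OneFree) (ψ : A.ArrowFamily x y S) (hS : S ∈ Man.topology U) :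
    Descent.{u, w} G.arr U where
  K := ψ.Rep
  W i := i.W
  f i := X.pr i.p
  cov := Rep.covering ψ hS
  ob i := i.g
  rel {T t i j} a b := Rep.Rel i j a b
  pr_rel := by
    rintro T t i j a b ⟨z, s, s', e, hs, hs', h, -⟩
    rw [← hs, ← hs', ← pr_comp, ← pr_comp, h]
  exists_rel {T t i} a j f hf := Rep.exists_rel i j a f hf
  comp_rel := by
    rintro T T' t t' i j c a b ⟨z, s, s', e, hs, hs', h, H⟩
    obtain ⟨z', r, hr⟩ := lift_exists z (G.arr.pr c)
    have e' := A.moment_lift r e c hr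
    refine ⟨z', r ≫ s, r ≫ s', e', by simp [hr, hs], by simp [hr, hs'],
      by rw [Category.assoc, h, Category.assoc], ?_⟩
    rw [← A.smHom_comp r c e' e hr s a _ hs, ← A.smHom_comp r c e' e hr s' b _ hs',
      Category.assoc, H, Category.assoc]
  rel_symm := by
    rintro T t i j a b ⟨z, s, s', e, hs, hs', h, H⟩
    exact ⟨z, s', s, e, hs', hs, h.symm, H.symm⟩
  rel_trans := by
    rintro T t i j l a b c ⟨z, s, s', e, hs, hs', h, H⟩ h₂
    obtain ⟨z₂, r, r', e₂, hr, hr', hh, H₂⟩ := id h₂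
    obtain ⟨d, hd, hd'⟩ := factor_exists r s' (𝟙 T) (by rw [hr, hs']; simp)
    have hdr : X.pr (d ≫ r') = G.arr.pr c := by rw [pr_comp, hd', hr']; simp
    have h₃ : s' ≫ j.p = (d ≫ r') ≫ l.p := by rw [← hd, Category.assoc, hh, Category.assoc]
    exact ⟨z, s, d ≫ r', e, hs, hdr, h.trans h₃,
      H.trans (Rep.Rel.eq h₂ s' (d ≫ r') e hs' hdr h₃)⟩
  eq_of_rel := by
    rintro T t i a b ⟨z, s, s', e, hs, hs', h, H⟩ hab
    obtain rfl := factor_unique i.p h (by rw [hs, hs', hab])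
    exact hA.hom_ext (factor_unique i.b H (by simp))

/-- Arrows of the prequotient of a 1-free action glue. -/
theorem exists_glue (hA : A.OneFree) (hG : G.arr.IsStack) (hX : X.IsPrestack)
    (ψ : A.ArrowFamily x y S) (hS : S ∈ Man.topology U) :
    ∃ a : A.Arrow x y, A.arrowPr a = 𝟙 U ∧ ∀ {W : Man.{u}} (z : X.Ob W) (p : X.of z ⟶ X.of x)
      (hp : S (X.pr p)), A.arrowComp (A.arrowOf p) a = ψ.arrow z p hp := by
  obtain ⟨g, q, hq, hrel⟩ := hG.effective (descent hA ψ hS)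
  change ∀ i : ψ.Rep, G.arr.of i.g ⟶ G.arr.of g at q
  replace hq : ∀ i : ψ.Rep, X.pr i.p = G.arr.pr (q i) := fun i => (hq i).symm
  replace hrel : ∀ {T : Man.{u}} {t : G.arr.Ob T} {i j : ψ.Rep} (a : G.arr.of t ⟶ G.arr.of i.g)
      (b : G.arr.of t ⟶ G.arr.of j.g), Rep.Rel i j a b → a ≫ q i = b ≫ q j := hrel
  have e : A.mo x = G.t g := by
    refine Man.hom_ext_of_covering (Rep.covering ψ hS) fun i => ?_
    refine (A.moment.val_eq i.p).trans (i.e.trans ?_)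
    rw [hq]
    exact (G.tgt.val_eq (q i)).symm
  obtain ⟨b, hb, hb'⟩ := hX.exists_glue (x := A.sm x g e) (y := y) (𝟙 U)
    (fun i : ψ.Rep => A.smHom i.p (q i) i.e e (hq i))
    (by simpa only [A.pr_smHom] using Rep.covering ψ hS) (fun i => i.b)
    (fun i => by rw [i.pr_b, A.pr_smHom, Category.comp_id]) (by
    intro i j T t s s' hs
    obtain ⟨z, h, m, r, a, hr, r', a', hr', k, rfl, rfl, h₁, h₂⟩ :=
      A.exists_common i.p (q i) i.e e (hq i) j.p (q j) j.e (hq j) s s' hs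
    obtain ⟨a'', ha, hR⟩ := Rep.exists_rel i j a (X.pr r') (by
      refine (congrArg (· ≫ X.pr i.p) hr).symm.trans ?_
      exact (pr_comp _ _).symm.trans ((congrArg X.pr h₁).trans (pr_comp _ _)))
    obtain rfl : a'' = a' := factor_unique (q j) ((hrel _ _ hR).symm.trans h₂) (ha.trans hr')
    rw [Category.assoc, hR.eq r r' m hr hr' h₁, Category.assoc])
  refine ⟨A.cls g e b, hb, fun {W} z p hp => ?_⟩
  obtain ⟨g', e', b', h⟩ := exists_rep (ψ := ψ) z p hp
  let i : ψ.Rep := ⟨W, z, p, hp, g', e', b', h⟩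
  rw [A.arrowOf_comp_cls p e b e' (q i) (hq i), ← h]
  exact congrArg _ (hb' i)

end ArrowFamily

/-- The prequotient of a 1-free action on a prestack is a prestack. -/
theorem OneFree.preq_isPrestack {A : Action G X} (hA : A.OneFree) (hG : G.arr.IsStack)
    (hX : X.IsPrestack) : A.preq.IsPrestack := by
  have hG₁ : G.arr.IsPrestack := hG.1
  apply isPrestack_of
  · intro U (x : X.Ob U) (y : X.Ob U) (φ : A.Arrow x y) (φ' : A.Arrow x y) (hφ : A.arrowPr φ = 𝟙 U)
      (hφ' : A.arrowPr φ' = 𝟙 U) S hS h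
    induction φ using Quotient.inductionOn with | _ a =>
    induction φ' using Quotient.inductionOn with | _ a' =>
    obtain ⟨g, e, b⟩ := a
    obtain ⟨g', e', b'⟩ := a'
    refine hA.cls_eq_of_locally hG₁ hX e e' b b' hφ hφ' hS fun z p hp => ?_
    refine h z (A.arrowOf p) ?_
    change S.arrows (A.arrowPr (A.arrowOf p))
    rwa [A.arrowPr_arrowOf]
  · intro U (x : X.Ob U) (y : X.Ob U) S hS ψ hψ hc
    let Ψ : A.ArrowFamily x y S :=
      { arrow := fun z p hp => ψ z (A.arrowOf p) (by
          change S.arrows (A.arrowPr (A.arrowOf p))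
          rwa [A.arrowPr_arrowOf])
        pr_arrow := fun z p hp => (hψ z _ _).trans (A.arrowPr_arrowOf p)
        compat := fun z p hp z' s h => by
          have hs : S.arrows (A.arrowPr (A.arrowComp (A.arrowOf s) (A.arrowOf p))) := by
            rw [← A.arrowOf_comp, A.arrowPr_arrowOf]; exact h
          have := hc (A.quot.obj z) (A.arrowOf p) (by
            change S.arrows (A.arrowPr (A.arrowOf p)); rwa [A.arrowPr_arrowOf]) (A.quot.obj z')
            (A.arrowOf s) hs
          refine Eq.trans ?_ this
          congr 1
          exact A.arrowOf_comp s p }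
    obtain ⟨a, ha, ha'⟩ := Ψ.exists_glue hA hG hX hS
    refine ⟨a, ha, ?_⟩
    intro W (z : X.Ob W) (r : A.Arrow z x) (hr : S.arrows (A.arrowPr r))
    change A.arrowComp r a = ψ z r hr
    induction r using Quotient.inductionOn with | _ r =>
    obtain ⟨k, e, c⟩ := r
    change S.arrows (X.pr c) at hr
    have h₁ := ha' (A.sm z k e) c hr
    have h₂ : A.cls k e c = A.arrowComp (A.gammaArrow z k e) (A.arrowOf c) := A.cls_eq_gamma k e c
    change A.arrowComp (A.cls k e c) a = ψ z (A.cls k e c) hr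
    have hc' : ∀ (d : A.Arrow z x) (hd : S.arrows (A.arrowPr d)),
        d = A.arrowComp (A.gammaArrow z k e) (A.arrowOf c) →
        ψ z d hd = A.arrowComp (A.gammaArrow z k e) (Ψ.arrow (A.sm z k e) c hr) := by
      intro d hd hd'
      subst hd'
      exact hc (A.quot.obj (A.sm z k e)) (A.quot.map c) _ (A.quot.obj z) (A.gamma z k e) _
    refine Eq.trans ?_ (hc' (A.cls k e c) hr h₂).symm
    rw [← h₁, ← A.arrowComp_assoc, ← h₂]

end Action

end StackyQuotient

end

noncomputable section

universe w w' k

namespace StackyQuotient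

namespace CFG

/-- The image of a descent datum. -/
def Descent.map {P : CFG.{w, u}} {S : CFG.{w', u}} (F : Mor P S) {U : Man.{u}}
    (d : Descent.{u, w, k} P U) : Descent.{u, w', k} S U where
  K := d.K
  W := d.W
  f := d.f
  cov := d.cov
  ob i := F.obj (d.ob i)
  rel {T t i j} a b := ∃ (x : P.Ob T) (e : S.of t ⟶ S.of (F.obj x)) (c : P.of x ⟶ P.of (d.ob i))
    (c' : P.of x ⟶ P.of (d.ob j)), S.pr e = 𝟙 T ∧ e ≫ F.map c = a ∧ e ≫ F.map c' = b ∧ d.rel c c'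
  pr_rel := by
    rintro T t i j a b ⟨x, e, c, c', he, rfl, rfl, h⟩
    rw [pr_comp, pr_comp, he, F.pr_map, F.pr_map, Category.id_comp, Category.id_comp, d.pr_rel h]
  exists_rel := by
    intro T t i a j g hg
    obtain ⟨x, c, hc⟩ := lift_exists (d.ob i) (S.pr a)
    obtain ⟨e, he, he'⟩ := factor_exists (F.map c) a (𝟙 T) (by rw [F.pr_map, hc]; simp)
    obtain ⟨c', hc', h⟩ := d.exists_rel c j g (by rw [hc, hg])
    exact ⟨e ≫ F.map c', by rw [pr_comp, he', F.pr_map, hc']; simp, x, e, c, c', he', he, rfl, h⟩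
  comp_rel := by
    rintro T T' t t' i j s a b ⟨x, e, c, c', he, rfl, rfl, h⟩
    obtain ⟨x', r, hr⟩ := lift_exists x (S.pr s)
    obtain ⟨e', he', hp⟩ := factor_exists (F.map r) (s ≫ e) (𝟙 T') (by
      rw [F.pr_map, hr, pr_comp, he]; simp)
    exact ⟨x', e', r ≫ c, r ≫ c', hp, by rw [F.map_comp, reassoc_of% he'],
      by rw [F.map_comp, reassoc_of% he'], d.comp_rel r h⟩
  rel_symm := by
    rintro T t i j a b ⟨x, e, c, c', he, h₁, h₂, h⟩
    exact ⟨x, e, c', c, he, h₂, h₁, d.rel_symm h⟩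
  rel_trans := by
    rintro T t i j l a b c ⟨x, e, m, m', he, h₁, h₂, h⟩ ⟨y, e', n, n', he', h₁', h₂', h'⟩
    have hm : P.pr m' = S.pr b := by rw [← h₂, pr_comp, he, F.pr_map]; simp
    have hn : P.pr n = S.pr b := by rw [← h₁', pr_comp, he', F.pr_map]; simp
    obtain ⟨q, hq, hq'⟩ := factor_exists n m' (𝟙 T) (by rw [hm, hn]; simp)
    have hqe : e ≫ F.map q = e' := by
      refine factor_unique (F.map n) ?_ (by rw [pr_comp, he, he', F.pr_map, hq']; simp)
      rw [Category.assoc, ← F.map_comp, hq, h₂, h₁']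
    refine ⟨x, e, m, q ≫ n', he, h₁, by rw [F.map_comp, ← Category.assoc, hqe, h₂'],
      d.rel_trans h ?_⟩
    rw [← hq]
    exact d.comp_rel q h'
  eq_of_rel := by
    rintro T t i a b ⟨x, e, c, c', he, rfl, rfl, h⟩ hab
    rw [d.eq_of_rel h]
    rw [pr_comp, pr_comp, F.pr_map, F.pr_map, he] at hab
    simpa using hab

section product

variable {X Y : CFG.{w, u}}

/-- The first projection. -/
def fstMor (X Y : CFG.{w, u}) : Mor (prod X Y) X where
  obj p := obFst p
  map a := homFst a
  map_id _ := rfl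
  map_comp _ _ := rfl
  pr_map _ := rfl

/-- The second projection. -/
def sndMor (X Y : CFG.{w, u}) : Mor (prod X Y) Y where
  obj p := obSnd p
  map a := homSnd a
  map_id _ := rfl
  map_comp _ _ := rfl
  pr_map a := homSnd_pr a

theorem IsPrestack.exists_glue_map {P S : CFG.{w, u}} (F : Mor P S) (hS : S.IsPrestack)
    {U : Man.{u}} {x y : P.Ob U} {C : Sieve U} (hC : C ∈ Man.topology U)
    (ψ : ∀ {W : Man.{u}} (z : P.Ob W) (r : P.of z ⟶ P.of x), C (P.pr r) → (P.of z ⟶ P.of y))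
    (hψ : ∀ {W : Man.{u}} (z : P.Ob W) (r : P.of z ⟶ P.of x) (h : C (P.pr r)),
        P.pr (ψ z r h) = P.pr r)
    (hc : ∀ {W : Man.{u}} (z : P.Ob W) (r : P.of z ⟶ P.of x) (h : C (P.pr r)) {W' : Man.{u}}
        (z' : P.Ob W') (s : P.of z' ⟶ P.of z) (h' : C (P.pr (s ≫ r))),
        ψ z' (s ≫ r) h' = s ≫ ψ z r h) :
    ∃ φ : S.of (F.obj x) ⟶ S.of (F.obj y), S.pr φ = 𝟙 U ∧
      ∀ {W : Man.{u}} (z : P.Ob W) (r : P.of z ⟶ P.of x) (h : C (P.pr r)),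
        F.map r ≫ φ = F.map (ψ z r h) := by
  obtain ⟨φ, hφ, hφ'⟩ := hS.exists_glue (x := F.obj x) (y := F.obj y) (𝟙 U)
    (fun κ : Σ (W : Man.{u}) (z : P.Ob W), { r : P.of z ⟶ P.of x // C (P.pr r) } =>
      F.map κ.2.2.1) (by
    refine Man.covering_of_mem hC ?_
    intro T t ht
    obtain ⟨z, r, hr⟩ := lift_exists x t
    exact ⟨⟨T, z, r, by rwa [hr]⟩, 𝟙 T, by simpa [F.pr_map] using hr⟩)
    (fun κ => F.map (ψ κ.2.1 κ.2.2.1 κ.2.2.2))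
    (fun κ => by rw [F.pr_map, F.pr_map, hψ, Category.comp_id]) (by
    rintro ⟨W₁, z₁, r₁, h₁⟩ ⟨W₂, z₂, r₂, h₂⟩ T t s s' hs
    obtain ⟨x₀, ρ, ρ', e, -, rfl, rfl, hρ⟩ := F.exists_common r₁ r₂ s s' hs
    have h₀ : C (P.pr (ρ ≫ r₁)) := by rw [pr_comp]; exact C.downward_closed h₁ _
    have h₀' : C (P.pr (ρ' ≫ r₂)) := by rw [pr_comp]; exact C.downward_closed h₂ _
    have e₁ := hc z₁ r₁ h₁ x₀ ρ h₀
    have e₂ := hc z₂ r₂ h₂ x₀ ρ' h₀'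
    simp only [hρ] at e₁
    dsimp only
    rw [Category.assoc, Category.assoc, ← F.map_comp, ← F.map_comp, ← e₁, ← e₂])
  exact ⟨φ, hφ, fun z r h => hφ' ⟨_, z, r, h⟩⟩

theorem IsPrestack.prod (hX : X.IsPrestack) (hY : Y.IsPrestack) : (prod X Y).IsPrestack := by
  apply isPrestack_of
  · intro U x y φ φ' hφ hφ' C hC h
    have key : ∀ {S : CFG.{w, u}} (F : Mor (CFG.prod X Y) S), S.IsPrestack → F.map φ = F.map φ' := by
      intro S F hS
      refine hS.hom_ext (by rw [F.pr_map, F.pr_map, hφ, hφ'])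
        (fun κ : Σ (W : Man.{u}) (z : (CFG.prod X Y).Ob W),
          { r : (CFG.prod X Y).of z ⟶ (CFG.prod X Y).of x // C ((CFG.prod X Y).pr r) } =>
          F.map κ.2.2.1) ?_ ?_
      · refine Man.covering_of_mem hC ?_
        intro T t ht
        obtain ⟨z, r, hr⟩ := lift_exists x t
        exact ⟨⟨T, z, r, by rwa [hr]⟩, 𝟙 T, by simpa [F.pr_map] using hr⟩
      · rintro ⟨W, z, r, hr⟩
        dsimp only
        rw [← F.map_comp, ← F.map_comp, h z r hr]
    exact CFG.hom_ext (key (fstMor X Y) hX) (key (sndMor X Y) hY)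
  · intro U x y C hC ψ hψ hc
    obtain ⟨φ₁, h₁, h₁'⟩ := hX.exists_glue_map (fstMor X Y) hC ψ hψ hc
    obtain ⟨φ₂, h₂, h₂'⟩ := hY.exists_glue_map (sndMor X Y) hC ψ hψ hc
    exact ⟨prodHom φ₁ φ₂ (h₁.trans h₂.symm), h₁, fun z r h => CFG.hom_ext (h₁' z r h) (h₂' z r h)⟩

/-- The product of two stacks is a stack. -/
theorem IsStack.prod (hX : X.IsStack) (hY : Y.IsStack) : (prod X Y).IsStack := by
  have hX₁ : X.IsPrestack := hX.1
  have hY₁ : Y.IsPrestack := hY.1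
  refine isStack_of (IsPrestack.prod hX₁ hY₁) ?_
  intro U d
  obtain ⟨y₁, p₁, h₁, h₁'⟩ := hX.effective (d.map (fstMor X Y))
  obtain ⟨y₂, p₂, h₂, h₂'⟩ := hY.effective (d.map (sndMor X Y))
  refine ⟨prodOb y₁ y₂, fun i => prodHom (p₁ i) (p₂ i) ((h₁ i).trans (h₂ i).symm), h₁, ?_⟩
  intro T t i j a b hab
  exact CFG.hom_ext (h₁' (homFst a) (homFst b) ⟨t, 𝟙 _, a, b, X.pr_id _, Category.id_comp _,
    Category.id_comp _, hab⟩) (h₂' (homSnd a) (homSnd b) ⟨t, 𝟙 _, a, b, Y.pr_id _,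
    Category.id_comp _, Category.id_comp _, hab⟩)

end product

end CFG

namespace Action

variable {G H : CfgGroupoid.{w, u}} {X : CFG.{w, u}}

theorem OneFree.left {A : Action (G.prod H) X} (hA : A.OneFree) : A.left.OneFree := by
  intro U x g g' e e' j j' hj hj' h
  have := hA x (prodOb g (H.one (A.mo₂ x))) (prodOb g' (H.one (A.mo₂ x)))
    (Man.prod_ext e (H.t_one _).symm) (Man.prod_ext e' (H.t_one _).symm)
    (prodHom j (H.oneHom (X.pr (𝟙 (X.of x))) _ _ (A.mo₂_eq _))
      (hj.symm.trans (H.pr_oneHom _ _ _ _).symm))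
    (prodHom j' (H.oneHom (X.pr (𝟙 (X.of x))) _ _ (A.mo₂_eq _))
      (hj'.symm.trans (H.pr_oneHom _ _ _ _).symm)) hj hj' h
  exact congrArg homFst this

end Action

theorem CfgGroupoid.IsStacky.prod {G H : CfgGroupoid.{w, u}} (hG : G.IsStacky) (hH : H.IsStacky) :
    (G.prod H).IsStacky := by
  have hG' : G.arr.IsStack := hG
  have hH' : H.arr.IsStack := hH
  exact IsStack.prod hG' hH'

end StackyQuotient

end

noncomputable section

universe w w' k

namespace StackyQuotient

namespace CfgGroupoid

variable {G : CfgGroupoid.{w, u}} {U : Man.{u}}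

theorem assoc_one_right (g g' : G.arr.Ob U) (p p' : U ⟶ G.M) (f : U ⟶ U) (hf : f = 𝟙 U)
    (h : f ≫ p' = p) (e : G.s g = G.t g') (e' : G.s g' = p) (e'' : G.s (G.mul g g' e) = p') :
    (G.coh.assoc g g' (G.one p) e (e'.trans (G.t_one p).symm)).hom ≫
      G.mulHom (𝟙 _) (G.oneHom f p p' h) ((G.s_mul g g' e).trans (e'.trans (G.t_one p).symm))
        (e''.trans (G.t_one p').symm) (by simp [hf]) ≫
      (G.coh.rho (G.mul g g' e) p' e'').hom =
    G.mulHom (𝟙 _) (G.coh.rho g' p e').hom (e.trans (G.t_mul _ _ _).symm) e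
      (by rw [pr_id, G.coh.rho_pr]) ≫ 𝟙 _ := by
  subst hf e'
  obtain rfl : p' = G.s g' := by rw [← h, Category.id_comp]
  simp only [G.oneHom_id, G.mulHom_id, Category.id_comp, Category.comp_id]
  exact G.coh.one_right g g' _ e rfl

theorem assoc_one_one (h : G.arr.Ob U) (p q : U ⟶ G.M) (e : p = q) (e' : q = G.t h) :
    (G.coh.assoc (G.one p) (G.one q) h ((G.s_one p).trans (e.trans (G.t_one q).symm))
        ((G.s_one q).trans e')).hom ≫
      G.mulHom (G.oneOne p q e).hom (𝟙 _) ((G.s_mul _ _ _).trans ((G.s_one q).trans e'))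
        ((G.s_one p).trans (e.trans e')) (by simp) ≫
      (G.coh.lam p h (e.trans e')).hom =
    G.mulHom (𝟙 _) (G.coh.lam q h e').hom
        ((G.s_one p).trans (e.trans ((G.t_mul _ _ _).trans (G.t_one q)).symm))
        ((G.s_one p).trans (e.trans e')) (by rw [pr_id, G.coh.lam_pr]) ≫
      (G.coh.lam p h (e.trans e')).hom := by
  rw [← Category.assoc]
  congr 1
  exact G.coh.one_mid (G.one p) h q ((G.s_one p).trans e) e'

theorem assoc_one_mul_one (h : G.arr.Ob U) (p q q' : U ⟶ G.M) (f : U ⟶ U) (hf : f = 𝟙 U)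
    (hq : f ≫ q' = q) (e : p = G.t h) (e' : G.s h = q) (e'' : G.s h = q') :
    (G.coh.assoc (G.one p) h (G.one q) ((G.s_one p).trans e) (e'.trans (G.t_one q).symm)).hom ≫
      G.mulHom (G.coh.lam p h e).hom (G.oneHom f q q' hq)
        ((G.s_mul _ _ _).trans (e'.trans (G.t_one q).symm)) (e''.trans (G.t_one q').symm)
        (by rw [G.coh.lam_pr, G.pr_oneHom, hf]) ≫
      (G.coh.rho h q' e'').hom =
    G.mulHom (𝟙 _) (G.coh.rho h q e').hom ((G.s_one p).trans (e.trans (G.t_mul _ _ _).symm))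
      ((G.s_one p).trans e) (by rw [pr_id, G.coh.rho_pr]) ≫ (G.coh.lam p h e).hom := by
  subst hf e' e''
  have h₁ := G.coh.one_left p h (G.one (G.s h)) e (G.t_one _).symm
  have h₂ := lam_nat_of (G := G) p _ (e.trans (G.t_mul h (G.one (G.s h)) (G.t_one _).symm).symm) p h e
    (G.coh.rho h _ rfl).hom (G.coh.rho_pr _ _ _) (Category.id_comp p)
  simp only [G.oneHom_id] at h₂ ⊢
  rw [h₂, ← h₁, Category.assoc]

theorem assoc_mul_one_one (h : G.arr.Ob U) (p q q' : U ⟶ G.M) (f : U ⟶ U) (hf : f = 𝟙 U)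
    (hq : f ≫ q' = q) (e : G.s h = p) (e' : p = q) (e'' : G.s h = q') :
    (G.coh.assoc h (G.one p) (G.one q) (e.trans (G.t_one p).symm)
        ((G.s_one p).trans (e'.trans (G.t_one q).symm))).hom ≫
      G.mulHom (G.coh.rho h p e).hom (G.oneHom f q q' hq)
        ((G.s_mul _ _ _).trans ((G.s_one p).trans (e'.trans (G.t_one q).symm)))
        (e''.trans (G.t_one q').symm) (by rw [G.coh.rho_pr, G.pr_oneHom, hf]) ≫
      (G.coh.rho h q' e'').hom =
    G.mulHom (𝟙 _) (G.oneOne p q e').hom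
        (e.trans ((G.t_mul _ _ _).trans (G.t_one p)).symm) (e.trans (G.t_one p).symm) (by simp) ≫
      (G.coh.rho h p e).hom := by
  subst hf e e''
  subst e'
  simp only [G.oneHom_id]
  have h₀ : (G.oneOne (G.s h) (G.s h) rfl).hom = (G.coh.lam (G.s h) _ (G.t_one _).symm).hom :=
    G.rho_one _
  rw [← Category.assoc, G.coh.one_mid h (G.one (G.s h)) (G.s h) rfl (G.t_one _).symm]
  simp only [h₀]

theorem lam_one_comp (p q : U ⟶ G.M) (f : U ⟶ U) (hf : f = 𝟙 U) (h : f ≫ p = q) (e : p = q) :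
    (G.coh.lam p (G.one q) (e.trans (G.t_one q).symm)).hom ≫ G.oneHom f q p h =
      (G.coh.rho (G.one p) q ((G.s_one p).trans e)).hom := by
  subst hf e
  rw [G.oneHom_id, Category.comp_id, G.rho_one]

end CfgGroupoid

namespace Action

section mu

variable {G : CfgGroupoid.{w, u}} {X : CFG.{w, u}} {U V W : Man.{u}} (A : Action G X)

/-- The arrow `(x · g) · g' ⟶ x · k` given by an arrow `g · g' ⟶ k`. -/
def mu (x : X.Ob U) {g g' k : G.arr.Ob U} (e : A.mo x = G.t g) (i : G.s g = G.t g')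
    (e' : A.mo x = G.t k) (j : G.arr.of (G.mul g g' i) ⟶ G.arr.of k) (hj : G.arr.pr j = 𝟙 U) :
    X.of (A.sm (A.sm x g e) g' ((A.mo_sm x g e).trans i)) ⟶ X.of (A.sm x k e') :=
  (A.coh.beta x g g' e i).inv ≫
    A.smHom (𝟙 (X.of x)) j (e.trans (G.t_mul g g' i).symm) e' (by rw [hj, pr_id])

@[simp] theorem mu_pr (x : X.Ob U) {g g' k : G.arr.Ob U} (e : A.mo x = G.t g) (i : G.s g = G.t g')
    (e' : A.mo x = G.t k) (j : G.arr.of (G.mul g g' i) ⟶ G.arr.of k) (hj : G.arr.pr j = 𝟙 U) :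
    X.pr (A.mu x e i e' j hj) = 𝟙 U := by
  rw [mu, pr_comp, pr_inv _ (A.coh.beta_pr _ _ _ _ _)]
  simp

theorem beta_comp_mu (x : X.Ob U) {g g' k : G.arr.Ob U} (e : A.mo x = G.t g) (i : G.s g = G.t g')
    (e' : A.mo x = G.t k) (j : G.arr.of (G.mul g g' i) ⟶ G.arr.of k) (hj : G.arr.pr j = 𝟙 U) :
    (A.coh.beta x g g' e i).hom ≫ A.mu x e i e' j hj =
      A.smHom (𝟙 (X.of x)) j (e.trans (G.t_mul g g' i).symm) e' (by rw [hj, pr_id]) := by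
  rw [mu, Iso.hom_inv_id_assoc]

theorem mu_nat {x : X.Ob U} {y : X.Ob V} {g g' k : G.arr.Ob U} {l l' m : G.arr.Ob V}
    (b : X.of x ⟶ X.of y) (a : G.arr.of g ⟶ G.arr.of l) (a' : G.arr.of g' ⟶ G.arr.of l')
    (c : G.arr.of k ⟶ G.arr.of m) (e : A.mo x = G.t g) (i : G.s g = G.t g') (e' : A.mo x = G.t k)
    (f : A.mo y = G.t l) (i' : G.s l = G.t l') (f' : A.mo y = G.t m)
    (j : G.arr.of (G.mul g g' i) ⟶ G.arr.of k) (hj : G.arr.pr j = 𝟙 U)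
    (j' : G.arr.of (G.mul l l' i') ⟶ G.arr.of m) (hj' : G.arr.pr j' = 𝟙 V)
    (ha : X.pr b = G.arr.pr a) (ha' : G.arr.pr a = G.arr.pr a') (hc : X.pr b = G.arr.pr c)
    (H : G.mulHom a a' i i' ha' ≫ j' = j ≫ c) :
    A.smHom (A.smHom b a e f ha) a' ((A.mo_sm x g e).trans i) ((A.mo_sm y l f).trans i')
        ((A.pr_smHom b a e f ha).trans (ha.trans ha')) ≫ A.mu y f i' f' j' hj' =
      A.mu x e i e' j hj ≫ A.smHom b c e' f' hc := by
  rw [← cancel_epi (A.coh.beta x g g' e i).hom, ← Category.assoc, ← A.coh.beta_nat b a a' e i f i'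
    ha ha', Category.assoc, A.beta_comp_mu, ← Category.assoc, A.beta_comp_mu, A.smHom_comp,
    A.smHom_comp]
  simp only [Category.id_comp, Category.comp_id, H]

theorem mu_assoc (x : X.Ob U) {g g' g'' k g₃ l r₀ : G.arr.Ob U} (e : A.mo x = G.t g)
    (i : G.s g = G.t g') (i' : G.s g' = G.t g'') (ek : A.mo x = G.t k) (el : A.mo x = G.t l)
    (j : G.arr.of (G.mul g g' i) ⟶ G.arr.of k) (hj : G.arr.pr j = 𝟙 U)
    (t : G.arr.of g'' ⟶ G.arr.of g₃) (ht : G.arr.pr t = 𝟙 U) (ik : G.s k = G.t g₃)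
    (j' : G.arr.of (G.mul k g₃ ik) ⟶ G.arr.of l) (hj' : G.arr.pr j' = 𝟙 U)
    (r : G.arr.of (G.mul g' g'' i') ⟶ G.arr.of r₀) (hr : G.arr.pr r = 𝟙 U)
    (er : A.mo (A.sm x g e) = G.t r₀) (ir : G.s g = G.t r₀)
    (r' : G.arr.of (G.mul g r₀ ir) ⟶ G.arr.of l) (hr' : G.arr.pr r' = 𝟙 U)
    (H : (G.coh.assoc g g' g'' i i').hom ≫ G.mulHom j t ((G.s_mul g g' i).trans i') ik
        (hj.trans ht.symm) ≫ j' =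
      G.mulHom (𝟙 _) r (i.trans (G.t_mul g' g'' i').symm) ir (by rw [pr_id, hr]) ≫ r') :
    A.smHom (A.mu x e i ek j hj) t ((A.mo_sm _ _ _).trans i') ((A.mo_sm x k ek).trans ik)
        (by rw [mu_pr, ht]) ≫ A.mu x ek ik el j' hj' =
      A.mu (A.sm x g e) ((A.mo_sm x g e).trans i) i' er r hr ≫ A.mu x e ir el r' hr' := by
  have P := A.coh.pentagon x g g' g'' e i i'
  have h₁ : (A.coh.beta x (G.mul g g' i) g'' (e.trans (G.t_mul g g' i).symm)
      ((G.s_mul g g' i).trans i')).hom ≫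
      A.smHom (A.coh.beta x g g' e i).hom (𝟙 (G.arr.of g''))
        (by rw [A.mo_sm, G.s_mul]; exact i') (by rw [A.mo_sm]; exact i')
        (by rw [pr_id, A.coh.beta_pr]) ≫
      A.smHom (A.mu x e i ek j hj) t ((A.mo_sm _ _ _).trans i') ((A.mo_sm x k ek).trans ik)
        (by rw [mu_pr, ht]) ≫ A.mu x ek ik el j' hj' =
      A.smHom (𝟙 (X.of x)) (G.mulHom j t ((G.s_mul g g' i).trans i') ik
        (hj.trans ht.symm) ≫ j') ((e.trans (G.t_mul g g' i).symm).trans (G.t_mul _ _ _).symm) el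
        (by simp [hj, hj']) := by
    rw [← Category.assoc (A.smHom _ _ _ _ _), A.smHom_comp]
    simp only [A.beta_comp_mu, Category.id_comp]
    rw [← Category.assoc, ← A.coh.beta_nat (𝟙 (X.of x)) j t (e.trans (G.t_mul g g' i).symm)
      ((G.s_mul g g' i).trans i') ek ik (by rw [pr_id, hj]) (hj.trans ht.symm), Category.assoc,
      A.beta_comp_mu, A.smHom_comp]
    simp only [Category.id_comp]
  have h₂ : (A.coh.beta x g (G.mul g' g'' i') e (i.trans (G.t_mul g' g'' i').symm)).hom ≫
      (A.coh.beta (A.sm x g e) g' g'' ((A.mo_sm x g e).trans i) i').hom ≫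
      A.mu (A.sm x g e) ((A.mo_sm x g e).trans i) i' er r hr ≫ A.mu x e ir el r' hr' =
      A.smHom (𝟙 (X.of x)) (G.mulHom (𝟙 _) r (i.trans (G.t_mul g' g'' i').symm) ir
        (by rw [pr_id, hr]) ≫ r') (e.trans (G.t_mul _ _ _).symm) el (by simp [hr']) := by
    have N := A.coh.beta_nat (𝟙 (X.of x)) (𝟙 (G.arr.of g)) r e
      (i.trans (G.t_mul g' g'' i').symm) e ir (by simp) (by rw [pr_id, hr])
    simp only [A.smHom_id] at N
    rw [← Category.assoc (A.coh.beta (A.sm x g e) _ _ _ _).hom, A.beta_comp_mu, ← Category.assoc,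
      ← N, Category.assoc, A.beta_comp_mu, A.smHom_comp]
    simp only [Category.id_comp]
  rw [← cancel_epi (A.coh.beta (A.sm x g e) g' g'' ((A.mo_sm x g e).trans i) i').hom,
    ← cancel_epi (A.coh.beta x g (G.mul g' g'' i') e (i.trans (G.t_mul g' g'' i').symm)).hom, h₂,
    ← Category.assoc, P, Category.assoc, Category.assoc, h₁, A.smHom_comp]
  simp only [Category.id_comp, H]

theorem eps_eq_mu (x : X.Ob U) (g : G.arr.Ob U) (p : U ⟶ G.M) (e : A.mo x = G.t g)
    (e' : G.s g = p) :
    (A.coh.eps (A.sm x g e) p ((A.mo_sm x g e).trans e')).hom =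
      A.mu x e (e'.trans (G.t_one p).symm) e (G.coh.rho g p e').hom (G.coh.rho_pr _ _ _) := by
  rw [← cancel_epi (A.coh.beta x g (G.one p) e (e'.trans (G.t_one p).symm)).hom,
    A.coh.one_right, A.beta_comp_mu]

theorem smHom_eps_eq_mu (x : X.Ob U) {g k : G.arr.Ob U} (p : U ⟶ G.M) (e : A.mo x = p)
    (e' : p = G.t g) (t : G.arr.of g ⟶ G.arr.of k) (ht : G.arr.pr t = 𝟙 U) (ek : A.mo x = G.t k) :
    A.smHom (A.coh.eps x p e).hom t ((A.mo_sm _ _ _).trans ((G.s_one p).trans e')) ek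
        (by rw [A.coh.eps_pr, ht]) =
      A.mu x (e.trans (G.t_one p).symm) ((G.s_one p).trans e') ek
        ((G.coh.lam p g e').hom ≫ t) (by rw [pr_comp, G.coh.lam_pr, ht]; simp) := by
  rw [← cancel_epi (A.coh.beta x (G.one p) g (e.trans (G.t_one p).symm)
    ((G.s_one p).trans e')).hom, A.beta_comp_mu]
  have := A.coh.one_mid x g p e e'
  have h : A.smHom (A.coh.eps x p e).hom t ((A.mo_sm _ _ _).trans ((G.s_one p).trans e')) ek
        (by rw [A.coh.eps_pr, ht]) = A.smHom (A.coh.eps x p e).hom (𝟙 (G.arr.of g))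
        (by rw [A.mo_sm, G.s_one]; exact e') (e.trans e') (by rw [pr_id, A.coh.eps_pr]) ≫
        A.smHom (𝟙 (X.of x)) t (e.trans e') ek (by rw [pr_id, ht]) := by
    rw [A.smHom_comp]
    simp
  rw [h, ← Category.assoc, this, A.smHom_comp]
  simp only [Category.id_comp]

end mu

end Action

end StackyQuotient

end

noncomputable section

universe w w' k

namespace StackyQuotient

namespace Action

variable {G H : CfgGroupoid.{w, u}} {X : CFG.{w, u}} {U V W : Man.{u}}
  (A : Action (G.prod H) X)

theorem mo₁_left (x : X.Ob U) (g : G.arr.Ob U) (e : A.mo₁ x = G.t g) :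
    A.mo₁ (A.left.sm x g e) = G.s g := A.mo₁_smL x g e

theorem mo₂_left (x : X.Ob U) (g : G.arr.Ob U) (e : A.mo₁ x = G.t g) :
    A.mo₂ (A.left.sm x g e) = A.mo₂ x := A.mo₂_smL x g e

theorem mo₁_right (x : X.Ob U) (h : H.arr.Ob U) (e : A.mo₂ x = H.t h) :
    A.mo₁ (A.right.sm x h e) = A.mo₁ x :=
  (A.mo₁_sm x (G.one (A.mo₁ x)) h (G.t_one _).symm e).trans (G.s_one _)

theorem mo₂_right (x : X.Ob U) (h : H.arr.Ob U) (e : A.mo₂ x = H.t h) :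
    A.mo₂ (A.right.sm x h e) = H.s h := A.mo₂_sm x (G.one (A.mo₁ x)) h (G.t_one _).symm e

/-- The arrow `(x · (g, h)) · (g', h') ⟶ x · (k, l)` given by arrows `g · g' ⟶ k` and
`h · h' ⟶ l`. -/
def mu₂ (x : X.Ob U) {g g' k : G.arr.Ob U} {h h' l : H.arr.Ob U} (e₁ : A.mo₁ x = G.t g)
    (e₂ : A.mo₂ x = H.t h) (i₁ : G.s g = G.t g') (i₂ : H.s h = H.t h') (f₁ : A.mo₁ x = G.t k)
    (f₂ : A.mo₂ x = H.t l) (j₁ : G.arr.of (G.mul g g' i₁) ⟶ G.arr.of k)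
    (j₂ : H.arr.of (H.mul h h' i₂) ⟶ H.arr.of l) (hj₁ : G.arr.pr j₁ = 𝟙 U)
    (hj₂ : H.arr.pr j₂ = 𝟙 U) :
    X.of (A.sm₂ (A.sm₂ x g h e₁ e₂) g' h' ((A.mo₁_sm x g h e₁ e₂).trans i₁)
      ((A.mo₂_sm x g h e₁ e₂).trans i₂)) ⟶ X.of (A.sm₂ x k l f₁ f₂) :=
  A.mu x (g := prodOb g h) (g' := prodOb g' h') (k := prodOb k l) (Man.prod_ext e₁ e₂)
    (Man.pair_eq i₁ i₂) (Man.prod_ext f₁ f₂) (prodHom j₁ j₂ (hj₁.trans hj₂.symm)) hj₁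

@[simp] theorem mu₂_pr (x : X.Ob U) {g g' k : G.arr.Ob U} {h h' l : H.arr.Ob U}
    (e₁ : A.mo₁ x = G.t g)
    (e₂ : A.mo₂ x = H.t h) (i₁ : G.s g = G.t g') (i₂ : H.s h = H.t h') (f₁ : A.mo₁ x = G.t k)
    (f₂ : A.mo₂ x = H.t l) (j₁ : G.arr.of (G.mul g g' i₁) ⟶ G.arr.of k)
    (j₂ : H.arr.of (H.mul h h' i₂) ⟶ H.arr.of l) (hj₁ : G.arr.pr j₁ = 𝟙 U)
    (hj₂ : H.arr.pr j₂ = 𝟙 U) : X.pr (A.mu₂ x e₁ e₂ i₁ i₂ f₁ f₂ j₁ j₂ hj₁ hj₂) = 𝟙 U :=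
  A.mu_pr (g := prodOb g h) (g' := prodOb g' h') (k := prodOb k l) x (Man.prod_ext e₁ e₂)
    (Man.pair_eq i₁ i₂) (Man.prod_ext f₁ f₂)
    (prodHom j₁ j₂ (hj₁.trans hj₂.symm)) hj₁

theorem mu₂_nat {x : X.Ob U} {y : X.Ob V} {g g' k : G.arr.Ob U} {h h' l : H.arr.Ob U}
    {m m' n : G.arr.Ob V} {p p' q : H.arr.Ob V} (b : X.of x ⟶ X.of y)
    (a₁ : G.arr.of g ⟶ G.arr.of m) (a₂ : H.arr.of h ⟶ H.arr.of p)
    (a₁' : G.arr.of g' ⟶ G.arr.of m') (a₂' : H.arr.of h' ⟶ H.arr.of p')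
    (c₁ : G.arr.of k ⟶ G.arr.of n) (c₂ : H.arr.of l ⟶ H.arr.of q)
    (e₁ : A.mo₁ x = G.t g) (e₂ : A.mo₂ x = H.t h) (i₁ : G.s g = G.t g') (i₂ : H.s h = H.t h')
    (f₁ : A.mo₁ x = G.t k) (f₂ : A.mo₂ x = H.t l)
    (e₁' : A.mo₁ y = G.t m) (e₂' : A.mo₂ y = H.t p) (i₁' : G.s m = G.t m') (i₂' : H.s p = H.t p')
    (f₁' : A.mo₁ y = G.t n) (f₂' : A.mo₂ y = H.t q)
    (j₁ : G.arr.of (G.mul g g' i₁) ⟶ G.arr.of k) (j₂ : H.arr.of (H.mul h h' i₂) ⟶ H.arr.of l)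
    (hj₁ : G.arr.pr j₁ = 𝟙 U) (hj₂ : H.arr.pr j₂ = 𝟙 U)
    (j₁' : G.arr.of (G.mul m m' i₁') ⟶ G.arr.of n) (j₂' : H.arr.of (H.mul p p' i₂') ⟶ H.arr.of q)
    (hj₁' : G.arr.pr j₁' = 𝟙 V) (hj₂' : H.arr.pr j₂' = 𝟙 V)
    (ha₁ : X.pr b = G.arr.pr a₁) (ha₂ : X.pr b = H.arr.pr a₂) (ha₁' : G.arr.pr a₁ = G.arr.pr a₁')
    (ha₂' : H.arr.pr a₂ = H.arr.pr a₂') (hc₁ : X.pr b = G.arr.pr c₁) (hc₂ : X.pr b = H.arr.pr c₂)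
    (H₁ : G.mulHom a₁ a₁' i₁ i₁' ha₁' ≫ j₁' = j₁ ≫ c₁)
    (H₂ : H.mulHom a₂ a₂' i₂ i₂' ha₂' ≫ j₂' = j₂ ≫ c₂) :
    A.smHom₂ (A.smHom₂ b a₁ a₂ e₁ e₂ e₁' e₂' ha₁ ha₂) a₁' a₂' ((A.mo₁_sm x g h e₁ e₂).trans i₁)
        ((A.mo₂_sm x g h e₁ e₂).trans i₂) ((A.mo₁_sm y m p e₁' e₂').trans i₁')
        ((A.mo₂_sm y m p e₁' e₂').trans i₂') ((A.pr_smHom₂ _ _ _ _ _ _ _ _ _).trans (ha₁.trans ha₁'))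
        ((A.pr_smHom₂ _ _ _ _ _ _ _ _ _).trans (ha₂.trans ha₂')) ≫
      A.mu₂ y e₁' e₂' i₁' i₂' f₁' f₂' j₁' j₂' hj₁' hj₂' =
    A.mu₂ x e₁ e₂ i₁ i₂ f₁ f₂ j₁ j₂ hj₁ hj₂ ≫ A.smHom₂ b c₁ c₂ f₁ f₂ f₁' f₂' hc₁ hc₂ :=
  A.mu_nat b (prodHom a₁ a₂ (ha₁.symm.trans ha₂))
    (prodHom a₁' a₂' (ha₁'.symm.trans (ha₁.symm.trans (ha₂.trans ha₂'))))
    (prodHom c₁ c₂ (hc₁.symm.trans hc₂)) (Man.prod_ext e₁ e₂) (Man.pair_eq i₁ i₂)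
    (Man.prod_ext f₁ f₂) (Man.prod_ext e₁' e₂') (Man.pair_eq i₁' i₂') (Man.prod_ext f₁' f₂')
    (prodHom j₁ j₂ (hj₁.trans hj₂.symm)) hj₁ (prodHom j₁' j₂' (hj₁'.trans hj₂'.symm)) hj₁'
    ha₁ ha₁' hc₁ (CFG.hom_ext H₁ H₂)

theorem mu₂_assoc (x : X.Ob U) {g g' g'' k g₃ l r₀ : G.arr.Ob U} {h h' h'' m h₃ n s₀ : H.arr.Ob U}
    (e₁ : A.mo₁ x = G.t g) (e₂ : A.mo₂ x = H.t h) (i₁ : G.s g = G.t g') (i₂ : H.s h = H.t h')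
    (i₁' : G.s g' = G.t g'') (i₂' : H.s h' = H.t h'')
    (ek₁ : A.mo₁ x = G.t k) (ek₂ : A.mo₂ x = H.t m) (el₁ : A.mo₁ x = G.t l)
    (el₂ : A.mo₂ x = H.t n) (j₁ : G.arr.of (G.mul g g' i₁) ⟶ G.arr.of k)
    (j₂ : H.arr.of (H.mul h h' i₂) ⟶ H.arr.of m) (hj₁ : G.arr.pr j₁ = 𝟙 U)
    (hj₂ : H.arr.pr j₂ = 𝟙 U) (t₁ : G.arr.of g'' ⟶ G.arr.of g₃) (t₂ : H.arr.of h'' ⟶ H.arr.of h₃)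
    (ht₁ : G.arr.pr t₁ = 𝟙 U) (ht₂ : H.arr.pr t₂ = 𝟙 U) (ik₁ : G.s k = G.t g₃)
    (ik₂ : H.s m = H.t h₃) (j₁' : G.arr.of (G.mul k g₃ ik₁) ⟶ G.arr.of l)
    (j₂' : H.arr.of (H.mul m h₃ ik₂) ⟶ H.arr.of n) (hj₁' : G.arr.pr j₁' = 𝟙 U)
    (hj₂' : H.arr.pr j₂' = 𝟙 U) (r₁ : G.arr.of (G.mul g' g'' i₁') ⟶ G.arr.of r₀)
    (r₂ : H.arr.of (H.mul h' h'' i₂') ⟶ H.arr.of s₀) (hr₁ : G.arr.pr r₁ = 𝟙 U)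
    (hr₂ : H.arr.pr r₂ = 𝟙 U) (er₁ : A.mo₁ (A.sm₂ x g h e₁ e₂) = G.t r₀)
    (er₂ : A.mo₂ (A.sm₂ x g h e₁ e₂) = H.t s₀) (ir₁ : G.s g = G.t r₀) (ir₂ : H.s h = H.t s₀)
    (r₁' : G.arr.of (G.mul g r₀ ir₁) ⟶ G.arr.of l) (r₂' : H.arr.of (H.mul h s₀ ir₂) ⟶ H.arr.of n)
    (hr₁' : G.arr.pr r₁' = 𝟙 U) (hr₂' : H.arr.pr r₂' = 𝟙 U)
    (H₁ : (G.coh.assoc g g' g'' i₁ i₁').hom ≫ G.mulHom j₁ t₁ ((G.s_mul g g' i₁).trans i₁') ik₁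
        (hj₁.trans ht₁.symm) ≫ j₁' =
      G.mulHom (𝟙 _) r₁ (i₁.trans (G.t_mul g' g'' i₁').symm) ir₁ (by rw [pr_id, hr₁]) ≫ r₁')
    (H₂ : (H.coh.assoc h h' h'' i₂ i₂').hom ≫ H.mulHom j₂ t₂ ((H.s_mul h h' i₂).trans i₂') ik₂
        (hj₂.trans ht₂.symm) ≫ j₂' =
      H.mulHom (𝟙 _) r₂ (i₂.trans (H.t_mul h' h'' i₂').symm) ir₂ (by rw [pr_id, hr₂]) ≫ r₂') :
    A.smHom₂ (A.mu₂ x e₁ e₂ i₁ i₂ ek₁ ek₂ j₁ j₂ hj₁ hj₂) t₁ t₂ ((A.mo₁_sm _ _ _ _ _).trans i₁')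
        ((A.mo₂_sm _ _ _ _ _).trans i₂') ((A.mo₁_sm _ _ _ _ _).trans ik₁)
        ((A.mo₂_sm _ _ _ _ _).trans ik₂) (by rw [mu₂_pr, ht₁]) (by rw [mu₂_pr, ht₂]) ≫
      A.mu₂ x ek₁ ek₂ ik₁ ik₂ el₁ el₂ j₁' j₂' hj₁' hj₂' =
      A.mu₂ (A.sm₂ x g h e₁ e₂) ((A.mo₁_sm _ _ _ _ _).trans i₁) ((A.mo₂_sm _ _ _ _ _).trans i₂)
        i₁' i₂' er₁ er₂ r₁ r₂ hr₁ hr₂ ≫ A.mu₂ x e₁ e₂ ir₁ ir₂ el₁ el₂ r₁' r₂' hr₁' hr₂' :=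
  A.mu_assoc x (g := prodOb g h) (g' := prodOb g' h') (g'' := prodOb g'' h'') (k := prodOb k m)
    (g₃ := prodOb g₃ h₃) (l := prodOb l n) (r₀ := prodOb r₀ s₀)
    (Man.prod_ext e₁ e₂) (Man.pair_eq i₁ i₂) (Man.pair_eq i₁' i₂') (Man.prod_ext ek₁ ek₂)
    (Man.prod_ext el₁ el₂) (prodHom j₁ j₂ (hj₁.trans hj₂.symm)) hj₁
    (prodHom t₁ t₂ (ht₁.trans ht₂.symm)) ht₁ (Man.pair_eq ik₁ ik₂)
    (prodHom j₁' j₂' (hj₁'.trans hj₂'.symm)) hj₁' (prodHom r₁ r₂ (hr₁.trans hr₂.symm)) hr₁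
    (Man.prod_ext er₁ er₂) (Man.pair_eq ir₁ ir₂) (prodHom r₁' r₂' (hr₁'.trans hr₂'.symm)) hr₁'
    (CFG.hom_ext H₁ H₂)

end Action

end StackyQuotient

end

noncomputable section

universe w w' k

namespace StackyQuotient

namespace Action

variable {G H : CfgGroupoid.{w, u}} {X : CFG.{w, u}} {U V W : Man.{u}}
  (A : Action (G.prod H) X)

theorem xi₁_hom (x : X.Ob U) (g : G.arr.Ob U) (h : H.arr.Ob U) (e₁ : A.mo₁ x = G.t g)
    (e₂ : A.mo₂ x = H.t h) : (A.xi₁ x g h e₁ e₂).hom =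
      A.mu₂ x (G.t_one _).symm e₂ ((G.s_one _).trans e₁)
        ((A.mo₂_right x h e₂).symm.trans (H.t_one _).symm) e₁ e₂ (G.coh.lam _ g e₁).hom
        (H.coh.rho h _ (A.mo₂_right x h e₂).symm).hom (G.coh.lam_pr _ _ _) (H.coh.rho_pr _ _ _) :=
  rfl

theorem xi₂_hom (x : X.Ob U) (g : G.arr.Ob U) (h : H.arr.Ob U) (e₁ : A.mo₁ x = G.t g)
    (e₂ : A.mo₂ x = H.t h) : (A.xi₂ x g h e₁ e₂).hom =
      A.mu₂ x e₁ (H.t_one _).symm ((A.mo₁_left x g e₁).symm.trans (G.t_one _).symm)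
        ((H.s_one _).trans e₂) e₁ e₂ (G.coh.rho g _ (A.mo₁_left x g e₁).symm).hom
        (H.coh.lam _ h e₂).hom (G.coh.rho_pr _ _ _) (H.coh.lam_pr _ _ _) :=
  rfl

theorem xi₁_pr (x : X.Ob U) (g : G.arr.Ob U) (h : H.arr.Ob U) (e₁ : A.mo₁ x = G.t g)
    (e₂ : A.mo₂ x = H.t h) : X.pr (A.xi₁ x g h e₁ e₂).hom = 𝟙 U :=
  A.mu₂_pr x (G.t_one _).symm e₂ ((G.s_one _).trans e₁)
    ((A.mo₂_right x h e₂).symm.trans (H.t_one _).symm) e₁ e₂ _ _ (G.coh.lam_pr _ g e₁)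
    (H.coh.rho_pr h _ (A.mo₂_right x h e₂).symm)

theorem xi₂_pr (x : X.Ob U) (g : G.arr.Ob U) (h : H.arr.Ob U) (e₁ : A.mo₁ x = G.t g)
    (e₂ : A.mo₂ x = H.t h) : X.pr (A.xi₂ x g h e₁ e₂).hom = 𝟙 U :=
  A.mu₂_pr x e₁ (H.t_one _).symm ((A.mo₁_left x g e₁).symm.trans (G.t_one _).symm)
    ((H.s_one _).trans e₂) e₁ e₂ _ _ (G.coh.rho_pr g _ (A.mo₁_left x g e₁).symm)
    (H.coh.lam_pr _ h e₂)

@[simp] theorem delta_pr (x : X.Ob U) (g : G.arr.Ob U) (h : H.arr.Ob U) (e₁ : A.mo₁ x = G.t g)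
    (e₂ : A.mo₂ x = H.t h) : X.pr (A.delta x g h e₁ e₂).hom = 𝟙 U := by
  rw [delta, Iso.trans_hom, Iso.symm_hom, pr_comp, A.xi₁_pr, pr_inv _ (A.xi₂_pr _ _ _ _ _)]
  simp

theorem delta_comp_xi₂ (x : X.Ob U) (g : G.arr.Ob U) (h : H.arr.Ob U) (e₁ : A.mo₁ x = G.t g)
    (e₂ : A.mo₂ x = H.t h) :
    (A.delta x g h e₁ e₂).hom ≫ (A.xi₂ x g h e₁ e₂).hom = (A.xi₁ x g h e₁ e₂).hom := by
  rw [delta, Iso.trans_hom, Iso.symm_hom, Category.assoc, Iso.inv_hom_id, Category.comp_id]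

theorem xi₁_nat {x : X.Ob U} {y : X.Ob V} {g : G.arr.Ob U} {l : G.arr.Ob V} {h : H.arr.Ob U}
    {m : H.arr.Ob V} (b : X.of x ⟶ X.of y) (j : G.arr.of g ⟶ G.arr.of l)
    (k : H.arr.of h ⟶ H.arr.of m) (e₁ : A.mo₁ x = G.t g) (e₂ : A.mo₂ x = H.t h)
    (f₁ : A.mo₁ y = G.t l) (f₂ : A.mo₂ y = H.t m) (hj : X.pr b = G.arr.pr j)
    (hk : X.pr b = H.arr.pr k) :
    A.left.smHom (A.right.smHom b k e₂ f₂ hk) j ((A.mo₁_right x h e₂).trans e₁)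
        ((A.mo₁_right y m f₂).trans f₁) ((A.right.pr_smHom _ _ _ _ _).trans hj) ≫
      (A.xi₁ y l m f₁ f₂).hom =
    (A.xi₁ x g h e₁ e₂).hom ≫ A.smHom₂ b j k e₁ e₂ f₁ f₂ hj hk := by
  have hb : X.pr (A.right.smHom b k e₂ f₂ hk) = X.pr b := A.right.pr_smHom _ _ _ _ _
  exact A.mu₂_nat b (G.oneHom (X.pr b) _ _ (A.mo₁_eq b)) k j
    (H.oneHom (X.pr (A.right.smHom b k e₂ f₂ hk)) _ _ (A.mo₂_eq _)) j k
    (G.t_one _).symm e₂ ((G.s_one _).trans e₁)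
    ((A.mo₂_right x h e₂).symm.trans (H.t_one _).symm) e₁ e₂
    (G.t_one _).symm f₂ ((G.s_one _).trans f₁)
    ((A.mo₂_right y m f₂).symm.trans (H.t_one _).symm) f₁ f₂
    _ _ (G.coh.lam_pr _ _ _) (H.coh.rho_pr _ _ _) _ _ (G.coh.lam_pr _ _ _) (H.coh.rho_pr _ _ _)
    (G.pr_oneHom _ _ _ _).symm hk ((G.pr_oneHom _ _ _ _).trans hj)
    (hk.symm.trans (hb.symm.trans (H.pr_oneHom _ _ _ _).symm)) hj hk
    (CfgGroupoid.lam_nat_of _ _ _ _ _ _ j hj.symm (A.mo₁_eq b))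
    (CfgGroupoid.rho_nat_of _ _ _ _ _ _ k (hk.symm.trans hb.symm) (A.mo₂_eq _))

theorem xi₂_nat {x : X.Ob U} {y : X.Ob V} {g : G.arr.Ob U} {l : G.arr.Ob V} {h : H.arr.Ob U}
    {m : H.arr.Ob V} (b : X.of x ⟶ X.of y) (j : G.arr.of g ⟶ G.arr.of l)
    (k : H.arr.of h ⟶ H.arr.of m) (e₁ : A.mo₁ x = G.t g) (e₂ : A.mo₂ x = H.t h)
    (f₁ : A.mo₁ y = G.t l) (f₂ : A.mo₂ y = H.t m) (hj : X.pr b = G.arr.pr j)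
    (hk : X.pr b = H.arr.pr k) :
    A.right.smHom (A.left.smHom b j e₁ f₁ hj) k ((A.mo₂_left x g e₁).trans e₂)
        ((A.mo₂_left y l f₁).trans f₂) ((A.left.pr_smHom _ _ _ _ _).trans hk) ≫
      (A.xi₂ y l m f₁ f₂).hom =
    (A.xi₂ x g h e₁ e₂).hom ≫ A.smHom₂ b j k e₁ e₂ f₁ f₂ hj hk := by
  have hb : X.pr (A.left.smHom b j e₁ f₁ hj) = X.pr b := A.left.pr_smHom _ _ _ _ _
  exact A.mu₂_nat b j (H.oneHom (X.pr b) _ _ (A.mo₂_eq b))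
    (G.oneHom (X.pr (A.left.smHom b j e₁ f₁ hj)) _ _ (A.mo₁_eq _)) k j k
    e₁ (H.t_one _).symm ((A.mo₁_left x g e₁).symm.trans (G.t_one _).symm)
    ((H.s_one _).trans e₂) e₁ e₂ f₁ (H.t_one _).symm
    ((A.mo₁_left y l f₁).symm.trans (G.t_one _).symm) ((H.s_one _).trans f₂) f₁ f₂
    _ _ (G.coh.rho_pr _ _ _) (H.coh.lam_pr _ _ _) _ _ (G.coh.rho_pr _ _ _) (H.coh.lam_pr _ _ _)
    hj (H.pr_oneHom _ _ _ _).symm (hj.symm.trans (hb.symm.trans (G.pr_oneHom _ _ _ _).symm))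
    ((H.pr_oneHom _ _ _ _).trans hk) hj hk
    (CfgGroupoid.rho_nat_of _ _ _ _ _ _ j (hj.symm.trans hb.symm) (A.mo₁_eq _))
    (CfgGroupoid.lam_nat_of _ _ _ _ _ _ k hk.symm (A.mo₂_eq b))

/-- The isomorphism `δ` is natural. -/
theorem delta_nat {x : X.Ob U} {y : X.Ob V} {g : G.arr.Ob U} {l : G.arr.Ob V} {h : H.arr.Ob U}
    {m : H.arr.Ob V} (b : X.of x ⟶ X.of y) (j : G.arr.of g ⟶ G.arr.of l)
    (k : H.arr.of h ⟶ H.arr.of m) (e₁ : A.mo₁ x = G.t g) (e₂ : A.mo₂ x = H.t h)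
    (f₁ : A.mo₁ y = G.t l) (f₂ : A.mo₂ y = H.t m) (hj : X.pr b = G.arr.pr j)
    (hk : X.pr b = H.arr.pr k) :
    A.left.smHom (A.right.smHom b k e₂ f₂ hk) j ((A.mo₁_right x h e₂).trans e₁)
        ((A.mo₁_right y m f₂).trans f₁) ((A.right.pr_smHom _ _ _ _ _).trans hj) ≫
      (A.delta y l m f₁ f₂).hom =
    (A.delta x g h e₁ e₂).hom ≫ A.right.smHom (A.left.smHom b j e₁ f₁ hj) k
      ((A.mo₂_left x g e₁).trans e₂) ((A.mo₂_left y l f₁).trans f₂)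
      ((A.left.pr_smHom _ _ _ _ _).trans hk) := by
  rw [← cancel_mono (A.xi₂ y l m f₁ f₂).hom, Category.assoc, A.delta_comp_xi₂, Category.assoc,
    A.xi₂_nat, A.xi₁_nat, ← Category.assoc, A.delta_comp_xi₂]

theorem delta_beta_aux {C : Type*} [Category C] {c₁ c₂ c₃ c₄ c₅ c₆ c₇ c₈ : C}
    {T : c₁ ⟶ c₂} {t : c₂ ⟶ c₁} {x₂ : c₂ ⟶ c₃} {x₂' : c₁ ⟶ c₄} {N : c₄ ⟶ c₃} {S₂ : c₅ ⟶ c₆}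
    {N' : c₆ ⟶ c₃} {x₁' : c₅ ⟶ c₄} {S₁ : c₇ ⟶ c₆} {b : c₈ ⟶ c₇} {b' : c₇ ⟶ c₈} {x₁ : c₈ ⟶ c₃}
    {d : c₈ ⟶ c₂} {d' : c₅ ⟶ c₁} {D : c₇ ⟶ c₅} (h₁ : T ≫ x₂ = x₂' ≫ N) (h₂ : S₂ ≫ N' = x₁' ≫ N)
    (h₃ : S₁ ≫ N' = b' ≫ x₁) (hd : d ≫ x₂ = x₁) (hd' : d' ≫ x₂' = x₁') (hD : D ≫ S₂ = S₁)
    (hb : b ≫ b' = 𝟙 _) (hT : T ≫ t = 𝟙 _) [IsIso x₂] :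
    d ≫ t = b ≫ D ≫ d' := by
  have : d = (b ≫ D ≫ d') ≫ T := by
    rw [← cancel_mono x₂, hd, Category.assoc, h₁]
    simp only [Category.assoc]
    rw [reassoc_of% hd', ← h₂, reassoc_of% hD, h₃, reassoc_of% hb]
  rw [this]
  simp [hT]

theorem _root_.StackyQuotient.PreAction.smHom_congr {G : CfgGroupoid.{w, u}} {X : CFG.{w, u}}
    (A : PreAction G X) {x : X.Ob U} {x' : X.Ob V} {g : G.arr.Ob U} {g' : G.arr.Ob V}
    {b b' : X.of x ⟶ X.of x'} {j j' : G.arr.of g ⟶ G.arr.of g'} (hb : b = b') (hj : j = j')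
    (e : A.mo x = G.t g) (e' : A.mo x' = G.t g') (hp : X.pr b = G.arr.pr j)
    (hp' : X.pr b' = G.arr.pr j') : A.smHom b j e e' hp = A.smHom b' j' e e' hp' := by
  subst hb hj
  rfl

theorem _root_.StackyQuotient.PreAction.smHom_hom_inv {G : CfgGroupoid.{w, u}} {X : CFG.{w, u}}
    (A : PreAction G X) {x x' : X.Ob U} (b : X.of x ≅ X.of x') (g : G.arr.Ob U)
    (e : A.mo x = G.t g) (e' : A.mo x' = G.t g) (hb : X.pr b.hom = 𝟙 U) :
    A.smHom b.hom (𝟙 (G.arr.of g)) e e' (hb.trans (G.arr.pr_id _).symm) ≫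
      A.smHom b.inv (𝟙 (G.arr.of g)) e' e ((pr_inv _ hb).trans (G.arr.pr_id _).symm) = 𝟙 _ := by
  rw [A.smHom_comp]
  simp only [Iso.hom_inv_id, Category.comp_id]
  exact A.smHom_id _ _ _

theorem mu_congr {G : CfgGroupoid.{w, u}} {X : CFG.{w, u}} (A : Action G X) (x : X.Ob U)
    {g g' k : G.arr.Ob U} (e : A.mo x = G.t g) (i : G.s g = G.t g') (f : A.mo x = G.t k)
    {j j' : G.arr.of (G.mul g g' i) ⟶ G.arr.of k} (h : j = j') (hj : G.arr.pr j = 𝟙 U)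
    (hj' : G.arr.pr j' = 𝟙 U) : A.mu x e i f j hj = A.mu x e i f j' hj' := by
  subst h
  rfl

section beta

variable (x : X.Ob U) (g g' : G.arr.Ob U) (h : H.arr.Ob U) (e₁ : A.mo₁ x = G.t g)
  (e₂ : A.mo₂ x = H.t h) (i : G.s g = G.t g')

theorem left_beta_inv_pr : X.pr (A.left.coh.beta x g g' e₁ i).inv = 𝟙 U :=
  pr_inv _ (A.left.coh.beta_pr _ _ _ _ _)

theorem betaL_inv_comp_xi₂ :
    A.right.smHom (A.left.coh.beta x g g' e₁ i).inv (𝟙 (H.arr.of h))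
        ((A.mo₂_left _ _ _).trans ((A.mo₂_left x g e₁).trans e₂)) ((A.mo₂_left x _ _).trans e₂)
        (by rw [A.left_beta_inv_pr, pr_id]) ≫
      (A.xi₂ x (G.mul g g' i) h (e₁.trans (G.t_mul g g' i).symm) e₂).hom =
    (A.xi₂ (A.left.sm x g e₁) g' h ((A.mo₁_left x g e₁).trans i)
      ((A.mo₂_left x g e₁).trans e₂)).hom ≫
      A.mu₂ x (g' := g') e₁ (H.t_one _).symm i ((H.s_one _).trans e₂)
        (e₁.trans (G.t_mul g g' i).symm) e₂ (𝟙 _) (H.coh.lam (A.mo₂ x) h e₂).hom (G.arr.pr_id _)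
        (H.coh.lam_pr _ _ _) := by
  have hp := A.left_beta_inv_pr x g g' e₁ i
  exact A.mu₂_assoc x e₁ (H.t_one _).symm i
    ((H.s_one _).trans ((A.mo₂_left x g e₁).symm.trans (H.t_one _).symm))
    ((A.mo₁_left _ _ _).symm.trans (G.t_one _).symm)
    ((H.s_one _).trans ((A.mo₂_left x g e₁).trans e₂)) (e₁.trans (G.t_mul g g' i).symm)
    (H.t_one _).symm (e₁.trans (G.t_mul g g' i).symm) e₂ (𝟙 _)
    (H.oneOne _ _ (A.mo₂_left x g e₁).symm).hom (G.arr.pr_id _) (H.oneOne_pr _ _ _)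
    (G.oneHom (X.pr (A.left.coh.beta x g g' e₁ i).inv) _ _ (A.mo₁_eq _)) (𝟙 _)
    ((G.pr_oneHom _ _ _ _).trans hp) (H.arr.pr_id _)
    ((A.mo₁_left x _ (e₁.trans (G.t_mul g g' i).symm)).symm.trans (G.t_one _).symm)
    ((H.s_one _).trans e₂) (G.coh.rho _ _ (A.mo₁_left x _ _).symm).hom (H.coh.lam _ h e₂).hom
    (G.coh.rho_pr _ _ _) (H.coh.lam_pr _ _ _) (G.coh.rho g' _ (A.mo₁_left _ _ _).symm).hom
    (H.coh.lam _ h ((A.mo₂_left x g e₁).trans e₂)).hom (G.coh.rho_pr _ _ _) (H.coh.lam_pr _ _ _)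
    ((A.mo₁_left x g e₁).trans i) ((A.mo₂_left x g e₁).trans e₂) i ((H.s_one _).trans e₂) (𝟙 _)
    (H.coh.lam (A.mo₂ x) h e₂).hom (G.arr.pr_id _) (H.coh.lam_pr _ _ _)
    (G.assoc_one_right g g' _ _ _ hp _ i _ _) (H.assoc_one_one h _ _ _ _)

theorem left_xi₂_comp :
    A.left.smHom (A.xi₂ x g h e₁ e₂).hom (𝟙 (G.arr.of g'))
        ((A.mo₁_right _ _ _).trans ((A.mo₁_left x g e₁).trans i))
        ((A.mo₁_sm x g h e₁ e₂).trans i) (by rw [A.xi₂_pr, pr_id]) ≫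
      A.mu₂ x (g' := g') e₁ e₂ i ((A.mo₂_sm x g h e₁ e₂).symm.trans (H.t_one _).symm)
        (e₁.trans (G.t_mul g g' i).symm) e₂ (𝟙 _)
        (H.coh.rho h _ (A.mo₂_sm x g h e₁ e₂).symm).hom (G.arr.pr_id _) (H.coh.rho_pr _ _ _) =
    (A.xi₁ (A.left.sm x g e₁) g' h ((A.mo₁_left x g e₁).trans i)
      ((A.mo₂_left x g e₁).trans e₂)).hom ≫
      A.mu₂ x (g' := g') e₁ (H.t_one _).symm i ((H.s_one _).trans e₂)
        (e₁.trans (G.t_mul g g' i).symm) e₂ (𝟙 _) (H.coh.lam (A.mo₂ x) h e₂).hom (G.arr.pr_id _)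
        (H.coh.lam_pr _ _ _) := by
  have hp := A.xi₂_pr x g h e₁ e₂
  exact A.mu₂_assoc x e₁ (H.t_one _).symm ((A.mo₁_left x g e₁).symm.trans (G.t_one _).symm)
    ((H.s_one _).trans e₂) ((G.s_one _).trans ((A.mo₁_left x g e₁).trans i))
    ((A.mo₂_right _ _ ((A.mo₂_left x g e₁).trans e₂)).symm.trans (H.t_one _).symm) e₁ e₂
    (e₁.trans (G.t_mul g g' i).symm) e₂
    (G.coh.rho g _ (A.mo₁_left _ _ _).symm).hom (H.coh.lam _ h e₂).hom
    (G.coh.rho_pr _ _ _) (H.coh.lam_pr _ _ _) (𝟙 _)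
    (H.oneHom (X.pr (A.xi₂ x g h e₁ e₂).hom) _ _ (A.mo₂_eq _)) (G.arr.pr_id _)
    ((H.pr_oneHom _ _ _ _).trans hp) i ((A.mo₂_sm x g h e₁ e₂).symm.trans (H.t_one _).symm)
    (𝟙 _) (H.coh.rho h _ (A.mo₂_sm x g h e₁ e₂).symm).hom (G.arr.pr_id _) (H.coh.rho_pr _ _ _)
    (G.coh.lam _ g' ((A.mo₁_left x g e₁).trans i)).hom
    (H.coh.rho h _ (A.mo₂_right _ _ ((A.mo₂_left x g e₁).trans e₂)).symm).hom
    (G.coh.lam_pr _ _ _) (H.coh.rho_pr _ _ _)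
    ((A.mo₁_left x g e₁).trans i) ((A.mo₂_left x g e₁).trans e₂) i ((H.s_one _).trans e₂) (𝟙 _)
    (H.coh.lam (A.mo₂ x) h e₂).hom (G.arr.pr_id _) (H.coh.lam_pr _ _ _)
    ((congrArg (_ ≫ ·) (Category.comp_id _)).trans
      ((G.coh.one_mid g g' _ _ _).trans (Category.comp_id _).symm))
    (H.assoc_one_mul_one h _ _ _ _ hp _ _ _ _)

theorem left_xi₁_comp :
    A.left.smHom (A.xi₁ x g h e₁ e₂).hom (𝟙 (G.arr.of g'))
        ((A.mo₁_left _ _ _).trans i)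
        ((A.mo₁_sm x g h e₁ e₂).trans i) (by rw [A.xi₁_pr, pr_id]) ≫
      A.mu₂ x (g' := g') e₁ e₂ i ((A.mo₂_sm x g h e₁ e₂).symm.trans (H.t_one _).symm)
        (e₁.trans (G.t_mul g g' i).symm) e₂ (𝟙 _)
        (H.coh.rho h _ (A.mo₂_sm x g h e₁ e₂).symm).hom (G.arr.pr_id _) (H.coh.rho_pr _ _ _) =
    (A.left.coh.beta (A.right.sm x h e₂) g g' ((A.mo₁_right x h e₂).trans e₁) i).inv ≫
      (A.xi₁ x (G.mul g g' i) h (e₁.trans (G.t_mul g g' i).symm) e₂).hom := by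
  have hp := A.xi₁_pr x g h e₁ e₂
  exact A.mu₂_assoc x (G.t_one _).symm e₂ ((G.s_one _).trans e₁)
    ((A.mo₂_right x h e₂).symm.trans (H.t_one _).symm) i
    ((H.s_one _).trans ((A.mo₂_left _ _ ((A.mo₁_right x h e₂).trans e₁)).symm.trans
      (H.t_one _).symm)) e₁ e₂ (e₁.trans (G.t_mul g g' i).symm) e₂
    (G.coh.lam _ g e₁).hom (H.coh.rho h _ (A.mo₂_right x h e₂).symm).hom
    (G.coh.lam_pr _ _ _) (H.coh.rho_pr _ _ _) (𝟙 _)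
    (H.oneHom (X.pr (A.xi₁ x g h e₁ e₂).hom) _ _ (A.mo₂_eq _)) (G.arr.pr_id _)
    ((H.pr_oneHom _ _ _ _).trans hp) i ((A.mo₂_sm x g h e₁ e₂).symm.trans (H.t_one _).symm)
    (𝟙 _) (H.coh.rho h _ (A.mo₂_sm x g h e₁ e₂).symm).hom (G.arr.pr_id _) (H.coh.rho_pr _ _ _)
    (𝟙 _) (H.oneOne _ _ (A.mo₂_left _ _ ((A.mo₁_right x h e₂).trans e₁)).symm).hom
    (G.arr.pr_id _) (H.oneOne_pr _ _ _)
    (((A.mo₁_right x h e₂).trans e₁).trans (G.t_mul g g' i).symm) (H.t_one _).symm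
    ((G.s_one _).trans (e₁.trans (G.t_mul g g' i).symm))
    ((A.mo₂_right x h e₂).symm.trans (H.t_one _).symm)
    (G.coh.lam _ _ (e₁.trans (G.t_mul g g' i).symm)).hom
    (H.coh.rho h _ (A.mo₂_right x h e₂).symm).hom (G.coh.lam_pr _ _ _) (H.coh.rho_pr _ _ _)
    ((congrArg (_ ≫ ·) (Category.comp_id _)).trans
      ((G.coh.one_left _ g g' _ _).trans (by
        refine (Category.id_comp _).symm.trans (congrArg (· ≫ _) ?_)
        exact (G.mulHom_id _ _ _).symm)))
    (H.assoc_mul_one_one h _ _ _ _ hp _ _ _ _)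

/-- The isomorphism `δ` is compatible with the associativity 2-isomorphisms for the first
groupoid. -/
theorem delta_left_beta :
    (A.delta x (G.mul g g' i) h (e₁.trans (G.t_mul g g' i).symm) e₂).hom ≫
      A.right.smHom (A.left.coh.beta x g g' e₁ i).hom (𝟙 (H.arr.of h))
        ((A.mo₂_left x _ _).trans e₂) ((A.mo₂_left _ _ _).trans ((A.mo₂_left x g e₁).trans e₂))
        ((A.left.coh.beta_pr _ _ _ _ _).trans (H.arr.pr_id _).symm) =
    (A.left.coh.beta (A.right.sm x h e₂) g g' ((A.mo₁_right x h e₂).trans e₁) i).hom ≫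
      A.left.smHom (A.delta x g h e₁ e₂).hom (𝟙 (G.arr.of g')) ((A.mo₁_left _ _ _).trans i)
        ((A.mo₁_right _ _ _).trans ((A.mo₁_left x g e₁).trans i)) (by rw [A.delta_pr, pr_id]) ≫
      (A.delta (A.left.sm x g e₁) g' h ((A.mo₁_left x g e₁).trans i)
        ((A.mo₂_left x g e₁).trans e₂)).hom := by
  have hT : A.right.smHom (A.left.coh.beta x g g' e₁ i).inv (𝟙 (H.arr.of h)) _ _ _ ≫
      A.right.smHom (A.left.coh.beta x g g' e₁ i).hom (𝟙 (H.arr.of h)) _ _ _ = 𝟙 _ :=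
    A.right.smHom_hom_inv (A.left.coh.beta x g g' e₁ i).symm h
      ((A.mo₂_left _ _ _).trans ((A.mo₂_left x g e₁).trans e₂)) ((A.mo₂_left x _ _).trans e₂)
      (A.left_beta_inv_pr x g g' e₁ i)
  exact delta_beta_aux (A.betaL_inv_comp_xi₂ x g g' h e₁ e₂ i) (A.left_xi₂_comp x g g' h e₁ e₂ i)
    (A.left_xi₁_comp x g g' h e₁ e₂ i) (A.delta_comp_xi₂ _ _ _ _ _) (A.delta_comp_xi₂ _ _ _ _ _)
    ((A.left.smHom_comp _ _ _ _ _ _ _ _ _).trans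
      (A.left.smHom_congr (A.delta_comp_xi₂ x g h e₁ e₂) (Category.comp_id _) _ _ _ _))
    (Iso.hom_inv_id _) hT

end beta

/-- The isomorphism `δ` is compatible with the identity 2-isomorphisms for the first groupoid. -/
theorem delta_left_eps (x : X.Ob U) (h : H.arr.Ob U) (p : U ⟶ G.M) (e₁ : A.mo₁ x = p)
    (e₂ : A.mo₂ x = H.t h) :
    (A.delta x (G.one p) h (e₁.trans (G.t_one p).symm) e₂).hom ≫
      A.right.smHom (A.left.coh.eps x p e₁).hom (𝟙 (H.arr.of h)) ((A.mo₂_left x _ _).trans e₂) e₂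
        ((A.left.coh.eps_pr _ _ _).trans (H.arr.pr_id _).symm) =
    (A.left.coh.eps (A.right.sm x h e₂) p ((A.mo₁_right x h e₂).trans e₁)).hom := by
  subst e₁
  have hp := A.left.coh.eps_pr x (A.mo₁ x) rfl
  have h₁ : A.right.smHom (A.left.coh.eps x (A.mo₁ x) rfl).hom (𝟙 (H.arr.of h))
        ((A.mo₂_left x _ (G.t_one _).symm).trans e₂) e₂
        ((A.left.coh.eps_pr _ _ _).trans (H.arr.pr_id _).symm) =
      (A.xi₂ x (G.one (A.mo₁ x)) h (G.t_one _).symm e₂).hom := by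
    refine (A.smHom_eps_eq_mu x
      (g := prodOb (G.one (A.mo₁ (A.left.sm x (G.one (A.mo₁ x)) (G.t_one _).symm))) h)
      (k := prodOb (G.one (A.mo₁ x)) h) (Man.pair (A.mo₁ x) (A.mo₂ x)) rfl
      (Man.pair_eq (((A.mo₁_left _ _ (G.t_one _).symm).trans (G.s_one _)).symm.trans
        (G.t_one _).symm) e₂)
      (prodHom (G.oneHom (X.pr (A.left.coh.eps x (A.mo₁ x) rfl).hom) _ _ (A.mo₁_eq _)) (𝟙 _)
        (by rw [G.pr_oneHom, hp, pr_id])) ((G.pr_oneHom _ _ _ _).trans hp)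
      (Man.prod_ext (G.t_one _).symm e₂)).trans ?_
    refine Eq.trans ?_ (A.xi₂_hom x _ h (G.t_one _).symm e₂).symm
    refine A.mu_congr x _ _ _ ?_ _ _
    exact CFG.hom_ext (G.lam_one_comp _ _ _ hp _
      ((A.mo₁_left x _ (G.t_one _).symm).trans (G.s_one _)).symm) (Category.comp_id _)
  have h₂ : (A.left.coh.eps (A.right.sm x h e₂) (A.mo₁ x) (A.mo₁_right x h e₂)).hom =
      (A.xi₁ x (G.one (A.mo₁ x)) h (G.t_one _).symm e₂).hom := by
    refine (A.eps_eq_mu x (prodOb (G.one (A.mo₁ x)) h)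
      (Man.pair (A.mo₁ x) (A.mo₂ (A.right.sm x h e₂)))
      (Man.prod_ext (G.t_one _).symm e₂)
      (Man.pair_eq (G.s_one _) (A.mo₂_right x h e₂).symm)).trans ?_
    refine Eq.trans ?_ (A.xi₁_hom x _ h (G.t_one _).symm e₂).symm
    refine A.mu_congr x _ _ _ ?_ _ _
    exact CFG.hom_ext (G.rho_one _) rfl
  exact (congrArg (_ ≫ ·) h₁).trans ((A.delta_comp_xi₂ x _ h _ e₂).trans h₂.symm)

end Action

end StackyQuotient

end

noncomputable section

universe w w' k

namespace StackyQuotient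

namespace Action

variable {G H : CfgGroupoid.{w, u}} {X : CFG.{w, u}} {U V W : Man.{u}}
  (A : Action (G.prod H) X)

theorem delta_inv_pr (x : X.Ob U) (g : G.arr.Ob U) (h : H.arr.Ob U) (e₁ : A.mo₁ x = G.t g)
    (e₂ : A.mo₂ x = H.t h) : X.pr (A.delta x g h e₁ e₂).inv = 𝟙 U :=
  pr_inv _ (A.delta_pr _ _ _ _ _)

theorem delta_inv_comp_xi₁ (x : X.Ob U) (g : G.arr.Ob U) (h : H.arr.Ob U) (e₁ : A.mo₁ x = G.t g)
    (e₂ : A.mo₂ x = H.t h) :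
    (A.delta x g h e₁ e₂).inv ≫ (A.xi₁ x g h e₁ e₂).hom = (A.xi₂ x g h e₁ e₂).hom := by
  rw [← A.delta_comp_xi₂, Iso.inv_hom_id_assoc]

theorem delta_beta_inv_aux {C : Type*} [Category C] {c₁ c₂ c₃ c₄ c₅ : C}
    {d : c₁ ≅ c₂} {t : c₁ ⟶ c₃} {b : c₂ ≅ c₄} {D : c₄ ⟶ c₅} {D' : c₅ ⟶ c₄}
    {d' : c₃ ≅ c₅} (h : d.inv ≫ t = b.hom ≫ D ≫ d'.inv) (hD : D ≫ D' = 𝟙 _) :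
    d.hom ≫ b.hom = t ≫ d'.hom ≫ D' := by
  have : t ≫ d'.hom = d.hom ≫ b.hom ≫ D := by
    rw [← Iso.inv_comp_eq, reassoc_of% h]
    simp
  rw [reassoc_of% this, hD, Category.comp_id]

section beta

variable (x : X.Ob U) (g : G.arr.Ob U) (h h' : H.arr.Ob U) (e₁ : A.mo₁ x = G.t g)
  (e₂ : A.mo₂ x = H.t h) (i : H.s h = H.t h')

theorem right_beta_inv_pr : X.pr (A.right.coh.beta x h h' e₂ i).inv = 𝟙 U :=
  pr_inv _ (A.right.coh.beta_pr _ _ _ _ _)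

theorem betaR_inv_comp_xi₁ :
    A.left.smHom (A.right.coh.beta x h h' e₂ i).inv (𝟙 (G.arr.of g))
        ((A.mo₁_right _ _ _).trans ((A.mo₁_right x h e₂).trans e₁)) ((A.mo₁_right x _ _).trans e₁)
        ((A.right_beta_inv_pr x h h' e₂ i).trans (G.arr.pr_id _).symm) ≫
      (A.xi₁ x g (H.mul h h' i) e₁ (e₂.trans (H.t_mul h h' i).symm)).hom =
    (A.xi₁ (A.right.sm x h e₂) g h' ((A.mo₁_right x h e₂).trans e₁)
      ((A.mo₂_right x h e₂).trans i)).hom ≫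
      A.mu₂ x (h' := h') (G.t_one _).symm e₂ ((G.s_one _).trans e₁) i e₁
        (e₂.trans (H.t_mul h h' i).symm) (G.coh.lam (A.mo₁ x) g e₁).hom (𝟙 _)
        (G.coh.lam_pr _ _ _) (H.arr.pr_id _) := by
  have hp := A.right_beta_inv_pr x h h' e₂ i
  exact A.mu₂_assoc x (G.t_one _).symm e₂
    ((G.s_one _).trans ((A.mo₁_right x h e₂).symm.trans (G.t_one _).symm)) i
    ((G.s_one _).trans ((A.mo₁_right x h e₂).trans e₁))
    ((A.mo₂_right _ _ _).symm.trans (H.t_one _).symm)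
    (G.t_one _).symm (e₂.trans (H.t_mul h h' i).symm) e₁ (e₂.trans (H.t_mul h h' i).symm)
    (G.oneOne _ _ (A.mo₁_right x h e₂).symm).hom (𝟙 _) (G.oneOne_pr _ _ _) (H.arr.pr_id _)
    (𝟙 _) (H.oneHom (X.pr (A.right.coh.beta x h h' e₂ i).inv) _ _ (A.mo₂_eq _))
    (G.arr.pr_id _) ((H.pr_oneHom _ _ _ _).trans hp)
    ((G.s_one _).trans e₁)
    ((A.mo₂_right x _ (e₂.trans (H.t_mul h h' i).symm)).symm.trans (H.t_one _).symm)
    (G.coh.lam _ g e₁).hom (H.coh.rho _ _ (A.mo₂_right x _ _).symm).hom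
    (G.coh.lam_pr _ _ _) (H.coh.rho_pr _ _ _)
    (G.coh.lam _ g ((A.mo₁_right x h e₂).trans e₁)).hom
    (H.coh.rho h' _ (A.mo₂_right _ _ _).symm).hom (G.coh.lam_pr _ _ _) (H.coh.rho_pr _ _ _)
    ((A.mo₁_right x h e₂).trans e₁) ((A.mo₂_right x h e₂).trans i) ((G.s_one _).trans e₁) i
    (G.coh.lam (A.mo₁ x) g e₁).hom (𝟙 _) (G.coh.lam_pr _ _ _) (H.arr.pr_id _)
    (G.assoc_one_one g _ _ _ _) (H.assoc_one_right h h' _ _ _ hp _ i _ _)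

theorem right_xi₁_comp :
    A.right.smHom (A.xi₁ x g h e₁ e₂).hom (𝟙 (H.arr.of h'))
        ((A.mo₂_left _ _ _).trans ((A.mo₂_right x h e₂).trans i))
        ((A.mo₂_sm x g h e₁ e₂).trans i) ((A.xi₁_pr _ _ _ _ _).trans (H.arr.pr_id _).symm) ≫
      A.mu₂ x (h' := h') e₁ e₂ ((A.mo₁_sm x g h e₁ e₂).symm.trans (G.t_one _).symm) i
        e₁ (e₂.trans (H.t_mul h h' i).symm) (G.coh.rho g _ (A.mo₁_sm x g h e₁ e₂).symm).hom (𝟙 _)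
        (G.coh.rho_pr _ _ _) (H.arr.pr_id _) =
    (A.xi₂ (A.right.sm x h e₂) g h' ((A.mo₁_right x h e₂).trans e₁)
      ((A.mo₂_right x h e₂).trans i)).hom ≫
      A.mu₂ x (h' := h') (G.t_one _).symm e₂ ((G.s_one _).trans e₁) i e₁
        (e₂.trans (H.t_mul h h' i).symm) (G.coh.lam (A.mo₁ x) g e₁).hom (𝟙 _)
        (G.coh.lam_pr _ _ _) (H.arr.pr_id _) := by
  have hp := A.xi₁_pr x g h e₁ e₂
  exact A.mu₂_assoc x (G.t_one _).symm e₂ ((G.s_one _).trans e₁)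
    ((A.mo₂_right x h e₂).symm.trans (H.t_one _).symm)
    ((A.mo₁_left _ _ ((A.mo₁_right x h e₂).trans e₁)).symm.trans (G.t_one _).symm)
    ((H.s_one _).trans ((A.mo₂_right x h e₂).trans i)) e₁ e₂
    e₁ (e₂.trans (H.t_mul h h' i).symm)
    (G.coh.lam _ g e₁).hom (H.coh.rho h _ (A.mo₂_right _ _ _).symm).hom
    (G.coh.lam_pr _ _ _) (H.coh.rho_pr _ _ _)
    (G.oneHom (X.pr (A.xi₁ x g h e₁ e₂).hom) _ _ (A.mo₁_eq _)) (𝟙 _)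
    ((G.pr_oneHom _ _ _ _).trans hp) (H.arr.pr_id _)
    ((A.mo₁_sm x g h e₁ e₂).symm.trans (G.t_one _).symm) i
    (G.coh.rho g _ (A.mo₁_sm x g h e₁ e₂).symm).hom (𝟙 _) (G.coh.rho_pr _ _ _) (H.arr.pr_id _)
    (G.coh.rho g _ (A.mo₁_left _ _ ((A.mo₁_right x h e₂).trans e₁)).symm).hom
    (H.coh.lam _ h' ((A.mo₂_right x h e₂).trans i)).hom
    (G.coh.rho_pr _ _ _) (H.coh.lam_pr _ _ _)
    ((A.mo₁_right x h e₂).trans e₁) ((A.mo₂_right x h e₂).trans i) ((G.s_one _).trans e₁) i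
    (G.coh.lam (A.mo₁ x) g e₁).hom (𝟙 _) (G.coh.lam_pr _ _ _) (H.arr.pr_id _)
    (G.assoc_one_mul_one g _ _ _ _ hp _ _ _ _)
    ((congrArg (_ ≫ ·) (Category.comp_id _)).trans
      ((H.coh.one_mid h h' _ _ _).trans (Category.comp_id _).symm))

theorem right_xi₂_comp :
    A.right.smHom (A.xi₂ x g h e₁ e₂).hom (𝟙 (H.arr.of h'))
        ((A.mo₂_right _ _ _).trans i)
        ((A.mo₂_sm x g h e₁ e₂).trans i) ((A.xi₂_pr _ _ _ _ _).trans (H.arr.pr_id _).symm) ≫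
      A.mu₂ x (h' := h') e₁ e₂ ((A.mo₁_sm x g h e₁ e₂).symm.trans (G.t_one _).symm) i
        e₁ (e₂.trans (H.t_mul h h' i).symm) (G.coh.rho g _ (A.mo₁_sm x g h e₁ e₂).symm).hom (𝟙 _)
        (G.coh.rho_pr _ _ _) (H.arr.pr_id _) =
    (A.right.coh.beta (A.left.sm x g e₁) h h' ((A.mo₂_left x g e₁).trans e₂) i).inv ≫
      (A.xi₂ x g (H.mul h h' i) e₁ (e₂.trans (H.t_mul h h' i).symm)).hom := by
  have hp := A.xi₂_pr x g h e₁ e₂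
  exact A.mu₂_assoc x e₁ (H.t_one _).symm
    ((A.mo₁_left x g e₁).symm.trans (G.t_one _).symm) ((H.s_one _).trans e₂)
    ((G.s_one _).trans ((A.mo₁_right _ _ ((A.mo₂_left x g e₁).trans e₂)).symm.trans
      (G.t_one _).symm)) i e₁ e₂ e₁ (e₂.trans (H.t_mul h h' i).symm)
    (G.coh.rho g _ (A.mo₁_left x g e₁).symm).hom (H.coh.lam _ h e₂).hom
    (G.coh.rho_pr _ _ _) (H.coh.lam_pr _ _ _)
    (G.oneHom (X.pr (A.xi₂ x g h e₁ e₂).hom) _ _ (A.mo₁_eq _)) (𝟙 _)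
    ((G.pr_oneHom _ _ _ _).trans hp) (H.arr.pr_id _)
    ((A.mo₁_sm x g h e₁ e₂).symm.trans (G.t_one _).symm) i
    (G.coh.rho g _ (A.mo₁_sm x g h e₁ e₂).symm).hom (𝟙 _) (G.coh.rho_pr _ _ _) (H.arr.pr_id _)
    (G.oneOne _ _ (A.mo₁_right _ _ ((A.mo₂_left x g e₁).trans e₂)).symm).hom (𝟙 _)
    (G.oneOne_pr _ _ _) (H.arr.pr_id _)
    (G.t_one _).symm (((A.mo₂_left x g e₁).trans e₂).trans (H.t_mul h h' i).symm)
    ((A.mo₁_left x g e₁).symm.trans (G.t_one _).symm)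
    ((H.s_one _).trans (e₂.trans (H.t_mul h h' i).symm))
    (G.coh.rho g _ (A.mo₁_left x g e₁).symm).hom
    (H.coh.lam _ _ (e₂.trans (H.t_mul h h' i).symm)).hom (G.coh.rho_pr _ _ _) (H.coh.lam_pr _ _ _)
    (G.assoc_mul_one_one g _ _ _ _ hp _ _ _ _)
    ((congrArg (_ ≫ ·) (Category.comp_id _)).trans
      ((H.coh.one_left _ h h' _ _).trans (by
        refine (Category.id_comp _).symm.trans (congrArg (· ≫ _) ?_)
        exact (H.mulHom_id _ _ _).symm)))

/-- The isomorphism `δ` is compatible with the associativity 2-isomorphisms for the second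
groupoid. -/
theorem delta_right_beta :
    (A.delta x g (H.mul h h' i) e₁ (e₂.trans (H.t_mul h h' i).symm)).hom ≫
      (A.right.coh.beta (A.left.sm x g e₁) h h' ((A.mo₂_left x g e₁).trans e₂) i).hom =
    A.left.smHom (A.right.coh.beta x h h' e₂ i).hom (𝟙 (G.arr.of g))
        ((A.mo₁_right x _ _).trans e₁) ((A.mo₁_right _ _ _).trans ((A.mo₁_right x h e₂).trans e₁))
        ((A.right.coh.beta_pr _ _ _ _ _).trans (G.arr.pr_id _).symm) ≫
      (A.delta (A.right.sm x h e₂) g h' ((A.mo₁_right x h e₂).trans e₁)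
        ((A.mo₂_right x h e₂).trans i)).hom ≫
      A.right.smHom (A.delta x g h e₁ e₂).hom (𝟙 (H.arr.of h'))
        ((A.mo₂_left _ _ _).trans ((A.mo₂_right x h e₂).trans i)) ((A.mo₂_right _ _ _).trans i)
        ((A.delta_pr _ _ _ _ _).trans (H.arr.pr_id _).symm) := by
  have hT : A.left.smHom (A.right.coh.beta x h h' e₂ i).inv (𝟙 (G.arr.of g)) _ _ _ ≫
      A.left.smHom (A.right.coh.beta x h h' e₂ i).hom (𝟙 (G.arr.of g)) _ _ _ = 𝟙 _ :=
    A.left.smHom_hom_inv (A.right.coh.beta x h h' e₂ i).symm g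
      ((A.mo₁_right _ _ _).trans ((A.mo₁_right x h e₂).trans e₁)) ((A.mo₁_right x _ _).trans e₁)
      (A.right_beta_inv_pr x h h' e₂ i)
  have hS' := A.right.smHom_hom_inv (A.delta x g h e₁ e₂).symm h'
    ((A.mo₂_right _ _ _).trans i) ((A.mo₂_left _ _ _).trans ((A.mo₂_right x h e₂).trans i))
    (A.delta_inv_pr _ _ _ _ _)
  have hd := delta_beta_aux (A.betaR_inv_comp_xi₁ x g h h' e₁ e₂ i)
    (A.right_xi₁_comp x g h h' e₁ e₂ i) (A.right_xi₂_comp x g h h' e₁ e₂ i)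
    (A.delta_inv_comp_xi₁ _ _ _ _ _) (A.delta_inv_comp_xi₁ _ _ _ _ _)
    ((A.right.smHom_comp _ _ _ ((A.mo₂_left _ _ _).trans ((A.mo₂_right x h e₂).trans i))
      ((A.delta_inv_pr x g h e₁ e₂).trans (H.arr.pr_id _).symm) _ _ _ _).trans
      (A.right.smHom_congr (A.delta_inv_comp_xi₁ x g h e₁ e₂) (Category.comp_id _) _ _ _ _))
    (Iso.hom_inv_id _) hT
  exact delta_beta_inv_aux hd hS'

end beta

/-- The isomorphism `δ` is compatible with the identity 2-isomorphisms for the second groupoid. -/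
theorem delta_right_eps (x : X.Ob U) (g : G.arr.Ob U) (p : U ⟶ H.M) (e₁ : A.mo₁ x = G.t g)
    (e₂ : A.mo₂ x = p) :
    (A.delta x g (H.one p) e₁ (e₂.trans (H.t_one p).symm)).hom ≫
      (A.right.coh.eps (A.left.sm x g e₁) p ((A.mo₂_left x g e₁).trans e₂)).hom =
      A.left.smHom (A.right.coh.eps x p e₂).hom (𝟙 (G.arr.of g)) ((A.mo₁_right x _ _).trans e₁) e₁
        ((A.right.coh.eps_pr _ _ _).trans (G.arr.pr_id _).symm) := by
  subst e₂
  have hp := A.right.coh.eps_pr x (A.mo₂ x) rfl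
  have h₁ : A.left.smHom (A.right.coh.eps x (A.mo₂ x) rfl).hom (𝟙 (G.arr.of g))
        ((A.mo₁_right x _ (H.t_one _).symm).trans e₁) e₁
        ((A.right.coh.eps_pr _ _ _).trans (G.arr.pr_id _).symm) =
      (A.xi₁ x g (H.one (A.mo₂ x)) e₁ (H.t_one _).symm).hom := by
    refine (A.smHom_eps_eq_mu x
      (g := prodOb g (H.one (A.mo₂ (A.right.sm x (H.one (A.mo₂ x)) (H.t_one _).symm))))
      (k := prodOb g (H.one (A.mo₂ x))) (Man.pair (A.mo₁ x) (A.mo₂ x)) rfl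
      (Man.pair_eq e₁ (((A.mo₂_right _ _ (H.t_one _).symm).trans (H.s_one _)).symm.trans
        (H.t_one _).symm))
      (prodHom (𝟙 _) (H.oneHom (X.pr (A.right.coh.eps x (A.mo₂ x) rfl).hom) _ _ (A.mo₂_eq _))
        (by rw [H.pr_oneHom, hp, pr_id])) (G.arr.pr_id _)
      (Man.prod_ext e₁ (H.t_one _).symm)).trans ?_
    refine Eq.trans ?_ (A.xi₁_hom x g _ e₁ (H.t_one _).symm).symm
    refine A.mu_congr x _ _ _ ?_ _ _
    exact CFG.hom_ext (Category.comp_id _) (H.lam_one_comp _ _ _ hp _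
      ((A.mo₂_right x _ (H.t_one _).symm).trans (H.s_one _)).symm)
  have h₂ : (A.right.coh.eps (A.left.sm x g e₁) (A.mo₂ x) (A.mo₂_left x g e₁)).hom =
      (A.xi₂ x g (H.one (A.mo₂ x)) e₁ (H.t_one _).symm).hom := by
    refine (A.eps_eq_mu x (prodOb g (H.one (A.mo₂ x)))
      (Man.pair (A.mo₁ (A.left.sm x g e₁)) (A.mo₂ x))
      (Man.prod_ext e₁ (H.t_one _).symm)
      (Man.pair_eq (A.mo₁_left x g e₁).symm (H.s_one _))).trans ?_
    refine Eq.trans ?_ (A.xi₂_hom x g _ e₁ (H.t_one _).symm).symm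
    refine A.mu_congr x _ _ _ ?_ _ _
    exact CFG.hom_ext rfl (H.rho_one _)
  exact (congrArg (_ ≫ ·) h₂).trans ((A.delta_comp_xi₂ x g _ e₁ _).trans h₁.symm)

end Action

end StackyQuotient

end

noncomputable section

universe w w' k

namespace StackyQuotient

namespace Action

variable {G H : CfgGroupoid.{w, u}} {X : CFG.{w, u}} {U V W : Man.{u}}

/-- Two actions on the same category fibred in groupoids which commute up to an isomorphism `δ`
that is compatible with the associativity and identity 2-isomorphisms of both. -/
structure Commuting (L : Action G X) (R : Action H X) where
  moL : ∀ {U : Man.{u}} (x : X.Ob U) (h : H.arr.Ob U) (e : R.mo x = H.t h),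
    L.mo (R.sm x h e) = L.mo x
  moR : ∀ {U : Man.{u}} (x : X.Ob U) (g : G.arr.Ob U) (e : L.mo x = G.t g),
    R.mo (L.sm x g e) = R.mo x
  delta : ∀ {U : Man.{u}} (x : X.Ob U) (g : G.arr.Ob U) (h : H.arr.Ob U) (e₁ : L.mo x = G.t g)
    (e₂ : R.mo x = H.t h), X.of (L.sm (R.sm x h e₂) g ((moL x h e₂).trans e₁)) ⟶
      X.of (R.sm (L.sm x g e₁) h ((moR x g e₁).trans e₂))
  delta_pr : ∀ {U : Man.{u}} (x : X.Ob U) (g : G.arr.Ob U) (h : H.arr.Ob U) (e₁ : L.mo x = G.t g)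
    (e₂ : R.mo x = H.t h), X.pr (delta x g h e₁ e₂) = 𝟙 U
  delta_nat : ∀ {U V : Man.{u}} {x : X.Ob U} {y : X.Ob V} {g : G.arr.Ob U} {l : G.arr.Ob V}
    {h : H.arr.Ob U} {m : H.arr.Ob V} (b : X.of x ⟶ X.of y) (j : G.arr.of g ⟶ G.arr.of l)
    (k : H.arr.of h ⟶ H.arr.of m) (e₁ : L.mo x = G.t g) (e₂ : R.mo x = H.t h)
    (f₁ : L.mo y = G.t l) (f₂ : R.mo y = H.t m) (hj : X.pr b = G.arr.pr j)
    (hk : X.pr b = H.arr.pr k),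
    L.smHom (R.smHom b k e₂ f₂ hk) j ((moL x h e₂).trans e₁) ((moL y m f₂).trans f₁)
        ((R.pr_smHom _ _ _ _ _).trans hj) ≫ delta y l m f₁ f₂ =
      delta x g h e₁ e₂ ≫ R.smHom (L.smHom b j e₁ f₁ hj) k ((moR x g e₁).trans e₂)
        ((moR y l f₁).trans f₂) ((L.pr_smHom _ _ _ _ _).trans hk)
  left_beta : ∀ {U : Man.{u}} (x : X.Ob U) (g g' : G.arr.Ob U) (h : H.arr.Ob U)
    (e₁ : L.mo x = G.t g) (e₂ : R.mo x = H.t h) (i : G.s g = G.t g'),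
    delta x (G.mul g g' i) h (e₁.trans (G.t_mul g g' i).symm) e₂ ≫
      R.smHom (L.coh.beta x g g' e₁ i).hom (𝟙 (H.arr.of h)) ((moR x _ _).trans e₂)
        ((moR _ _ _).trans ((moR x g e₁).trans e₂))
        ((L.coh.beta_pr _ _ _ _ _).trans (H.arr.pr_id _).symm) =
    (L.coh.beta (R.sm x h e₂) g g' ((moL x h e₂).trans e₁) i).hom ≫
      L.smHom (delta x g h e₁ e₂) (𝟙 (G.arr.of g')) ((L.mo_sm _ _ _).trans i)
        ((moL _ _ _).trans ((L.mo_sm x g e₁).trans i))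
        ((delta_pr _ _ _ _ _).trans (G.arr.pr_id _).symm) ≫
      delta (L.sm x g e₁) g' h ((L.mo_sm x g e₁).trans i) ((moR x g e₁).trans e₂)
  left_eps : ∀ {U : Man.{u}} (x : X.Ob U) (h : H.arr.Ob U) (p : U ⟶ G.M) (e₁ : L.mo x = p)
    (e₂ : R.mo x = H.t h),
    delta x (G.one p) h (e₁.trans (G.t_one p).symm) e₂ ≫
      R.smHom (L.coh.eps x p e₁).hom (𝟙 (H.arr.of h)) ((moR x _ _).trans e₂) e₂
        ((L.coh.eps_pr _ _ _).trans (H.arr.pr_id _).symm) =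
    (L.coh.eps (R.sm x h e₂) p ((moL x h e₂).trans e₁)).hom
  right_beta : ∀ {U : Man.{u}} (x : X.Ob U) (g : G.arr.Ob U) (h h' : H.arr.Ob U)
    (e₁ : L.mo x = G.t g) (e₂ : R.mo x = H.t h) (i : H.s h = H.t h'),
    delta x g (H.mul h h' i) e₁ (e₂.trans (H.t_mul h h' i).symm) ≫
      (R.coh.beta (L.sm x g e₁) h h' ((moR x g e₁).trans e₂) i).hom =
    L.smHom (R.coh.beta x h h' e₂ i).hom (𝟙 (G.arr.of g)) ((moL x _ _).trans e₁)
        ((moL _ _ _).trans ((moL x h e₂).trans e₁))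
        ((R.coh.beta_pr _ _ _ _ _).trans (G.arr.pr_id _).symm) ≫
      delta (R.sm x h e₂) g h' ((moL x h e₂).trans e₁) ((R.mo_sm x h e₂).trans i) ≫
      R.smHom (delta x g h e₁ e₂) (𝟙 (H.arr.of h'))
        ((moR _ _ _).trans ((R.mo_sm x h e₂).trans i)) ((R.mo_sm _ _ _).trans i)
        ((delta_pr _ _ _ _ _).trans (H.arr.pr_id _).symm)
  right_eps : ∀ {U : Man.{u}} (x : X.Ob U) (g : G.arr.Ob U) (p : U ⟶ H.M) (e₁ : L.mo x = G.t g)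
    (e₂ : R.mo x = p),
    delta x g (H.one p) e₁ (e₂.trans (H.t_one p).symm) ≫
      (R.coh.eps (L.sm x g e₁) p ((moR x g e₁).trans e₂)).hom =
    L.smHom (R.coh.eps x p e₂).hom (𝟙 (G.arr.of g)) ((moL x _ _).trans e₁) e₁
      ((R.coh.eps_pr _ _ _).trans (G.arr.pr_id _).symm)

/-- The restrictions to `G` and `H` of an action of `G × H` commute. -/
def commuting (A : Action (G.prod H) X) : Commuting A.left A.right where
  moL x h e := A.mo₁_right x h e
  moR x g e := A.mo₂_left x g e
  delta x g h e₁ e₂ := (A.delta x g h e₁ e₂).hom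
  delta_pr x g h e₁ e₂ := A.delta_pr x g h e₁ e₂
  delta_nat b j k e₁ e₂ f₁ f₂ hj hk := A.delta_nat b j k e₁ e₂ f₁ f₂ hj hk
  left_beta x g g' h e₁ e₂ i := A.delta_left_beta x g g' h e₁ e₂ i
  left_eps x h p e₁ e₂ := A.delta_left_eps x h p e₁ e₂
  right_beta x g h h' e₁ e₂ i := A.delta_right_beta x g h h' e₁ e₂ i
  right_eps x g p e₁ e₂ := A.delta_right_eps x g p e₁ e₂

theorem arrowId_eq (L : Action G X) (x : X.Ob U) (p : U ⟶ G.M) (e : L.mo x = p) :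
    L.arrowId x = L.cls (G.one p) (e.trans (G.t_one p).symm) (L.coh.eps x p e).hom := by
  subst e
  rfl

theorem arrowOf_eq (L : Action G X) {x : X.Ob U} {y : X.Ob V} (b : X.of x ⟶ X.of y) (p : U ⟶ G.M)
    (e : L.mo x = p) : L.arrowOf b = L.cls (G.one p) (e.trans (G.t_one p).symm)
      ((L.coh.eps x p e).hom ≫ b) := by
  subst e
  rfl

theorem arrow_exists_cls (L : Action G X) {x : X.Ob U} {y : X.Ob V} (a : L.Arrow x y) :
    ∃ (g : G.arr.Ob U) (e : L.mo x = G.t g) (b : X.of (L.sm x g e) ⟶ X.of y),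
      L.cls g e b = a := by
  induction a using Quotient.inductionOn with | _ a =>
  exact ⟨a.g, a.mo_eq, a.b, rfl⟩

namespace Commuting

variable {L : Action G X} {R : Action H X} (D : Commuting L R)

include D in
theorem mo_arrow {x : X.Ob U} {y : X.Ob V} (a : L.Arrow x y) :
    L.arrowPr a ≫ R.mo y = R.mo x := by
  obtain ⟨g, e, b, rfl⟩ := L.arrow_exists_cls a
  exact (R.moment.val_eq b).trans (D.moR x g e)

theorem delta_comp_pr {x : X.Ob U} {y : X.Ob V} {h : H.arr.Ob U} {h' : H.arr.Ob V} (g : G.arr.Ob U)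
    (i : L.mo x = G.t g) (b : X.of (L.sm x g i) ⟶ X.of y)
    (k : H.arr.of h ⟶ H.arr.of h') (e : R.mo x = H.t h) (e' : R.mo y = H.t h')
    (hk : X.pr b = H.arr.pr k) :
    X.pr (D.delta x g h i e ≫ R.smHom b k ((D.moR x _ _).trans e) e' hk) = X.pr b := by
  rw [pr_comp, D.delta_pr, R.pr_smHom, Category.id_comp]

theorem cls_delta_eq {x : X.Ob U} {y : X.Ob V} {h : H.arr.Ob U} {h' : H.arr.Ob V}
    {g g' : G.arr.Ob U} {i : L.mo x = G.t g} {i' : L.mo x = G.t g'}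
    {b : X.of (L.sm x g i) ⟶ X.of y} {b' : X.of (L.sm x g' i') ⟶ X.of y}
    (hb : L.cls g i b = L.cls g' i' b')
    (k : H.arr.of h ⟶ H.arr.of h') (e : R.mo x = H.t h) (e' : R.mo y = H.t h')
    (hk : X.pr b = H.arr.pr k) (hk' : X.pr b' = H.arr.pr k) :
    L.cls g ((D.moL x h e).trans i)
      (D.delta x g h i e ≫ R.smHom b k ((D.moR x _ _).trans e) e' hk) =
    L.cls g' ((D.moL x h e).trans i')
      (D.delta x g' h i' e ≫ R.smHom b' k ((D.moR x _ _).trans e) e' hk') := by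
  obtain ⟨j, hj, hb⟩ := L.cls_eq_iff.1 hb
  refine L.cls_eq_iff.2 ⟨j, (X.pr_id _).trans ((X.pr_id _).symm.trans hj), ?_⟩
  have N := D.delta_nat (𝟙 (X.of x)) j (𝟙 (H.arr.of h)) i e i' e hj (by simp)
  have hN : L.smHom (R.smHom (𝟙 (X.of x)) (𝟙 (H.arr.of h)) e e (by simp)) j
      ((D.moL x h e).trans i) ((D.moL x h e).trans i')
      ((R.pr_smHom _ _ _ _ _).trans hj) = L.smHom (𝟙 (X.of (R.sm x h e))) j
      ((D.moL x h e).trans i) ((D.moL x h e).trans i')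
      ((X.pr_id _).trans ((X.pr_id _).symm.trans hj)) :=
    L.smHom_congr (R.smHom_id _ _ _) rfl _ _ _ _
  rw [hN] at N
  rw [← Category.assoc, N, Category.assoc, R.smHom_comp]
  congr 1
  exact R.smHom_congr hb (Category.id_comp _) _ _ _ _

theorem cls_delta_comp {x : X.Ob U} {y : X.Ob V} {z : X.Ob W} {h : H.arr.Ob U} {h' : H.arr.Ob V}
    {h'' : H.arr.Ob W} {g l : G.arr.Ob U} {g' : G.arr.Ob V} (i : L.mo x = G.t g)
    (b : X.of (L.sm x g i) ⟶ X.of y) (i' : L.mo y = G.t g') (c : X.of (L.sm y g' i') ⟶ X.of z)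
    (m : G.arr.of l ⟶ G.arr.of g') (hm : G.arr.pr m = X.pr b) (il : G.s g = G.t l)
    (k : H.arr.of h ⟶ H.arr.of h') (k' : H.arr.of h' ⟶ H.arr.of h'') (e : R.mo x = H.t h)
    (e' : R.mo y = H.t h') (e'' : R.mo z = H.t h'') (hk : X.pr b = H.arr.pr k)
    (hk' : X.pr c = H.arr.pr k') :
    L.arrowComp
      (L.cls g ((D.moL x h e).trans i)
        (D.delta x g h i e ≫ R.smHom b k ((D.moR x _ _).trans e) e' hk))
      (L.cls g' ((D.moL y h' e').trans i')
        (D.delta y g' h' i' e' ≫ R.smHom c k' ((D.moR y _ _).trans e') e'' hk')) =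
    L.cls (G.mul g l il) ((D.moL x h e).trans (i.trans (G.t_mul _ _ _).symm))
      (D.delta x (G.mul g l il) h (i.trans (G.t_mul _ _ _).symm) e ≫
        R.smHom ((L.coh.beta x g l i il).hom ≫ L.smHom b m ((L.mo_sm x g i).trans il) i' hm.symm ≫ c)
          (k ≫ k') ((D.moR x _ _).trans e) e'' (by simp [L.coh.beta_pr, hk, hk'])) := by
  refine (L.cls_comp_mk _ _ _ _ _ _ l m
    (hm.trans (D.delta_comp_pr g i b k e e' hk).symm)).trans ?_
  refine L.cls_eq_iff.2 ⟨𝟙 _, by simp, ?_⟩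
  have il' : L.mo (L.sm x g i) = G.t l := (L.mo_sm x g i).trans il
  have S₁ : R.smHom ((L.coh.beta x g l i il).hom ≫ L.smHom b m il' i' hm.symm ≫ c) (k ≫ k')
      ((D.moR x _ _).trans e) e'' (by simp [L.coh.beta_pr, hk, hk']) =
      R.smHom (L.coh.beta x g l i il).hom (𝟙 (H.arr.of h)) ((D.moR x _ _).trans e)
        ((D.moR _ _ _).trans ((D.moR x g i).trans e))
        ((L.coh.beta_pr _ _ _ _ _).trans (H.arr.pr_id _).symm) ≫
      R.smHom (L.smHom b m il' i' hm.symm) k ((D.moR _ _ _).trans ((D.moR x g i).trans e))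
        ((D.moR _ _ _).trans e') ((L.pr_smHom _ _ _ _ _).trans hk) ≫
      R.smHom c k' ((D.moR _ _ _).trans e') e'' hk' := by
    rw [R.smHom_comp, R.smHom_comp]
    exact R.smHom_congr rfl (Category.id_comp _).symm _ _ _ _
  have S₂ : L.smHom (D.delta x g h i e ≫ R.smHom b k ((D.moR x _ _).trans e) e' hk) m
        ((L.mo_sm _ _ _).trans il) ((D.moL _ _ _).trans i')
        ((D.delta_comp_pr g i b k e e' hk).trans hm.symm) =
      L.smHom (D.delta x g h i e) (𝟙 _) ((L.mo_sm _ _ _).trans il)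
        ((D.moL _ _ _).trans il') ((D.delta_pr _ _ _ _ _).trans (G.arr.pr_id _).symm) ≫
      L.smHom (R.smHom b k ((D.moR x _ _).trans e) e' hk) m ((D.moL _ _ _).trans il')
        ((D.moL _ _ _).trans i') ((R.pr_smHom _ _ _ _ _).trans hm.symm) := by
    rw [L.smHom_comp]
    exact L.smHom_congr rfl (Category.id_comp _).symm _ _ _ _
  rw [L.smHom_id, Category.id_comp, S₁, S₂,
    reassoc_of% (D.left_beta x g l h i e il),
    ← reassoc_of% (D.delta_nat b m k il' ((D.moR x g i).trans e) i' e' hm.symm hk)]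
  simp only [Category.assoc]

/-- The arrow `[g, (b · k) ∘ δ]` from `x · h` to `y · h'` for a class `[g, b]` from `x` to `y` and
an arrow `k : h ⟶ h'`. -/
def smArrow {x : X.Ob U} {y : X.Ob V} {h : H.arr.Ob U} {h' : H.arr.Ob V} (a : L.Arrow x y)
    (k : H.arr.of h ⟶ H.arr.of h') (e : R.mo x = H.t h) (e' : R.mo y = H.t h')
    (hk : L.arrowPr a = H.arr.pr k) : L.Arrow (R.sm x h e) (R.sm y h' e') :=
  L.cls a.out.g ((D.moL x h e).trans a.out.mo_eq)
    (D.delta x a.out.g h a.out.mo_eq e ≫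
      R.smHom a.out.b k ((D.moR x _ _).trans e) e'
        (Eq.trans (congrArg L.arrowPr (Quotient.out_eq a)) hk))

theorem smArrow_cls {x : X.Ob U} {y : X.Ob V} {h : H.arr.Ob U} {h' : H.arr.Ob V} (g : G.arr.Ob U)
    (i : L.mo x = G.t g) (b : X.of (L.sm x g i) ⟶ X.of y)
    (k : H.arr.of h ⟶ H.arr.of h') (e : R.mo x = H.t h) (e' : R.mo y = H.t h')
    (hk : X.pr b = H.arr.pr k) :
    D.smArrow (L.cls g i b) k e e' hk = L.cls g ((D.moL x h e).trans i)
      (D.delta x g h i e ≫ R.smHom b k ((D.moR x _ _).trans e) e' hk) := by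
  exact D.cls_delta_eq (Quotient.out_eq (L.cls g i b)) _ _ _ _ _

theorem arrowPr_smArrow {x : X.Ob U} {y : X.Ob V} {h : H.arr.Ob U} {h' : H.arr.Ob V}
    (a : L.Arrow x y) (k : H.arr.of h ⟶ H.arr.of h') (e : R.mo x = H.t h) (e' : R.mo y = H.t h')
    (hk : L.arrowPr a = H.arr.pr k) : L.arrowPr (D.smArrow a k e e' hk) = L.arrowPr a := by
  obtain ⟨g, i, b, rfl⟩ := L.arrow_exists_cls a
  rw [D.smArrow_cls g i b k e e' hk]
  exact D.delta_comp_pr g i b k e e' hk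

theorem smArrow_arrowOf {x : X.Ob U} {y : X.Ob V} {h : H.arr.Ob U} {h' : H.arr.Ob V}
    (b : X.of x ⟶ X.of y) (k : H.arr.of h ⟶ H.arr.of h') (e : R.mo x = H.t h) (e' : R.mo y = H.t h')
    (hk : X.pr b = H.arr.pr k) :
    D.smArrow (L.arrowOf b) k e e' ((L.arrowPr_arrowOf b).trans hk) =
      L.arrowOf (R.smHom b k e e' hk) := by
  refine (D.smArrow_cls _ _ _ _ _ _ ((L.arrowPr_arrowOf b).trans hk)).trans ?_
  rw [L.arrowOf_eq (R.smHom b k e e' hk) (L.mo x) (D.moL x h e),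
    ← D.left_eps x h (L.mo x) rfl e, Category.assoc, R.smHom_comp]
  congr 2
  exact R.smHom_congr rfl (Category.id_comp _).symm _ _ _ _

theorem smArrow_id (x : X.Ob U) (h : H.arr.Ob U) (e : R.mo x = H.t h) :
    D.smArrow (L.arrowId x) (𝟙 (H.arr.of h)) e e
      ((L.coh.eps_pr _ _ _).trans (H.arr.pr_id _).symm) = L.arrowId (R.sm x h e) := by
  refine (D.smArrow_cls _ _ _ _ _ _ ((L.coh.eps_pr _ _ _).trans (H.arr.pr_id _).symm)).trans ?_
  rw [L.arrowId_eq (R.sm x h e) (L.mo x) (D.moL x h e), ← D.left_eps x h (L.mo x) rfl e]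

theorem smArrow_comp {x : X.Ob U} {y : X.Ob V} {z : X.Ob W} {h : H.arr.Ob U} {h' : H.arr.Ob V}
    {h'' : H.arr.Ob W} (a : L.Arrow x y) (a' : L.Arrow y z)
    (k : H.arr.of h ⟶ H.arr.of h') (k' : H.arr.of h' ⟶ H.arr.of h'') (e : R.mo x = H.t h)
    (e' : R.mo y = H.t h') (e'' : R.mo z = H.t h'') (hk : L.arrowPr a = H.arr.pr k)
    (hk' : L.arrowPr a' = H.arr.pr k') (hkk : L.arrowPr (L.arrowComp a a') = H.arr.pr (k ≫ k')) :
    L.arrowComp (D.smArrow a k e e' hk) (D.smArrow a' k' e' e'' hk') =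
      D.smArrow (L.arrowComp a a') (k ≫ k') e e'' hkk := by
  obtain ⟨g, i, b, rfl⟩ := L.arrow_exists_cls a
  obtain ⟨g', i', c, rfl⟩ := L.arrow_exists_cls a'
  obtain ⟨l, m, hm⟩ := lift_exists g' (X.pr b)
  have hc : L.arrowComp (L.cls g i b) (L.cls g' i' c) = L.compAux g i b g' i' c l m hm :=
    L.cls_comp_mk _ _ _ _ _ _ l m hm
  have hkc : L.arrowPr (L.compAux g i b g' i' c l m hm) = H.arr.pr (k ≫ k') := hc ▸ hkk
  have hr : D.smArrow (L.arrowComp (L.cls g i b) (L.cls g' i' c)) (k ≫ k') e e'' hkk =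
      D.smArrow (L.compAux g i b g' i' c l m hm) (k ≫ k') e e'' hkc := by
    congr 1
  rw [hr, D.smArrow_cls g i b k e e' hk, D.smArrow_cls g' i' c k' e' e'' hk']
  exact (D.cls_delta_comp i b i' c m hm _ k k' e e' e'' hk hk').trans
    (D.smArrow_cls _ _ _ _ _ _ hkc).symm

end Commuting

end Action

end StackyQuotient

end

noncomputable section

universe w w' k

namespace StackyQuotient

namespace CFG

/-- The image of an isomorphism under a morphism. -/
def Mor.mapIso {X : CFG.{w, u}} {Y : CFG.{w', u}} (F : Mor X Y) {U V : Man.{u}} {x : X.Ob U}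
    {y : X.Ob V} (b : X.of x ≅ X.of y) : Y.of (F.obj x) ≅ Y.of (F.obj y) where
  hom := F.map b.hom
  inv := F.map b.inv
  hom_inv_id := by rw [← F.map_comp, b.hom_inv_id, F.map_id]
  inv_hom_id := by rw [← F.map_comp, b.inv_hom_id, F.map_id]

end CFG

namespace Action

variable {G H : CfgGroupoid.{w, u}} {X : CFG.{w, u}} {U V W : Man.{u}}

namespace Commuting

variable {L : Action G X} {R : Action H X} (D : Commuting L R)

/-- The action of the second groupoid on the prequotient by the first: the structure maps. -/
def preqPre : PreAction H L.preq where
  moment := Mor.ofVal (fun x => R.mo x) fun a => D.mo_arrow a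
  act :=
    { obj := fun c => R.sm (PairOb.fst (X := L.preq) c) (PairOb.snd (X := L.preq) c)
        (PairOb.prop (X := L.preq) c)
      map := fun {_ _ c d} a => D.smArrow (PairHom.fst (X := L.preq) a)
        (PairHom.snd (X := L.preq) a) (PairOb.prop (X := L.preq) c)
        (PairOb.prop (X := L.preq) d) (PairHom.pr_eq (X := L.preq) a)
      map_id := fun c => D.smArrow_id _ _ (PairOb.prop (X := L.preq) c)
      map_comp := fun {_ _ _ c d c'} a b => (D.smArrow_comp (PairHom.fst (X := L.preq) a)
        (PairHom.fst (X := L.preq) b) (PairHom.snd (X := L.preq) a) (PairHom.snd (X := L.preq) b)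
        (PairOb.prop (X := L.preq) c) (PairOb.prop (X := L.preq) d) (PairOb.prop c')
        (PairHom.pr_eq (X := L.preq) a) (PairHom.pr_eq (X := L.preq) b)
        (PairHom.pr_eq (X := L.preq) (a ≫ b))).symm
      pr_map := fun {_ _ c d} a => D.arrowPr_smArrow (PairHom.fst (X := L.preq) a)
        (PairHom.snd (X := L.preq) a) (PairOb.prop (X := L.preq) c) (PairOb.prop (X := L.preq) d)
        (PairHom.pr_eq (X := L.preq) a) }
  moment_act x h e := R.mo_sm x h e

theorem preqPre_smHom {x : X.Ob U} {y : X.Ob V} {h : H.arr.Ob U} {h' : H.arr.Ob V}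
    (b : X.of x ⟶ X.of y) (k : H.arr.of h ⟶ H.arr.of h') (e : R.mo x = H.t h) (e' : R.mo y = H.t h')
    (hk : X.pr b = H.arr.pr k) :
    D.preqPre.smHom (L.quot.map b) k e e' ((L.arrowPr_arrowOf b).trans hk) =
      L.quot.map (R.smHom b k e e' hk) := D.smArrow_arrowOf b k e e' hk

theorem preqPre_smHom_id {x : X.Ob U} {h h' : H.arr.Ob U}
    (k : H.arr.of h ⟶ H.arr.of h') (e : R.mo x = H.t h) (e' : R.mo x = H.t h')
    (hk : X.pr (𝟙 (X.of x)) = H.arr.pr k) (hk' : L.preq.pr (𝟙 (L.preq.of x)) = H.arr.pr k) :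
    D.preqPre.smHom (𝟙 (L.preq.of (L.quot.obj x))) k e e' hk' =
      L.quot.map (R.smHom (𝟙 (X.of x)) k e e' hk) :=
  (D.preqPre.smHom_congr (L.quot.map_id x).symm rfl e e' hk' _).trans
    (D.preqPre_smHom (𝟙 (X.of x)) k e e' hk)

theorem smArrow_beta {x : X.Ob U} {h l : H.arr.Ob U} {x' : X.Ob V} {h' l' : H.arr.Ob V}
    (a : L.Arrow x x') (b : H.arr.of h ⟶ H.arr.of h') (c : H.arr.of l ⟶ H.arr.of l')
    (e₁ : R.mo x = H.t h) (e₂ : H.s h = H.t l) (e₁' : R.mo x' = H.t h') (e₂' : H.s h' = H.t l')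
    (hab : L.arrowPr a = H.arr.pr b) (hbc : H.arr.pr b = H.arr.pr c) :
    L.arrowComp (D.smArrow a (H.mulHom b c e₂ e₂' hbc) (e₁.trans (H.t_mul h l e₂).symm)
        (e₁'.trans (H.t_mul h' l' e₂').symm) (hab.trans (H.pr_mulHom b c e₂ e₂' hbc).symm))
      (L.arrowOf (R.coh.beta x' h' l' e₁' e₂').hom) =
    L.arrowComp (L.arrowOf (R.coh.beta x h l e₁ e₂).hom)
      (D.smArrow (D.smArrow a b e₁ e₁' hab) c ((R.mo_sm x h e₁).trans e₂)
        ((R.mo_sm x' h' e₁').trans e₂')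
        ((D.arrowPr_smArrow a b e₁ e₁' hab).trans (hab.trans hbc))) := by
  obtain ⟨g, i, p, rfl⟩ := L.arrow_exists_cls a
  have hp : X.pr p = H.arr.pr b := hab
  have hd := D.delta_comp_pr g i p b e₁ e₁' hp
  have i' : L.mo (R.sm x h e₁) = G.t g := (D.moL x h e₁).trans i
  have h₁ : D.smArrow (D.smArrow (L.cls g i p) b e₁ e₁' hab) c ((R.mo_sm x h e₁).trans e₂)
        ((R.mo_sm x' h' e₁').trans e₂')
        ((D.arrowPr_smArrow (L.cls g i p) b e₁ e₁' hab).trans (hab.trans hbc)) =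
      L.cls g ((D.moL _ _ ((R.mo_sm x h e₁).trans e₂)).trans i')
        (D.delta (R.sm x h e₁) g l i' ((R.mo_sm x h e₁).trans e₂) ≫
          R.smHom (D.delta x g h i e₁ ≫ R.smHom p b ((D.moR x _ _).trans e₁) e₁' hp) c
            ((D.moR _ _ _).trans ((R.mo_sm x h e₁).trans e₂)) ((R.mo_sm x' h' e₁').trans e₂')
            (hd.trans (hp.trans hbc))) := by
    refine Eq.trans ?_ (D.smArrow_cls g i' _ c ((R.mo_sm x h e₁).trans e₂)
        ((R.mo_sm x' h' e₁').trans e₂') (hd.trans (hp.trans hbc)))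
    congr 1
    exact D.smArrow_cls g i p b e₁ e₁' hp
  have h₂ := D.smArrow_cls g i p (H.mulHom b c e₂ e₂' hbc) (e₁.trans (H.t_mul h l e₂).symm)
        (e₁'.trans (H.t_mul h' l' e₂').symm) (hp.trans (H.pr_mulHom b c e₂ e₂' hbc).symm)
  have S : R.smHom (D.delta x g h i e₁ ≫ R.smHom p b ((D.moR x _ _).trans e₁) e₁' hp) c
            ((D.moR _ _ _).trans ((R.mo_sm x h e₁).trans e₂)) ((R.mo_sm x' h' e₁').trans e₂')
            (hd.trans (hp.trans hbc)) =
      R.smHom (D.delta x g h i e₁) (𝟙 _) ((D.moR _ _ _).trans ((R.mo_sm x h e₁).trans e₂))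
        ((R.mo_sm _ _ _).trans e₂) ((D.delta_pr _ _ _ _ _).trans (H.arr.pr_id _).symm) ≫
      R.smHom (R.smHom p b ((D.moR x _ _).trans e₁) e₁' hp) c ((R.mo_sm _ _ _).trans e₂)
        ((R.mo_sm x' h' e₁').trans e₂') ((R.pr_smHom _ _ _ _ _).trans (hp.trans hbc)) := by
    rw [R.smHom_comp]
    exact R.smHom_congr rfl (Category.id_comp _).symm _ _ _ _
  refine (congrArg (L.arrowComp · _) h₂).trans (Eq.trans ?_ (congrArg (L.arrowComp _ ·) h₁).symm)
  rw [L.cls_comp_arrowOf, L.arrowOf_comp_cls _ _ _ ((D.moL x _ _).trans i) (𝟙 _)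
    ((R.coh.beta_pr _ _ _ _ _).trans (G.arr.pr_id _).symm), S,
    ← reassoc_of% (D.right_beta x g h l i e₁ e₂), Category.assoc,
    R.coh.beta_nat p b c ((D.moR x _ _).trans e₁) e₂ e₁' e₂' hp hbc]

theorem smArrow_eps (x : X.Ob U) (p : U ⟶ H.M) (e : R.mo x = p) (x' : X.Ob V) (p' : V ⟶ H.M)
    (e' : R.mo x' = p') (a : L.Arrow x x') (h : L.arrowPr a ≫ p' = p) :
    L.arrowComp (D.smArrow a (H.oneHom (L.arrowPr a) p p' h) (e.trans (H.t_one p).symm)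
        (e'.trans (H.t_one p').symm) (H.pr_oneHom _ p p' h).symm)
      (L.arrowOf (R.coh.eps x' p' e').hom) =
    L.arrowComp (L.arrowOf (R.coh.eps x p e).hom) a := by
  obtain ⟨g, i, b, rfl⟩ := L.arrow_exists_cls a
  refine (congrArg (L.arrowComp · _) (D.smArrow_cls g i b (H.oneHom (X.pr b) p p' h)
    (e.trans (H.t_one p).symm) (e'.trans (H.t_one p').symm) (H.pr_oneHom _ p p' h).symm)).trans ?_
  rw [L.cls_comp_arrowOf, L.arrowOf_comp_cls _ _ _ ((D.moL x _ _).trans i) (𝟙 _)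
    ((R.coh.eps_pr _ _ _).trans (G.arr.pr_id _).symm), ← D.right_eps x g p i e, Category.assoc,
    Category.assoc, ← R.coh.eps_nat (L.sm x g i) p ((D.moR x g i).trans e) x' p' e' b h]

/-- The action of the second groupoid on the prequotient by the first: `x · h` is as in `X`, and
`[g, b] · k = [g, (b · k) ∘ δ]`. -/
def preq : Action H L.preq where
  toPreAction := D.preqPre
  coh :=
    { beta := fun x h l e i => L.quot.mapIso (R.coh.beta x h l e i)
      beta_pr := fun x h l e i => (L.quot.pr_map _).trans (R.coh.beta_pr x h l e i)
      beta_nat := fun a b c e₁ e₂ e₁' e₂' hab hbc => D.smArrow_beta a b c e₁ e₂ e₁' e₂' hab hbc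
      eps := fun x p e => L.quot.mapIso (R.coh.eps x p e)
      eps_pr := fun x p e => (L.quot.pr_map _).trans (R.coh.eps_pr x p e)
      eps_nat := fun x p e x' p' e' a h => D.smArrow_eps x p e x' p' e' a h
      pentagon := fun x g h l e₁ e₂ e₃ => by
        have P := congrArg L.quot.map (R.coh.pentagon x g h l e₁ e₂ e₃)
        refine ((L.quot.map_comp _ _).symm.trans P).trans ?_
        refine (L.quot.map_comp _ _).trans ?_
        refine congrArg₂ (· ≫ ·) (D.preqPre_smHom_id _ _ _ _ _).symm ?_
        refine (L.quot.map_comp _ _).trans ?_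
        exact congrArg (_ ≫ ·) (D.preqPre_smHom _ _ _ _ _).symm
      one_mid := fun x g p e e' => by
        refine Eq.trans ?_ ((congrArg L.quot.map (R.coh.one_mid x g p e e')).trans
          (D.preqPre_smHom_id _ _ _ _ _).symm)
        refine Eq.trans ?_ (L.quot.map_comp _ _).symm
        exact congrArg (_ ≫ ·) (D.preqPre_smHom _ _ _ _ _)
      one_right := fun x g p e e' =>
        (L.quot.map_comp _ _).symm.trans ((congrArg L.quot.map (R.coh.one_right x g p e e')).trans
          (D.preqPre_smHom_id _ _ _ _ _).symm) }

/-- The projection to the prequotient by the first groupoid is equivariant. -/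
def quotEquivariance : Equivariance R D.preq L.quot where
  mo_eq x := rfl
  phi x h e := 𝟙 _
  phi_pr x h e := L.preq.pr_id _
  phi_nat b j e e' hp := (Category.comp_id _).trans
    ((D.preqPre_smHom b j e e' hp).trans (Category.id_comp _).symm)
  phi_beta x g h e i := by
    refine (Category.id_comp _).trans ?_
    refine (Category.comp_id _).symm.trans (congrArg (_ ≫ ·) ?_)
    exact (Category.comp_id _).symm.trans (congrArg (· ≫ _) (D.preqPre.smHom_id _ _ _).symm)
  phi_eps x p e := Category.id_comp _

theorem smHom_gamma (x : X.Ob U) (g : G.arr.Ob U) (h : H.arr.Ob U) (e₁ : L.mo x = G.t g)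
    (e₂ : R.mo x = H.t h) :
    D.preq.smHom (L.gamma x g e₁) (𝟙 (H.arr.of h)) e₂ ((D.moR x g e₁).trans e₂)
      ((L.arrowPr_gammaArrow x g e₁).trans (H.arr.pr_id h).symm) =
    L.gamma (R.sm x h e₂) g ((D.moL x h e₂).trans e₁) ≫ L.quot.map (D.delta x g h e₁ e₂) := by
  refine (D.smArrow_cls g e₁ (𝟙 _) (𝟙 _) e₂ ((D.moR x g e₁).trans e₂)
    ((X.pr_id _).trans (H.arr.pr_id _).symm)).trans ?_
  refine Eq.trans ?_ (L.cls_comp_arrowOf _ _ _ _).symm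
  rw [R.smHom_id]
  exact congrArg (L.cls g _) ((Category.comp_id _).trans (Category.id_comp _).symm)

end Commuting

end Action

end StackyQuotient

end

noncomputable section

universe w w' k

namespace StackyQuotient

namespace CFG

variable {P Q S Y : CFG.{w, u}} {U V W : Man.{u}}

section prodOn

variable {p : ∀ {U : Man.{u}}, P.Ob U → Y.Ob U → Prop}
  {hp : ∀ {U V : Man.{u}} {x : P.Ob U} {x' : P.Ob V} {y : Y.Ob U} {y' : Y.Ob V}
    (a : P.of x ⟶ P.of x') (b : Y.of y ⟶ Y.of y'), P.pr a = Y.pr b → p x' y' → p x y}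
  {q : ∀ {U : Man.{u}}, Q.Ob U → Y.Ob U → Prop}
  {hq : ∀ {U V : Man.{u}} {x : Q.Ob U} {x' : Q.Ob V} {y : Y.Ob U} {y' : Y.Ob V}
    (a : Q.of x ⟶ Q.of x') (b : Y.of y ⟶ Y.of y'), Q.pr a = Y.pr b → q x' y' → q x y}

/-- The morphism between categories of pairs induced by a morphism on the first component. -/
def Mor.prodOn (ι : Mor P Q) (hpq : ∀ {U : Man.{u}} (x : P.Ob U) (y : Y.Ob U),
    p x y ↔ q (ι.obj x) y) : Mor (CFG.prodOn P Y p hp) (CFG.prodOn Q Y q hq) where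
  obj c := ⟨ι.obj (PairOb.fst c), PairOb.snd c, (hpq _ _).1 (PairOb.prop c)⟩
  map a := ⟨ι.map (PairHom.fst a), PairHom.snd a, (ι.pr_map _).trans (PairHom.pr_eq a)⟩
  map_id _ := PairHom.ext (ι.map_id _) rfl
  map_comp _ _ := PairHom.ext (ι.map_comp _ _) rfl
  pr_map _ := ι.pr_map _

theorem Mor.LocEquiv.prodOn {ι : Mor P Q} (h : ι.LocEquiv)
    (hpq : ∀ {U : Man.{u}} (x : P.Ob U) (y : Y.Ob U), p x y ↔ q (ι.obj x) y) :
    (ι.prodOn hpq (hp := hp) (hq := hq)).LocEquiv where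
  surj := by
    rintro U ⟨y, c, hc⟩
    obtain ⟨C, hC, hh⟩ := h.surj y
    refine ⟨C, hC, fun {W} f hf => ?_⟩
    obtain ⟨x, a, ha⟩ := hh f hf
    obtain ⟨c', b, hb⟩ := lift_exists c f
    exact ⟨⟨x, c', (hpq _ _).2 (hq a b (ha.trans hb.symm) hc)⟩, ⟨a, b, ha.trans hb.symm⟩, ha⟩
  full := by
    rintro U ⟨x, c, hc⟩ ⟨x', c', hc'⟩ m hm
    obtain ⟨C, hC, hh⟩ := h.full x x' (PairHom.fst m) hm
    refine ⟨C, hC, fun {W} z r hr => ?_⟩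
    obtain ⟨n, hn⟩ := hh (PairOb.fst z) (PairHom.fst r) hr
    exact ⟨⟨n, PairHom.snd r ≫ PairHom.snd m, (ι.pr_map n).symm.trans ((congrArg Q.pr hn).trans
      ((pr_comp _ _).trans ((congrArg₂ (· ≫ ·) ((ι.pr_map _).trans (PairHom.pr_eq r))
        (PairHom.pr_eq m)).trans (pr_comp _ _).symm)))⟩, PairHom.ext hn rfl⟩
  faithful := by
    rintro U ⟨x, c, hc⟩ ⟨x', c', hc'⟩ n n' hn hn' e
    obtain ⟨C, hC, hh⟩ := h.faithful (n := PairHom.fst n) (n' := PairHom.fst n') hn hn'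
      (congrArg PairHom.fst e)
    refine ⟨C, hC, fun {W} z r hr => PairHom.ext (hh (PairOb.fst z) (PairHom.fst r) hr) ?_⟩
    exact congrArg (PairHom.snd r ≫ ·) (congrArg PairHom.snd e :)

end prodOn

theorem Mor.LocEquiv.val_eq {ι : Mor P Q} (h : ι.LocEquiv) {M : Man.{u}} (F : Mor P M.cfg)
    {x : P.Ob U} {x' : P.Ob V} (m : Q.of (ι.obj x) ⟶ Q.of (ι.obj x')) :
    Q.pr m ≫ F.val x' = F.val x := by
  refine Man.hom_ext_of_covering (h.covering_full m) ?_
  rintro ⟨W, z, ⟨r, n⟩, hn⟩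
  have hp := congrArg Q.pr hn
  simp only [pr_comp, ι.pr_map] at hp
  rw [F.val_eq r, ← F.val_eq n, hp, Category.assoc]

/-- A morphism to a manifold extends along a local equivalence. -/
theorem Mor.LocEquiv.exists_val {ι : Mor P Q} (h : ι.LocEquiv) {M : Man.{u}} (F : Mor P M.cfg) :
    ∃ F' : Mor Q M.cfg, ∀ {U : Man.{u}} (x : P.Ob U), F'.val (ι.obj x) = F.val x := by
  have key : ∀ {U : Man.{u}} (y : Q.Ob U), ∃ v : U ⟶ M, ∀ κ : Over ι y,
      Q.pr κ.2.2 ≫ v = F.val κ.2.1 := by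
    intro U y
    refine Man.exists_glue (h.covering_over y) (fun κ => F.val κ.2.1) ?_
    rintro ⟨W, x, a⟩ ⟨W', x', a'⟩ T s s' e
    obtain ⟨z, r, hr⟩ := lift_exists x s
    obtain ⟨z', r', hr'⟩ := lift_exists x' s'
    obtain ⟨m, hm, hm'⟩ := factor_exists (ι.map r' ≫ a') (ι.map r ≫ a) (𝟙 T) (by
      rw [Category.id_comp, pr_comp, pr_comp, ι.pr_map, ι.pr_map, hr, hr', e])
    have := h.val_eq F m
    change s ≫ F.val x = s' ≫ F.val x'
    rw [← hr, ← hr', F.val_eq, F.val_eq, ← this, hm', Category.id_comp]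
  choose v hv using @key
  have hv' : ∀ {U W : Man.{u}} (y : Q.Ob U) (x : P.Ob W) (a : Q.of (ι.obj x) ⟶ Q.of y),
      Q.pr a ≫ v y = F.val x := fun y x a => hv y ⟨_, x, a⟩
  refine ⟨Mor.ofVal (fun y => v y) fun {U V y y'} b => ?_, fun x => ?_⟩
  · refine Man.hom_ext_of_covering (h.covering_over y) ?_
    rintro ⟨W, x, a⟩
    rw [← Category.assoc, ← pr_comp, hv', hv']
  · have := hv' _ x (𝟙 _)
    rwa [pr_id, Category.id_comp] at this

end CFG

variable {H : CfgGroupoid.{w, u}} {P Q : CFG.{w, u}} {U V W : Man.{u}}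

/-- The structure of an equivariant morphism, apart from the compatibility with associativity and
identity 2-isomorphisms. -/
structure PreEquivariance (R : PreAction H P) (B : PreAction H Q) (ι : Mor P Q) where
  mo_eq : ∀ {U : Man.{u}} (x : P.Ob U), B.mo (ι.obj x) = R.mo x
  chi : ∀ {U : Man.{u}} (x : P.Ob U) (g : H.arr.Ob U) (e : R.mo x = H.t g),
    Q.of (ι.obj (R.sm x g e)) ⟶ Q.of (B.sm (ι.obj x) g ((mo_eq x).trans e))
  chi_pr : ∀ {U : Man.{u}} (x : P.Ob U) (g : H.arr.Ob U) (e : R.mo x = H.t g),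
    Q.pr (chi x g e) = 𝟙 U
  chi_nat : ∀ {U V : Man.{u}} {x : P.Ob U} {g : H.arr.Ob U} {x' : P.Ob V} {g' : H.arr.Ob V}
    (b : P.of x ⟶ P.of x') (j : H.arr.of g ⟶ H.arr.of g') (e : R.mo x = H.t g)
    (e' : R.mo x' = H.t g') (hp : P.pr b = H.arr.pr j),
    ι.map (R.smHom b j e e' hp) ≫ chi x' g' e' = chi x g e ≫
      B.smHom (ι.map b) j ((mo_eq x).trans e) ((mo_eq x').trans e') ((ι.pr_map b).trans hp)

/-- The structure maps of an action extend along a local equivalence to a stack. -/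
theorem CFG.Mor.LocEquiv.exists_preEquivariance {ι : Mor P Q} (h : ι.LocEquiv) (hQ : Q.IsStack)
    (R : PreAction H P) : ∃ B : PreAction H Q, Nonempty (PreEquivariance R B ι) := by
  obtain ⟨F, hF⟩ := h.exists_val R.moment
  have hT : (ι.prodOn (p := fun x g => R.moment.val x = H.tgt.val g)
      (q := fun x g => F.val x = H.tgt.val g)
      (hp := fun a b h e => by rw [← R.moment.val_eq a, ← H.tgt.val_eq b, h, e])
      (hq := fun a b h e => by rw [← F.val_eq a, ← H.tgt.val_eq b, h, e])
      fun x g => by rw [hF]).LocEquiv := h.prodOn _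
  obtain ⟨act, ⟨ζ⟩⟩ := hT.exists_extension hQ (R.act.comp ι)
  have hact : ∀ {U : Man.{u}} (y : Q.Ob U) (g : H.arr.Ob U) (e : F.val y = H.tgt.val g),
      F.val (act.obj (pullOb y g e)) = H.src.val g := by
    intro U y g e
    refine Man.hom_ext_of_covering (h.covering_over y) ?_
    rintro ⟨W, x, a⟩
    obtain ⟨g', j, hj⟩ := lift_exists g (Q.pr a)
    have e' : R.moment.val x = H.tgt.val g' := by
      rw [← hF, ← F.val_eq a, ← H.tgt.val_eq j, hj, e]
    have hc := F.val_eq (ζ.symm.app (pullOb x g' e') ≫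
      act.map (pullHom a j ((hF x).trans e') e hj.symm))
    have hp : Q.pr (ζ.symm.app (pullOb x g' e') ≫
        act.map (pullHom a j ((hF x).trans e') e hj.symm)) = Q.pr a :=
      (pr_comp _ _).trans ((congrArg₂ (· ≫ ·) (ζ.symm.pr_app _) (act.pr_map _)).trans
        (Category.id_comp _))
    rw [hp] at hc
    refine Eq.trans hc ((hF _).trans ((R.moment_act x g' e').trans ?_))
    rw [← H.src.val_eq j, hj]
  exact ⟨⟨F, act, hact⟩, ⟨⟨hF, fun x g e => ζ.symm.app (pullOb x g e),
    fun x g e => ζ.symm.pr_app _, fun b j e e' hp => ζ.symm.naturality (pullHom b j e e' hp)⟩⟩⟩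

end StackyQuotient

end

noncomputable section

universe w w' k

namespace StackyQuotient

variable {H : CfgGroupoid.{w, u}} {P Q : CFG.{w, u}} {U V W : Man.{u}}

namespace PreEquivariance

variable {R : PreAction H P} {B : PreAction H Q} {ι : Mor P Q} (E : PreEquivariance R B ι)

/-- The arrow from `ι (x · h)` to `y · h'` given by an arrow from `ι x` to `y` and an arrow from
`h` to `h'`. -/
def psi {x : P.Ob U} {y : Q.Ob V} {h : H.arr.Ob U} {h' : H.arr.Ob V}
    (a : Q.of (ι.obj x) ⟶ Q.of y) (k : H.arr.of h ⟶ H.arr.of h') (e : R.mo x = H.t h)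
    (e' : B.mo y = H.t h') (hp : Q.pr a = H.arr.pr k) :
    Q.of (ι.obj (R.sm x h e)) ⟶ Q.of (B.sm y h' e') :=
  E.chi x h e ≫ B.smHom a k ((E.mo_eq x).trans e) e' hp

@[simp] theorem pr_psi {x : P.Ob U} {y : Q.Ob V} {h : H.arr.Ob U} {h' : H.arr.Ob V}
    (a : Q.of (ι.obj x) ⟶ Q.of y) (k : H.arr.of h ⟶ H.arr.of h') (e : R.mo x = H.t h)
    (e' : B.mo y = H.t h') (hp : Q.pr a = H.arr.pr k) : Q.pr (E.psi a k e e' hp) = Q.pr a := by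
  rw [psi, pr_comp, E.chi_pr, B.pr_smHom, Category.id_comp]

theorem psi_congr {x : P.Ob U} {y : Q.Ob V} {h : H.arr.Ob U} {h' : H.arr.Ob V}
    {a a' : Q.of (ι.obj x) ⟶ Q.of y} {k k' : H.arr.of h ⟶ H.arr.of h'} (ha : a = a') (hk : k = k')
    (e : R.mo x = H.t h) (e' : B.mo y = H.t h') (hp : Q.pr a = H.arr.pr k)
    (hp' : Q.pr a' = H.arr.pr k') : E.psi a k e e' hp = E.psi a' k' e e' hp' := by
  subst ha hk
  rfl

theorem psi_comp {x : P.Ob U} {y : Q.Ob V} {z : Q.Ob W} {h : H.arr.Ob U} {h' : H.arr.Ob V}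
    {h'' : H.arr.Ob W} (a : Q.of (ι.obj x) ⟶ Q.of y) (k : H.arr.of h ⟶ H.arr.of h')
    (e : R.mo x = H.t h) (e' : B.mo y = H.t h') (hp : Q.pr a = H.arr.pr k)
    (c : Q.of y ⟶ Q.of z) (j : H.arr.of h' ⟶ H.arr.of h'') (e'' : B.mo z = H.t h'')
    (hc : Q.pr c = H.arr.pr j) :
    E.psi a k e e' hp ≫ B.smHom c j e' e'' hc =
      E.psi (a ≫ c) (k ≫ j) e e'' (by rw [pr_comp, pr_comp, hp, hc]) := by
  rw [psi, Category.assoc, B.smHom_comp]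
  rfl

theorem map_psi {z : P.Ob W} {x : P.Ob U} {y : Q.Ob V} {h₀ : H.arr.Ob W} {h : H.arr.Ob U}
    {h' : H.arr.Ob V} (b : P.of z ⟶ P.of x) (j : H.arr.of h₀ ⟶ H.arr.of h) (e₀ : R.mo z = H.t h₀)
    (hb : P.pr b = H.arr.pr j) (a : Q.of (ι.obj x) ⟶ Q.of y) (k : H.arr.of h ⟶ H.arr.of h')
    (e : R.mo x = H.t h) (e' : B.mo y = H.t h') (hp : Q.pr a = H.arr.pr k) :
    ι.map (R.smHom b j e₀ e hb) ≫ E.psi a k e e' hp =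
      E.psi (ι.map b ≫ a) (j ≫ k) e₀ e' (by rw [pr_comp, pr_comp, ι.pr_map, hp, hb]) := by
  rw [psi, ← Category.assoc, E.chi_nat, Category.assoc, B.smHom_comp]
  rfl

theorem psi_id {x : P.Ob U} {h : H.arr.Ob U} (e : R.mo x = H.t h)
    (hp : Q.pr (𝟙 (Q.of (ι.obj x))) = H.arr.pr (𝟙 (H.arr.of h))) :
    E.psi (𝟙 _) (𝟙 _) e ((E.mo_eq x).trans e) hp = E.chi x h e := by
  rw [psi, B.smHom_id, Category.comp_id]

instance (x : P.Ob U) (h : H.arr.Ob U) (e : R.mo x = H.t h) : IsIso (E.chi x h e) :=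
  isIso_of_pr _ (E.chi_pr x h e)

include E in
theorem mo_lift {x : P.Ob U} {y : Q.Ob V} (a : Q.of (ι.obj x) ⟶ Q.of y) {p : U ⟶ H.M}
    {p' : V ⟶ H.M} (hp : Q.pr a ≫ p' = p) (e' : B.mo y = p') : R.mo x = p := by
  exact (E.mo_eq x).symm.trans ((B.moment.val_eq a).symm.trans ((congrArg (Q.pr a ≫ ·) e').trans hp))

/-- Arrows from `y · h` to an object of a prestack can be compared locally. -/
theorem hom_ext (hι : ι.LocEquiv) (hQ : Q.IsPrestack) {y : Q.Ob V} {h : H.arr.Ob V}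
    {e : B.mo y = H.t h} {z : Q.Ob W} {c c' : Q.of (B.sm y h e) ⟶ Q.of z} (hp : Q.pr c = Q.pr c')
    (hc : ∀ {U : Man.{u}} (x : P.Ob U) (a : Q.of (ι.obj x) ⟶ Q.of y),
      ∃ (h₀ : H.arr.Ob U) (k : H.arr.of h₀ ⟶ H.arr.of h) (e₀ : R.mo x = H.t h₀)
        (hk : Q.pr a = H.arr.pr k), E.psi a k e₀ e hk ≫ c = E.psi a k e₀ e hk ≫ c') : c = c' := by
  choose h₀ k e₀ hk hh using @hc
  refine CFG.IsPrestack.hom_ext hQ hp (fun κ : CFG.Mor.LocEquiv.Over ι y =>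
    E.psi κ.2.2 (k _ κ.2.2) (e₀ _ _) e (hk _ _)) ?_
    fun κ => hh _ _
  simpa only [pr_psi] using hι.covering_over y

end PreEquivariance

theorem PreAction.triple_of_hom (B : PreAction H Q) {x : Q.Ob U} {x' : Q.Ob V}
    {y : (CFG.prod H.arr H.arr).Ob U} {y' : (CFG.prod H.arr H.arr).Ob V} (a : Q.of x ⟶ Q.of x')
    (b : (CFG.prod H.arr H.arr).of y ⟶ (CFG.prod H.arr H.arr).of y')
    (hp : Q.pr a = (CFG.prod H.arr H.arr).pr b)
    (e : B.mo x' = H.t (obFst y') ∧ H.s (obFst y') = H.t (obSnd y')) :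
    B.mo x = H.t (obFst y) ∧ H.s (obFst y) = H.t (obSnd y) :=
  ⟨(B.moment.val_eq a).symm.trans ((congrArg₂ (· ≫ ·) hp e.1).trans (H.tgt.val_eq (homFst b))),
    (H.src.val_eq (homFst b)).symm.trans ((congrArg₂ (· ≫ ·) (homSnd_pr b).symm e.2).trans
      (H.tgt.val_eq (homSnd b)))⟩

/-- The triples `(y, g, h)` for which `(y · g) · h` is defined. -/
def PreAction.triples (B : PreAction H Q) : CFG.{w, u} :=
  CFG.prodOn Q (CFG.prod H.arr H.arr)
    (fun y c => B.mo y = H.t (obFst c) ∧ H.s (obFst c) = H.t (obSnd c)) B.triple_of_hom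

namespace PreAction

variable (B : PreAction H Q)

/-- The morphism `(y, g, h) ↦ y · (g · h)`. -/
def smMul : Mor B.triples Q where
  obj c := B.sm (PairOb.fst c) (H.mul (obFst (PairOb.snd c)) (obSnd (PairOb.snd c))
    (PairOb.prop c).2) ((PairOb.prop c).1.trans (H.t_mul _ _ _).symm)
  map {_ _ c d} a := B.smHom (PairHom.fst a) (H.mulHom (homFst (PairHom.snd a))
    (homSnd (PairHom.snd a)) (PairOb.prop c).2 (PairOb.prop d).2 (homSnd_pr _).symm) _ _
    ((PairHom.pr_eq a).trans (H.pr_mulHom _ _ _ _ _).symm)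
  map_id c := by
    refine Eq.trans ?_ (B.smHom_id _ _ _)
    exact B.smHom_congr rfl (H.mulHom_id _ _ _) _ _ _ _
  map_comp {_ _ _ c d c'} a b := by
    refine Eq.trans ?_ (B.smHom_comp _ _ _ _ _ _ _ _ _).symm
    exact B.smHom_congr rfl (H.mulHom_comp _ _ _ _ _ _ _ _ _).symm _ _ _ _
  pr_map a := B.pr_smHom _ _ _ _ _

/-- The morphism `(y, g, h) ↦ (y · g) · h`. -/
def smSm : Mor B.triples Q where
  obj c := B.sm (B.sm (PairOb.fst c) (obFst (PairOb.snd c)) (PairOb.prop c).1)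
    (obSnd (PairOb.snd c)) ((B.mo_sm _ _ _).trans (PairOb.prop c).2)
  map {_ _ c d} a := B.smHom (B.smHom (PairHom.fst a) (homFst (PairHom.snd a))
    (PairOb.prop c).1 (PairOb.prop d).1 (PairHom.pr_eq a)) (homSnd (PairHom.snd a)) _ _
    ((B.pr_smHom _ _ _ _ _).trans ((PairHom.pr_eq a).trans (homSnd_pr (PairHom.snd a)).symm))
  map_id c := by
    refine Eq.trans ?_ (B.smHom_id _ _ _)
    exact B.smHom_congr (B.smHom_id _ _ _) rfl _ _ _ _
  map_comp {_ _ _ c d c'} a b := by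
    refine Eq.trans ?_ (B.smHom_comp _ _ _ _ _ _ _ _ _).symm
    exact B.smHom_congr (B.smHom_comp _ _ _ _ _ _ _ _ _).symm rfl _ _ _ _
  pr_map a := (B.pr_smHom _ _ _ _ _).trans (B.pr_smHom _ _ _ _ _)

/-- The morphism `y ↦ y · 1`. -/
def smOne : Mor Q Q where
  obj y := B.sm y (H.one (B.mo y)) (H.t_one _).symm
  map {_ _ y y'} a := B.smHom a (H.oneHom (Q.pr a) _ _ (B.moment.val_eq a)) _ _
    (H.pr_oneHom _ _ _ _).symm
  map_id y := by
    refine Eq.trans ?_ (B.smHom_id _ _ _)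
    refine B.smHom_congr rfl ?_ _ _ _ _
    have : ∀ (f : _ ⟶ _) (hf : f = 𝟙 _) (h : f ≫ B.mo y = B.mo y),
        H.oneHom f (B.mo y) (B.mo y) h = 𝟙 _ := by
      rintro f rfl h
      exact H.oneHom_id _
    exact this _ (Q.pr_id y) _
  map_comp a b := by
    refine Eq.trans ?_ (B.smHom_comp _ _ _ _ _ _ _ _ _).symm
    refine B.smHom_congr rfl ?_ _ _ _ _
    refine Eq.trans ?_ (H.oneHom_comp _ _ _ _ _ _ _).symm
    congr 1
    exact pr_comp _ _
  pr_map a := B.pr_smHom _ _ _ _ _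

/-- An object of the category of triples. -/
def triple (y : Q.Ob U) (g h : H.arr.Ob U) (e : B.mo y = H.t g) (i : H.s g = H.t h) :
    B.triples.Ob U := ⟨y, prodOb g h, e, i⟩

/-- An arrow of the category of triples. -/
def tripleHom {y : Q.Ob U} {g h : H.arr.Ob U} {y' : Q.Ob V} {g' h' : H.arr.Ob V}
    (a : Q.of y ⟶ Q.of y') (b : H.arr.of g ⟶ H.arr.of g') (c : H.arr.of h ⟶ H.arr.of h')
    (e : B.mo y = H.t g) (i : H.s g = H.t h) (e' : B.mo y' = H.t g') (i' : H.s g' = H.t h')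
    (hab : Q.pr a = H.arr.pr b) (hbc : H.arr.pr b = H.arr.pr c) :
    B.triples.of (B.triple y g h e i) ⟶ B.triples.of (B.triple y' g' h' e' i') :=
  ⟨a, prodHom b c hbc, hab⟩

end PreAction

end StackyQuotient

end

noncomputable section

universe w w' k

namespace StackyQuotient

variable {H : CfgGroupoid.{w, u}} {P Q : CFG.{w, u}} {U V W : Man.{u}}

namespace PreEquivariance

variable {R : PreAction H P} {B : PreAction H Q} {ι : Mor P Q} (E : PreEquivariance R B ι)

/-- The associativity isomorphism of the action on the target at objects in the image. -/
def betaAt (C : R.Coherence) (x : P.Ob U) (g h : H.arr.Ob U) (e : R.mo x = H.t g)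
    (i : H.s g = H.t h) :
    Q.of (B.sm (ι.obj x) (H.mul g h i) (((E.mo_eq x).trans e).trans (H.t_mul g h i).symm)) ⟶
      Q.of (B.sm (B.sm (ι.obj x) g ((E.mo_eq x).trans e)) h ((B.mo_sm _ _ _).trans i)) :=
  inv (E.chi x (H.mul g h i) (e.trans (H.t_mul g h i).symm)) ≫
    ι.map (C.beta x g h e i).hom ≫
    E.psi (E.chi x g e) (𝟙 (H.arr.of h)) ((R.mo_sm x g e).trans i) ((B.mo_sm _ _ _).trans i)
      ((E.chi_pr x g e).trans (H.arr.pr_id h).symm)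

theorem chi_betaAt (C : R.Coherence) (x : P.Ob U) (g h : H.arr.Ob U) (e : R.mo x = H.t g)
    (i : H.s g = H.t h) :
    E.chi x (H.mul g h i) (e.trans (H.t_mul g h i).symm) ≫ E.betaAt C x g h e i =
    ι.map (C.beta x g h e i).hom ≫
    E.psi (E.chi x g e) (𝟙 (H.arr.of h)) ((R.mo_sm x g e).trans i) ((B.mo_sm _ _ _).trans i)
      ((E.chi_pr x g e).trans (H.arr.pr_id h).symm) := by
  rw [betaAt, IsIso.hom_inv_id_assoc]

theorem betaAt_pr (C : R.Coherence) (x : P.Ob U) (g h : H.arr.Ob U) (e : R.mo x = H.t g)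
    (i : H.s g = H.t h) : Q.pr (E.betaAt C x g h e i) = 𝟙 U := by
  rw [betaAt, pr_comp, pr_comp, pr_isIso_inv _ (E.chi_pr _ _ _), E.pr_psi, E.chi_pr, ι.pr_map,
    C.beta_pr, Category.comp_id, Category.comp_id]

theorem betaAt_nat (C : R.Coherence) {x : P.Ob U} {g h : H.arr.Ob U} {x' : P.Ob V}
    {g' h' : H.arr.Ob V} (a : P.of x ⟶ P.of x') (b : H.arr.of g ⟶ H.arr.of g')
    (c : H.arr.of h ⟶ H.arr.of h') (e : R.mo x = H.t g) (i : H.s g = H.t h) (e' : R.mo x' = H.t g')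
    (i' : H.s g' = H.t h') (hab : P.pr a = H.arr.pr b) (hbc : H.arr.pr b = H.arr.pr c) :
    B.smHom (ι.map a) (H.mulHom b c i i' hbc) (((E.mo_eq x).trans e).trans (H.t_mul g h i).symm)
        (((E.mo_eq x').trans e').trans (H.t_mul g' h' i').symm)
        ((ι.pr_map a).trans (hab.trans (H.pr_mulHom b c i i' hbc).symm)) ≫ E.betaAt C x' g' h' e' i' =
      E.betaAt C x g h e i ≫ B.smHom (B.smHom (ι.map a) b ((E.mo_eq x).trans e)
        ((E.mo_eq x').trans e') ((ι.pr_map a).trans hab)) c ((B.mo_sm _ _ _).trans i)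
        ((B.mo_sm _ _ _).trans i')
        ((B.pr_smHom _ _ _ _ _).trans ((ι.pr_map a).trans (hab.trans hbc))) := by
  rw [← cancel_epi (E.chi x (H.mul g h i) (e.trans (H.t_mul g h i).symm)),
    ← reassoc_of% (E.chi_nat a (H.mulHom b c i i' hbc) (e.trans (H.t_mul g h i).symm)
      (e'.trans (H.t_mul g' h' i').symm) (hab.trans (H.pr_mulHom b c i i' hbc).symm)),
    E.chi_betaAt, reassoc_of% E.chi_betaAt, ← Category.assoc, ← ι.map_comp,
    C.beta_nat a b c e i e' i' hab hbc, ι.map_comp, Category.assoc, E.map_psi, E.psi_comp]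
  congr 1
  exact E.psi_congr (E.chi_nat _ _ _ _ _) ((Category.comp_id _).trans (Category.id_comp _).symm)
    _ _ _ _

/-- The identity isomorphism of the action on the target at objects in the image. -/
def epsAt (C : R.Coherence) (x : P.Ob U) (p : U ⟶ H.M) (e : R.mo x = p) :
    Q.of (B.sm (ι.obj x) (H.one p) (((E.mo_eq x).trans e).trans (H.t_one p).symm)) ⟶
      Q.of (ι.obj x) :=
  inv (E.chi x (H.one p) (e.trans (H.t_one p).symm)) ≫ ι.map (C.eps x p e).hom

theorem chi_epsAt (C : R.Coherence) (x : P.Ob U) (p : U ⟶ H.M) (e : R.mo x = p) :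
    E.chi x (H.one p) (e.trans (H.t_one p).symm) ≫ E.epsAt C x p e = ι.map (C.eps x p e).hom := by
  rw [epsAt, IsIso.hom_inv_id_assoc]

theorem epsAt_pr (C : R.Coherence) (x : P.Ob U) (p : U ⟶ H.M) (e : R.mo x = p) :
    Q.pr (E.epsAt C x p e) = 𝟙 U := by
  rw [epsAt, pr_comp, pr_isIso_inv _ (E.chi_pr _ _ _), ι.pr_map, C.eps_pr, Category.comp_id]

theorem epsAt_nat (C : R.Coherence) (x : P.Ob U) (p : U ⟶ H.M) (e : R.mo x = p) (x' : P.Ob V)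
    (p' : V ⟶ H.M) (e' : R.mo x' = p') (a : P.of x ⟶ P.of x') {f : U ⟶ V} (hf : P.pr a = f)
    (h : f ≫ p' = p) :
    B.smHom (ι.map a) (H.oneHom f p p' h) (((E.mo_eq x).trans e).trans (H.t_one p).symm)
        (((E.mo_eq x').trans e').trans (H.t_one p').symm)
        ((ι.pr_map a).trans (hf.trans (H.pr_oneHom _ p p' h).symm)) ≫ E.epsAt C x' p' e' =
      E.epsAt C x p e ≫ ι.map a := by
  subst hf
  rw [← cancel_epi (E.chi x (H.one p) (e.trans (H.t_one p).symm)),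
    ← reassoc_of% (E.chi_nat a (H.oneHom (P.pr a) p p' h) (e.trans (H.t_one p).symm)
      (e'.trans (H.t_one p').symm) (H.pr_oneHom _ p p' h).symm),
    E.chi_epsAt, reassoc_of% E.chi_epsAt, ← ι.map_comp, ← ι.map_comp, C.eps_nat x p e x' p' e' a h]

/-- The associativity isomorphism extends along a local equivalence. -/
theorem exists_beta (hι : ι.LocEquiv) (hQ : Q.IsPrestack) (C : R.Coherence) :
    ∃ b : TwoMor B.smMul B.smSm, ∀ {U : Man.{u}} (x : P.Ob U) (g h : H.arr.Ob U)
      (e : R.mo x = H.t g) (i : H.s g = H.t h),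
      b.app (B.triple (ι.obj x) g h ((E.mo_eq x).trans e) i) = E.betaAt C x g h e i := by
  have hT : (ι.prodOn (hp := R.triple_of_hom) (hq := B.triple_of_hom)
      fun x c => by rw [E.mo_eq]).LocEquiv := hι.prodOn _
  obtain ⟨b, hb, -⟩ := hT.existsUnique_twoMor hQ (F₁ := B.smMul) (F₂ := B.smSm)
    (fun c => E.betaAt C (PairOb.fst c) (obFst (PairOb.snd c)) (obSnd (PairOb.snd c))
      (PairOb.prop c).1 (PairOb.prop c).2)
    (fun c => E.betaAt_pr C _ _ _ _ _)
    (fun {_ _ c d} a => E.betaAt_nat C (PairHom.fst a) (homFst (PairHom.snd a)) (homSnd (PairHom.snd a))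
      (PairOb.prop c).1 (PairOb.prop c).2 (PairOb.prop d).1 (PairOb.prop d).2 (PairHom.pr_eq a)
      (homSnd_pr (PairHom.snd a)).symm)
  exact ⟨b, fun x g h e i => hb ⟨x, prodOb g h, e, i⟩⟩

/-- The identity isomorphism extends along a local equivalence. -/
theorem exists_eps (hι : ι.LocEquiv) (hQ : Q.IsPrestack) (C : R.Coherence) :
    ∃ b : TwoMor B.smOne (Mor.id Q), ∀ {U : Man.{u}} (x : P.Ob U),
      b.app (ι.obj x) = E.epsAt C x (B.mo (ι.obj x)) (E.mo_eq x).symm := by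
  obtain ⟨b, hb, -⟩ := hι.existsUnique_twoMor hQ (F₁ := B.smOne) (F₂ := Mor.id Q)
    (fun x => E.epsAt C x (B.mo (ι.obj x)) (E.mo_eq x).symm)
    (fun x => E.epsAt_pr C _ _ _)
    (fun {_ _ x x'} a => E.epsAt_nat C x _ _ x' _ _ a (ι.pr_map a).symm _)
  exact ⟨b, hb⟩

end PreEquivariance

end StackyQuotient

end

noncomputable section

universe w w' k

namespace StackyQuotient

variable {H : CfgGroupoid.{w, u}} {P Q : CFG.{w, u}} {U V W : Man.{u}}

namespace PreAction

variable (B : PreAction H Q)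

/-- The components of an identity 2-isomorphism, with the unit at any map equal to the moment. -/
def epsOf (c : TwoMor B.smOne (Mor.id Q)) (y : Q.Ob U) (p : U ⟶ H.M) (e : B.mo y = p) :
    Q.of (B.sm y (H.one p) (e.trans (H.t_one p).symm)) ⟶ Q.of y :=
  B.smHom (𝟙 _) (H.oneHom (𝟙 U) p (B.mo y) ((Category.id_comp _).trans e)) _ _
    ((Q.pr_id _).trans (H.pr_oneHom _ _ _ _).symm) ≫ c.app y

theorem epsOf_rfl (c : TwoMor B.smOne (Mor.id Q)) (y : Q.Ob U) :
    B.epsOf c y (B.mo y) rfl = c.app y := by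
  refine Eq.trans (congrArg (· ≫ c.app y) ?_) (Category.id_comp _)
  exact (B.smHom_congr rfl (H.oneHom_id _) _ _ _ _).trans (B.smHom_id _ _ _)

theorem epsOf_pr (c : TwoMor B.smOne (Mor.id Q)) (y : Q.Ob U) (p : U ⟶ H.M) (e : B.mo y = p) :
    Q.pr (B.epsOf c y p e) = 𝟙 U := by
  subst e
  rw [epsOf_rfl]
  exact c.pr_app y

theorem epsOf_nat (c : TwoMor B.smOne (Mor.id Q)) (y : Q.Ob U) (p : U ⟶ H.M) (e : B.mo y = p)
    (y' : Q.Ob V) (p' : V ⟶ H.M) (e' : B.mo y' = p') (a : Q.of y ⟶ Q.of y')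
    (h : Q.pr a ≫ p' = p) :
    B.smHom a (H.oneHom (Q.pr a) p p' h) (e.trans (H.t_one p).symm)
        (e'.trans (H.t_one p').symm) (H.pr_oneHom _ p p' h).symm ≫ B.epsOf c y' p' e' =
      B.epsOf c y p e ≫ a := by
  subst e e'
  rw [epsOf_rfl, epsOf_rfl]
  exact c.naturality a

end PreAction

namespace PreEquivariance

variable {R : PreAction H P} {B : PreAction H Q} {ι : Mor P Q} (E : PreEquivariance R B ι)

/-- Associativity and identity isomorphisms on the target of a local equivalence which extend those
on the source. -/
structure Transport (C : R.Coherence) where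
  beta : ∀ {U : Man.{u}} (y : Q.Ob U) (g h : H.arr.Ob U) (e : B.mo y = H.t g) (i : H.s g = H.t h),
    Q.of (B.sm y (H.mul g h i) (e.trans (H.t_mul g h i).symm)) ⟶
      Q.of (B.sm (B.sm y g e) h ((B.mo_sm y g e).trans i))
  beta_pr : ∀ {U : Man.{u}} (y : Q.Ob U) (g h : H.arr.Ob U) (e : B.mo y = H.t g)
    (i : H.s g = H.t h), Q.pr (beta y g h e i) = 𝟙 U
  beta_nat : ∀ {U V : Man.{u}} {y : Q.Ob U} {g h : H.arr.Ob U} {y' : Q.Ob V} {g' h' : H.arr.Ob V}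
    (a : Q.of y ⟶ Q.of y') (j : H.arr.of g ⟶ H.arr.of g') (k : H.arr.of h ⟶ H.arr.of h')
    (e : B.mo y = H.t g) (i : H.s g = H.t h) (e' : B.mo y' = H.t g') (i' : H.s g' = H.t h')
    (hj : Q.pr a = H.arr.pr j) (hjk : H.arr.pr j = H.arr.pr k),
    B.smHom a (H.mulHom j k i i' hjk) (e.trans (H.t_mul g h i).symm)
        (e'.trans (H.t_mul g' h' i').symm) (hj.trans (H.pr_mulHom j k i i' hjk).symm) ≫
      beta y' g' h' e' i' =
    beta y g h e i ≫ B.smHom (B.smHom a j e e' hj) k ((B.mo_sm y g e).trans i)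
      ((B.mo_sm y' g' e').trans i') ((B.pr_smHom a j e e' hj).trans (hj.trans hjk))
  beta_val : ∀ {U : Man.{u}} (x : P.Ob U) (g h : H.arr.Ob U) (e : R.mo x = H.t g)
    (i : H.s g = H.t h), beta (ι.obj x) g h ((E.mo_eq x).trans e) i = E.betaAt C x g h e i
  eps : ∀ {U : Man.{u}} (y : Q.Ob U) (p : U ⟶ H.M) (e : B.mo y = p),
    Q.of (B.sm y (H.one p) (e.trans (H.t_one p).symm)) ⟶ Q.of y
  eps_pr : ∀ {U : Man.{u}} (y : Q.Ob U) (p : U ⟶ H.M) (e : B.mo y = p), Q.pr (eps y p e) = 𝟙 U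
  eps_nat : ∀ {U V : Man.{u}} (y : Q.Ob U) (p : U ⟶ H.M) (e : B.mo y = p)
    (y' : Q.Ob V) (p' : V ⟶ H.M) (e' : B.mo y' = p') (a : Q.of y ⟶ Q.of y')
    {f : U ⟶ V} (hf : Q.pr a = f) (h : f ≫ p' = p),
    B.smHom a (H.oneHom f p p' h) (e.trans (H.t_one p).symm)
        (e'.trans (H.t_one p').symm) (hf.trans (H.pr_oneHom _ p p' h).symm) ≫ eps y' p' e' =
      eps y p e ≫ a
  eps_val : ∀ {U : Man.{u}} (x : P.Ob U) (p : U ⟶ H.M) (e : R.mo x = p),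
    eps (ι.obj x) p ((E.mo_eq x).trans e) = E.epsAt C x p e

theorem exists_transport (hι : ι.LocEquiv) (hQ : Q.IsPrestack) (C : R.Coherence) :
    Nonempty (E.Transport C) := by
  obtain ⟨b, hb⟩ := E.exists_beta hι hQ C
  obtain ⟨c, hc⟩ := E.exists_eps hι hQ C
  exact ⟨{
    beta := fun y g h e i => b.app (B.triple y g h e i)
    beta_pr := fun y g h e i => b.pr_app _
    beta_nat := fun a j k e i e' i' hj hjk => b.naturality (B.tripleHom a j k e i e' i' hj hjk)
    beta_val := hb
    eps := fun y p e => B.epsOf c y p e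
    eps_pr := fun y p e => B.epsOf_pr c y p e
    eps_nat := by
      rintro U V y p e y' p' e' a f rfl h
      exact B.epsOf_nat c y p e y' p' e' a h
    eps_val := by
      intro U x p e
      obtain rfl : p = B.mo (ι.obj x) := e.symm.trans (E.mo_eq x).symm
      exact (B.epsOf_rfl c _).trans (hc x) }⟩

namespace Transport

variable {E} {C : R.Coherence} (T : E.Transport C)

theorem psi_beta {x : P.Ob U} {y : Q.Ob V} {g h : H.arr.Ob U} {g' h' : H.arr.Ob V}
    (a : Q.of (ι.obj x) ⟶ Q.of y) (j : H.arr.of g ⟶ H.arr.of g') (k : H.arr.of h ⟶ H.arr.of h')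
    (e : R.mo x = H.t g) (e' : B.mo y = H.t g') (i : H.s g = H.t h) (i' : H.s g' = H.t h')
    (hj : Q.pr a = H.arr.pr j) (hjk : H.arr.pr j = H.arr.pr k) :
    E.psi a (H.mulHom j k i i' hjk) (e.trans (H.t_mul g h i).symm) (e'.trans (H.t_mul g' h' i').symm)
        (hj.trans (H.pr_mulHom j k i i' hjk).symm) ≫ T.beta y g' h' e' i' =
      ι.map (C.beta x g h e i).hom ≫ E.psi (E.psi a j e e' hj) k ((R.mo_sm x g e).trans i)
        ((B.mo_sm y g' e').trans i') ((E.pr_psi _ _ _ _ _).trans (hj.trans hjk)) := by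
  rw [psi, Category.assoc, T.beta_nat, T.beta_val, reassoc_of% E.chi_betaAt, E.psi_comp]
  congr 1
  exact E.psi_congr rfl (Category.id_comp _) _ _ _ _

theorem psi_eps {x : P.Ob U} {y : Q.Ob V} (a : Q.of (ι.obj x) ⟶ Q.of y) {f : U ⟶ V}
    (hf : Q.pr a = f) (p : U ⟶ H.M) (p' : V ⟶ H.M) (h : f ≫ p' = p) (e : R.mo x = p)
    (e' : B.mo y = p') :
    E.psi a (H.oneHom f p p' h) (e.trans (H.t_one p).symm) (e'.trans (H.t_one p').symm)
        (hf.trans (H.pr_oneHom _ _ _ _).symm) ≫ T.eps y p' e' =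
      ι.map (C.eps x p e).hom ≫ a := by
  rw [psi, Category.assoc, T.eps_nat (ι.obj x) p ((E.mo_eq x).trans e) y p' e' a hf h, T.eps_val,
    ← Category.assoc, E.chi_epsAt]

include E in
theorem exists_lift_tgt {x : P.Ob U} {y : Q.Ob V} (a : Q.of (ι.obj x) ⟶ Q.of y)
    (g : H.arr.Ob V) (e : B.mo y = H.t g) : ∃ (g₀ : H.arr.Ob U) (j : H.arr.of g₀ ⟶ H.arr.of g),
      Q.pr a = H.arr.pr j ∧ R.mo x = H.t g₀ := by
  obtain ⟨g₀, j, hj⟩ := lift_exists g (Q.pr a)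
  exact ⟨g₀, j, hj.symm, E.mo_lift a ((congrArg (· ≫ H.t g) hj.symm).trans (H.tgt.val_eq j)) e⟩

theorem _root_.StackyQuotient.CfgGroupoid.exists_lift_mul (H : CfgGroupoid.{w, u})
    {g₀ : H.arr.Ob U} {g : H.arr.Ob V}
    (j : H.arr.of g₀ ⟶ H.arr.of g) (h : H.arr.Ob V) (i : H.s g = H.t h) :
    ∃ (h₀ : H.arr.Ob U) (k : H.arr.of h₀ ⟶ H.arr.of h), H.arr.pr j = H.arr.pr k ∧
      H.s g₀ = H.t h₀ := by
  obtain ⟨h₀, k, hk⟩ := lift_exists h (H.arr.pr j)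
  exact ⟨h₀, k, hk.symm, (H.src.val_eq j).symm.trans ((congrArg₂ (· ≫ ·) hk.symm i).trans
      (H.tgt.val_eq k))⟩

theorem pentagon (hι : ι.LocEquiv) (hQ : Q.IsPrestack) (y : Q.Ob V) (g h l : H.arr.Ob V)
    (e₁ : B.mo y = H.t g) (e₂ : H.s g = H.t h) (e₃ : H.s h = H.t l) :
    T.beta y g (H.mul h l e₃) e₁ (e₂.trans (H.t_mul h l e₃).symm) ≫
      T.beta (B.sm y g e₁) h l ((B.mo_sm y g e₁).trans e₂) e₃ =
    B.smHom (𝟙 (Q.of y)) (H.coh.assoc g h l e₂ e₃).hom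
        (by rw [H.t_mul]; exact e₁) (by rw [H.t_mul, H.t_mul]; exact e₁)
        (by rw [pr_id, H.coh.assoc_pr]) ≫
      T.beta y (H.mul g h e₂) l (e₁.trans (H.t_mul g h e₂).symm)
        ((H.s_mul g h e₂).trans e₃) ≫
      B.smHom (T.beta y g h e₁ e₂) (𝟙 (H.arr.of l))
        (by rw [B.mo_sm, H.s_mul]; exact e₃) (by rw [B.mo_sm]; exact e₃)
        (by rw [pr_id, T.beta_pr]) := by
  refine E.hom_ext hι hQ (by simp [T.beta_pr]) fun {U} x a => ?_
  obtain ⟨g₀, j, hj, f₁⟩ := exists_lift_tgt (E := E) a g e₁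
  obtain ⟨h₀, k, hk, f₂⟩ := H.exists_lift_mul j h e₂
  obtain ⟨l₀, m, hm, f₃⟩ := H.exists_lift_mul k l e₃
  refine ⟨_, H.mulHom j (H.mulHom k m f₃ e₃ hm) (f₂.trans (H.t_mul _ _ _).symm)
    (e₂.trans (H.t_mul _ _ _).symm) (hk.trans (H.pr_mulHom _ _ _ _ _).symm),
    f₁.trans (H.t_mul _ _ _).symm, hj.trans (H.pr_mulHom _ _ _ _ _).symm, ?_⟩
  have hs := E.map_psi (𝟙 (P.of x)) (H.coh.assoc g₀ h₀ l₀ f₂ f₃).hom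
    (f₁.trans (H.t_mul _ _ _).symm) (by rw [pr_id, H.coh.assoc_pr]) a
    (H.mulHom (H.mulHom j k f₂ e₂ hk) m ((H.s_mul _ _ _).trans f₃) ((H.s_mul _ _ _).trans e₃)
      ((H.pr_mulHom _ _ _ _ _).trans (hk.trans hm)))
    (f₁.trans ((H.t_mul _ _ _).symm.trans (H.t_mul _ _ _).symm))
    (e₁.trans ((H.t_mul _ _ _).symm.trans (H.t_mul _ _ _).symm))
    (hj.trans ((H.pr_mulHom _ _ _ _ _).symm.trans (H.pr_mulHom _ _ _ _ _).symm))
  have hb := E.map_psi (C.beta x g₀ h₀ f₁ f₂).hom (𝟙 (H.arr.of l₀))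
    (by rw [R.mo_sm, H.s_mul]; exact f₃) (by rw [C.beta_pr, pr_id])
    (E.psi (E.psi a j f₁ e₁ hj) k ((R.mo_sm _ _ _).trans f₂) ((B.mo_sm _ _ _).trans e₂)
      ((E.pr_psi _ _ _ _ _).trans (hj.trans hk))) m
    ((R.mo_sm _ _ _).trans f₃) ((B.mo_sm _ _ _).trans e₃)
    ((E.pr_psi _ _ _ _ _).trans ((E.pr_psi _ _ _ _ _).trans (hj.trans (hk.trans hm))))
  have N := congrArg ι.map (C.pentagon x g₀ h₀ l₀ f₁ f₂ f₃)
  simp only [ι.map_comp] at N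
  have step : E.psi a (H.mulHom j (H.mulHom k m f₃ e₃ hm) (f₂.trans (H.t_mul _ _ _).symm)
    (e₂.trans (H.t_mul _ _ _).symm) (hk.trans (H.pr_mulHom _ _ _ _ _).symm))
    (f₁.trans (H.t_mul _ _ _).symm) (e₁.trans (H.t_mul _ _ _).symm)
    (hj.trans (H.pr_mulHom _ _ _ _ _).symm) ≫ B.smHom (𝟙 (Q.of y)) (H.coh.assoc g h l e₂ e₃).hom
        (by rw [H.t_mul]; exact e₁) (by rw [H.t_mul, H.t_mul]; exact e₁)
        (by rw [pr_id, H.coh.assoc_pr]) = _ :=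
    (E.psi_comp _ _ _ _ _ _ _ _ _).trans ((E.psi_congr
      (by rw [ι.map_id, Category.id_comp, Category.comp_id])
      (H.coh.assoc_nat j k m f₂ f₃ e₂ e₃ hk hm) _ _ _ _).trans hs.symm)
  have step' : E.psi (E.psi a (H.mulHom j k f₂ e₂ hk) (f₁.trans (H.t_mul _ _ _).symm)
      (e₁.trans (H.t_mul _ _ _).symm) (hj.trans (H.pr_mulHom _ _ _ _ _).symm)) m
      (by rw [R.mo_sm, H.s_mul]; exact f₃) (by rw [B.mo_sm, H.s_mul]; exact e₃)
      ((E.pr_psi _ _ _ _ _).trans (hj.trans (hk.trans hm))) ≫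
      B.smHom (T.beta y g h e₁ e₂) (𝟙 (H.arr.of l))
        (by rw [B.mo_sm, H.s_mul]; exact e₃) (by rw [B.mo_sm]; exact e₃)
        (by rw [pr_id, T.beta_pr]) = _ :=
    (E.psi_comp _ _ _ _ _ _ _ _ _).trans ((E.psi_congr
      (T.psi_beta a j k f₁ e₁ f₂ e₂ hj hk)
      ((Category.comp_id _).trans (Category.id_comp _).symm) _ _ _ _).trans hb.symm)
  rw [reassoc_of% step, reassoc_of% (T.psi_beta a (H.mulHom j k f₂ e₂ hk) m (f₁.trans (H.t_mul _ _ _).symm)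
      (e₁.trans (H.t_mul _ _ _).symm) ((H.s_mul _ _ _).trans f₃) ((H.s_mul _ _ _).trans e₃)
      (hj.trans (H.pr_mulHom _ _ _ _ _).symm) ((H.pr_mulHom _ _ _ _ _).trans (hk.trans hm))), step',
    reassoc_of% (T.psi_beta a j (H.mulHom k m f₃ e₃ hm)), T.psi_beta, reassoc_of% N]

theorem one_mid (hι : ι.LocEquiv) (hQ : Q.IsPrestack) (y : Q.Ob V) (g : H.arr.Ob V) (p : V ⟶ H.M)
    (e : B.mo y = p) (e' : p = H.t g) :
    T.beta y (H.one p) g (e.trans (H.t_one p).symm) ((H.s_one p).trans e') ≫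
      B.smHom (T.eps y p e) (𝟙 (H.arr.of g)) (by rw [B.mo_sm, H.s_one]; exact e')
        (e.trans e') (by rw [pr_id, T.eps_pr]) =
    B.smHom (𝟙 (Q.of y)) (H.coh.lam p g e').hom (by rw [H.t_mul, H.t_one]; exact e)
      (e.trans e') (by rw [pr_id, H.coh.lam_pr]) := by
  refine E.hom_ext hι hQ (by simp [T.beta_pr, T.eps_pr]) fun {U} x a => ?_
  obtain ⟨g₀, j, hj, f₁⟩ := exists_lift_tgt (E := E) a g (e.trans e')
  have hq : H.arr.pr j ≫ p = H.t g₀ := (congrArg (_ ≫ ·) e').trans (H.tgt.val_eq j)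
  refine ⟨_, H.mulHom (H.oneHom (H.arr.pr j) (H.t g₀) p hq) j (H.s_one _) ((H.s_one p).trans e')
    (H.pr_oneHom _ _ _ _), f₁.trans ((H.t_one _).symm.trans (H.t_mul _ _ _).symm),
    hj.trans ((H.pr_oneHom _ _ _ _).symm.trans (H.pr_mulHom _ _ _ _ _).symm), ?_⟩
  rw [reassoc_of% (T.psi_beta a (H.oneHom (H.arr.pr j) (H.t g₀) p hq) j
    (f₁.trans (H.t_one _).symm) (e.trans (H.t_one _).symm) (H.s_one _) ((H.s_one p).trans e')
    (hj.trans (H.pr_oneHom _ _ _ _).symm) (H.pr_oneHom _ _ _ _)), E.psi_comp, E.psi_comp]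
  have N := congrArg ι.map (C.one_mid x g₀ (H.t g₀) f₁ rfl)
  rw [ι.map_comp] at N
  have h₁ := E.map_psi (C.eps x (H.t g₀) f₁).hom (𝟙 (H.arr.of g₀))
    (by rw [R.mo_sm, H.s_one]) (by rw [C.eps_pr, pr_id]) a j f₁ (e.trans e') hj
  have h₂ := E.map_psi (𝟙 (P.of x)) (H.coh.lam (H.t g₀) g₀ rfl).hom
    (f₁.trans ((H.t_one _).symm.trans (H.t_mul _ _ _).symm)) (by rw [pr_id, H.coh.lam_pr])
    a j f₁ (e.trans e') hj
  refine (congrArg (_ ≫ ·) ((E.psi_congr (T.psi_eps a hj (H.t g₀) p hq f₁ e)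
      ((Category.comp_id _).trans (Category.id_comp _).symm) _ _ _ _).trans h₁.symm)).trans ?_
  rw [reassoc_of% N, h₂]
  exact E.psi_congr (by rw [ι.map_id, Category.id_comp, Category.comp_id])
    (H.coh.lam_nat _ _ _ _ _ _ _ _).symm _ _ _ _

theorem one_right (hι : ι.LocEquiv) (hQ : Q.IsPrestack) (y : Q.Ob V) (g : H.arr.Ob V) (p : V ⟶ H.M)
    (e : B.mo y = H.t g) (e' : H.s g = p) :
    T.beta y g (H.one p) e (e'.trans (H.t_one p).symm) ≫
      T.eps (B.sm y g e) p ((B.mo_sm y g e).trans e') =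
    B.smHom (𝟙 (Q.of y)) (H.coh.rho g p e').hom (by rw [H.t_mul]; exact e) e
      (by rw [pr_id, H.coh.rho_pr]) := by
  refine E.hom_ext hι hQ (by simp [T.beta_pr, T.eps_pr]) fun {U} x a => ?_
  obtain ⟨g₀, j, hj, f₁⟩ := exists_lift_tgt (E := E) a g e
  have hq : H.arr.pr j ≫ p = H.s g₀ := (congrArg (_ ≫ ·) e'.symm).trans (H.src.val_eq j)
  refine ⟨_, H.mulHom j (H.oneHom (H.arr.pr j) (H.s g₀) p hq) (H.t_one _).symm
    (e'.trans (H.t_one p).symm) (H.pr_oneHom _ _ _ _).symm, f₁.trans (H.t_mul _ _ _).symm,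
    hj.trans (H.pr_mulHom _ _ _ _ _).symm, ?_⟩
  rw [reassoc_of% (T.psi_beta a j (H.oneHom (H.arr.pr j) (H.s g₀) p hq)), E.psi_comp]
  have N := congrArg ι.map (C.one_right x g₀ (H.s g₀) f₁ rfl)
  rw [ι.map_comp] at N
  have h₂ := E.map_psi (𝟙 (P.of x)) (H.coh.rho g₀ (H.s g₀) rfl).hom
    (f₁.trans (H.t_mul _ _ _).symm) (by rw [pr_id, H.coh.rho_pr]) a j f₁ e hj
  refine (congrArg (_ ≫ ·) (T.psi_eps (E.psi a j f₁ e hj) ((E.pr_psi _ _ _ _ _).trans hj) (H.s g₀) p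
    hq ((R.mo_sm _ _ _).trans rfl) ((B.mo_sm _ _ _).trans e'))).trans ?_
  rw [reassoc_of% N, h₂]
  exact E.psi_congr (by rw [ι.map_id, Category.id_comp, Category.comp_id])
    (H.coh.rho_nat _ _ _ _ _ _ _ _).symm _ _ _ _

/-- The action on the target of a local equivalence. -/
def coherence (hι : ι.LocEquiv) (hQ : Q.IsPrestack) : B.Coherence where
  beta y g h e i := haveI := isIso_of_pr _ (T.beta_pr y g h e i); asIso (T.beta y g h e i)
  beta_pr := T.beta_pr
  beta_nat := T.beta_nat
  eps y p e := haveI := isIso_of_pr _ (T.eps_pr y p e); asIso (T.eps y p e)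
  eps_pr := T.eps_pr
  eps_nat y p e y' p' e' a h := T.eps_nat y p e y' p' e' a rfl h
  pentagon := T.pentagon hι hQ
  one_mid := T.one_mid hι hQ
  one_right := T.one_right hι hQ

theorem inv_chi_beta (x : P.Ob U) (g h : H.arr.Ob U) (e : R.mo x = H.t g) (i : H.s g = H.t h) :
    inv (E.chi x (H.mul g h i) (e.trans (H.t_mul g h i).symm)) ≫ ι.map (C.beta x g h e i).hom =
      T.beta (ι.obj x) g h ((E.mo_eq x).trans e) i ≫
        B.smHom (inv (E.chi x g e)) (𝟙 (H.arr.of h)) ((B.mo_sm _ _ _).trans i)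
          ((E.mo_eq _).trans ((R.mo_sm x g e).trans i))
          ((pr_isIso_inv _ (E.chi_pr x g e)).trans (H.arr.pr_id h).symm) ≫
        inv (E.chi (R.sm x g e) h ((R.mo_sm x g e).trans i)) := by
  have hc := E.chi_betaAt C x g h e i
  have hψ := (E.psi_comp (E.chi x g e) (𝟙 (H.arr.of h)) ((R.mo_sm x g e).trans i)
    ((B.mo_sm _ _ _).trans i) ((E.chi_pr x g e).trans (H.arr.pr_id h).symm) (inv (E.chi x g e))
    (𝟙 (H.arr.of h)) ((E.mo_eq _).trans ((R.mo_sm x g e).trans i))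
    ((pr_isIso_inv _ (E.chi_pr x g e)).trans (H.arr.pr_id h).symm)).trans
    ((E.psi_congr (IsIso.hom_inv_id (E.chi x g e)) (Category.comp_id (𝟙 (H.arr.of h)))
    ((R.mo_sm x g e).trans i) ((E.mo_eq _).trans ((R.mo_sm x g e).trans i)) (by simp)
      (by simp)).trans (E.psi_id _ _))
  rw [IsIso.inv_comp_eq, T.beta_val x g h e i, reassoc_of% hc, reassoc_of% hψ, IsIso.hom_inv_id,
    Category.comp_id]

/-- A local equivalence is equivariant for the action on its target. -/
def equivariance (hι : ι.LocEquiv) (hQ : Q.IsPrestack) :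
    Equivariance ⟨R, C⟩ ⟨B, T.coherence hι hQ⟩ ι where
  mo_eq := E.mo_eq
  phi x g e := inv (E.chi x g e)
  phi_pr x g e := pr_isIso_inv _ (E.chi_pr x g e)
  phi_nat b j e e' hp := by
    rw [IsIso.comp_inv_eq, Category.assoc, IsIso.eq_inv_comp]
    exact (E.chi_nat b j e e' hp).symm
  phi_beta x g h e i := by
    exact T.inv_chi_beta x g h e i
  phi_eps x p e := by
    rw [IsIso.inv_comp_eq]
    exact (E.chi_epsAt C x p e).symm.trans (congrArg (_ ≫ ·) (T.eps_val x p e).symm)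

end Transport

end PreEquivariance

end StackyQuotient

end

noncomputable section

universe w w' k

namespace StackyQuotient

namespace Action

variable {G H : CfgGroupoid.{w, u}} {X P Q : CFG.{w, u}} {U V W : Man.{u}}

/-- An action extends along a local equivalence to a stack. -/
theorem exists_equivariance (R : Action H P) {ι : Mor P Q} (hι : ι.LocEquiv) (hQ : Q.IsStack) :
    ∃ B : Action H Q, Nonempty (Equivariance R B ι) := by
  obtain ⟨B, ⟨E⟩⟩ := hι.exists_preEquivariance hQ R.toPreAction
  have hQ₁ : Q.IsPrestack := hQ.1
  obtain ⟨T⟩ := E.exists_transport hι hQ₁ R.coh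
  exact ⟨⟨B, T.coherence hι hQ₁⟩, ⟨T.equivariance hι hQ₁⟩⟩

theorem comp_equivariance_aux {C : Type*} [Category C] {a b c d e f g h i : C} {φ : a ⟶ b}
    {β₁ : b ⟶ c} {β₂ : a ⟶ d} {s₂ : d ⟶ e} {φ' : e ⟶ c} {δ : b ⟶ f} {β : f ⟶ g} {s₁ : c ⟶ h}
    {δ' : h ⟶ g} {s₃ : e ⟶ i} {φ'' : i ⟶ h} {s₄ : d ⟶ i} (h₁ : φ ≫ β₁ = β₂ ≫ s₂ ≫ φ')
    (h₂ : δ ≫ β = β₁ ≫ s₁ ≫ δ') (h₃ : s₃ ≫ φ'' = φ' ≫ s₁) (h₄ : s₂ ≫ s₃ = s₄) :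
    (φ ≫ δ) ≫ β = β₂ ≫ s₄ ≫ φ'' ≫ δ' := by
  rw [Category.assoc, h₂, reassoc_of% h₁, ← h₄, Category.assoc, reassoc_of% h₃]

/-- The composition of equivariant morphisms. -/
def _root_.StackyQuotient.Equivariance.comp {R : Action H X} {R' : Action H P} {B : Action H Q}
    {q : Mor X P}
    {ι : Mor P Q} (D : Equivariance R R' q) (E : Equivariance R' B ι) :
    Equivariance R B (q.comp ι) where
  mo_eq x := (E.mo_eq _).trans (D.mo_eq x)
  phi x g e := E.phi (q.obj x) g ((D.mo_eq x).trans e) ≫ ι.map (D.phi x g e)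
  phi_pr x g e := by
    refine (pr_comp _ _).trans ?_
    exact (congrArg₂ (· ≫ ·) (E.phi_pr _ _ _) ((ι.pr_map _).trans (D.phi_pr _ _ _))).trans
      (Category.id_comp _)
  phi_nat b j e e' hp := by
    have h₁ := E.phi_nat (q.map b) j ((D.mo_eq _).trans e) ((D.mo_eq _).trans e')
      ((q.pr_map b).trans hp)
    have h₂ := congrArg ι.map (D.phi_nat b j e e' hp)
    rw [ι.map_comp, ι.map_comp] at h₂
    refine (Category.assoc _ _ _).symm.trans ((congrArg (· ≫ _) h₁).trans ?_)
    refine (Category.assoc _ _ _).trans ((congrArg (_ ≫ ·) h₂).trans (Category.assoc _ _ _).symm)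
  phi_beta x g h e i := by
    have h₁ := E.phi_beta (q.obj x) g h ((D.mo_eq x).trans e) i
    have h₂ := congrArg ι.map (D.phi_beta x g h e i)
    rw [ι.map_comp, ι.map_comp, ι.map_comp] at h₂
    have h₃ := E.phi_nat (D.phi x g e) (𝟙 (H.arr.of h)) ((R'.mo_sm _ _ _).trans i)
      ((D.mo_eq _).trans ((R.mo_sm x g e).trans i)) ((D.phi_pr x g e).trans (H.arr.pr_id h).symm)
    have h₄ := B.smHom_comp (E.phi (q.obj x) g ((D.mo_eq x).trans e)) (𝟙 (H.arr.of h))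
      ((B.mo_sm _ _ _).trans i) ((E.mo_eq _).trans ((R'.mo_sm _ _ _).trans i))
      ((E.phi_pr _ _ _).trans (H.arr.pr_id h).symm) (ι.map (D.phi x g e)) (𝟙 (H.arr.of h))
      ((E.mo_eq _).trans ((D.mo_eq _).trans ((R.mo_sm x g e).trans i)))
      (((ι.pr_map _).trans (D.phi_pr x g e)).trans (H.arr.pr_id h).symm)
    refine (comp_equivariance_aux h₁ h₂ h₃ h₄).trans (congrArg (fun c => _ ≫ c ≫ _) ?_)
    exact B.smHom_congr rfl (Category.comp_id _) _ _ _ _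
  phi_eps x p e := by
    have h₁ := E.phi_eps (q.obj x) p ((D.mo_eq x).trans e)
    have h₂ := congrArg ι.map (D.phi_eps x p e)
    rw [ι.map_comp] at h₂
    exact (Category.assoc _ _ _).trans ((congrArg (_ ≫ ·) h₂).trans h₁)

/-- Commuting actions induce an action on a stackification of the prequotient. -/
theorem exists_inducedAction (A : Action (G.prod H) X) {ι : Mor A.left.preq Q} (hι : ι.LocEquiv)
    (hQ : Q.IsStack) : Nonempty (A.InducedAction ι) := by
  obtain ⟨B, ⟨E⟩⟩ := A.commuting.preq.exists_equivariance hι hQ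
  refine ⟨⟨B, A.commuting.quotEquivariance.comp E, fun x g h e₁ e₂ => ?_⟩⟩
  have h₁ := E.phi_nat (A.left.gamma x g e₁) (𝟙 (H.arr.of h)) e₂
    ((A.commuting.moR x g e₁).trans e₂)
    ((A.left.arrowPr_gammaArrow x g e₁).trans (H.arr.pr_id h).symm)
  have h₂ := (congrArg ι.map (A.commuting.smHom_gamma x g h e₁ e₂)).trans (ι.map_comp _ _)
  have h₃ : ∀ {V : Man.{u}} {x : X.Ob V} {c : H.arr.Ob V} (e : A.right.mo x = H.t c),
      (A.commuting.quotEquivariance.comp E).phi x c e = E.phi (A.left.quot.obj x) c e :=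
    fun e => (congrArg (_ ≫ ·) (ι.map_id _)).trans (Category.comp_id _)
  refine (congrArg (_ ≫ ·) (h₃ _)).trans (h₁.trans ?_)
  exact (congrArg (_ ≫ ·) h₂).trans (congrArg (· ≫ _) (h₃ _).symm)

end Action

end StackyQuotient

end

noncomputable section

universe w w' k

namespace StackyQuotient

namespace Action

variable {G H : CfgGroupoid.{w, u}} {X S : CFG.{w, u}} {U V W : Man.{u}} (A : Action G X)

theorem gamma_pr (x : X.Ob U) (g : G.arr.Ob U) (e : A.mo x = G.t g) :
    A.preq.pr (A.gamma x g e) = 𝟙 U := A.arrowPr_gammaArrow x g e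

/-- Every arrow of the prequotient is a composition `x ⟶ x · g ⟶ y`. -/
theorem preq_hom_eq {x : X.Ob U} {y : X.Ob V}
    (a : A.preq.of (A.quot.obj x) ⟶ A.preq.of (A.quot.obj y)) :
    ∃ (g : G.arr.Ob U) (e : A.mo x = G.t g) (b : X.of (A.sm x g e) ⟶ X.of y),
      a = A.gamma x g e ≫ A.quot.map b := by
  obtain ⟨g, e, b, rfl⟩ := A.arrow_exists_cls a
  exact ⟨g, e, b, A.cls_eq_gamma g e b⟩

theorem gamma_nat {x : X.Ob U} {y : X.Ob V} {g : G.arr.Ob U} {g' : G.arr.Ob V}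
    (p : X.of x ⟶ X.of y) (m : G.arr.of g ⟶ G.arr.of g') (e : A.mo x = G.t g)
    (e' : A.mo y = G.t g') (hp : X.pr p = G.arr.pr m) :
    A.quot.map p ≫ A.gamma y g' e' = A.gamma x g e ≫ A.quot.map (A.smHom p m e e' hp) := by
  refine (A.arrowOf_comp_cls p e' (𝟙 _) e m hp).trans (Eq.trans ?_ (A.cls_comp_arrowOf _ _ _ _).symm)
  exact congrArg (A.cls g e) ((Category.comp_id _).trans (Category.id_comp _).symm)

theorem gamma_mul (x : X.Ob U) (g g' : G.arr.Ob U) (e : A.mo x = G.t g) (i : G.s g = G.t g') :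
    A.gamma x g e ≫ A.gamma (A.sm x g e) g' ((A.mo_sm x g e).trans i) =
      A.gamma x (G.mul g g' i) (e.trans (G.t_mul g g' i).symm) ≫
        A.quot.map (A.coh.beta x g g' e i).hom := by
  refine (A.cls_comp_mk g e (𝟙 _) g' _ (𝟙 _) g' (𝟙 _) (by simp)).trans
    (Eq.trans ?_ (A.cls_comp_arrowOf _ _ _ _).symm)
  refine congrArg (A.cls _ _) ?_
  refine Eq.trans ?_ (Category.id_comp _).symm
  rw [A.smHom_id, Category.comp_id]
  exact Category.comp_id _

theorem gamma_one (x : X.Ob U) (p : U ⟶ G.M) (e : A.mo x = p) :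
    A.gamma x (G.one p) (e.trans (G.t_one p).symm) ≫ A.quot.map (A.coh.eps x p e).hom = 𝟙 _ := by
  refine (A.cls_comp_arrowOf _ _ _ _).trans (Eq.trans ?_ (A.arrowId_eq x p e).symm)
  exact congrArg (A.cls _ _) (Category.id_comp _)

/-- A morphism from `X` which is invariant under the action, in the sense that it comes with arrows
`F x ⟶ F (x · g)`. -/
structure Invariant (S : CFG.{w, u}) where
  mor : Mor X S
  arrow : ∀ {U : Man.{u}} (x : X.Ob U) (g : G.arr.Ob U) (e : A.mo x = G.t g),
    S.of (mor.obj x) ⟶ S.of (mor.obj (A.sm x g e))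
  arrow_pr : ∀ {U : Man.{u}} (x : X.Ob U) (g : G.arr.Ob U) (e : A.mo x = G.t g),
    S.pr (arrow x g e) = 𝟙 U
  arrow_nat : ∀ {U V : Man.{u}} {x : X.Ob U} {y : X.Ob V} {g : G.arr.Ob U} {g' : G.arr.Ob V}
    (p : X.of x ⟶ X.of y) (m : G.arr.of g ⟶ G.arr.of g') (e : A.mo x = G.t g)
    (e' : A.mo y = G.t g') (hp : X.pr p = G.arr.pr m),
    mor.map p ≫ arrow y g' e' = arrow x g e ≫ mor.map (A.smHom p m e e' hp)
  arrow_mul : ∀ {U : Man.{u}} (x : X.Ob U) (g g' : G.arr.Ob U) (e : A.mo x = G.t g)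
    (i : G.s g = G.t g'),
    arrow x g e ≫ arrow (A.sm x g e) g' ((A.mo_sm x g e).trans i) =
      arrow x (G.mul g g' i) (e.trans (G.t_mul g g' i).symm) ≫ mor.map (A.coh.beta x g g' e i).hom
  arrow_one : ∀ {U : Man.{u}} (x : X.Ob U) (p : U ⟶ G.M) (e : A.mo x = p),
    arrow x (G.one p) (e.trans (G.t_one p).symm) ≫ mor.map (A.coh.eps x p e).hom = 𝟙 _

namespace Invariant

variable {A} (I : A.Invariant S)

/-- The effect of an invariant morphism on arrows of the prequotient. -/
def descMap {x : X.Ob U} {y : X.Ob V} (a : A.Arrow x y) : S.of (I.mor.obj x) ⟶ S.of (I.mor.obj y) :=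
  I.arrow x a.out.g a.out.mo_eq ≫ I.mor.map a.out.b

theorem descMap_cls {x : X.Ob U} {y : X.Ob V} (g : G.arr.Ob U) (e : A.mo x = G.t g)
    (b : X.of (A.sm x g e) ⟶ X.of y) : I.descMap (A.cls g e b) = I.arrow x g e ≫ I.mor.map b := by
  have key : ∀ {g g' : G.arr.Ob U} {e : A.mo x = G.t g} {e' : A.mo x = G.t g'}
      {b : X.of (A.sm x g e) ⟶ X.of y} {b' : X.of (A.sm x g' e') ⟶ X.of y},
      A.cls g e b = A.cls g' e' b' → I.arrow x g e ≫ I.mor.map b = I.arrow x g' e' ≫ I.mor.map b' := by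
    intro g g' e e' b b' h
    obtain ⟨j, hj, rfl⟩ := A.cls_eq_iff.1 h
    rw [I.mor.map_comp, ← reassoc_of% (I.arrow_nat (𝟙 _) j e e' hj), I.mor.map_id, Category.id_comp]
  exact key (Quotient.out_eq (A.cls g e b))

theorem descMap_comp {x : X.Ob U} {y : X.Ob V} {z : X.Ob W} (a : A.Arrow x y) (c : A.Arrow y z) :
    I.descMap (A.arrowComp a c) = I.descMap a ≫ I.descMap c := by
  obtain ⟨g, e, b, rfl⟩ := A.arrow_exists_cls a
  obtain ⟨g', e', b', rfl⟩ := A.arrow_exists_cls c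
  obtain ⟨l, m, hm⟩ := lift_exists g' (X.pr b)
  rw [A.cls_comp_mk g e b g' e' b' l m hm, compAux, descMap_cls, descMap_cls, descMap_cls,
    I.mor.map_comp, I.mor.map_comp, ← reassoc_of% I.arrow_mul,
    ← reassoc_of% (I.arrow_nat b m _ e' hm.symm), Category.assoc]

theorem pr_descMap {x : X.Ob U} {y : X.Ob V} (a : A.Arrow x y) :
    S.pr (I.descMap a) = A.arrowPr a := by
  obtain ⟨g, e, b, rfl⟩ := A.arrow_exists_cls a
  rw [I.descMap_cls, pr_comp, I.arrow_pr, I.mor.pr_map, Category.id_comp, A.arrowPr_cls]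

theorem descMap_arrowOf {x : X.Ob U} {y : X.Ob V} (b : X.of x ⟶ X.of y) :
    I.descMap (A.arrowOf b) = I.mor.map b := by
  rw [arrowOf, descMap_cls, I.mor.map_comp, ← Category.assoc, I.arrow_one, Category.id_comp]

theorem descMap_gammaArrow (x : X.Ob U) (g : G.arr.Ob U) (e : A.mo x = G.t g) :
    I.descMap (A.gammaArrow x g e) = I.arrow x g e := by
  rw [gammaArrow, descMap_cls, I.mor.map_id, Category.comp_id]

/-- The morphism from the prequotient given by an invariant morphism. -/
def desc : Mor A.preq S where
  obj x := I.mor.obj x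
  map a := I.descMap a
  map_id x := (I.descMap_cls _ _ _).trans (I.arrow_one x _ rfl)
  map_comp a c := I.descMap_comp a c
  pr_map a := I.pr_descMap a

theorem desc_quot {x : X.Ob U} {y : X.Ob V} (b : X.of x ⟶ X.of y) :
    I.desc.map (A.quot.map b) = I.mor.map b := I.descMap_arrowOf b

theorem desc_gamma (x : X.Ob U) (g : G.arr.Ob U) (e : A.mo x = G.t g) :
    I.desc.map (A.gamma x g e) = I.arrow x g e := I.descMap_gammaArrow x g e

end Invariant

/-- A transformation between morphisms from the prequotient is a 2-morphism if it is natural for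
arrows of `X` and for the arrows `x ⟶ x · g`. -/
def twoMorOfGamma {F F' : Mor A.preq S}
    (η : ∀ {U : Man.{u}} (x : X.Ob U), S.of (F.obj (A.quot.obj x)) ⟶ S.of (F'.obj (A.quot.obj x)))
    (pr_η : ∀ {U : Man.{u}} (x : X.Ob U), S.pr (η x) = 𝟙 U)
    (η_quot : ∀ {U V : Man.{u}} {x : X.Ob U} {y : X.Ob V} (b : X.of x ⟶ X.of y),
      F.map (A.quot.map b) ≫ η y = η x ≫ F'.map (A.quot.map b))
    (η_gamma : ∀ {U : Man.{u}} (x : X.Ob U) (g : G.arr.Ob U) (e : A.mo x = G.t g),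
      F.map (A.gamma x g e) ≫ η (A.sm x g e) = η x ≫ F'.map (A.gamma x g e)) : TwoMor F F' where
  app x := η x
  pr_app x := pr_η x
  naturality {U V x y} a := by
    obtain ⟨g, e, b, rfl⟩ := A.preq_hom_eq (x := x) (y := y) a
    refine (congrArg (· ≫ _) (F.map_comp _ _)).trans ((Category.assoc _ _ _).trans ?_)
    refine (congrArg (_ ≫ ·) (η_quot b)).trans ((Category.assoc _ _ _).symm.trans ?_)
    refine (congrArg (· ≫ _) (η_gamma x g e)).trans ((Category.assoc _ _ _).trans ?_)
    exact congrArg (_ ≫ ·) (F'.map_comp _ _).symm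

end Action

end StackyQuotient

end

noncomputable section

universe w w' k

namespace StackyQuotient

variable {G H : CfgGroupoid.{w, u}} {X P Q : CFG.{w, u}} {U V W : Man.{u}}

/-- The projection from the first quotient is equivariant as a morphism from the prequotient. -/
def Action.InducedAction.equivariance {A : Action (G.prod H) X} {ι : Mor A.left.preq Q}
    (B : A.InducedAction ι) : Equivariance A.commuting.preq B.action ι where
  mo_eq x := B.equiv.mo_eq x
  phi x h e := B.equiv.phi x h e
  phi_pr x h e := B.equiv.phi_pr x h e
  phi_nat {U V x h x' h'} a j e e' hp := by
    obtain ⟨g, i, b, rfl⟩ := A.left.preq_hom_eq (x := x) (y := x') a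
    have hb : X.pr b = H.arr.pr j :=
      ((A.left.arrowPr_cls g i b).symm.trans (congrArg _ (A.left.cls_eq_gamma g i b))).trans hp
    have hγ : A.left.preq.pr (A.left.gamma x g i) = H.arr.pr (𝟙 (H.arr.of h)) :=
      (A.left.arrowPr_gammaArrow x g i).trans (H.arr.pr_id h).symm
    have hq : A.left.preq.pr (A.left.quot.map b) = H.arr.pr j :=
      (A.left.arrowPr_arrowOf b).trans hb
    have i' := (A.commuting.moR x g i).trans e
    have s₁ := (B.action.smHom_congr (ι.map_comp (A.left.gamma x g i) (A.left.quot.map b))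
      (Category.id_comp j).symm ((B.equiv.mo_eq x).trans e) ((B.equiv.mo_eq x').trans e')
      ((ι.pr_map _).trans hp)
      ((pr_comp _ _).trans ((congrArg₂ (· ≫ ·) ((ι.pr_map _).trans hγ) ((ι.pr_map _).trans hq)).trans
        (pr_comp _ _).symm))).trans (B.action.smHom_comp (ι.map (A.left.gamma x g i)) (𝟙 _)
      ((B.equiv.mo_eq x).trans e) ((B.equiv.mo_eq _).trans i') ((ι.pr_map _).trans hγ)
      (ι.map (A.left.quot.map b)) j ((B.equiv.mo_eq x').trans e') ((ι.pr_map _).trans hq)).symm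
    have s₂ := B.equiv.phi_nat b j i' e' hb
    have s₃ := B.phi_gamma x g h i e
    have s₄ := (congrArg ι.map ((A.commuting.preq.smHom_congr rfl (Category.id_comp j).symm e e' hp
      (hp.trans (congrArg _ (Category.id_comp j).symm))).trans
      ((A.commuting.preq.smHom_comp (A.left.gamma x g i) (𝟙 _) e i' hγ (A.left.quot.map b) j e'
        hq).symm.trans (congrArg₂ (· ≫ ·) (A.commuting.smHom_gamma x g h i e)
          (A.commuting.preqPre_smHom b j i' e' hb))))).trans
      ((ι.map_comp _ _).trans (congrArg (· ≫ _) (ι.map_comp _ _)))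
    refine (congrArg (· ≫ _) s₁).trans ((Category.assoc _ _ _).trans ?_)
    refine (congrArg (_ ≫ ·) s₂).trans ((Category.assoc _ _ _).symm.trans ?_)
    refine (congrArg (· ≫ _) s₃).trans ((Category.assoc _ _ _).trans ?_)
    exact congrArg (_ ≫ ·) s₄.symm
  phi_beta x g h e i := B.equiv.phi_beta x g h e i
  phi_eps x p e := B.equiv.phi_eps x p e

namespace Equivariance

variable {R : Action H P} {B : Action H Q} {ι : Mor P Q} (E : Equivariance R B ι)

/-- An equivariant morphism, followed by the projection to the prequotient of its target, is
invariant. -/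
def invariant : R.Invariant B.preq where
  mor := ι.comp B.quot
  arrow x g e := B.gamma (ι.obj x) g ((E.mo_eq x).trans e) ≫ B.quot.map (E.phi x g e)
  arrow_pr x g e := (pr_comp _ _).trans ((congrArg₂ (· ≫ ·) (B.gamma_pr _ _ _)
    ((B.quot.pr_map _).trans (E.phi_pr x g e))).trans (Category.comp_id _))
  arrow_nat p m e e' hp := by
    refine (Category.assoc _ _ _).symm.trans ((congrArg (· ≫ _) (B.gamma_nat (ι.map p) m
      ((E.mo_eq _).trans e) ((E.mo_eq _).trans e') ((ι.pr_map p).trans hp))).trans ?_)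
    refine (Category.assoc _ _ _).trans (Eq.trans (congrArg (_ ≫ ·) ?_) (Category.assoc _ _ _).symm)
    exact (B.quot.map_comp _ _).symm.trans ((congrArg B.quot.map (E.phi_nat p m e e' hp)).trans
      (B.quot.map_comp _ _))
  arrow_mul x g g' e i := by
    have i' := (R.mo_sm x g e).trans i
    have s₁ := B.gamma_nat (E.phi x g e) (𝟙 _) ((B.mo_sm _ _ _).trans i)
      ((E.mo_eq _).trans i') ((E.phi_pr x g e).trans (H.arr.pr_id g').symm)
    have s₂ := B.gamma_mul (ι.obj x) g g' ((E.mo_eq x).trans e) i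
    have s₃ := (B.quot.map_comp _ _).symm.trans ((congrArg B.quot.map (E.phi_beta x g g' e i)).trans
      ((B.quot.map_comp _ _).trans (congrArg (_ ≫ ·) (B.quot.map_comp _ _))))
    refine (Category.assoc _ _ _).trans ((congrArg (_ ≫ ·) ((Category.assoc _ _ _).symm.trans
      ((congrArg (· ≫ _) s₁).trans (Category.assoc _ _ _)))).trans ?_)
    refine (Category.assoc _ _ _).symm.trans ((congrArg (· ≫ _) s₂).trans ?_)
    refine (Category.assoc _ _ _).trans ((congrArg (_ ≫ ·) s₃.symm).trans ?_)
    exact (Category.assoc _ _ _).symm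
  arrow_one x p e := by
    refine (Category.assoc _ _ _).trans ((congrArg (_ ≫ ·) ((B.quot.map_comp _ _).symm.trans
      (congrArg B.quot.map (E.phi_eps x p e)))).trans ?_)
    exact B.gamma_one _ p ((E.mo_eq x).trans e)

/-- The morphism between prequotients induced by an equivariant morphism. -/
def preq : Mor R.preq B.preq := E.invariant.desc

theorem preq_cls {x : P.Ob U} {y : P.Ob V} (g : H.arr.Ob U) (e : R.mo x = H.t g)
    (b : P.of (R.sm x g e) ⟶ P.of y) : E.preq.map (R.gamma x g e ≫ R.quot.map b) =
      B.cls g ((E.mo_eq x).trans e) (E.phi x g e ≫ ι.map b) := by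
  refine (E.preq.map_comp _ _).trans ((congrArg₂ (· ≫ ·) (E.invariant.desc_gamma x g e)
    (E.invariant.desc_quot b)).trans ((Category.assoc _ _ _).trans ?_))
  refine (congrArg (_ ≫ ·) (B.quot.map_comp _ _).symm).trans ?_
  exact (B.cls_eq_gamma _ _ _).symm

instance (x : P.Ob U) (g : H.arr.Ob U) (e : R.mo x = H.t g) : IsIso (E.phi x g e) :=
  isIso_of_pr _ (E.phi_pr x g e)

theorem preq_full (h : ι.LocEquiv) {x x' : P.Ob U}
    (m : B.preq.of (E.preq.obj (R.quot.obj x)) ⟶ B.preq.of (E.preq.obj (R.quot.obj x')))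
    (hm : B.preq.pr m = 𝟙 U) : ∃ C ∈ Man.topology U, ∀ {W : Man.{u}} (z : P.Ob W)
      (r : R.preq.of (R.quot.obj z) ⟶ R.preq.of (R.quot.obj x)), C (R.preq.pr r) →
        ∃ n : R.preq.of (R.quot.obj z) ⟶ R.preq.of (R.quot.obj x'), E.preq.map n = E.preq.map r ≫ m := by
  obtain ⟨g, i, b, rfl⟩ := B.preq_hom_eq (x := ι.obj x) (y := ι.obj x') m
  have e : R.mo x = H.t g := (E.mo_eq x).symm.trans i
  have hb : Q.pr b = 𝟙 U := ((B.arrowPr_cls g i b).symm.trans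
    (congrArg _ (B.cls_eq_gamma g i b))).trans hm
  obtain ⟨v, hv, hv'⟩ : ∃ v, E.phi x g e ≫ v = 𝟙 _ ∧ Q.pr v = 𝟙 U :=
    ⟨inv (E.phi x g e), IsIso.hom_inv_id _, pr_isIso_inv _ (E.phi_pr x g e)⟩
  obtain ⟨C, hC, hh⟩ := h.full (R.sm x g e) x' (v ≫ b) (by
    rw [pr_comp, hb, hv', Category.comp_id])
  refine ⟨C, hC, fun {W} z r hr => ?_⟩
  obtain ⟨k, f, r', hr'⟩ := R.preq_hom_eq (x := z) (y := R.sm x g e) (r ≫ R.gamma x g e)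
  have hp : P.pr r' = R.preq.pr r := by
    refine ((R.arrowPr_cls k f r').symm.trans (congrArg _ (R.cls_eq_gamma k f r'))).trans
      ((congrArg R.preq.pr hr').symm.trans ((pr_comp _ _).trans ?_))
    exact (congrArg (_ ≫ ·) (R.gamma_pr x g e)).trans (Category.comp_id _)
  obtain ⟨n₀, hn₀⟩ := hh _ r' (by rwa [hp])
  refine ⟨R.gamma z k f ≫ R.quot.map n₀, ?_⟩
  have s₁ : E.preq.map (R.quot.map n₀) = E.preq.map (R.quot.map r') ≫
      B.quot.map v ≫ B.quot.map b := by
    refine (E.invariant.desc_quot n₀).trans ((congrArg B.quot.map hn₀).trans ?_)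
    refine (B.quot.map_comp _ _).trans (congrArg₂ (· ≫ ·) (E.invariant.desc_quot r').symm ?_)
    exact B.quot.map_comp _ _
  have s₂ : E.preq.map (R.gamma x g e) ≫ B.quot.map v =
      B.gamma (ι.obj x) g i := by
    refine (congrArg (· ≫ _) (E.invariant.desc_gamma x g e)).trans ((Category.assoc _ _ _).trans ?_)
    refine (congrArg (_ ≫ ·) ((B.quot.map_comp _ _).symm.trans ((congrArg B.quot.map
      hv).trans (B.quot.map_id _)))).trans (Category.comp_id _)
  refine (E.preq.map_comp _ _).trans ((congrArg (_ ≫ ·) s₁).trans ?_)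
  refine (Category.assoc _ _ _).symm.trans ?_
  refine (congrArg (· ≫ _) ((E.preq.map_comp _ _).symm.trans ((congrArg E.preq.map hr'.symm).trans
    (E.preq.map_comp _ _)))).trans ?_
  refine (Category.assoc _ _ _).trans (congrArg (_ ≫ ·) ?_)
  exact (Category.assoc _ _ _).symm.trans (congrArg (· ≫ _) s₂)

theorem preq_faithful (h : ι.LocEquiv) {x x' : P.Ob U}
    {n n' : R.preq.of (R.quot.obj x) ⟶ R.preq.of (R.quot.obj x')} (hn : R.preq.pr n = 𝟙 U)
    (hn' : R.preq.pr n' = 𝟙 U) (hnn : E.preq.map n = E.preq.map n') : ∃ C ∈ Man.topology U, ∀ {W : Man.{u}}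
      (z : P.Ob W) (r : R.preq.of (R.quot.obj z) ⟶ R.preq.of (R.quot.obj x)), C (R.preq.pr r) →
        r ≫ n = r ≫ n' := by
  obtain ⟨g, e, b, rfl⟩ := R.preq_hom_eq (x := x) (y := x') n
  obtain ⟨g', e', b', rfl⟩ := R.preq_hom_eq (x := x) (y := x') n'
  have hb : P.pr b = 𝟙 U := ((R.arrowPr_cls g e b).symm.trans
    (congrArg _ (R.cls_eq_gamma g e b))).trans hn
  have hb' : P.pr b' = 𝟙 U := ((R.arrowPr_cls g' e' b').symm.trans
    (congrArg _ (R.cls_eq_gamma g' e' b'))).trans hn'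
  obtain ⟨j, hj, hjb⟩ := B.cls_eq_iff.1 ((E.preq_cls g e b).symm.trans
    (hnn.trans (E.preq_cls g' e' b')))
  have hj' : P.pr (𝟙 (P.of x)) = H.arr.pr j := (P.pr_id _).trans ((Q.pr_id _).symm.trans hj)
  have key : ι.map b = ι.map (R.smHom (𝟙 _) j e e' hj' ≫ b') := by
    rw [← cancel_epi (E.phi x g e), ι.map_comp, ← reassoc_of% (E.phi_nat (𝟙 _) j e e' hj'), ← hjb]
    congr 1
    exact B.smHom_congr (ι.map_id x).symm rfl _ _ _ _
  obtain ⟨C, hC, hh⟩ := h.faithful hb (by rw [pr_comp, R.pr_smHom, hb', pr_id, Category.comp_id])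
    key
  refine ⟨C, hC, fun {W} z r hr => ?_⟩
  obtain ⟨k, f, r', hr'⟩ := R.preq_hom_eq (x := z) (y := R.sm x g e) (r ≫ R.gamma x g e)
  have hp : P.pr r' = R.preq.pr r := by
    refine ((R.arrowPr_cls k f r').symm.trans (congrArg _ (R.cls_eq_gamma k f r'))).trans
      ((congrArg R.preq.pr hr').symm.trans ((pr_comp _ _).trans ?_))
    exact (congrArg (_ ≫ ·) (R.gamma_pr x g e)).trans (Category.comp_id _)
  have hz := hh _ r' (by rwa [hp])
  have s₁ : R.gamma x g' e' ≫ R.quot.map b' =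
      R.gamma x g e ≫ R.quot.map (R.smHom (𝟙 _) j e e' hj' ≫ b') := by
    refine Eq.trans ?_ (congrArg (_ ≫ ·) (R.quot.map_comp _ _).symm)
    refine Eq.trans (congrArg (· ≫ _) ?_) (Category.assoc _ _ _)
    refine Eq.trans ?_ (R.gamma_nat (𝟙 _) j e e' hj')
    exact (Category.id_comp _).symm.trans (congrArg (· ≫ _) (R.quot.map_id x).symm)
  have s₂ : ∀ c : P.of (R.sm x g e) ⟶ P.of x', r ≫ R.gamma x g e ≫ R.quot.map c =
      R.gamma z k f ≫ R.quot.map (r' ≫ c) := fun c => by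
    refine (Category.assoc _ _ _).symm.trans ((congrArg (· ≫ _) hr').trans ?_)
    exact (Category.assoc _ _ _).trans (congrArg (_ ≫ ·) (R.quot.map_comp _ _).symm)
  refine (s₂ b).trans (Eq.trans ?_ (congrArg (r ≫ ·) s₁).symm)
  exact (congrArg (fun c => R.gamma z k f ≫ R.quot.map c) hz).trans (s₂ _).symm

/-- The prequotients of a local equivalence are locally equivalent. -/
theorem preq_locEquiv (h : ι.LocEquiv) : E.preq.LocEquiv where
  surj y := by
    obtain ⟨C, hC, hh⟩ := h.surj y
    refine ⟨C, hC, fun f hf => ?_⟩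
    obtain ⟨x, a, ha⟩ := hh f hf
    exact ⟨x, B.quot.map a, (B.quot.pr_map a).trans ha⟩
  full {_} x x' m hm := E.preq_full h (x := x) (x' := x') m hm
  faithful {_ x x'} _ _ hn hn' hnn := E.preq_faithful h (x := x) (x' := x') hn hn' hnn

end Equivariance

end StackyQuotient

end

noncomputable section

universe w w' k

namespace StackyQuotient

namespace Action

section mu

variable {G : CfgGroupoid.{w, u}} {X : CFG.{w, u}} {U V W : Man.{u}} (A : Action G X)

theorem gamma_mu (x : X.Ob U) {g g' k : G.arr.Ob U} (e : A.mo x = G.t g) (i : G.s g = G.t g')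
    (f : A.mo x = G.t k) (j : G.arr.of (G.mul g g' i) ⟶ G.arr.of k) (hj : G.arr.pr j = 𝟙 U) :
    A.gamma x g e ≫ A.gamma (A.sm x g e) g' ((A.mo_sm x g e).trans i) ≫
      A.quot.map (A.mu x e i f j hj) = A.gamma x k f := by
  have hj' : X.pr (𝟙 (X.of x)) = G.arr.pr j := (X.pr_id x).trans hj.symm
  have s₁ := A.gamma_nat (𝟙 (X.of x)) j (e.trans (G.t_mul g g' i).symm) f hj'
  have s₂ : A.mu x e i f j hj = (A.coh.beta x g g' e i).inv ≫ A.smHom (𝟙 (X.of x)) j _ f hj' := rfl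
  refine (Category.assoc _ _ _).symm.trans ((congrArg (· ≫ _) (A.gamma_mul x g g' e i)).trans ?_)
  refine (Category.assoc _ _ _).trans ((congrArg (_ ≫ ·) ((A.quot.map_comp _ _).symm.trans
    (congrArg A.quot.map ((congrArg (_ ≫ ·) s₂).trans (Iso.hom_inv_id_assoc _ _))))).trans ?_)
  refine s₁.symm.trans ((congrArg (· ≫ _) (A.quot.map_id x)).trans (Category.id_comp _))

end mu

variable {G H : CfgGroupoid.{w, u}} {X : CFG.{w, u}} {U V W : Man.{u}} (A : Action (G.prod H) X)

/-- The arrow from `x` to `x · (g, h)` in the prequotient by a product. -/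
def gammaProd (x : X.Ob U) (g : G.arr.Ob U) (h : H.arr.Ob U) (e₁ : A.mo₁ x = G.t g)
    (e₂ : A.mo₂ x = H.t h) :
    A.preq.of (A.quot.obj x) ⟶ A.preq.of (A.quot.obj (A.sm₂ x g h e₁ e₂)) :=
  A.gamma x (prodOb g h) (Man.prod_ext e₁ e₂)

/-- The arrow from `x` to `x · g` in the prequotient by a product. -/
def gammaL (x : X.Ob U) (g : G.arr.Ob U) (e : A.mo₁ x = G.t g) :
    A.preq.of (A.quot.obj x) ⟶ A.preq.of (A.quot.obj (A.left.sm x g e)) :=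
  A.gammaProd x g (H.one (A.mo₂ x)) e (H.t_one _).symm

/-- The arrow from `x` to `x · h` in the prequotient by a product. -/
def gammaR (x : X.Ob U) (h : H.arr.Ob U) (e : A.mo₂ x = H.t h) :
    A.preq.of (A.quot.obj x) ⟶ A.preq.of (A.quot.obj (A.right.sm x h e)) :=
  A.gammaProd x (G.one (A.mo₁ x)) h (G.t_one _).symm e

theorem gammaL_pr (x : X.Ob U) (g : G.arr.Ob U) (e : A.mo₁ x = G.t g) :
    A.preq.pr (A.gammaL x g e) = 𝟙 U := A.gamma_pr _ _ _

theorem gammaR_pr (x : X.Ob U) (h : H.arr.Ob U) (e : A.mo₂ x = H.t h) :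
    A.preq.pr (A.gammaR x h e) = 𝟙 U := A.gamma_pr _ _ _

theorem gammaProd_nat {x : X.Ob U} {y : X.Ob V} {g : G.arr.Ob U} {g' : G.arr.Ob V}
    {h : H.arr.Ob U} {h' : H.arr.Ob V} (b : X.of x ⟶ X.of y) (j : G.arr.of g ⟶ G.arr.of g')
    (k : H.arr.of h ⟶ H.arr.of h') (e₁ : A.mo₁ x = G.t g) (e₂ : A.mo₂ x = H.t h)
    (f₁ : A.mo₁ y = G.t g') (f₂ : A.mo₂ y = H.t h') (hj : X.pr b = G.arr.pr j)
    (hk : X.pr b = H.arr.pr k) :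
    A.quot.map b ≫ A.gammaProd y g' h' f₁ f₂ =
      A.gammaProd x g h e₁ e₂ ≫ A.quot.map (A.smHom₂ b j k e₁ e₂ f₁ f₂ hj hk) :=
  A.gamma_nat b (g := prodOb g h) (g' := prodOb g' h') (prodHom j k (hj.symm.trans hk)) _ _ hj

theorem gammaL_nat {x : X.Ob U} {y : X.Ob V} {g : G.arr.Ob U} {g' : G.arr.Ob V}
    (b : X.of x ⟶ X.of y) (j : G.arr.of g ⟶ G.arr.of g') (e : A.mo₁ x = G.t g)
    (f : A.mo₁ y = G.t g') (hj : X.pr b = G.arr.pr j) :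
    A.quot.map b ≫ A.gammaL y g' f =
      A.gammaL x g e ≫ A.quot.map (A.left.smHom b j e f hj) :=
  A.gammaProd_nat b j _ _ _ _ _ hj (H.pr_oneHom _ _ _ (A.mo₂_eq b)).symm

theorem gammaR_nat {x : X.Ob U} {y : X.Ob V} {h : H.arr.Ob U} {h' : H.arr.Ob V}
    (b : X.of x ⟶ X.of y) (k : H.arr.of h ⟶ H.arr.of h') (e : A.mo₂ x = H.t h)
    (f : A.mo₂ y = H.t h') (hk : X.pr b = H.arr.pr k) :
    A.quot.map b ≫ A.gammaR y h' f =
      A.gammaR x h e ≫ A.quot.map (A.right.smHom b k e f hk) :=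
  A.gammaProd_nat b _ k _ _ _ _ (G.pr_oneHom _ _ _ (A.mo₁_eq b)).symm hk

theorem gammaProd_mu (x : X.Ob U) {g g' k : G.arr.Ob U} {h h' l : H.arr.Ob U}
    (e₁ : A.mo₁ x = G.t g)
    (e₂ : A.mo₂ x = H.t h) (i₁ : G.s g = G.t g') (i₂ : H.s h = H.t h') (f₁ : A.mo₁ x = G.t k)
    (f₂ : A.mo₂ x = H.t l) (j₁ : G.arr.of (G.mul g g' i₁) ⟶ G.arr.of k)
    (j₂ : H.arr.of (H.mul h h' i₂) ⟶ H.arr.of l) (hj₁ : G.arr.pr j₁ = 𝟙 U)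
    (hj₂ : H.arr.pr j₂ = 𝟙 U) :
    A.gammaProd x g h e₁ e₂ ≫ A.gammaProd (A.sm₂ x g h e₁ e₂) g' h' ((A.mo₁_sm x g h e₁ e₂).trans i₁)
      ((A.mo₂_sm x g h e₁ e₂).trans i₂) ≫
      A.quot.map (A.mu₂ x e₁ e₂ i₁ i₂ f₁ f₂ j₁ j₂ hj₁ hj₂) = A.gammaProd x k l f₁ f₂ :=
  A.gamma_mu x (g := prodOb g h) (g' := prodOb g' h') (k := prodOb k l) (Man.prod_ext e₁ e₂)
    (Man.pair_eq i₁ i₂) (Man.prod_ext f₁ f₂) (prodHom j₁ j₂ (hj₁.trans hj₂.symm)) hj₁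

theorem gammaR_gammaL (x : X.Ob U) (g : G.arr.Ob U) (h : H.arr.Ob U) (e₁ : A.mo₁ x = G.t g)
    (e₂ : A.mo₂ x = H.t h) :
    A.gammaR x h e₂ ≫ A.gammaL (A.right.sm x h e₂) g ((A.mo₁_right x h e₂).trans e₁) ≫
      A.quot.map (A.xi₁ x g h e₁ e₂).hom = A.gammaProd x g h e₁ e₂ :=
  A.gammaProd_mu x (G.t_one _).symm e₂ ((G.s_one _).trans e₁)
    ((A.mo₂_right x h e₂).symm.trans (H.t_one _).symm) e₁ e₂ _ _ (G.coh.lam_pr _ _ _)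
    (H.coh.rho_pr _ _ _)

theorem gammaL_gammaR (x : X.Ob U) (g : G.arr.Ob U) (h : H.arr.Ob U) (e₁ : A.mo₁ x = G.t g)
    (e₂ : A.mo₂ x = H.t h) :
    A.gammaL x g e₁ ≫ A.gammaR (A.left.sm x g e₁) h ((A.mo₂_left x g e₁).trans e₂) ≫
      A.quot.map (A.xi₂ x g h e₁ e₂).hom = A.gammaProd x g h e₁ e₂ :=
  A.gammaProd_mu x e₁ (H.t_one _).symm ((A.mo₁_left x g e₁).symm.trans (G.t_one _).symm)
    ((H.s_one _).trans e₂) e₁ e₂ _ _ (G.coh.rho_pr _ _ _) (H.coh.lam_pr _ _ _)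

theorem gamma_delta (x : X.Ob U) (g : G.arr.Ob U) (h : H.arr.Ob U) (e₁ : A.mo₁ x = G.t g)
    (e₂ : A.mo₂ x = H.t h) :
    A.gammaR x h e₂ ≫ A.gammaL (A.right.sm x h e₂) g ((A.mo₁_right x h e₂).trans e₁) ≫
      A.quot.map (A.delta x g h e₁ e₂).hom =
    A.gammaL x g e₁ ≫ A.gammaR (A.left.sm x g e₁) h ((A.mo₂_left x g e₁).trans e₂) := by
  have hi : A.quot.map (A.xi₂ x g h e₁ e₂).hom ≫ A.quot.map (A.xi₂ x g h e₁ e₂).inv = 𝟙 _ :=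
    (A.quot.map_comp _ _).symm.trans ((congrArg A.quot.map (Iso.hom_inv_id _)).trans
      (A.quot.map_id _))
  have s := (A.gammaR_gammaL x g h e₁ e₂).trans (A.gammaL_gammaR x g h e₁ e₂).symm
  have hd : A.quot.map (A.delta x g h e₁ e₂).hom =
      A.quot.map (A.xi₁ x g h e₁ e₂).hom ≫ A.quot.map (A.xi₂ x g h e₁ e₂).inv :=
    A.quot.map_comp _ _
  have s' := congrArg (· ≫ A.quot.map (A.xi₂ x g h e₁ e₂).inv) s
  simp only [Category.assoc] at s'
  rw [hd, s', hi, Category.comp_id]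

theorem gammaL_mul (x : X.Ob U) (g g' : G.arr.Ob U) (e : A.mo₁ x = G.t g) (i : G.s g = G.t g') :
    A.gammaL x g e ≫ A.gammaL (A.left.sm x g e) g' ((A.mo₁_left x g e).trans i) =
      A.gammaL x (G.mul g g' i) (e.trans (G.t_mul g g' i).symm) ≫
        A.quot.map (A.left.coh.beta x g g' e i).hom := by
  have hi : A.quot.map (A.left.coh.beta x g g' e i).inv ≫
      A.quot.map (A.left.coh.beta x g g' e i).hom = 𝟙 _ :=
    (A.quot.map_comp _ _).symm.trans ((congrArg A.quot.map (Iso.inv_hom_id _)).trans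
      (A.quot.map_id _))
  have s : A.gammaL x g e ≫ A.gammaL (A.left.sm x g e) g' ((A.mo₁_left x g e).trans i) ≫
      A.quot.map (A.left.coh.beta x g g' e i).inv =
        A.gammaL x (G.mul g g' i) (e.trans (G.t_mul g g' i).symm) :=
    A.gammaProd_mu x e (H.t_one _).symm i
        ((H.s_one _).trans ((A.mo₂_left x g e).symm.trans (H.t_one _).symm))
        (e.trans (G.t_mul g g' i).symm) (H.t_one _).symm (𝟙 _)
        (H.oneOne _ _ (A.mo₂_left x g e).symm).hom (G.arr.pr_id _) (H.oneOne_pr _ _ _)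
  rw [← s, Category.assoc, Category.assoc, hi, Category.comp_id]

theorem gammaR_mul (x : X.Ob U) (h h' : H.arr.Ob U) (e : A.mo₂ x = H.t h) (i : H.s h = H.t h') :
    A.gammaR x h e ≫ A.gammaR (A.right.sm x h e) h' ((A.mo₂_right x h e).trans i) =
      A.gammaR x (H.mul h h' i) (e.trans (H.t_mul h h' i).symm) ≫
        A.quot.map (A.right.coh.beta x h h' e i).hom := by
  have hi : A.quot.map (A.right.coh.beta x h h' e i).inv ≫
      A.quot.map (A.right.coh.beta x h h' e i).hom = 𝟙 _ :=
    (A.quot.map_comp _ _).symm.trans ((congrArg A.quot.map (Iso.inv_hom_id _)).trans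
      (A.quot.map_id _))
  have s : A.gammaR x h e ≫ A.gammaR (A.right.sm x h e) h' ((A.mo₂_right x h e).trans i) ≫
      A.quot.map (A.right.coh.beta x h h' e i).inv =
        A.gammaR x (H.mul h h' i) (e.trans (H.t_mul h h' i).symm) :=
    A.gammaProd_mu x (G.t_one _).symm e
        ((G.s_one _).trans ((A.mo₁_right x h e).symm.trans (G.t_one _).symm)) i
        (G.t_one _).symm (e.trans (H.t_mul h h' i).symm)
        (G.oneOne _ _ (A.mo₁_right x h e).symm).hom (𝟙 _) (G.oneOne_pr _ _ _) (H.arr.pr_id _)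
  rw [← s, Category.assoc, Category.assoc, hi, Category.comp_id]

theorem gammaL_one (x : X.Ob U) (p : U ⟶ G.M) (e : A.mo₁ x = p) :
    A.gammaL x (G.one p) (e.trans (G.t_one p).symm) ≫ A.quot.map (A.left.coh.eps x p e).hom = 𝟙 _ :=
  A.gamma_one x (Man.pair p (A.mo₂ x)) (Man.prod_ext e rfl)

theorem gammaR_one (x : X.Ob U) (p : U ⟶ H.M) (e : A.mo₂ x = p) :
    A.gammaR x (H.one p) (e.trans (H.t_one p).symm) ≫ A.quot.map (A.right.coh.eps x p e).hom = 𝟙 _ :=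
  A.gamma_one x (Man.pair (A.mo₁ x) p) (Man.prod_ext rfl e)

/-- The projection to the prequotient by a product is invariant under the first factor. -/
def leftInvariant : A.left.Invariant A.preq where
  mor := A.quot
  arrow x g e := A.gammaL x g e
  arrow_pr x g e := A.gammaL_pr x g e
  arrow_nat p m e e' hp := A.gammaL_nat p m e e' hp
  arrow_mul x g g' e i := A.gammaL_mul x g g' e i
  arrow_one x p e := A.gammaL_one x p e

/-- The morphism from the prequotient by the first factor to the prequotient by the product. -/
def ofLeft : Mor A.left.preq A.preq := A.leftInvariant.desc

theorem ofLeft_quot {x : X.Ob U} {y : X.Ob V} (b : X.of x ⟶ X.of y) :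
    A.ofLeft.map (A.left.quot.map b) = A.quot.map b := A.leftInvariant.desc_quot b

theorem ofLeft_gamma (x : X.Ob U) (g : G.arr.Ob U) (e : A.mo₁ x = G.t g) :
    A.ofLeft.map (A.left.gamma x g e) = A.gammaL x g e := A.leftInvariant.desc_gamma x g e

/-- The morphism from the prequotient by the first factor to the prequotient by the product is
invariant under the second factor. -/
def ofLeftInvariant : A.commuting.preq.Invariant A.preq where
  mor := A.ofLeft
  arrow x h e := A.gammaR x h e
  arrow_pr x h e := A.gammaR_pr x h e
  arrow_nat {U V x y h h'} p m e e' hp := by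
    obtain ⟨g, i, b, rfl⟩ := A.left.preq_hom_eq (x := x) (y := y) p
    have hb : X.pr b = H.arr.pr m :=
      ((A.left.arrowPr_cls g i b).symm.trans (congrArg _ (A.left.cls_eq_gamma g i b))).trans hp
    have hγ : A.left.preq.pr (A.left.gamma x g i) = H.arr.pr (𝟙 (H.arr.of h)) :=
      (A.left.arrowPr_gammaArrow x g i).trans (H.arr.pr_id h).symm
    have hq : A.left.preq.pr (A.left.quot.map b) = H.arr.pr m :=
      (A.left.arrowPr_arrowOf b).trans hb
    have i' := (A.commuting.moR x g i).trans e
    have s := (A.commuting.preq.smHom_congr rfl (Category.id_comp m).symm e e' hp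
      (hp.trans (congrArg _ (Category.id_comp m).symm))).trans
      ((A.commuting.preq.smHom_comp (A.left.gamma x g i) (𝟙 _) e i' hγ (A.left.quot.map b) m e'
        hq).symm.trans (congrArg₂ (· ≫ ·) (A.commuting.smHom_gamma x g h i e)
          (A.commuting.preqPre_smHom b m i' e' hb)))
    have s' := (congrArg A.ofLeft.map s).trans ((A.ofLeft.map_comp _ _).trans (congrArg₂ (· ≫ ·)
      ((A.ofLeft.map_comp _ _).trans (congrArg₂ (· ≫ ·) (A.ofLeft_gamma _ _ _) (A.ofLeft_quot _)))
      (A.ofLeft_quot _)))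
    refine Eq.trans ?_ (congrArg (_ ≫ ·) s').symm
    refine (congrArg (· ≫ _) ((A.ofLeft.map_comp _ _).trans (congrArg₂ (· ≫ ·)
      (A.ofLeft_gamma x g i) (A.ofLeft_quot b)))).trans ?_
    refine (Category.assoc _ _ _).trans ((congrArg (_ ≫ ·) (A.gammaR_nat b m i' e' hb)).trans ?_)
    refine (Category.assoc _ _ _).symm.trans (Eq.trans ?_ (Category.assoc _ _ _))
    exact congrArg (· ≫ _) (A.gamma_delta x g h i e).symm
  arrow_mul x h h' e i :=
    (A.gammaR_mul x h h' e i).trans (congrArg (_ ≫ ·) (A.ofLeft_quot _).symm)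
  arrow_one x p e := (congrArg (_ ≫ ·) (A.ofLeft_quot _)).trans (A.gammaR_one x p e)

/-- The comparison from the iterated prequotient to the prequotient by the product. -/
def stages : Mor A.commuting.preq.preq A.preq := A.ofLeftInvariant.desc

theorem stages_quot {x : X.Ob U} {y : X.Ob V}
    (b : A.left.preq.of (A.left.quot.obj x) ⟶ A.left.preq.of (A.left.quot.obj y)) :
    A.stages.map (A.commuting.preq.quot.map b) = A.ofLeft.map b := A.ofLeftInvariant.desc_quot b

theorem stages_gamma (x : X.Ob U) (h : H.arr.Ob U) (e : A.mo₂ x = H.t h) :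
    A.stages.map (A.commuting.preq.gamma x h e) = A.gammaR x h e :=
  A.ofLeftInvariant.desc_gamma x h e

/-- Every arrow of the prequotient by a product is a composition `x ⟶ x · (g, h) ⟶ y`. -/
theorem preq_hom_eq_prod {x : X.Ob U} {y : X.Ob V}
    (a : A.preq.of (A.quot.obj x) ⟶ A.preq.of (A.quot.obj y)) :
    ∃ (g : G.arr.Ob U) (h : H.arr.Ob U) (e₁ : A.mo₁ x = G.t g) (e₂ : A.mo₂ x = H.t h)
      (b : X.of (A.sm₂ x g h e₁ e₂) ⟶ X.of y), a = A.gammaProd x g h e₁ e₂ ≫ A.quot.map b := by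
  obtain ⟨c, e, b, rfl⟩ := A.preq_hom_eq a
  exact ⟨obFst c, obSnd c, CfgGroupoid.fst_eq e, CfgGroupoid.snd_eq e, b, rfl⟩

theorem stages_cls {x : X.Ob U} {y : X.Ob V} (g : G.arr.Ob U) (h : H.arr.Ob U)
    (e₁ : A.mo₁ x = G.t g) (e₂ : A.mo₂ x = H.t h)
    (b : X.of (A.sm₂ x g h e₁ e₂) ⟶ X.of y) :
    A.stages.map (A.commuting.preq.gamma x h e₂ ≫ A.commuting.preq.quot.map
      (A.left.gamma (A.right.sm x h e₂) g ((A.mo₁_right x h e₂).trans e₁) ≫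
        A.left.quot.map ((A.xi₁ x g h e₁ e₂).hom ≫ b))) =
      A.gammaProd x g h e₁ e₂ ≫ A.quot.map b := by
  refine (A.stages.map_comp _ _).trans ((congrArg₂ (· ≫ ·) (A.stages_gamma x h e₂)
    ((A.stages_quot _).trans ((A.ofLeft.map_comp _ _).trans (congrArg₂ (· ≫ ·)
      (A.ofLeft_gamma _ _ _) ((A.ofLeft_quot _).trans (A.quot.map_comp _ _)))))).trans ?_)
  have s := congrArg (· ≫ A.quot.map b) (A.gammaR_gammaL x g h e₁ e₂)
  simp only [Category.assoc] at s
  exact s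

theorem stages_full {x : X.Ob U} {y : X.Ob V}
    (m : A.preq.of (A.quot.obj x) ⟶ A.preq.of (A.quot.obj y)) :
    ∃ n : A.commuting.preq.preq.of (A.commuting.preq.quot.obj (A.left.quot.obj x)) ⟶
      A.commuting.preq.preq.of (A.commuting.preq.quot.obj (A.left.quot.obj y)),
      A.stages.map n = m := by
  obtain ⟨g, h, e₁, e₂, b, rfl⟩ := A.preq_hom_eq_prod m
  exact ⟨_, A.stages_cls g h e₁ e₂ b⟩

/-- Every arrow of the iterated prequotient is a composition `x ⟶ x · h ⟶ (x · h) · g ⟶ y`. -/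
theorem stages_hom_eq {x : X.Ob U} {y : X.Ob V}
    (n : A.commuting.preq.preq.of (A.commuting.preq.quot.obj (A.left.quot.obj x)) ⟶
      A.commuting.preq.preq.of (A.commuting.preq.quot.obj (A.left.quot.obj y))) :
    ∃ (g : G.arr.Ob U) (h : H.arr.Ob U) (e₁ : A.mo₁ x = G.t g) (e₂ : A.mo₂ x = H.t h)
      (b : X.of (A.sm₂ x g h e₁ e₂) ⟶ X.of y), n = A.commuting.preq.gamma x h e₂ ≫
        A.commuting.preq.quot.map
          (A.left.gamma (A.right.sm x h e₂) g ((A.mo₁_right x h e₂).trans e₁) ≫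
            A.left.quot.map ((A.xi₁ x g h e₁ e₂).hom ≫ b)) := by
  obtain ⟨h, e₂, a, rfl⟩ := A.commuting.preq.preq_hom_eq (x := x) (y := y) n
  obtain ⟨g, e, b, rfl⟩ := A.left.preq_hom_eq (x := A.right.sm x h e₂) (y := y) a
  have e₁ : A.mo₁ x = G.t g := (A.mo₁_right x h e₂).symm.trans e
  exact ⟨g, h, e₁, e₂, (A.xi₁ x g h e₁ e₂).inv ≫ b, congrArg (fun c => A.commuting.preq.gamma x h e₂ ≫
    A.commuting.preq.quot.map (A.left.gamma (A.right.sm x h e₂) g e ≫ A.left.quot.map c))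
      (Iso.hom_inv_id_assoc (A.xi₁ x g h e₁ e₂) b).symm⟩

theorem stages_faithful {x : X.Ob U} {y : X.Ob V}
    {n n' : A.commuting.preq.preq.of (A.commuting.preq.quot.obj (A.left.quot.obj x)) ⟶
      A.commuting.preq.preq.of (A.commuting.preq.quot.obj (A.left.quot.obj y))}
    (hn : A.stages.map n = A.stages.map n') : n = n' := by
  obtain ⟨g, h, e₁, e₂, b, rfl⟩ := A.stages_hom_eq n
  obtain ⟨g', h', e₁', e₂', b', rfl⟩ := A.stages_hom_eq n'
  have hc : A.cls (prodOb g h) (Man.prod_ext e₁ e₂) b =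
      A.cls (prodOb g' h') (Man.prod_ext e₁' e₂') b' :=
    (A.cls_eq_gamma _ _ b).trans (((A.stages_cls g h e₁ e₂ b).symm.trans
      (hn.trans (A.stages_cls g' h' e₁' e₂' b'))).trans (A.cls_eq_gamma _ _ b').symm)
  obtain ⟨c, hj, rfl⟩ := A.cls_eq_iff.1 hc
  obtain ⟨j, hj₁, k, hk, hjk⟩ : ∃ (j : G.arr.of g ⟶ G.arr.of g') (hj₁ : X.pr (𝟙 (X.of x)) = G.arr.pr j)
      (k : H.arr.of h ⟶ H.arr.of h') (hk : X.pr (𝟙 (X.of x)) = H.arr.pr k),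
      A.smHom₂ (𝟙 (X.of x)) j k e₁ e₂ e₁' e₂' hj₁ hk =
        A.smHom (𝟙 (X.of x)) c (Man.prod_ext e₁ e₂) (Man.prod_ext e₁' e₂') hj :=
    ⟨homFst c, hj, homSnd c, hj.trans (homSnd_pr c).symm, rfl⟩
  have hk' : A.left.preq.pr (𝟙 (A.left.preq.of (A.left.quot.obj x))) = H.arr.pr k :=
    (A.left.preq.pr_id _).trans ((X.pr_id _).symm.trans hk)
  have s₁ := A.commuting.preq.gamma_nat (𝟙 (A.left.preq.of (A.left.quot.obj x))) k e₂ e₂' hk'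
  have s₂ := (congrArg (· ≫ _) (A.commuting.preq.quot.map_id x)).symm.trans s₁
  have s₃ := (Category.id_comp _).symm.trans (s₂.trans (congrArg (_ ≫ A.commuting.preq.quot.map ·)
    (A.commuting.preqPre_smHom_id k e₂ e₂' hk hk')))
  have s₄ := A.left.gamma_nat (A.right.smHom (𝟙 (X.of x)) k e₂ e₂' hk) j
    ((A.mo₁_right x h e₂).trans e₁) ((A.mo₁_right x h' e₂').trans e₁')
    ((A.right.pr_smHom _ _ _ _ _).trans hj₁)
  have s₅ := (A.xi₁_nat (𝟙 (X.of x)) j k e₁ e₂ e₁' e₂' hj₁ hk).trans (congrArg (_ ≫ ·) hjk)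
  refine Eq.trans ?_ (congrArg (· ≫ _) s₃).symm
  refine Eq.trans (congrArg (_ ≫ ·) ?_) (Category.assoc _ _ _).symm
  refine Eq.trans (congrArg A.commuting.preq.quot.map ?_) (A.commuting.preq.quot.map_comp _ _)
  refine Eq.trans ?_ ((congrArg (· ≫ _) s₄).symm.trans (Category.assoc _ _ _))
  refine Eq.trans (congrArg (_ ≫ ·) ?_) (Category.assoc _ _ _).symm
  refine Eq.trans (congrArg A.left.quot.map ?_) (A.left.quot.map_comp _ _)
  exact (Category.assoc _ _ _).symm.trans ((congrArg (· ≫ b') s₅).symm.trans (Category.assoc _ _ _))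

/-- The comparison from the iterated prequotient to the prequotient by the product is a local
equivalence. -/
theorem stages_locEquiv : A.stages.LocEquiv where
  surj {U} y := ⟨⊤, Man.topology.top_mem U, fun {W} f _ => by
    obtain ⟨x, a, ha⟩ := lift_exists (X := A.preq) y f
    exact ⟨x, a, ha⟩⟩
  full {U} x x' m _ := ⟨⊤, Man.topology.top_mem U, fun {W} z r _ => by
    obtain ⟨n, hn⟩ := A.stages_full (x := x) (y := x') m
    exact ⟨r ≫ n, (A.stages.map_comp r n).trans (congrArg (_ ≫ ·) hn)⟩⟩
  faithful {U x x' n n'} _ _ h := ⟨⊤, Man.topology.top_mem U, fun {W} z r _ =>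
    congrArg (r ≫ ·) (A.stages_faithful (x := x) (y := x') h)⟩

end Action

end StackyQuotient

end

noncomputable section

universe w w' k

namespace StackyQuotient

namespace CFG

variable {P Q R S : CFG.{w, u}} {U V W : Man.{u}}

/-- The composition of a 2-morphism with a morphism on the source. -/
def TwoMor.whiskerLeft (F : Mor P Q) {G G' : Mor Q R} (η : TwoMor G G') :
    TwoMor (F.comp G) (F.comp G') where
  app x := η.app (F.obj x)
  pr_app _ := η.pr_app _
  naturality a := η.naturality (F.map a)

/-- The composition of a 2-morphism with a morphism on the target. -/
def TwoMor.whiskerRight {F F' : Mor P Q} (η : TwoMor F F') (G : Mor Q R) :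
    TwoMor (F.comp G) (F'.comp G) where
  app x := G.map (η.app x)
  pr_app x := (G.pr_map _).trans (η.pr_app x)
  naturality a := (G.map_comp _ _).symm.trans ((congrArg G.map (η.naturality a)).trans
    (G.map_comp _ _))

theorem isStackification_of {ι : Mor P Q} (hQ : Q.IsStack)
    (h : ∀ S : CFG.{w, u}, S.IsStack → ∀ F : Mor P S,
      ∃ F' : Mor Q S, Nonempty (TwoMor (ι.comp F') F))
    (h' : ∀ S : CFG.{w, u}, S.IsStack → ∀ (F₁ F₂ : Mor Q S) (τ : TwoMor (ι.comp F₁) (ι.comp F₂)),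
      ∃! η : TwoMor F₁ F₂, ∀ {U : Man.{u}} (x : P.Ob U), η.app (ι.obj x) = τ.app x) :
    IsStackification ι := by
  refine ⟨hQ, h, ?_⟩
  intro S hS F₁ F₂ η F₁' F₂' ζ₁ ζ₂
  have key : ∀ η' : TwoMor F₁' F₂',
      (∀ {U : Man.{u}} (x : P.Ob U), η'.app (ι.obj x) ≫ ζ₂.app x = ζ₁.app x ≫ η.app x) ↔
        ∀ {U : Man.{u}} (x : P.Ob U), η'.app (ι.obj x) = ((ζ₁.trans η).trans ζ₂.symm).app x := by
    refine fun η' => ⟨fun hη U x => ζ₂.eq_comp_symm_app x (hη x), fun hη U x => ?_⟩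
    rw [hη]
    exact (Category.assoc _ _ _).trans ((congrArg (_ ≫ ·) (ζ₂.symm_app_app x)).trans
      (Category.comp_id _))
  obtain ⟨η', h₁, h₂⟩ := h' S hS F₁' F₂' ((ζ₁.trans η).trans ζ₂.symm)
  exact ⟨η', (key η').2 h₁, fun η'' hη => h₂ η'' ((key η'').1 hη)⟩

theorem IsStackification.existsUnique {ι : Mor P Q} (h : IsStackification ι) (hS : S.IsStack)
    {F₁ F₂ : Mor Q S} (τ : TwoMor (ι.comp F₁) (ι.comp F₂)) :
    ∃! η : TwoMor F₁ F₂, ∀ {U : Man.{u}} (x : P.Ob U), η.app (ι.obj x) = τ.app x := by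
  have key : ∀ η : TwoMor F₁ F₂, (∀ {U : Man.{u}} (x : P.Ob U),
      η.app (ι.obj x) ≫ (TwoMor.refl (ι.comp F₂)).app x =
        (TwoMor.refl (ι.comp F₁)).app x ≫ τ.app x) ↔
      ∀ {U : Man.{u}} (x : P.Ob U), η.app (ι.obj x) = τ.app x :=
    fun η => ⟨fun hη U x => (Category.comp_id _).symm.trans ((hη x).trans (Category.id_comp _)),
      fun hη U x => (Category.comp_id _).trans ((hη x).trans (Category.id_comp _).symm)⟩
  obtain ⟨η, h₁, h₂⟩ := h.2.2 S hS _ _ τ F₁ F₂ (TwoMor.refl _) (TwoMor.refl _)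
  exact ⟨η, (key η).1 h₁, fun η' hη => h₂ η' ((key η').2 hη)⟩

/-- The composition of a local equivalence and a stackification is a stackification. -/
theorem Mor.LocEquiv.comp_isStackification {F : Mor P R} (hF : F.LocEquiv) {κ : Mor R Q}
    (hκ : IsStackification κ) : IsStackification (F.comp κ) := by
  refine isStackification_of hκ.1 (fun S hS F₀ => ?_) fun S hS F₁ F₂ τ => ?_
  · obtain ⟨F₁, ⟨ζ₁⟩⟩ := hF.exists_extension hS F₀
    obtain ⟨F₂, ⟨ζ₂⟩⟩ := hκ.2.1 S hS F₁
    exact ⟨F₂, ⟨(TwoMor.whiskerLeft F ζ₂).trans ζ₁⟩⟩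
  · obtain ⟨σ, h₁, h₂⟩ := hF.existsUnique_twoMor hS.1 (F₁ := κ.comp F₁) (F₂ := κ.comp F₂)
      (fun x => τ.app x) (fun x => τ.pr_app x) (fun a => τ.naturality a)
    obtain ⟨η, h₃, h₄⟩ := hκ.existsUnique hS σ
    refine ⟨η, fun {U} x => (h₃ (F.obj x)).trans (h₁ x), fun η' hη => h₄ η' fun {U} x => ?_⟩
    have := h₂ (TwoMor.whiskerLeft κ η') hη
    rw [← this]
    rfl

/-- Stackifications are invariant under 2-isomorphism. -/
theorem IsStackification.of_twoMor {ι ι' : Mor P Q} (h : IsStackification ι) (z : TwoMor ι ι') :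
    IsStackification ι' := by
  refine isStackification_of h.1 (fun S hS F => ?_) fun S hS F₁ F₂ τ => ?_
  · obtain ⟨F', ⟨ζ⟩⟩ := h.2.1 S hS F
    exact ⟨F', ⟨(z.symm.whiskerRight F').trans ζ⟩⟩
  · have key : ∀ η : TwoMor F₁ F₂, (∀ {U : Man.{u}} (x : P.Ob U), η.app (ι'.obj x) = τ.app x) ↔
        ∀ {U : Man.{u}} (x : P.Ob U), η.app (ι.obj x) =
          (((z.whiskerRight F₁).trans τ).trans (z.whiskerRight F₂).symm).app x := by
      refine fun η => ⟨fun hη U x => (z.whiskerRight F₂).eq_comp_symm_app x ?_, fun hη U x => ?_⟩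
      · exact (η.naturality (z.app x)).symm.trans (congrArg (_ ≫ ·) (hη x))
      · have := isIso_of_pr (F₁.map (z.app x)) ((F₁.pr_map _).trans (z.pr_app x))
        refine (cancel_epi (F₁.map (z.app x))).1 ((η.naturality (z.app x)).trans
          ((congrArg (· ≫ _) (hη x)).trans ?_))
        exact (Category.assoc _ _ _).trans ((congrArg (_ ≫ ·)
          ((z.whiskerRight F₂).symm_app_app x)).trans (Category.comp_id _))
    obtain ⟨η, h₁, h₂⟩ := h.existsUnique hS
      (((z.whiskerRight F₁).trans τ).trans (z.whiskerRight F₂).symm)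
    exact ⟨η, (key η).2 h₁, fun η' hη => h₂ η' ((key η').1 hη)⟩

/-- Stackifications extend along local equivalences. -/
theorem Mor.LocEquiv.exists_isStackification {F : Mor P R} (hF : F.LocEquiv) {ι : Mor P Q}
    (hι : IsStackification ι) : ∃ κ : Mor R Q, IsStackification κ := by
  obtain ⟨κ, ⟨z⟩⟩ := hF.exists_extension hι.1 ι
  have h := hι.of_twoMor z.symm
  refine ⟨κ, isStackification_of hι.1 (fun S hS F₀ => ?_) fun S hS F₁ F₂ τ => ?_⟩
  · obtain ⟨F', ⟨ζ⟩⟩ := h.2.1 S hS (F.comp F₀)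
    obtain ⟨ζ', -, -⟩ := hF.existsUnique_twoMor hS.1 (F₁ := κ.comp F') (F₂ := F₀)
      (fun x => ζ.app x) (fun x => ζ.pr_app x) (fun a => ζ.naturality a)
    exact ⟨F', ⟨ζ'⟩⟩
  · obtain ⟨η, h₁, h₂⟩ := h.existsUnique hS (TwoMor.whiskerLeft F τ)
    refine ⟨η, ?_, fun η' hη => h₂ η' fun {U} x => hη (F.obj x)⟩
    obtain ⟨σ, -, h₃⟩ := hF.existsUnique_twoMor hS.1 (F₁ := κ.comp F₁) (F₂ := κ.comp F₂)
      (fun x => τ.app (F.obj x)) (fun x => τ.pr_app _) (fun a => τ.naturality (F.map a))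
    have s := (h₃ (TwoMor.whiskerLeft κ η) h₁).trans (h₃ τ fun x => rfl).symm
    intro U x
    rw [← s]
    rfl

end CFG

namespace Action

variable {G H : CfgGroupoid.{w, u}} {X S Q Q₁ Q₁₂ : CFG.{w, u}} {U V W : Man.{u}}
  {A : Action (G.prod H) X}

/-- 2-morphisms between morphisms from the iterated prequotient, from their values on `X`. -/
theorem exists_twoMor_of_gamma {F F' : Mor A.commuting.preq.preq S}
    (η : ∀ {U : Man.{u}} (x : X.Ob U),
      S.of (F.obj (A.commuting.preq.quot.obj (A.left.quot.obj x))) ⟶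
        S.of (F'.obj (A.commuting.preq.quot.obj (A.left.quot.obj x))))
    (pr_η : ∀ {U : Man.{u}} (x : X.Ob U), S.pr (η x) = 𝟙 U)
    (η_quot : ∀ {U V : Man.{u}} {x : X.Ob U} {y : X.Ob V} (b : X.of x ⟶ X.of y),
      F.map (A.commuting.preq.quot.map (A.left.quot.map b)) ≫ η y =
        η x ≫ F'.map (A.commuting.preq.quot.map (A.left.quot.map b)))
    (η_left : ∀ {U : Man.{u}} (x : X.Ob U) (g : G.arr.Ob U) (e : A.mo₁ x = G.t g),
      F.map (A.commuting.preq.quot.map (A.left.gamma x g e)) ≫ η (A.left.sm x g e) =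
        η x ≫ F'.map (A.commuting.preq.quot.map (A.left.gamma x g e)))
    (η_right : ∀ {U : Man.{u}} (x : X.Ob U) (h : H.arr.Ob U) (e : A.mo₂ x = H.t h),
      F.map (A.commuting.preq.gamma x h e) ≫ η (A.right.sm x h e) =
        η x ≫ F'.map (A.commuting.preq.gamma x h e)) :
    ∃ ζ : TwoMor F F', ∀ {U : Man.{u}} (x : X.Ob U),
      ζ.app (A.commuting.preq.quot.obj (A.left.quot.obj x)) = η x := by
  let σ : TwoMor (A.commuting.preq.quot.comp F) (A.commuting.preq.quot.comp F') :=
    A.left.twoMorOfGamma (fun x => η x) (fun x => pr_η x) (fun b => η_quot b)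
      fun x g e => η_left x g e
  exact ⟨A.commuting.preq.twoMorOfGamma (fun x => σ.app x) (fun x => σ.pr_app x)
    (fun b => σ.naturality b) fun x h e => η_right x h e, fun x => rfl⟩

namespace InducedAction

variable {ι₁ : Mor A.left.preq Q₁} (B : A.InducedAction ι₁)

/-- The morphism from the iterated prequotient of `X` to the prequotient of the first quotient. -/
def toPreq : Mor A.commuting.preq.preq B.action.preq := B.equivariance.preq

theorem toPreq_quot {x : X.Ob U} {y : X.Ob V}
    (b : A.left.preq.of (A.left.quot.obj x) ⟶ A.left.preq.of (A.left.quot.obj y)) :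
    B.toPreq.map (A.commuting.preq.quot.map b) = B.action.quot.map (ι₁.map b) :=
  B.equivariance.invariant.desc_quot b

theorem toPreq_gamma (x : X.Ob U) (h : H.arr.Ob U) (e : A.mo₂ x = H.t h) :
    B.toPreq.map (A.commuting.preq.gamma x h e) =
      B.action.gamma ((A.left.quot.comp ι₁).obj x) h ((B.equiv.mo_eq x).trans e) ≫
        B.action.quot.map (B.equiv.phi x h e) :=
  B.equivariance.invariant.desc_gamma x h e

variable (ι₁₂ : Mor B.action.preq Q₁₂) (ι : Mor A.preq Q) {Θ : Mor Q₁₂ Q}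

/-- The 2-isomorphism relating the projections of `X`, from one on the iterated prequotient. -/
def twoMorProj (ζ : TwoMor ((B.toPreq.comp ι₁₂).comp Θ) (A.stages.comp ι)) :
    TwoMor ((B.proj ι₁₂).comp Θ) (A.quot.comp ι) where
  app x := ζ.app (A.commuting.preq.quot.obj (A.left.quot.obj x))
  pr_app x := ζ.pr_app _
  naturality {U V x y} b := by
    have s := ζ.naturality (A.commuting.preq.quot.map (A.left.quot.map b))
    refine (congrArg (· ≫ _) (congrArg (fun c => Θ.map (ι₁₂.map c))
      (B.toPreq_quot (A.left.quot.map b)))).symm.trans (s.trans ?_)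
    exact congrArg (fun c => _ ≫ ι.map c) ((A.stages_quot _).trans (A.ofLeft_quot b))

theorem isCanonical_twoMorProj (ζ : TwoMor ((B.toPreq.comp ι₁₂).comp Θ) (A.stages.comp ι)) :
    B.IsCanonical ι₁₂ ι Θ (B.twoMorProj ι₁₂ ι ζ) := by
  refine ⟨fun {U} x g e => ?_, fun {U} x h e => ?_⟩
  · have s := ζ.naturality (A.commuting.preq.quot.map (A.left.gamma x g e))
    refine (congrArg (· ≫ _) (congrArg (fun c => Θ.map (ι₁₂.map c))
      (B.toPreq_quot (A.left.gamma x g e)))).symm.trans (s.trans ?_)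
    exact congrArg (fun c => _ ≫ ι.map c) ((A.stages_quot _).trans (A.ofLeft_gamma x g e))
  · have s := ζ.naturality (A.commuting.preq.gamma x h e)
    refine (congrArg (· ≫ _) (congrArg Θ.map ((congrArg ι₁₂.map (B.toPreq_gamma x h e)).trans
      (ι₁₂.map_comp _ _)))).symm.trans (s.trans ?_)
    exact congrArg (fun c => _ ≫ ι.map c) (A.stages_gamma x h e)

theorem IsCanonical.exists_twoMor {B : A.InducedAction ι₁} {ι₁₂ : Mor B.action.preq Q₁₂}
    {ι : Mor A.preq Q} {θ : TwoMor ((B.proj ι₁₂).comp Θ) (A.quot.comp ι)}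
    (h : B.IsCanonical ι₁₂ ι Θ θ) :
    ∃ ζ : TwoMor ((B.toPreq.comp ι₁₂).comp Θ) (A.stages.comp ι), ∀ {U : Man.{u}} (x : X.Ob U),
      ζ.app (A.commuting.preq.quot.obj (A.left.quot.obj x)) = θ.app x := by
  refine exists_twoMor_of_gamma (F := (B.toPreq.comp ι₁₂).comp Θ) (F' := A.stages.comp ι)
    (fun x => θ.app x) (fun x => θ.pr_app x) (fun {U V x y} b => ?_) (fun {U} x g e => ?_)
    fun {U} x g e => ?_
  · refine (congrArg (· ≫ _) (congrArg (fun c => Θ.map (ι₁₂.map c))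
      (B.toPreq_quot (A.left.quot.map b)))).trans ((θ.naturality b).trans ?_)
    exact congrArg (fun c => _ ≫ ι.map c) ((A.stages_quot _).trans (A.ofLeft_quot b)).symm
  · refine (congrArg (· ≫ _) (congrArg (fun c => Θ.map (ι₁₂.map c))
      (B.toPreq_quot (A.left.gamma x g e)))).trans ((h.1 x g e).trans ?_)
    exact congrArg (fun c => _ ≫ ι.map c) ((A.stages_quot _).trans (A.ofLeft_gamma x g e)).symm
  · refine (congrArg (· ≫ _) (congrArg Θ.map ((congrArg ι₁₂.map (B.toPreq_gamma x g e)).trans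
      (ι₁₂.map_comp _ _)))).trans ((h.2 x g e).trans ?_)
    exact congrArg (fun c => _ ≫ ι.map c) (A.stages_gamma x g e).symm

/-- The canonical isomorphism from the iterated quotient to the quotient by the product. -/
theorem exists_isCanonical (hι₁ : ι₁.LocEquiv) (hι₁₂ : IsStackification ι₁₂)
    (hι : IsStackification ι) :
    ∃ (Θ : Mor Q₁₂ Q) (θ : TwoMor ((B.proj ι₁₂).comp Θ) (A.quot.comp ι)),
      Θ.IsIsomorphism ∧ B.IsCanonical ι₁₂ ι Θ θ := by
  have h : B.toPreq.LocEquiv := B.equivariance.preq_locEquiv hι₁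
  obtain ⟨Θ, Θ', ⟨ζ⟩, hΘ⟩ := (h.comp_isStackification hι₁₂).exists_isomorphism
    (A.stages_locEquiv.comp_isStackification hι)
  exact ⟨Θ, B.twoMorProj ι₁₂ ι ζ, ⟨Θ', hΘ⟩, B.isCanonical_twoMorProj ι₁₂ ι ζ⟩

/-- Canonical morphisms are unique up to a unique 2-isomorphism. -/
theorem IsCanonical.existsUnique {B : A.InducedAction ι₁} {ι₁₂ : Mor B.action.preq Q₁₂}
    {ι : Mor A.preq Q} {Θ' : Mor Q₁₂ Q} {θ : TwoMor ((B.proj ι₁₂).comp Θ) (A.quot.comp ι)}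
    {θ' : TwoMor ((B.proj ι₁₂).comp Θ') (A.quot.comp ι)} (hι₁ : ι₁.LocEquiv)
    (hι₁₂ : IsStackification ι₁₂) (hQ : Q.IsStack) (h : B.IsCanonical ι₁₂ ι Θ θ)
    (h' : B.IsCanonical ι₁₂ ι Θ' θ') :
    ∃! ψ : TwoMor Θ Θ', ∀ {U : Man.{u}} (x : X.Ob U),
      ψ.app ((B.proj ι₁₂).obj x) ≫ θ'.app x = θ.app x := by
  have hp : B.toPreq.LocEquiv := B.equivariance.preq_locEquiv hι₁
  obtain ⟨ζ, hζ⟩ := h.exists_twoMor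
  obtain ⟨ζ', hζ'⟩ := h'.exists_twoMor
  obtain ⟨ψ, h₁, h₂⟩ := (hp.comp_isStackification hι₁₂).2.2 Q hQ _ _
    (TwoMor.refl (A.stages.comp ι)) Θ Θ' ζ ζ'
  refine ⟨ψ, fun {U} x => ?_, fun ψ' hψ => h₂ ψ' fun {U} x => ?_⟩
  · exact (congrArg (_ ≫ ·) (hζ' x)).symm.trans ((h₁ x).trans ((Category.comp_id _).trans (hζ x)))
  · exact (congrArg (_ ≫ ·) (hζ' x)).trans ((hψ x).trans ((hζ x).symm.trans
      (Category.comp_id _).symm))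

end InducedAction

end Action

end StackyQuotient

end

theorem propositionA13 {G₁ G₂ : CfgGroupoid.{max u v, u}} (hG₁ : G₁.IsStacky)
    (hG₂ : G₂.IsStacky) {X : CFG.{max u v, u}} (hX : X.IsPrestack)
    (A : StackyQuotient.Action (G₁.prod G₂) X) (hA : A.OneFree) :
    -- the quotients `X / G₁` and `X / (G₁ × G₂)` exist
    (∃ (Q₁ : CFG.{max u v, u}) (ι₁ : Mor A.left.preq Q₁), IsStackification ι₁) ∧
    (∃ (Q : CFG.{max u v, u}) (ι : Mor A.preq Q), IsStackification ι) ∧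
    ∀ (Q₁ : CFG.{max u v, u}) (ι₁ : Mor A.left.preq Q₁), IsStackification ι₁ →
      -- there is an induced action of `G₂` on `Q₁ = X / G₁`
      Nonempty (A.InducedAction ι₁) ∧
      ∀ B : A.InducedAction ι₁,
        -- the quotient `(X / G₁) / G₂` exists
        (∃ (Q₁₂ : CFG.{max u v, u}) (ι₁₂ : Mor B.action.preq Q₁₂), IsStackification ι₁₂) ∧
        ∀ (Q₁₂ : CFG.{max u v, u}) (ι₁₂ : Mor B.action.preq Q₁₂), IsStackification ι₁₂ →
        ∀ (Q : CFG.{max u v, u}) (ι : Mor A.preq Q), IsStackification ι →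
          -- there is a canonical isomorphism from `Q₁₂ = (X / G₁) / G₂` to `Q = X / (G₁ × G₂)`
          (∃ (Θ : Mor Q₁₂ Q) (θ : TwoMor ((B.proj ι₁₂).comp Θ) (A.quot.comp ι)),
            Θ.IsIsomorphism ∧ B.IsCanonical ι₁₂ ι Θ θ) ∧
          -- canonical morphisms are unique up to a unique 2-isomorphism
          ∀ (Θ Θ' : Mor Q₁₂ Q) (θ : TwoMor ((B.proj ι₁₂).comp Θ) (A.quot.comp ι))
            (θ' : TwoMor ((B.proj ι₁₂).comp Θ') (A.quot.comp ι)),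
            B.IsCanonical ι₁₂ ι Θ θ → B.IsCanonical ι₁₂ ι Θ' θ' →
            ∃! ψ : TwoMor Θ Θ', ∀ {U : Man.{u}} (x : X.Ob U),
              ψ.app ((B.proj ι₁₂).obj x) ≫ θ'.app x = θ.app x := by
  have hG₁' : G₁.arr.IsStack := hG₁
  have hP : A.left.preq.IsPrestack := StackyQuotient.Action.OneFree.preq_isPrestack hA.left hG₁' hX
  have hι₁ : ∀ {Q₁ : CFG.{max u v, u}} {ι₁ : Mor A.left.preq Q₁}, IsStackification ι₁ →
      ι₁.LocEquiv := fun h => IsStackification.locEquiv.{v} hP h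
  obtain ⟨Q₀, ι₀, hQ₀, hι₀⟩ := IsPrestack.exists_stackification.{v} hP
  obtain ⟨Q, ι, hQ, hι⟩ := IsPrestack.exists_stackification.{v}
    (hA.preq_isPrestack (hG₁.prod hG₂) hX)
  have hιs := hι.isStackification hQ
  refine ⟨⟨Q₀, ι₀, hι₀.isStackification hQ₀⟩, ⟨Q, ι, hιs⟩, fun Q₁ ι₁ h₁ =>
    ⟨A.exists_inducedAction (hι₁ h₁) h₁.1, fun B => ⟨⟨Q, ?_⟩, fun Q₁₂ ι₁₂ h₁₂ Q' ι' h' =>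
      ⟨B.exists_isCanonical ι₁₂ ι' (hι₁ h₁) h₁₂ h', fun Θ Θ' θ θ' hθ hθ' =>
        hθ.existsUnique (hι₁ h₁) h₁₂ h'.1 hθ'⟩⟩⟩⟩
  exact (B.equivariance.preq_locEquiv (hι₁ h₁)).exists_isStackification
    (A.stages_locEquiv.comp_isStackification hιs)
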